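/- Let $(a,b)$, $-\infty\le a<b\le\infty$, be an open interval and let $\varrho,\varsigma,\chi$ be Borel measures on $(a,b)$ that are finite on compact subsets (but not necessarily near the endpoints), such that $\varrho$ is real-valued, $\varsigma$ is positive with support equal to the whole interval, $\chi$ is positive and not identically zero, and $\varsigma(\{x\})\chi(\{x\})=\varsigma(\{x\})\varrho(\{x\})=0$ for all $x\in(a,b)$. **Notation.** For a measure $\nu$ on $(a,b)$ write $\int_c^x h\,d\nu=\int_{[c,x)}h\,d\nu$ if $x\ge c$ and $-\int_{[x,c)}h\,d\nu$ if $x<c$, and let $AC_{\rm loc}(\nu)$ be the set of $f:(a,b)\to\mathbb C$ with $f(x)=f(c)+\int_c^xh\,d\nu$ for some $h=df/d\nu\in L^1_{\rm loc}((a,b);\nu)$. Let $T_{\rm loc}$ be the set of pairs $(f,f_\tau)$ with $f,f_\tau\in AC_{\rm loc}(\varsigma)$ for which $df/d\varsigma$ has a (unique) representative $f^{[1]}$ such that $-f^{[1]}+\int_c^{\cdot}f\,d\chi\in AC_{\rm loc}(\varrho)$ with derivative $f_\tau$ with respect to $\varrho$; one writes $\tau f=f_\tau$. A solution of $(\tau-z)u=0$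 is a function $u$ with $(u,zu)\in T_{\rm loc}$. Let $H^1(a,b)$ be the Hilbert space of all $f\in AC_{\rm loc}(\varsigma)$ with $f\in L^2(\chi)$ and $df/d\varsigma\in L^2(\varsigma)$, with inner product $$\langle f,g\rangle=\int_a^b f\,\overline g\,d\chi+\int_a^b \frac{df}{d\varsigma}\,\overline{\frac{dg}{d\varsigma}}\,d\varsigma ;$$ for $c\in(a,b)$ let $\delta_c\in H^1(a,b)$ be the element with $f(c)=\langle f,\delta_c\rangle$ for all $f\in H^1(a,b)$. Let $T_{\max}=T_{\rm loc}\cap(H^1(a,b)\times H^1(a,b))$, and for $f,g\in T_{\rm loc}$ let $V(f,\overline g)=f_\tau\overline{g^{[1]}}-f^{[1]}\overline{g_\tau}$, where $V(f,\overline g)(a)$ and $V(f,\overline g)(b)$ denote limits at the endpoints. A function lies in $H^1(a,b)$ near an endpoint if it belongs to $AC_{\rm loc}(\varsigma)$ and the two square integrability conditions hold near this endpoint. The limit-circle case prevails at an endpoint if for every $z\in\mathbb C\setminus\{0\}$ all solutions of $(\tau-z)u=0$ lie in $H^1(a,b)$ near this endpoint. **Assumptions.** Let $v_a,v_b\in T_{\max}$.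 If the limit-circle case prevails at $a$, assume $V(v_a,\overline{v_a})(a)=0$ and $V(f,\overline{v_a})(a)\neq0$ for some $f\in T_{\max}$; likewise for $v_b$ at $b$. Let $$S=\{f\in T_{\max}: V(f,\overline{v_a})(a)=V(f,\overline{v_b})(b)=0\},$$ a linear relation in $H^1(a,b)$, and assume that $0$ is not an eigenvalue of $S$. For $z\in\mathbb C\setminus\{0\}$ let $\phi_z$ be a non-trivial solution of $(\tau-z)u=0$ which lies in $H^1(a,b)$ near $a$, satisfies $V(\phi_z,\overline{v_a})(a)=0$ if the limit-circle case prevails at $a$, and is such that for each $c\in(a,b)$ the functions $z\mapsto\phi_z(c)$ and $z\mapsto\phi_z^{[1]}(c)$ are holomorphic in $\mathbb C\setminus\{0\}$, real on $\mathbb R\setminus\{0\}$, and have at most a pole at $0$. **Theorem.** The relation $S$ is self-adjoint. There is a unique positive Borel measure $\mu$ on $\mathbb R^\times=\mathbb R\setminus\{0\}$ such that for all $\alpha,\beta\in(a,b)$ the function $\lambda\mapsto\phi_\lambda(\alpha)\phi_\lambda(\beta)$ is $\mu$-integrable and $$E_{\delta_\alpha,\delta_\beta}(B)=\int_{B\setminus\{0\}}\phi_\lambda(\alpha)\phi_\lambda(\beta)\,d\mu(\lambda)\quad\text{for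 all Borel sets } B\subseteq\mathbb R,$$ where $E_{f,g}$ is the complex Borel measure on $\mathbb R$ with $\langle (S-z)^{-1}f,g\rangle=\int_{\mathbb R}(\lambda-z)^{-1}dE_{f,g}(\lambda)$ for all $z$ in the resolvent set of $S$. There is a unique bounded linear operator $\mathcal F:H^1(a,b)\to L^2(\mathbb R^\times;\mu)$ such that for each $c\in(a,b)$, $(\mathcal F\delta_c)(\lambda)=\phi_\lambda(c)$ for $\mu$-almost all $\lambda$. Let $\mathfrak D=\overline{\operatorname{dom}S}$, let $\mathcal F^{-1}=\{(g,f):\mathcal Ff=g\}$ be the (in general multi-valued) inverse of $\mathcal F$, and let $\mathrm M_{\rm id}$ be the maximally defined operator of multiplication by the independent variable in $L^2(\mathbb R^\times;\mu)$. Then $$S=\mathcal F^{-1}\,\mathrm M_{\rm id}\,\mathcal F|_{\mathfrak D}.$$ Moreover, $\mathcal F$ vanishes on $\mathfrak D^\perp$, and $\mathcal F|_{\mathfrak D}$ is a unitary map from $\mathfrak D$ onto $L^2(\mathbb R^\times;\mu)$ which maps the operator part $S\cap(\mathfrak D\times\mathfrak D)$ of $S$ onto $\mathrm M_{\rm id}$.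 -/

import Mathlib

open MeasureTheory Filter Topology Set

open scoped ComplexConjugate ENNReal SetRel

noncomputable section

namespace LeftDefinite

/-- The open interval `(a, b)`, with possibly infinite end points, as a space of its own.
On it, `x → a` is the filter `atBot` and `x → b` is the filter `atTop`. -/
abbrev Ivl (a b : EReal) : Type := {x : ℝ // a < (x : EReal) ∧ (x : EReal) < b}

variable {a b : EReal}

/-- The oriented integral `∫_c^x h dμ`, that is, the integral over `[c, x)` if `c ≤ x` and minus the
integral over `[x, c)` if `x < c`. -/
def orientedIntegral (μ : Measure (Ivl a b)) (h : Ivl a b → ℂ) (c x : Ivl a b) : ℂ :=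
  if c ≤ x then ∫ s in Ico c x, h s ∂μ else -∫ s in Ico x c, h s ∂μ

/-- `f ∈ AC_loc((a, b); μ)` with Radon--Nikodym derivative `df/dμ = h`, for a positive measure. -/
structure HasDensity (μ : Measure (Ivl a b)) (f h : Ivl a b → ℂ) : Prop where
  locallyIntegrable : LocallyIntegrable h μ
  eq_add : ∀ c x, f x = f c + orientedIntegral μ h c x

/-- A real-valued Borel measure on `(a, b)`, finite on compact sets but possibly of infinite total
variation near the end points, given by its Jordan decomposition. -/
structure RealMeasure (a b : EReal) where
  pos : Measure (Ivl a b)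
  neg : Measure (Ivl a b)
  pos_locallyFinite : IsLocallyFiniteMeasure pos
  neg_locallyFinite : IsLocallyFiniteMeasure neg
  mutuallySingular : pos ⟂ₘ neg

/-- The total variation measure. -/
def RealMeasure.abs (ρ : RealMeasure a b) : Measure (Ivl a b) := ρ.pos + ρ.neg

/-- `f ∈ AC_loc((a, b); ρ)` with Radon--Nikodym derivative `df/dρ = h`, for a real measure `ρ`. -/
structure HasRealDensity (ρ : RealMeasure a b) (f h : Ivl a b → ℂ) : Prop where
  locallyIntegrable_pos : LocallyIntegrable h ρ.pos
  locallyIntegrable_neg : LocallyIntegrable h ρ.neg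
  eq_add : ∀ c x, f x = f c + (orientedIntegral ρ.pos h c x - orientedIntegral ρ.neg h c x)

/-- The coefficients of a left-definite Sturm--Liouville expression
`τ f = d/dϱ (-df/dς + ∫ f dχ)` on `(a, b)`. -/
structure Coefficients (a b : EReal) where
  rho : RealMeasure a b
  sigma : Measure (Ivl a b)
  chi : Measure (Ivl a b)
  sigma_locallyFinite : IsLocallyFiniteMeasure sigma
  chi_locallyFinite : IsLocallyFiniteMeasure chi
  /-- `ς` is supported on the whole interval. -/
  sigma_openPos : sigma.IsOpenPosMeasure
  chi_ne_zero : chi ≠ 0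
  sigma_chi_atoms : ∀ x, sigma {x} * chi {x} = 0
  sigma_rho_atoms : ∀ x, sigma {x} * rho.abs {x} = 0

attribute [instance] RealMeasure.pos_locallyFinite RealMeasure.neg_locallyFinite
  Coefficients.sigma_locallyFinite Coefficients.chi_locallyFinite Coefficients.sigma_openPos

/-! ### Elementary facts on densities -/

lemma isCompact_Icc_ivl (c x : Ivl a b) : IsCompact (Icc c x) := by
  rw [Subtype.isCompact_iff]
  have : (Subtype.val '' Icc c x : Set ℝ) = Icc c.1 x.1 := by
    ext y
    constructor
    · rintro ⟨y, hy, rfl⟩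
      exact hy
    · intro hy
      exact ⟨⟨y, lt_of_lt_of_le c.2.1 (EReal.coe_le_coe_iff.2 hy.1),
        lt_of_le_of_lt (EReal.coe_le_coe_iff.2 hy.2) x.2.2⟩, hy, rfl⟩
  rw [this]
  exact isCompact_Icc

lemma integrableOn_Ico {μ : Measure (Ivl a b)} {h : Ivl a b → ℂ} (hh : LocallyIntegrable h μ)
    (c x : Ivl a b) : IntegrableOn h (Ico c x) μ :=
  (hh.integrableOn_isCompact (isCompact_Icc_ivl c x)).mono_set Ico_subset_Icc_self

lemma orientedIntegral_add {μ : Measure (Ivl a b)} {h k : Ivl a b → ℂ}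
    (hh : LocallyIntegrable h μ) (hk : LocallyIntegrable k μ) (c x : Ivl a b) :
    orientedIntegral μ (h + k) c x = orientedIntegral μ h c x + orientedIntegral μ k c x := by
  unfold orientedIntegral
  split_ifs
  · exact integral_add (integrableOn_Ico hh c x) (integrableOn_Ico hk c x)
  · rw [← neg_add]
    exact congrArg _ (integral_add (integrableOn_Ico hh x c) (integrableOn_Ico hk x c))

lemma orientedIntegral_smul {μ : Measure (Ivl a b)} (r : ℂ) (h : Ivl a b → ℂ) (c x : Ivl a b) :
    orientedIntegral μ (r • h) c x = r * orientedIntegral μ h c x := by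
  unfold orientedIntegral
  split_ifs
  · exact integral_const_mul r h
  · rw [mul_neg]
    exact congrArg _ (integral_const_mul r h)

lemma orientedIntegral_zero {μ : Measure (Ivl a b)} (c x : Ivl a b) :
    orientedIntegral μ 0 c x = 0 := by
  simp [orientedIntegral]

lemma orientedIntegral_congr {μ : Measure (Ivl a b)} {h k : Ivl a b → ℂ} (hk : h =ᵐ[μ] k)
    (c x : Ivl a b) : orientedIntegral μ h c x = orientedIntegral μ k c x := by
  unfold orientedIntegral
  rw [integral_congr_ae (ae_restrict_of_ae hk), integral_congr_ae (ae_restrict_of_ae hk)]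

lemma HasDensity.add {μ : Measure (Ivl a b)} {f g h k : Ivl a b → ℂ} (hf : HasDensity μ f h)
    (hg : HasDensity μ g k) : HasDensity μ (f + g) (h + k) where
  locallyIntegrable := hf.1.add hg.1
  eq_add c x := by
    rw [orientedIntegral_add hf.1 hg.1, Pi.add_apply, Pi.add_apply, hf.2 c x, hg.2 c x]
    ring

lemma HasDensity.smul {μ : Measure (Ivl a b)} {f h : Ivl a b → ℂ} (r : ℂ)
    (hf : HasDensity μ f h) : HasDensity μ (r • f) (r • h) where
  locallyIntegrable := hf.1.smul r
  eq_add c x := by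
    rw [orientedIntegral_smul, Pi.smul_apply, Pi.smul_apply, hf.2 c x]
    simp only [smul_eq_mul]
    ring

lemma HasDensity.zero (μ : Measure (Ivl a b)) : HasDensity μ 0 0 where
  locallyIntegrable := locallyIntegrable_zero
  eq_add c x := by simp [orientedIntegral_zero]

lemma HasDensity.congr {μ : Measure (Ivl a b)} {f h k : Ivl a b → ℂ} (hf : HasDensity μ f h)
    (hk : h =ᵐ[μ] k) : HasDensity μ f k where
  locallyIntegrable x := by
    obtain ⟨s, hs, hi⟩ := hf.1 x
    exact ⟨s, hs, hi.congr_fun_ae (ae_restrict_of_ae hk)⟩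
  eq_add c x := by rw [← orientedIntegral_congr hk, ← hf.2]

lemma HasRealDensity.add {ρ : RealMeasure a b} {f g h k : Ivl a b → ℂ}
    (hf : HasRealDensity ρ f h) (hg : HasRealDensity ρ g k) :
    HasRealDensity ρ (f + g) (h + k) where
  locallyIntegrable_pos := hf.1.add hg.1
  locallyIntegrable_neg := hf.2.add hg.2
  eq_add c x := by
    rw [orientedIntegral_add hf.1 hg.1, orientedIntegral_add hf.2 hg.2, Pi.add_apply,
      Pi.add_apply, hf.3 c x, hg.3 c x]
    ring

lemma HasRealDensity.smul {ρ : RealMeasure a b} {f h : Ivl a b → ℂ} (r : ℂ)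
    (hf : HasRealDensity ρ f h) : HasRealDensity ρ (r • f) (r • h) where
  locallyIntegrable_pos := hf.1.smul r
  locallyIntegrable_neg := hf.2.smul r
  eq_add c x := by
    rw [orientedIntegral_smul, orientedIntegral_smul, Pi.smul_apply, Pi.smul_apply, hf.3 c x]
    simp only [smul_eq_mul]
    ring

lemma HasRealDensity.zero (ρ : RealMeasure a b) : HasRealDensity ρ 0 0 where
  locallyIntegrable_pos := locallyIntegrable_zero
  locallyIntegrable_neg := locallyIntegrable_zero
  eq_add c x := by simp [orientedIntegral_zero]

/-! ### The modified Sobolev space -/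

namespace Coefficients

variable (T : Coefficients a b)

/-- `f` lies in `H¹(a, b)`. -/
def MemH1 (f : Ivl a b → ℂ) : Prop :=
  ∃ h, HasDensity T.sigma f h ∧ MemLp f 2 T.chi ∧ MemLp h 2 T.sigma

/-- The functions in `H¹(a, b)`, each one recorded together with its Radon--Nikodym derivative
`df/dς ∈ L²((a, b); ς)`, which is determined by the function. -/
def h1Submodule : Submodule ℂ ((Ivl a b → ℂ) × Lp ℂ 2 T.sigma) where
  carrier := {u | MemLp u.1 2 T.chi ∧ HasDensity T.sigma u.1 u.2}
  add_mem' {u v} hu hv :=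
    ⟨hu.1.add hv.1, (hu.2.add hv.2).congr (Lp.coeFn_add u.2 v.2).symm⟩
  zero_mem' := ⟨MemLp.zero, (HasDensity.zero _).congr (Lp.coeFn_zero ℂ 2 T.sigma).symm⟩
  smul_mem' r u hu := ⟨hu.1.const_smul r, (hu.2.smul r).congr (Lp.coeFn_smul r u.2).symm⟩

/-- The modified Sobolev space `H¹(a, b)`. -/
def H1 : Type := T.h1Submodule

namespace H1

variable {T}

instance : AddCommGroup T.H1 := inferInstanceAs (AddCommGroup T.h1Submodule)

instance : Module ℂ T.H1 := inferInstanceAs (Module ℂ T.h1Submodule)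

instance : CoeFun T.H1 (fun _ => Ivl a b → ℂ) := ⟨fun u => u.1.1⟩

/-- The Radon--Nikodym derivative `df/dς` of `f ∈ H¹(a, b)`. -/
def deriv (u : T.H1) : Lp ℂ 2 T.sigma := u.1.2

lemma memLp (u : T.H1) : MemLp u 2 T.chi := u.2.1

lemma hasDensity (u : T.H1) : HasDensity T.sigma u u.deriv := u.2.2

/-- The class of `f ∈ H¹(a, b)` in `L²((a, b); χ)`. -/
def toL2 (u : T.H1) : Lp ℂ 2 T.chi := u.memLp.toLp u

@[simp] lemma coe_add (u v : T.H1) : ((u + v : T.H1) : Ivl a b → ℂ) = u + v := rfl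

@[simp] lemma coe_smul (r : ℂ) (u : T.H1) : ((r • u : T.H1) : Ivl a b → ℂ) = r • u := rfl

@[simp] lemma deriv_add (u v : T.H1) : (u + v).deriv = u.deriv + v.deriv := rfl

@[simp] lemma deriv_smul (r : ℂ) (u : T.H1) : (r • u).deriv = r • u.deriv := rfl

lemma toL2_add (u v : T.H1) : (u + v).toL2 = u.toL2 + v.toL2 := rfl

lemma toL2_smul (r : ℂ) (u : T.H1) : (r • u).toL2 = r • u.toL2 := rfl

/-- The inner product, conjugate linear in the first argument. -/
instance : Inner ℂ T.H1 where
  inner u v := (∫ x, conj (u x) * v x ∂T.chi) + ∫ x, conj (u.deriv x) * v.deriv x ∂T.sigma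

lemma inner_def (u v : T.H1) : inner ℂ u v =
    (∫ x, conj (u x) * v x ∂T.chi) + ∫ x, conj (u.deriv x) * v.deriv x ∂T.sigma := rfl

lemma inner_eq (u v : T.H1) :
    inner ℂ u v = inner ℂ u.toL2 v.toL2 + inner ℂ u.deriv v.deriv := by
  rw [inner_def, L2.inner_def, L2.inner_def]
  congr 1
  · refine integral_congr_ae ?_
    filter_upwards [u.memLp.coeFn_toLp, v.memLp.coeFn_toLp] with x hx hy
    rw [toL2, toL2, hx, hy, RCLike.inner_apply, mul_comm]
  · refine integral_congr_ae (Eventually.of_forall fun x => ?_)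
    simp only [RCLike.inner_apply, mul_comm]

lemma eq_zero_of_toL2 (u : T.H1) (h1 : u.toL2 = 0) (h2 : u.deriv = 0) : u = 0 := by
  have hu : (u : Ivl a b → ℂ) =ᵐ[T.chi] 0 := by
    filter_upwards [u.memLp.coeFn_toLp, Lp.coeFn_zero ℂ 2 T.chi] with x hx hy
    rw [← hx, ← hy, ← h1, toL2]
  have : NeBot (ae T.chi) := ae_neBot.2 T.chi_ne_zero
  obtain ⟨c, hc⟩ := hu.exists
  refine Subtype.ext (Prod.ext (funext fun x => ?_) h2)
  have h3 : (u.deriv : Ivl a b → ℂ) =ᵐ[T.sigma] 0 := by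
    rw [h2]
    exact Lp.coeFn_zero ℂ 2 T.sigma
  have := u.hasDensity.2 c x
  rw [orientedIntegral_congr h3, orientedIntegral_zero, hc] at this
  exact this.trans (add_zero _)

/-- The inner product of `H¹(a, b)` is positive definite. -/
abbrev core : InnerProductSpace.Core ℂ T.H1 where
  conj_inner_symm u v := by
    rw [inner_eq, inner_eq, map_add, inner_conj_symm, inner_conj_symm]
  re_inner_nonneg u := by
    rw [inner_eq, map_add]
    exact add_nonneg inner_self_nonneg inner_self_nonneg
  add_left u v w := by
    rw [inner_eq, inner_eq, inner_eq, toL2_add, deriv_add, inner_add_left, inner_add_left]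
    ring
  smul_left u v r := by
    rw [inner_eq, inner_eq, toL2_smul, deriv_smul, inner_smul_left, inner_smul_left]
    ring
  definite u hu := by
    rw [inner_eq] at hu
    have h := congrArg RCLike.re hu
    rw [map_add, map_zero] at h
    have h1 : 0 ≤ RCLike.re (inner ℂ u.toL2 u.toL2) := inner_self_nonneg
    have h2 : 0 ≤ RCLike.re (inner ℂ u.deriv u.deriv) := inner_self_nonneg
    rw [inner_self_eq_norm_sq] at h h1 h2
    rw [inner_self_eq_norm_sq] at h
    exact eq_zero_of_toL2 u (norm_eq_zero.1 (pow_eq_zero_iff two_ne_zero |>.1 (by linarith)))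
      (norm_eq_zero.1 (pow_eq_zero_iff two_ne_zero |>.1 (by linarith)))

instance : NormedAddCommGroup T.H1 := core.toNormedAddCommGroup

instance : InnerProductSpace ℂ T.H1 := InnerProductSpace.ofCore core.toCore

lemma norm_sq_eq (u : T.H1) : ‖u‖ ^ 2 = ‖u.toL2‖ ^ 2 + ‖u.deriv‖ ^ 2 := by
  rw [← inner_self_eq_norm_sq (𝕜 := ℂ) u, ← inner_self_eq_norm_sq (𝕜 := ℂ) u.toL2,
    ← inner_self_eq_norm_sq (𝕜 := ℂ) u.deriv, ← map_add]
  exact congrArg _ (inner_eq u u)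

lemma tendsto_orientedIntegral {h : ℕ → Lp ℂ 2 T.sigma} {k : Lp ℂ 2 T.sigma}
    (hk : Tendsto h atTop (𝓝 k)) (c x : Ivl a b) :
    Tendsto (fun n => orientedIntegral T.sigma (h n) c x) atTop
      (𝓝 (orientedIntegral T.sigma k c x)) := by
  have key : ∀ p q : Ivl a b, Tendsto (fun n => ∫ s in Ico p q, h n s ∂T.sigma) atTop
      (𝓝 (∫ s in Ico p q, k s ∂T.sigma)) := by
    intro p q
    have hfin : T.sigma (Ico p q) ≠ ∞ :=
      ((measure_mono Ico_subset_Icc_self).trans_lt (isCompact_Icc_ivl p q).measure_lt_top).ne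
    have := (tendsto_const_nhds (x := indicatorConstLp 2 measurableSet_Ico hfin (1 : ℂ))).inner
      (𝕜 := ℂ) hk
    simpa only [L2.inner_indicatorConstLp_one] using this
  unfold orientedIntegral
  split_ifs
  · exact key c x
  · exact (key x c).neg

/-- Convergence of functions and derivatives in `L²` gives pointwise convergence along a
subsequence, to a function with the limiting derivative. -/
lemma exists_subseq (u : ℕ → T.H1) {f : Lp ℂ 2 T.chi} {k : Lp ℂ 2 T.sigma}
    (hf : Tendsto (fun n => (u n).toL2) atTop (𝓝 f))
    (hk : Tendsto (fun n => (u n).deriv) atTop (𝓝 k)) :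
    ∃ w : T.H1, w.toL2 = f ∧ w.deriv = k ∧
      ∃ ns : ℕ → ℕ, StrictMono ns ∧ ∀ x, Tendsto (fun n => u (ns n) x) atTop (𝓝 (w x)) := by
  obtain ⟨ns, hns, hae⟩ := (tendstoInMeasure_of_tendsto_Lp hf).exists_seq_tendsto_ae
  have hall : ∀ᵐ x ∂T.chi, ∀ n, (u n).toL2 x = u n x :=
    ae_all_iff.2 fun n => (u n).memLp.coeFn_toLp
  have : NeBot (ae T.chi) := ae_neBot.2 T.chi_ne_zero
  obtain ⟨c, hc, hc'⟩ := (hae.and hall).exists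
  let w : Ivl a b → ℂ := fun x => f c + orientedIntegral T.sigma k c x
  have hw : ∀ x, Tendsto (fun n => u (ns n) x) atTop (𝓝 (w x)) := by
    intro x
    have h1 : ∀ n, u (ns n) x =
        (u (ns n)).toL2 c + orientedIntegral T.sigma (u (ns n)).deriv c x := fun n => by
      rw [hc', ← (u (ns n)).hasDensity.2 c x]
    simp only [h1]
    exact hc.add (tendsto_orientedIntegral (hk.comp hns.tendsto_atTop) c x)
  have hwf : w =ᵐ[T.chi] f := by
    filter_upwards [hae, hall] with x hx hx'
    refine tendsto_nhds_unique (hw x) ?_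
    simpa only [hx'] using hx
  have hwL : MemLp w 2 T.chi := (memLp_congr_ae hwf).2 (Lp.memLp f)
  have hd : HasDensity T.sigma w k := by
    refine ⟨(Lp.memLp k).locallyIntegrable (by norm_num), fun p x => ?_⟩
    refine tendsto_nhds_unique (hw x) ?_
    have h1 : ∀ n, u (ns n) x =
        u (ns n) p + orientedIntegral T.sigma (u (ns n)).deriv p x := fun n =>
      (u (ns n)).hasDensity.2 p x
    simp only [h1]
    exact (hw p).add (tendsto_orientedIntegral (hk.comp hns.tendsto_atTop) p x)
  refine ⟨⟨(w, k), hwL, hd⟩, ?_, rfl, ns, hns, hw⟩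
  exact Lp.ext (hwL.coeFn_toLp.trans hwf)

lemma norm_toL2_le (u : T.H1) : ‖u.toL2‖ ≤ ‖u‖ :=
  abs_le_of_sq_le_sq' (by nlinarith [norm_sq_eq u, sq_nonneg ‖u.deriv‖]) (norm_nonneg _) |>.2

lemma norm_deriv_le (u : T.H1) : ‖u.deriv‖ ≤ ‖u‖ :=
  abs_le_of_sq_le_sq' (by nlinarith [norm_sq_eq u, sq_nonneg ‖u.toL2‖]) (norm_nonneg _) |>.2

/-- `toL2` and `deriv` as continuous linear maps. -/
def toL2L : T.H1 →L[ℂ] Lp ℂ 2 T.chi :=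
  LinearMap.mkContinuous ⟨⟨toL2, toL2_add⟩, toL2_smul⟩ 1 fun u => by
    simpa using norm_toL2_le u

def derivL : T.H1 →L[ℂ] Lp ℂ 2 T.sigma :=
  LinearMap.mkContinuous ⟨⟨deriv, deriv_add⟩, deriv_smul⟩ 1 fun u => by
    simpa using norm_deriv_le u

instance : CompleteSpace T.H1 := by
  refine Metric.complete_of_cauchySeq_tendsto fun u hu => ?_
  obtain ⟨f, hf⟩ := cauchySeq_tendsto_of_complete (toL2L.uniformContinuous.comp_cauchySeq hu)
  obtain ⟨k, hk⟩ := cauchySeq_tendsto_of_complete (derivL.uniformContinuous.comp_cauchySeq hu)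
  obtain ⟨w, rfl, rfl, -⟩ := exists_subseq u hf hk
  refine ⟨w, tendsto_iff_norm_sub_tendsto_zero.2 ?_⟩
  have h1 := (tendsto_iff_norm_sub_tendsto_zero.1 hf).pow 2
  have h2 := (tendsto_iff_norm_sub_tendsto_zero.1 hk).pow 2
  have h3 : ∀ n, ‖u n - w‖ = √(‖toL2L (u n) - toL2L w‖ ^ 2 + ‖derivL (u n) - derivL w‖ ^ 2) := by
    intro n
    rw [← map_sub, ← map_sub, ← Real.sqrt_sq (norm_nonneg (u n - w)), norm_sq_eq]
    rfl
  simp only [h3]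
  simpa using! (h1.add h2).sqrt

/-- Point evaluation at `c` on `H¹(a, b)`. -/
def evalL (c : Ivl a b) : T.H1 →L[ℂ] ℂ where
  toFun u := u c
  map_add' _ _ := rfl
  map_smul' _ _ := rfl
  cont := by
    let g : T.H1 →ₗ[ℂ] ℂ := ⟨⟨fun u => u c, fun _ _ => rfl⟩, fun _ _ => rfl⟩
    refine g.continuous_of_seq_closed_graph fun u w y hu hy => ?_
    obtain ⟨w', h1, h2, ns, hns, h3⟩ := exists_subseq u
      ((toL2L.continuous.tendsto w).comp hu) ((derivL.continuous.tendsto w).comp hu)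
    have hw : w' = w := by
      refine sub_eq_zero.1 (eq_zero_of_toL2 _ ?_ ?_)
      · exact (toL2L.map_sub w' w).trans (sub_eq_zero.2 h1)
      · exact (derivL.map_sub w' w).trans (sub_eq_zero.2 h2)
    subst hw
    exact tendsto_nhds_unique (hy.comp hns.tendsto_atTop) (h3 c)

/-- The element `δ_c` of `H¹(a, b)` that represents point evaluation at `c`. -/
def delta (c : Ivl a b) : T.H1 := (InnerProductSpace.toDual ℂ T.H1).symm (evalL c)

lemma inner_delta (c : Ivl a b) (u : T.H1) : inner ℂ (delta c) u = u c :=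
  InnerProductSpace.toDual_symm_apply

end H1

/-! ### The differential expression and its relations -/

/-- An element `(f, f_τ)` of the relation `T_loc`: `f` and `f_τ` belong to `AC_loc((a, b); ς)`, `f` is
in the maximal domain of `τ` and `τ f = f_τ`. It is recorded together with the quasi-derivative
`f^[1]`, the representative of `df/dς` for which `-f^[1] + ∫ f dχ` belongs to `AC_loc((a, b); ϱ)`.
This representative is determined by `f`, because `ς` has full support. -/
structure LocPair where
  fst : Ivl a b → ℂ
  qd : Ivl a b → ℂ
  snd : Ivl a b → ℂ
  hasDensity_fst : HasDensity T.sigma fst qd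
  hasDensity_snd : ∃ h, HasDensity T.sigma snd h
  /-- The integral `∫ f dχ` makes sense (automatic, since `f` is locally bounded). -/
  locallyIntegrable_fst : LocallyIntegrable fst T.chi
  tau_eq : ∀ c, HasRealDensity T.rho (fun x => -qd x + orientedIntegral T.chi fst c x) snd

namespace LocPair

variable {T}

/-- The sum of two elements of `T_loc`. -/
def add (p q : T.LocPair) : T.LocPair where
  fst := p.fst + q.fst
  qd := p.qd + q.qd
  snd := p.snd + q.snd
  hasDensity_fst := p.hasDensity_fst.add q.hasDensity_fst
  hasDensity_snd := by
    obtain ⟨h, hh⟩ := p.hasDensity_snd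
    obtain ⟨k, hk⟩ := q.hasDensity_snd
    exact ⟨h + k, hh.add hk⟩
  locallyIntegrable_fst := p.locallyIntegrable_fst.add q.locallyIntegrable_fst
  tau_eq c := by
    convert (p.tau_eq c).add (q.tau_eq c) using 1
    funext x
    rw [orientedIntegral_add p.locallyIntegrable_fst q.locallyIntegrable_fst]
    simp only [Pi.add_apply]
    ring

/-- A scalar multiple of an element of `T_loc`. -/
def smul (r : ℂ) (p : T.LocPair) : T.LocPair where
  fst := r • p.fst
  qd := r • p.qd
  snd := r • p.snd
  hasDensity_fst := p.hasDensity_fst.smul r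
  hasDensity_snd := by
    obtain ⟨h, hh⟩ := p.hasDensity_snd
    exact ⟨r • h, hh.smul r⟩
  locallyIntegrable_fst := p.locallyIntegrable_fst.smul r
  tau_eq c := by
    convert (p.tau_eq c).smul r using 1
    funext x
    rw [orientedIntegral_smul]
    simp only [Pi.smul_apply, smul_eq_mul]
    ring

/-- The zero element of `T_loc`. -/
def zero : T.LocPair where
  fst := 0
  qd := 0
  snd := 0
  hasDensity_fst := HasDensity.zero _
  hasDensity_snd := ⟨0, HasDensity.zero _⟩
  locallyIntegrable_fst := locallyIntegrable_zero
  tau_eq c := by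
    convert HasRealDensity.zero T.rho using 1
    funext x
    simp [orientedIntegral_zero]

/-- The modified Wronskian `V(f, g^*) = f_τ (g^[1])^* - f^[1] (g_τ)^*`. -/
def wronskian (p q : T.LocPair) (x : Ivl a b) : ℂ :=
  p.snd x * conj (q.qd x) - p.qd x * conj (q.snd x)

/-- The pair belongs to `T_max`. -/
def IsMax (p : T.LocPair) : Prop := T.MemH1 p.fst ∧ T.MemH1 p.snd

/-- `f` is a solution of `(τ - z) u = 0`. -/
def IsSolution (p : T.LocPair) (z : ℂ) : Prop := p.snd = z • p.fst

/-- `V(f, g^*)(a) = 0`. -/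
def WronskianVanishesLeft (p q : T.LocPair) : Prop := Tendsto (p.wronskian q) atBot (𝓝 0)

/-- `V(f, g^*)(b) = 0`. -/
def WronskianVanishesRight (p q : T.LocPair) : Prop := Tendsto (p.wronskian q) atTop (𝓝 0)

end LocPair

/-- `f` is locally absolutely continuous and on the subset `s` both `f` and `df/dς` are square
integrable with respect to `χ` and `ς`. -/
def MemH1On (s : Set (Ivl a b)) (f : Ivl a b → ℂ) : Prop :=
  ∃ h, HasDensity T.sigma f h ∧ MemLp f 2 (T.chi.restrict s) ∧ MemLp h 2 (T.sigma.restrict s)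

/-- `f` lies in `H¹(a, b)` near `a`. -/
def MemH1NearLeft (f : Ivl a b → ℂ) : Prop := ∃ c, T.MemH1On (Iio c) f

/-- `f` lies in `H¹(a, b)` near `b`. -/
def MemH1NearRight (f : Ivl a b → ℂ) : Prop := ∃ c, T.MemH1On (Ioi c) f

/-- `τ` is in the limit-circle case at `a`. -/
def LimitCircleLeft : Prop :=
  ∀ z : ℂ, z ≠ 0 → ∀ p : T.LocPair, p.IsSolution z → T.MemH1NearLeft p.fst

/-- `τ` is in the limit-circle case at `b`. -/
def LimitCircleRight : Prop :=
  ∀ z : ℂ, z ≠ 0 → ∀ p : T.LocPair, p.IsSolution z → T.MemH1NearRight p.fst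

variable {T}

/-- `v ∈ T_max` is admissible for a boundary condition at `a`: in the limit-circle case,
`V(v, v^*)(a) = 0` and `V(f, v^*)(a) ≠ 0` for some `f ∈ T_max`. -/
def IsBoundaryFunctionLeft (v : T.LocPair) : Prop :=
  v.IsMax ∧ (T.LimitCircleLeft → v.WronskianVanishesLeft v ∧
    ∃ p : T.LocPair, p.IsMax ∧ ¬ p.WronskianVanishesLeft v)

/-- `v ∈ T_max` is admissible for a boundary condition at `b`. -/
def IsBoundaryFunctionRight (v : T.LocPair) : Prop :=
  v.IsMax ∧ (T.LimitCircleRight → v.WronskianVanishesRight v ∧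
    ∃ p : T.LocPair, p.IsMax ∧ ¬ p.WronskianVanishesRight v)

/-- The relation `S = {f ∈ T_max | V(f, v_a^*)(a) = V(f, v_b^*)(b) = 0}` in `H¹(a, b)`, the
restriction of the maximal relation by separated boundary conditions. -/
def sepRelation (va vb : T.LocPair) : Submodule ℂ (T.H1 × T.H1) where
  carrier := {u | ∃ p : T.LocPair, p.fst = u.1 ∧ p.snd = u.2 ∧
    p.WronskianVanishesLeft va ∧ p.WronskianVanishesRight vb}
  add_mem' := by
    rintro u v ⟨p, hp1, hp2, hp3, hp4⟩ ⟨q, hq1, hq2, hq3, hq4⟩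
    have key : ∀ w x, (p.add q).wronskian w x = p.wronskian w x + q.wronskian w x := by
      intro w x
      simp only [LocPair.wronskian, LocPair.add, Pi.add_apply]
      ring
    refine ⟨p.add q, congrArg₂ (· + ·) hp1 hq1, congrArg₂ (· + ·) hp2 hq2, ?_, ?_⟩
    · refine Tendsto.congr (fun x => (key va x).symm) ?_
      simpa using hp3.add hq3
    · refine Tendsto.congr (fun x => (key vb x).symm) ?_
      simpa using hp4.add hq4
  zero_mem' := by
    have key : ∀ w x, (LocPair.zero : T.LocPair).wronskian w x = 0 := by
      intro w x
      simp [LocPair.wronskian, LocPair.zero]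
    exact ⟨LocPair.zero, rfl, rfl, tendsto_const_nhds.congr fun x => (key va x).symm,
      tendsto_const_nhds.congr fun x => (key vb x).symm⟩
  smul_mem' := by
    rintro r u ⟨p, hp1, hp2, hp3, hp4⟩
    have key : ∀ w x, (p.smul r).wronskian w x = r * p.wronskian w x := by
      intro w x
      simp only [LocPair.wronskian, LocPair.smul, Pi.smul_apply, smul_eq_mul]
      ring
    refine ⟨p.smul r, congrArg (r • ·) hp1, congrArg (r • ·) hp2, ?_, ?_⟩
    · refine Tendsto.congr (fun x => (key va x).symm) ?_
      simpa using hp3.const_mul r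
    · refine Tendsto.congr (fun x => (key vb x).symm) ?_
      simpa using hp4.const_mul r

/-- A real analytic family `φ_z`, `z ∈ ℂ \ {0}`, of non-trivial solutions of `(τ - z) u = 0` lying in
`S` near `a`, where `va` gives the boundary condition of `S` at `a`. The value `φ 0` plays no role. -/
structure IsRealAnalyticFamily (va : T.LocPair) (φ : ℂ → T.LocPair) : Prop where
  isSolution : ∀ z, z ≠ 0 → (φ z).IsSolution z
  nontrivial : ∀ z, z ≠ 0 → (φ z).fst ≠ 0
  memH1_left : ∀ z, z ≠ 0 → T.MemH1NearLeft (φ z).fst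
  boundary_left : T.LimitCircleLeft → ∀ z, z ≠ 0 → (φ z).WronskianVanishesLeft va
  differentiable_fst : ∀ c, DifferentiableOn ℂ (fun z => (φ z).fst c) {0}ᶜ
  differentiable_qd : ∀ c, DifferentiableOn ℂ (fun z => (φ z).qd c) {0}ᶜ
  real_fst : ∀ c z, z ≠ 0 → (φ (conj z)).fst c = conj ((φ z).fst c)
  real_qd : ∀ c z, z ≠ 0 → (φ (conj z)).qd c = conj ((φ z).qd c)
  meromorphic_fst : ∀ c, MeromorphicAt (fun z => (φ z).fst c) 0
  meromorphic_qd : ∀ c, MeromorphicAt (fun z => (φ z).qd c) 0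

end Coefficients

/-! ### Linear relations -/

section Relations

variable {H : Type*} [NormedAddCommGroup H] [InnerProductSpace ℂ H]

/-- `z` belongs to the resolvent set of `S` with resolvent `R = (S - z)⁻¹`, an everywhere defined
bounded operator. -/
def IsResolvent (S : Submodule ℂ (H × H)) (z : ℂ) (R : H →L[ℂ] H) : Prop :=
  ∀ f h : H, R h = f ↔ (f, h + z • f) ∈ S

/-- Zero is an eigenvalue of `S`. -/
def ZeroIsEigenvalue (S : Submodule ℂ (H × H)) : Prop := ∃ f : H, f ≠ 0 ∧ (f, (0 : H)) ∈ S

/-- The closure of the domain of `S`. -/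
def domClosure (S : Submodule ℂ (H × H)) : Submodule ℂ H :=
  (S.map (LinearMap.fst ℂ H H)).topologicalClosure

/-- `E` is the complex Borel measure `E_{f,g}` on `ℝ`:
`⟨R_z f, g⟩ = ∫ (λ - z)⁻¹ dE(λ)` for every `z` in the resolvent set of `S`, where `⟨·, ·⟩` is linear in
the first argument. -/
def IsStieltjesMeasure (S : Submodule ℂ (H × H)) (f g : H) (E : ComplexMeasure ℝ) : Prop :=
  ∀ (z : ℂ) (R : H →L[ℂ] H), IsResolvent S z R →
    inner ℂ g (R f) = ∫ᵛ t, ((t : ℂ) - z)⁻¹ ∂[ContinuousLinearMap.mul ℝ ℂ; E]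

end Relations

/-- The punctured real line. -/
abbrev RealCross : Type := {t : ℝ // t ≠ 0}

/-- The maximally defined operator of multiplication by the independent variable in `L²(ℝ \ {0}; μ)`,
as a relation. -/
def mulId (μ : Measure RealCross) : SetRel (Lp ℂ 2 μ) (Lp ℂ 2 μ) :=
  {p | ∀ᵐ t ∂μ, p.2 t = ((t : ℝ) : ℂ) * p.1 t}

namespace Coefficients

variable {T : Coefficients a b}

/-- `μ` is the spectral measure of `S` associated with the family `φ`:
`E_{δ_α, δ_β}(B) = ∫_{B \ {0}} φ_λ(α) φ_λ(β) dμ(λ)` for all `α`, `β` and all Borel sets `B`. -/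
def IsSpectralMeasure (S : Submodule ℂ (T.H1 × T.H1)) (φ : ℂ → T.LocPair)
    (μ : Measure RealCross) : Prop :=
  ∀ α β : Ivl a b,
    Integrable (fun t : RealCross => (φ (t : ℝ)).fst α * (φ (t : ℝ)).fst β) μ ∧
    ∃ E : ComplexMeasure ℝ, IsStieltjesMeasure S (H1.delta α) (H1.delta β) E ∧
      ∀ B : Set ℝ, MeasurableSet B →
        E B = ∫ t in (Subtype.val ⁻¹' B : Set RealCross),
          (φ (t : ℝ)).fst α * (φ (t : ℝ)).fst β ∂μ

/-- `F` is the spectral transformation: `(F δ_c)(λ) = φ_λ(c)` for `μ`-almost every `λ`. -/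
def IsSpectralTransformation (φ : ℂ → T.LocPair) {μ : Measure RealCross}
    (F : T.H1 →L[ℂ] Lp ℂ 2 μ) : Prop :=
  ∀ c : Ivl a b, ∀ᵐ t ∂μ, F (H1.delta c) t = (φ ((t : ℝ) : ℂ)).fst c

/-- The graph of the restriction of `F` to the subspace `D`. -/
def restrictedGraph {μ : Measure RealCross} (F : T.H1 →L[ℂ] Lp ℂ 2 μ) (D : Submodule ℂ T.H1) :
    SetRel T.H1 (Lp ℂ 2 μ) := {p | p.1 ∈ D ∧ F p.1 = p.2}

/-- The inverse relation `F⁻¹ = {(g, f) | F f = g}`. -/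
def inverseRel {μ : Measure RealCross} (F : T.H1 →L[ℂ] Lp ℂ 2 μ) :
    SetRel (Lp ℂ 2 μ) T.H1 := {p | F p.2 = p.1}

end Coefficients

end LeftDefinite

end

open LeftDefinite LeftDefinite.Coefficients

noncomputable section

namespace LeftDefinite

variable {a b : EReal}

/-! ### The interval and oriented integrals -/

instance ordConnected_ivl : OrdConnected {x : ℝ | a < (x : EReal) ∧ (x : EReal) < b} :=
  ⟨fun _ hx _ hy _ hz => ⟨hx.1.trans_le (EReal.coe_le_coe_iff.2 hz.1),
    (EReal.coe_le_coe_iff.2 hz.2).trans_lt hy.2⟩⟩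

instance : OrderTopology (Ivl a b) :=
  orderTopology_of_ordConnected (t := {x : ℝ | a < (x : EReal) ∧ (x : EReal) < b})

instance : DenselyOrdered (Ivl a b) :=
  inferInstanceAs (DenselyOrdered ↑{x : ℝ | a < (x : EReal) ∧ (x : EReal) < b})

instance : NoMaxOrder (Ivl a b) :=
  ⟨fun x => by
    obtain ⟨y, hy, hy'⟩ := EReal.exists_between_coe_real x.2.2
    exact ⟨⟨y, x.2.1.trans hy, hy'⟩, EReal.coe_lt_coe_iff.1 hy⟩⟩

instance : NoMinOrder (Ivl a b) :=
  ⟨fun x => by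
    obtain ⟨y, hy, hy'⟩ := EReal.exists_between_coe_real x.2.1
    exact ⟨⟨y, hy, hy'.trans x.2.2⟩, EReal.coe_lt_coe_iff.1 hy'⟩⟩

lemma measure_Ico_lt_top (μ : Measure (Ivl a b)) [IsLocallyFiniteMeasure μ] (c x : Ivl a b) :
    μ (Ico c x) < ∞ :=
  (measure_mono Ico_subset_Icc_self).trans_lt (isCompact_Icc_ivl c x).measure_lt_top

instance (μ : Measure (Ivl a b)) [IsLocallyFiniteMeasure μ] (c x : Ivl a b) :
    IsFiniteMeasure (μ.restrict (Ico c x)) :=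
  ⟨by simpa using measure_Ico_lt_top μ c x⟩

lemma locallyIntegrable_of_Icc {μ : Measure (Ivl a b)} {h : Ivl a b → ℂ}
    (hh : ∀ c x, IntegrableOn h (Icc c x) μ) : LocallyIntegrable h μ := fun x => by
  obtain ⟨c, hc⟩ := exists_lt x
  obtain ⟨d, hd⟩ := exists_gt x
  exact ⟨Icc c d, Icc_mem_nhds hc hd, hh c d⟩

lemma orientedIntegral_of_le {μ : Measure (Ivl a b)} {h : Ivl a b → ℂ} {c x : Ivl a b}
    (hcx : c ≤ x) : orientedIntegral μ h c x = ∫ s in Ico c x, h s ∂μ := if_pos hcx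

lemma orientedIntegral_symm {μ : Measure (Ivl a b)} {h : Ivl a b → ℂ} (c x : Ivl a b) :
    orientedIntegral μ h x c = -orientedIntegral μ h c x := by
  unfold orientedIntegral
  rcases lt_trichotomy c x with h | rfl | h
  · simp [h.le, h.not_ge]
  · simp
  · simp [h.le, h.not_ge]

lemma setIntegral_Ico_add {μ : Measure (Ivl a b)} {h : Ivl a b → ℂ} (hh : LocallyIntegrable h μ)
    {c y x : Ivl a b} (hcy : c ≤ y) (hyx : y ≤ x) :
    (∫ s in Ico c y, h s ∂μ) + ∫ s in Ico y x, h s ∂μ = ∫ s in Ico c x, h s ∂μ := by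
  rw [← Ico_union_Ico_eq_Ico hcy hyx, setIntegral_union _ measurableSet_Ico
    (integrableOn_Ico hh _ _) (integrableOn_Ico hh _ _)]
  rw [Set.disjoint_left]
  exact fun s hs hs' => hs.2.not_ge hs'.1

lemma orientedIntegral_trans {μ : Measure (Ivl a b)} {h : Ivl a b → ℂ}
    (hh : LocallyIntegrable h μ) (c y x : Ivl a b) :
    orientedIntegral μ h c y + orientedIntegral μ h y x = orientedIntegral μ h c x := by
  have key : ∀ {c y x : Ivl a b}, c ≤ y → y ≤ x →
      orientedIntegral μ h c y + orientedIntegral μ h y x = orientedIntegral μ h c x := by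
    intro c y x h1 h2
    rw [orientedIntegral_of_le h1, orientedIntegral_of_le h2, orientedIntegral_of_le (h1.trans h2),
      setIntegral_Ico_add hh h1 h2]
  have s1 := orientedIntegral_symm (μ := μ) (h := h) c y
  have s2 := orientedIntegral_symm (μ := μ) (h := h) c x
  have s3 := orientedIntegral_symm (μ := μ) (h := h) y x
  rcases le_total c y with h1 | h1 <;> rcases le_total y x with h2 | h2 <;>
    rcases le_total c x with h3 | h3
  · exact key h1 h2
  · exact key h1 h2
  · have := key h3 h2
    rw [s3] at this
    linear_combination -this
  · have := key h3 h1
    rw [s2, s3] at this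
    linear_combination this
  · have := key h1 h3
    rw [s1] at this
    linear_combination -this
  · have := key h2 h3
    rw [s2, s1] at this
    linear_combination this
  · have := key h2 h1
    rw [s1, s3, s2] at this
    linear_combination -this
  · have := key h2 h1
    rw [s1, s3, s2] at this
    linear_combination -this

lemma HasDensity.of_le {μ : Measure (Ivl a b)} {f h : Ivl a b → ℂ} (hh : LocallyIntegrable h μ)
    (hf : ∀ c x, c ≤ x → f x = f c + ∫ s in Ico c x, h s ∂μ) : HasDensity μ f h where
  locallyIntegrable := hh
  eq_add c x := by
    rcases le_total c x with hcx | hcx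
    · rw [orientedIntegral_of_le hcx, hf c x hcx]
    · rw [orientedIntegral_symm, orientedIntegral_of_le hcx, hf x c hcx]
      ring

lemma HasDensity.of_base {μ : Measure (Ivl a b)} {f h : Ivl a b → ℂ} (hh : LocallyIntegrable h μ)
    (c : Ivl a b) (hf : ∀ x, f x = f c + orientedIntegral μ h c x) : HasDensity μ f h where
  locallyIntegrable := hh
  eq_add y x := by
    have h1 := hf x
    have h2 := hf y
    have h3 := orientedIntegral_trans hh c y x
    rw [h1, h2, ← h3]
    ring

lemma HasDensity.eq_of_le {μ : Measure (Ivl a b)} {f h : Ivl a b → ℂ} (hf : HasDensity μ f h)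
    {c x : Ivl a b} (hcx : c ≤ x) : f x = f c + ∫ s in Ico c x, h s ∂μ := by
  rw [hf.2 c x, orientedIntegral_of_le hcx]

lemma HasDensity.const (μ : Measure (Ivl a b)) (k : ℂ) : HasDensity μ (fun _ => k) 0 where
  locallyIntegrable := locallyIntegrable_zero
  eq_add c x := by simp [orientedIntegral_zero]

lemma measurableSet_lt_ivl {α : Type*} [MeasurableSpace α] {f g : α → Ivl a b} (hf : Measurable f)
    (hg : Measurable g) : MeasurableSet {x | f x < g x} := measurableSet_lt hf hg

lemma measurableSet_le_ivl {α : Type*} [MeasurableSpace α] {f g : α → Ivl a b} (hf : Measurable f)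
    (hg : Measurable g) : MeasurableSet {x | f x ≤ g x} := measurableSet_le hf hg

lemma stronglyMeasurable_orientedIntegral {μ : Measure (Ivl a b)} [IsLocallyFiniteMeasure μ]
    {h : Ivl a b → ℂ} (hh : LocallyIntegrable h μ) (c : Ivl a b) :
    StronglyMeasurable (orientedIntegral μ h c) := by
  have hm := hh.aestronglyMeasurable
  have e1 : orientedIntegral μ h c = orientedIntegral μ (hm.mk h) c :=
    funext fun x => orientedIntegral_congr hm.ae_eq_mk c x
  rw [e1]
  have hk := hm.stronglyMeasurable_mk
  generalize hm.mk h = k at hk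
  have m1 : MeasurableSet {p : Ivl a b × Ivl a b | c ≤ p.2 ∧ p.2 < p.1} :=
    (measurableSet_le_ivl measurable_const measurable_snd).inter
      (measurableSet_lt_ivl measurable_snd measurable_fst)
  have m2 : MeasurableSet {p : Ivl a b × Ivl a b | p.1 ≤ p.2 ∧ p.2 < c} :=
    (measurableSet_le_ivl measurable_fst measurable_snd).inter
      (measurableSet_lt_ivl measurable_snd measurable_const)
  have k1 := ((hk.comp_measurable measurable_snd).indicator m1).integral_prod_right' (ν := μ)
  have k2 := ((hk.comp_measurable measurable_snd).indicator m2).integral_prod_right' (ν := μ)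
  convert k1.sub k2 using 1
  funext x
  have r1 : (∫ y, {p : Ivl a b × Ivl a b | c ≤ p.2 ∧ p.2 < p.1}.indicator
      (k ∘ Prod.snd) (x, y) ∂μ) = ∫ s in Ico c x, k s ∂μ := by
    rw [← integral_indicator measurableSet_Ico]
    rfl
  have r2 : (∫ y, {p : Ivl a b × Ivl a b | p.1 ≤ p.2 ∧ p.2 < c}.indicator
      (k ∘ Prod.snd) (x, y) ∂μ) = ∫ s in Ico x c, k s ∂μ := by
    rw [← integral_indicator measurableSet_Ico]
    rfl
  simp only [Pi.sub_apply, r1, r2, orientedIntegral]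
  split_ifs with hcx
  · simp [Ico_eq_empty_of_le hcx]
  · simp [Ico_eq_empty_of_le (not_le.1 hcx).le]

lemma HasDensity.stronglyMeasurable {μ : Measure (Ivl a b)} [IsLocallyFiniteMeasure μ]
    {f h : Ivl a b → ℂ} (hf : HasDensity μ f h) : StronglyMeasurable f := by
  rcases isEmpty_or_nonempty (Ivl a b) with he | ⟨⟨c⟩⟩
  · exact (measurable_of_empty f).stronglyMeasurable
  · rw [show f = fun x => f c + orientedIntegral μ h c x from funext (hf.2 c)]
    exact stronglyMeasurable_const.add (stronglyMeasurable_orientedIntegral hf.1 c)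

lemma norm_setIntegral_Ico_le {μ : Measure (Ivl a b)} {h : Ivl a b → ℂ}
    (hh : LocallyIntegrable h μ) {c d x : Ivl a b} (hx : x ∈ Icc c d) :
    ‖∫ s in Ico c x, h s ∂μ‖ ≤ ∫ s in Ico c d, ‖h s‖ ∂μ :=
  (norm_integral_le_integral_norm _).trans
    (setIntegral_mono_set (integrableOn_Ico hh c d).norm (ae_of_all _ fun _ => norm_nonneg _)
      (Ico_subset_Ico_right hx.2).eventuallyLE)

lemma HasDensity.exists_bound {μ : Measure (Ivl a b)} {f h : Ivl a b → ℂ} (hf : HasDensity μ f h)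
    (c d : Ivl a b) : ∃ M, ∀ x ∈ Icc c d, ‖f x‖ ≤ M := by
  refine ⟨‖f c‖ + ∫ s in Ico c d, ‖h s‖ ∂μ, fun x hx => ?_⟩
  rw [hf.eq_of_le hx.1]
  exact (norm_add_le _ _).trans (by gcongr; exact norm_setIntegral_Ico_le hf.1 hx)

/-- A measurable function that is bounded on compact intervals. -/
structure LocBdd (f : Ivl a b → ℂ) : Prop where
  meas : StronglyMeasurable f
  bdd : ∀ c d, ∃ M, ∀ x ∈ Icc c d, ‖f x‖ ≤ M

lemma HasDensity.locBdd {μ : Measure (Ivl a b)} [IsLocallyFiniteMeasure μ] {f h : Ivl a b → ℂ}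
    (hf : HasDensity μ f h) : LocBdd f := ⟨hf.stronglyMeasurable, hf.exists_bound⟩

lemma hasDensity_orientedIntegral {μ : Measure (Ivl a b)} {h : Ivl a b → ℂ}
    (hh : LocallyIntegrable h μ) (c : Ivl a b) : HasDensity μ (orientedIntegral μ h c) h :=
  HasDensity.of_base hh c fun x => by simp [orientedIntegral]

namespace LocBdd

variable {f g : Ivl a b → ℂ}

lemma const (k : ℂ) : LocBdd (fun _ : Ivl a b => k) :=
  ⟨stronglyMeasurable_const, fun _ _ => ⟨‖k‖, fun _ _ => le_rfl⟩⟩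

lemma add (hf : LocBdd f) (hg : LocBdd g) : LocBdd (fun x => f x + g x) :=
  ⟨hf.1.add hg.1, fun c d => by
    obtain ⟨M, hM⟩ := hf.2 c d
    obtain ⟨N, hN⟩ := hg.2 c d
    exact ⟨M + N, fun x hx => (norm_add_le _ _).trans (add_le_add (hM x hx) (hN x hx))⟩⟩

lemma mul (hf : LocBdd f) (hg : LocBdd g) : LocBdd (fun x => f x * g x) :=
  ⟨hf.1.mul hg.1, fun c d => by
    obtain ⟨M, hM⟩ := hf.2 c d
    obtain ⟨N, hN⟩ := hg.2 c d
    exact ⟨M * N, fun x hx => by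
      rw [norm_mul]
      exact mul_le_mul (hM x hx) (hN x hx) (norm_nonneg _) ((norm_nonneg _).trans (hM x hx))⟩⟩

lemma neg (hf : LocBdd f) : LocBdd (fun x => -f x) := by
  simpa using (const (-1)).mul hf

lemma sub (hf : LocBdd f) (hg : LocBdd g) : LocBdd (fun x => f x - g x) := by
  simpa [sub_eq_add_neg] using hf.add hg.neg

lemma star (hf : LocBdd f) : LocBdd (fun x => conj (f x)) :=
  ⟨Complex.continuous_conj.comp_stronglyMeasurable hf.1, fun c d => by simpa using hf.2 c d⟩

lemma mul_locallyIntegrable {μ : Measure (Ivl a b)} [IsLocallyFiniteMeasure μ] (hf : LocBdd f)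
    (hg : LocallyIntegrable g μ) : LocallyIntegrable (fun x => f x * g x) μ :=
  locallyIntegrable_of_Icc fun c d => by
    obtain ⟨M, hM⟩ := hf.2 c d
    exact Integrable.bdd_mul (hg.integrableOn_isCompact (isCompact_Icc_ivl c d))
      hf.1.aestronglyMeasurable
      ((ae_restrict_iff' measurableSet_Icc).2 (ae_of_all _ hM))

lemma locallyIntegrable {μ : Measure (Ivl a b)} [IsLocallyFiniteMeasure μ] (hf : LocBdd f) :
    LocallyIntegrable f μ := by
  simpa using hf.mul_locallyIntegrable (locallyIntegrable_const (1 : ℂ))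

lemma memLp {μ : Measure (Ivl a b)} [IsLocallyFiniteMeasure μ] (hf : LocBdd f) (c d : Ivl a b) :
    MemLp f 2 (μ.restrict (Ico c d)) := by
  obtain ⟨M, hM⟩ := hf.2 c d
  exact MemLp.of_bound hf.1.aestronglyMeasurable M
    ((ae_restrict_iff' measurableSet_Ico).2 (ae_of_all _ fun x hx => hM x (Ico_subset_Icc_self hx)))

end LocBdd

/-! ### Uniqueness of densities -/

lemma ae_eq_zero_of_setIntegral_Ico {μ : Measure (Ivl a b)} [IsLocallyFiniteMeasure μ]
    {h : Ivl a b → ℂ} (hh : LocallyIntegrable h μ)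
    (h0 : ∀ c x, c < x → ∫ s in Ico c x, h s ∂μ = 0) : h =ᵐ[μ] 0 := by
  have key : ∀ c d : Ivl a b, h =ᵐ[μ.restrict (Ico c d)] 0 := by
    intro c d
    have hInt : Integrable h (μ.restrict (Ico c d)) := integrableOn_Ico hh c d
    have hall : ∀ s : Set (Ivl a b), MeasurableSet s →
        ∫ x in s, h x ∂(μ.restrict (Ico c d)) = 0 := by
      have huniv : ∫ x, h x ∂(μ.restrict (Ico c d)) = 0 := by
        rcases lt_or_ge c d with hcd | hcd
        · exact h0 c d hcd
        · simp [Ico_eq_empty_of_le hcd]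
      intro s hs
      have hgen : (inferInstance : MeasurableSpace (Ivl a b)) =
          MeasurableSpace.generateFrom {S | ∃ l u : Ivl a b, l < u ∧ Ico l u = S} := by
        rw [← borel_eq_generateFrom_Ico]
        exact BorelSpace.measurable_eq
      induction s, hs using MeasurableSpace.induction_on_inter hgen
        (isPiSystem_Ico id id) with
      | empty => simp
      | basic t ht =>
        obtain ⟨l, u, hlu, rfl⟩ := ht
        rw [Measure.restrict_restrict measurableSet_Ico, Ico_inter_Ico]
        rcases lt_or_ge (l ⊔ c) (u ⊓ d) with h1 | h1
        · exact h0 _ _ h1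
        · simp [Ico_eq_empty_of_le h1]
      | compl t ht ih =>
        have := integral_add_compl ht hInt
        rw [ih, huniv, zero_add] at this
        exact this
      | iUnion f hd hf ih =>
        rw [integral_iUnion hf hd hInt.integrableOn]
        simp [ih]
    exact hInt.ae_eq_zero_of_forall_setIntegral_eq_zero fun s hs _ => hall s hs
  rcases isEmpty_or_nonempty (Ivl a b) with he | hne
  · exact ae_of_all _ fun x => (he.false x).elim
  obtain ⟨u, hu, hu'⟩ := exists_seq_tendsto (atTop : Filter (Ivl a b)) |>.imp fun u hu =>
    (⟨hu, trivial⟩ : _ ∧ True)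
  obtain ⟨v, hv⟩ := exists_seq_tendsto (atBot : Filter (Ivl a b))
  have hcov : (⋃ n, Ico (v n) (u n)) = univ := by
    refine eq_univ_of_forall fun x => ?_
    obtain ⟨n, h1, h2⟩ := ((hu.eventually_gt_atTop x).and (hv.eventually_le_atBot x)).exists
    exact mem_iUnion.2 ⟨n, h2, h1⟩
  have := (ae_restrict_iUnion_iff (μ := μ) (fun n => Ico (v n) (u n)) (fun x => h x = 0)).2
    fun n => key _ _
  rwa [hcov, Measure.restrict_univ] at this

lemma HasDensity.ae_eq {μ : Measure (Ivl a b)} [IsLocallyFiniteMeasure μ] {f h k : Ivl a b → ℂ}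
    (hf : HasDensity μ f h) (hk : HasDensity μ f k) : h =ᵐ[μ] k := by
  have : (h - k) =ᵐ[μ] 0 := by
    refine ae_eq_zero_of_setIntegral_Ico (hf.1.sub hk.1) fun c x hcx => ?_
    have h1 := hf.eq_of_le hcx.le
    have h2 := hk.eq_of_le hcx.le
    simp only [Pi.sub_apply]
    rw [integral_sub (integrableOn_Ico hf.1 c x) (integrableOn_Ico hk.1 c x)]
    linear_combination h2 - h1
  filter_upwards [this] with x hx
  exact sub_eq_zero.1 hx

/-! ### Integration by parts -/

lemma setIntegral_Icc_eq {μ : Measure (Ivl a b)} {f : Ivl a b → ℂ} (hf : LocallyIntegrable f μ)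
    {c t : Ivl a b} (hct : c ≤ t) :
    ∫ s in Icc c t, f s ∂μ = (∫ s in Ico c t, f s ∂μ) + μ.real {t} • f t := by
  rw [← Ico_union_right hct, setIntegral_union (by simp) (measurableSet_singleton t)
    (integrableOn_Ico hf c t), integral_singleton]
  exact (hf.integrableOn_isCompact (isCompact_Icc_ivl c t)).mono_set (by simpa using hct)

lemma integral_mul_integral_Ico {μ ν : Measure (Ivl a b)} [IsLocallyFiniteMeasure μ]
    [IsLocallyFiniteMeasure ν] {f k : Ivl a b → ℂ} (hf : LocallyIntegrable f μ)
    (hk : LocallyIntegrable k ν) {c x : Ivl a b} :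
    (∫ s in Ico c x, f s ∂μ) * ∫ t in Ico c x, k t ∂ν =
      (∫ s in Ico c x, f s * ∫ t in Ico c s, k t ∂ν ∂μ) +
        ∫ t in Ico c x, (∫ s in Icc c t, f s ∂μ) * k t ∂ν := by
  set μ' := μ.restrict (Ico c x)
  set ν' := ν.restrict (Ico c x)
  have hf' : Integrable f μ' := integrableOn_Ico hf c x
  have hk' : Integrable k ν' := integrableOn_Ico hk c x
  have hfk : Integrable (fun z : Ivl a b × Ivl a b => f z.1 * k z.2) (μ'.prod ν') :=
    hf'.mul_prod hk'
  have ms : MeasurableSet {z : Ivl a b × Ivl a b | z.2 < z.1} :=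
    measurableSet_lt_ivl measurable_snd measurable_fst
  rw [← integral_prod_mul, ← integral_add_compl ms hfk]
  congr 1
  · rw [← integral_indicator ms, integral_prod _ (hfk.indicator ms)]
    refine setIntegral_congr_fun measurableSet_Ico fun s hs => ?_
    rw [← integral_const_mul, ← integral_indicator measurableSet_Ico,
      ← integral_indicator measurableSet_Ico]
    refine integral_congr_ae (ae_of_all _ fun t => ?_)
    simp only [indicator_apply, mem_ofPred_eq, mem_Ico]
    have := hs.2
    by_cases h1 : c ≤ t <;> by_cases h2 : t < s <;> simp [h1, h2]
    exact fun h3 => absurd (h2.trans hs.2) h3.not_gt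
  · rw [← integral_indicator ms.compl, integral_prod_symm _ (hfk.indicator ms.compl)]
    refine setIntegral_congr_fun measurableSet_Ico fun t ht => ?_
    rw [← integral_mul_const, ← integral_indicator measurableSet_Ico,
      ← integral_indicator measurableSet_Icc]
    refine integral_congr_ae (ae_of_all _ fun s => ?_)
    simp only [indicator_apply, mem_ofPred_eq, mem_Ico, mem_Icc, mem_compl_iff, not_lt]
    have := ht.2
    by_cases h1 : c ≤ s <;> by_cases h2 : s ≤ t <;> simp [h1, h2]
    exact fun h3 => absurd (h2.trans_lt ht.2) h3.not_gt

/-- The product rule for functions of locally bounded variation, in integrated form. -/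
lemma HasDensity.mul_eq {μ ν : Measure (Ivl a b)} [IsLocallyFiniteMeasure μ]
    [IsLocallyFiniteMeasure ν] {F f G k : Ivl a b → ℂ} (hF : HasDensity μ F f)
    (hG : HasDensity ν G k) {c x : Ivl a b} (hcx : c ≤ x) :
    F x * G x = F c * G c + (∫ s in Ico c x, f s * G s ∂μ) +
      ∫ t in Ico c x, (F t + μ.real {t} • f t) * k t ∂ν := by
  have h1 := integral_mul_integral_Ico hF.1 hG.1 (c := c) (x := x)
  have hf' := integrableOn_Ico hF.1 c x
  have hk' := integrableOn_Ico hG.1 c x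
  have e1 : ∫ s in Ico c x, f s * ∫ t in Ico c s, k t ∂ν ∂μ =
      (∫ s in Ico c x, f s * G s ∂μ) - (∫ s in Ico c x, f s ∂μ) * G c := by
    rw [← integral_mul_const, ← integral_sub]
    · refine setIntegral_congr_fun measurableSet_Ico fun s hs => ?_
      rw [hG.eq_of_le hs.1]
      ring
    · exact (integrableOn_Ico (hG.locBdd.mul_locallyIntegrable hF.1) c x).congr
        (ae_of_all _ fun _ => mul_comm _ _)
    · exact hf'.mul_const _
  have hbd : ∀ t ∈ Ico c x, ∫ s in Icc c t, f s ∂μ = (F t + μ.real {t} • f t) - F c := by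
    intro t ht
    rw [setIntegral_Icc_eq hF.1 ht.1, hF.eq_of_le ht.1]
    ring
  have hInt : IntegrableOn (fun t => (∫ s in Icc c t, f s ∂μ) * k t) (Ico c x) ν := by
    have ms : MeasurableSet {p : Ivl a b × Ivl a b | c ≤ p.2 ∧ p.2 ≤ p.1} :=
      (measurableSet_le_ivl measurable_const measurable_snd).inter
        (measurableSet_le_ivl measurable_snd measurable_fst)
    have hm := hF.1.aestronglyMeasurable
    have hsm : StronglyMeasurable (fun t => ∫ s in Icc c t, f s ∂μ) := by
      have := ((hm.stronglyMeasurable_mk.comp_measurable measurable_snd).indicator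
        ms).integral_prod_right' (ν := μ)
      convert this using 1
      funext t
      rw [integral_congr_ae (ae_restrict_of_ae hm.ae_eq_mk), ← integral_indicator measurableSet_Icc]
      rfl
    refine Integrable.bdd_mul (c := ∫ s in Ico c x, ‖f s‖ ∂μ) hk' hsm.aestronglyMeasurable
      ((ae_restrict_iff' measurableSet_Ico).2 (ae_of_all _ fun t ht => ?_))
    refine (norm_integral_le_integral_norm _).trans ?_
    exact setIntegral_mono_set hf'.norm (ae_of_all _ fun _ => norm_nonneg _)
      (Icc_subset_Ico_right ht.2).eventuallyLE
  have e2 : ∫ t in Ico c x, (F t + μ.real {t} • f t) * k t ∂ν =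
      (∫ t in Ico c x, (∫ s in Icc c t, f s ∂μ) * k t ∂ν) + F c * ∫ t in Ico c x, k t ∂ν := by
    rw [← integral_const_mul, ← integral_add hInt (hk'.const_mul _)]
    refine setIntegral_congr_fun measurableSet_Ico fun t ht => ?_
    rw [hbd t ht]
    ring
  rw [e2, hF.eq_of_le hcx, hG.eq_of_le hcx]
  linear_combination h1 + e1

lemma ae_add_singleton {μ ν : Measure (Ivl a b)} [IsLocallyFiniteMeasure μ]
    [IsLocallyFiniteMeasure ν] (hμν : ∀ x, μ {x} * ν {x} = 0) (f : Ivl a b → ℂ) :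
    ∀ᵐ t ∂ν, μ.real {t} • f t = 0 := by
  have hc : {t : Ivl a b | 0 < μ {t}}.Countable := by
    exact Measure.countable_meas_pos_of_disjoint_iUnion (fun t => measurableSet_singleton t)
      (fun s t hst => by simpa using hst)
  have h0 : ν {t : Ivl a b | 0 < μ {t}} = 0 := by
    rw [measure_null_iff_singleton hc]
    exact fun t ht => (mul_eq_zero.1 (hμν t)).resolve_left ht.ne'
  filter_upwards [measure_eq_zero_iff_ae_notMem.1 h0] with t ht
  simp only [not_lt, nonpos_iff_eq_zero] at ht
  simp [Measure.real, ht]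

/-- The product rule when the two measures have no atoms in common. -/
lemma HasDensity.mul_eq_of_atoms {μ ν : Measure (Ivl a b)} [IsLocallyFiniteMeasure μ]
    [IsLocallyFiniteMeasure ν] (hμν : ∀ x, μ {x} * ν {x} = 0) {F f G k : Ivl a b → ℂ}
    (hF : HasDensity μ F f) (hG : HasDensity ν G k) {c x : Ivl a b} (hcx : c ≤ x) :
    F x * G x = F c * G c + (∫ s in Ico c x, f s * G s ∂μ) + ∫ t in Ico c x, F t * k t ∂ν := by
  rw [hF.mul_eq hG hcx]
  congr 1
  refine integral_congr_ae (ae_restrict_of_ae ?_)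
  filter_upwards [ae_add_singleton hμν f] with t ht
  rw [ht, add_zero]

end LeftDefinite

end

noncomputable section

namespace LeftDefinite

variable {a b : EReal}

/-! ### Gronwall's inequality -/

lemma exists_lt_measure_Ioo_lt (ω : Measure (Ivl a b)) [IsLocallyFiniteMeasure ω] (x : Ivl a b)
    {ε : ℝ≥0∞} (hε : 0 < ε) : ∃ z < x, ∀ y, z ≤ y → y < x → ω (Ioo y x) < ε := by
  obtain ⟨u, hu, hux, hlim⟩ := exists_seq_strictMono_tendsto x
  have h1 : Tendsto (fun n => ω (Ioo (u n) x)) atTop (𝓝 (ω (⋂ n, Ioo (u n) x))) :=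
    tendsto_measure_iInter_atTop (fun n => measurableSet_Ioo.nullMeasurableSet)
      (fun m n hmn => Ioo_subset_Ioo_left (hu.monotone hmn))
      ⟨0, ((measure_mono Ioo_subset_Icc_self).trans_lt
        (isCompact_Icc_ivl _ _).measure_lt_top).ne⟩
  have h2 : (⋂ n, Ioo (u n) x) = ∅ := by
    refine eq_empty_of_forall_notMem fun y hy => ?_
    rw [mem_iInter] at hy
    obtain ⟨n, hn⟩ := (hlim.eventually (lt_mem_nhds (hy 0).2)).exists
    exact (hy n).1.not_gt hn
  rw [h2, measure_empty] at h1
  obtain ⟨n, hn⟩ := (h1.eventually (gt_mem_nhds hε)).exists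
  exact ⟨u n, hux n, fun y hy _ => (measure_mono (Ioo_subset_Ioo_left hy)).trans_lt hn⟩

lemma exists_gt_measure_Ioo_lt (ω : Measure (Ivl a b)) [IsLocallyFiniteMeasure ω] (x : Ivl a b)
    {ε : ℝ≥0∞} (hε : 0 < ε) : ∃ z > x, ∀ y, y ≤ z → x < y → ω (Ioo x y) < ε := by
  obtain ⟨u, hu, hux, hlim⟩ := exists_seq_strictAnti_tendsto x
  have h1 : Tendsto (fun n => ω (Ioo x (u n))) atTop (𝓝 (ω (⋂ n, Ioo x (u n)))) :=
    tendsto_measure_iInter_atTop (fun n => measurableSet_Ioo.nullMeasurableSet)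
      (fun m n hmn => Ioo_subset_Ioo_right (hu.antitone hmn))
      ⟨0, ((measure_mono Ioo_subset_Icc_self).trans_lt
        (isCompact_Icc_ivl _ _).measure_lt_top).ne⟩
  have h2 : (⋂ n, Ioo x (u n)) = ∅ := by
    refine eq_empty_of_forall_notMem fun y hy => ?_
    rw [mem_iInter] at hy
    obtain ⟨n, hn⟩ := (hlim.eventually (gt_mem_nhds (hy 0).1)).exists
    exact (hy n).2.not_gt hn
  rw [h2, measure_empty] at h1
  obtain ⟨n, hn⟩ := (h1.eventually (gt_mem_nhds hε)).exists
  exact ⟨u n, hux n, fun y hy _ => (measure_mono (Ioo_subset_Ioo_right hy)).trans_lt hn⟩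

/-- `K` is a Gronwall constant on `[α, β]`. -/
def IsGronwallConstant (ω : Measure (Ivl a b)) (C : ℝ) (α β : Ivl a b) (K : ℝ) : Prop :=
  ∀ g : Ivl a b → ℝ, Measurable g → (∀ x, 0 ≤ g x) → (∃ M, ∀ x ∈ Icc α β, g x ≤ M) → ∀ A, 0 ≤ A →
    (∀ x ∈ Icc α β, g x ≤ A + C * ∫ s in Ico α x, g s ∂ω) → ∀ x ∈ Icc α β, g x ≤ K * A

lemma IsGronwallConstant.extend {ω : Measure (Ivl a b)} [IsLocallyFiniteMeasure ω] {C : ℝ}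
    (hC : 0 ≤ C) {α y β : Ivl a b} (hαy : α ≤ y) (hyβ : y ≤ β)
    (hsmall : C * ω.real (Ioo y β) ≤ 1 / 2) {K : ℝ} (hK0 : 0 ≤ K)
    (hK : IsGronwallConstant ω C α y K) :
    ∃ K', 0 ≤ K' ∧ IsGronwallConstant ω C α β K' := by
  have hW : 0 ≤ ω.real (Icc α y) := measureReal_nonneg
  have h1 : 0 ≤ 2 * (1 + C * (K * ω.real (Icc α y))) := by positivity
  refine ⟨K + 2 * (1 + C * (K * ω.real (Icc α y))), by positivity, ?_⟩
  rintro g hg hg0 ⟨M, hM⟩ A hA hgA x hx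
  have hin : ∀ t ∈ Icc α y, g t ≤ K * A := hK g hg hg0
    ⟨M, fun t ht => hM t ⟨ht.1, ht.2.trans hyβ⟩⟩ A hA fun t ht => hgA t ⟨ht.1, ht.2.trans hyβ⟩
  rw [add_mul]
  rcases le_or_gt x y with hxy | hxy
  · linarith [hin x ⟨hx.1, hxy⟩, mul_nonneg h1 hA]
  set Q := sSup (g '' Ioc y β)
  have hbdd : BddAbove (g '' Ioc y β) := ⟨M, by
    rintro _ ⟨t, ht, rfl⟩
    exact hM t ⟨hαy.trans ht.1.le, ht.2⟩⟩
  have hQ : ∀ t ∈ Ioc y β, g t ≤ Q := fun t ht => le_csSup hbdd ⟨t, ht, rfl⟩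
  have hQ0 : 0 ≤ Q := (hg0 x).trans (hQ x ⟨hxy, hx.2⟩)
  have hfin : ω (Icc α β) ≠ ∞ := (isCompact_Icc_ivl α β).measure_lt_top.ne
  have hgi : IntegrableOn g (Icc α β) ω := by
    refine Measure.integrableOn_of_bounded (M := M) hfin hg.aestronglyMeasurable
      ((ae_restrict_iff' measurableSet_Icc).2 (ae_of_all _ fun t ht => ?_))
    rw [Real.norm_of_nonneg (hg0 t)]
    exact hM t ht
  have hbound : ∀ t ∈ Ioc y β, g t ≤ A + C * (K * A * ω.real (Icc α y)) + Q / 2 := by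
    intro t ht
    have hsub : Ico α t ⊆ Icc α y ∪ Ioo y β := by
      intro s hs
      rcases le_or_gt s y with h | h
      · exact Or.inl ⟨hs.1, h⟩
      · exact Or.inr ⟨h, hs.2.trans_le ht.2⟩
    have hsub' : Icc α y ∪ Ioo y β ⊆ Icc α β :=
      union_subset (Icc_subset_Icc_right hyβ) fun s hs => ⟨hαy.trans hs.1.le, hs.2.le⟩
    have i1 : ∫ s in Ico α t, g s ∂ω ≤ (∫ s in Icc α y, g s ∂ω) + ∫ s in Ioo y β, g s ∂ω := by
      rw [← setIntegral_union (by
        rw [Set.disjoint_left]; exact fun s hs hs' => hs.2.not_gt hs'.1) measurableSet_Ioo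
        (hgi.mono_set (subset_union_left.trans hsub'))
        (hgi.mono_set (subset_union_right.trans hsub'))]
      exact setIntegral_mono_set (hgi.mono_set hsub') (ae_of_all _ hg0) hsub.eventuallyLE
    have i2 : ∫ s in Icc α y, g s ∂ω ≤ K * A * ω.real (Icc α y) := by
      have := setIntegral_mono_on (hgi.mono_set (subset_union_left.trans hsub'))
        (integrableOn_const (C := K * A) (isCompact_Icc_ivl α y).measure_lt_top.ne)
        measurableSet_Icc hin
      simpa [mul_comm] using this
    have i3 : ∫ s in Ioo y β, g s ∂ω ≤ Q * ω.real (Ioo y β) := by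
      have := setIntegral_mono_on (hgi.mono_set (subset_union_right.trans hsub'))
        (integrableOn_const (C := Q) ((measure_mono (subset_union_right.trans hsub')).trans_lt
          hfin.lt_top).ne) measurableSet_Ioo fun s hs => hQ s ⟨hs.1, hs.2.le⟩
      simpa [mul_comm] using this
    have i4 := hgA t ⟨hαy.trans ht.1.le, ht.2⟩
    have i5 : C * ∫ s in Ico α t, g s ∂ω ≤
        C * (K * A * ω.real (Icc α y) + Q * ω.real (Ioo y β)) := by gcongr; linarith
    nlinarith [mul_le_mul_of_nonneg_left hsmall hQ0]
  have hQle : Q ≤ A + C * (K * A * ω.real (Icc α y)) + Q / 2 :=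
    csSup_le ⟨g x, x, ⟨hxy, hx.2⟩, rfl⟩ (by
      rintro _ ⟨t, ht, rfl⟩
      exact hbound t ht)
  have := hQ x ⟨hxy, hx.2⟩
  nlinarith [mul_nonneg hK0 hA]

lemma exists_isGronwallConstant (ω : Measure (Ivl a b)) [IsLocallyFiniteMeasure ω] {C : ℝ}
    (hC : 0 ≤ C) {α β : Ivl a b} (hαβ : α ≤ β) :
    ∃ K, 0 ≤ K ∧ IsGronwallConstant ω C α β K := by
  obtain ⟨ε, hε, hCε⟩ : ∃ ε : ℝ, 0 < ε ∧ C * ε ≤ 1 / 2 :=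
    ⟨1 / (2 * (C + 1)), by positivity, by
      rw [mul_one_div, div_le_div_iff₀ (by positivity) (by norm_num)]
      linarith⟩
  have hsm : ∀ {s : Set (Ivl a b)}, ω s < ENNReal.ofReal ε → C * ω.real s ≤ 1 / 2 := by
    intro s hs
    have : ω.real s ≤ ε := ENNReal.toReal_le_of_le_ofReal hε.le hs.le
    exact (mul_le_mul_of_nonneg_left this hC).trans hCε
  let P : Set ℝ := {t | ∃ x : Ivl a b, x.1 = t ∧ α ≤ x ∧ x ≤ β ∧
    ∃ K, 0 ≤ K ∧ IsGronwallConstant ω C α x K}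
  have hα : α.1 ∈ P := by
    refine ⟨α, rfl, le_rfl, hαβ, 1, zero_le_one, ?_⟩
    rintro g hg hg0 - A hA hgA x hx
    have := hgA x hx
    obtain rfl : x = α := le_antisymm hx.2 hx.1
    simpa using this
  have hbdd : BddAbove P := ⟨β.1, by
    rintro _ ⟨x, rfl, -, hx, -⟩
    exact hx⟩
  have h1 : α.1 ≤ sSup P := le_csSup hbdd hα
  have h2 : sSup P ≤ β.1 := csSup_le ⟨_, hα⟩ (by
    rintro _ ⟨x, rfl, -, hx, -⟩
    exact hx)
  let X : Ivl a b := ⟨sSup P, α.2.1.trans_le (EReal.coe_le_coe_iff.2 h1),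
    (EReal.coe_le_coe_iff.2 h2).trans_lt β.2.2⟩
  have hX : ∃ K, 0 ≤ K ∧ IsGronwallConstant ω C α X K := by
    obtain ⟨z, hzX, hz⟩ := exists_lt_measure_Ioo_lt ω X (ENNReal.ofReal_pos.2 hε)
    obtain ⟨_, ⟨y, rfl, hy1, hy2, K, hK0, hK⟩, hzy⟩ := exists_lt_of_lt_csSup ⟨_, hα⟩
      (show z.1 < sSup P from hzX)
    have hyX : y ≤ X := le_csSup hbdd ⟨y, rfl, hy1, hy2, K, hK0, hK⟩
    refine hK.extend hC hy1 hyX ?_ hK0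
    rcases hyX.eq_or_lt with h | h
    · rw [h]; simp
    · exact hsm (hz y (le_of_lt hzy) h)
  rcases eq_or_lt_of_le (show X ≤ β from h2) with hXβ | hXβ
  · rwa [← hXβ]
  exfalso
  obtain ⟨z, hzX, hz⟩ := exists_gt_measure_Ioo_lt ω X (ENNReal.ofReal_pos.2 hε)
  obtain ⟨K, hK0, hK⟩ := hX
  have hlt : X < min z β := lt_min hzX hXβ
  have := hK.extend hC h1 hlt.le (hsm (hz _ (min_le_left _ _) hlt)) hK0
  have hmem : (min z β).1 ∈ P := ⟨min z β, rfl, (show α ≤ X from h1).trans hlt.le,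
    min_le_right _ _, this⟩
  exact (le_csSup hbdd hmem).not_gt hlt

end LeftDefinite

end

noncomputable section

namespace LeftDefinite

variable {a b : EReal}

/-! ### Limits of integrals at the end points -/

section Limits

variable {E : Type*} [NormedAddCommGroup E] [NormedSpace ℝ E] {μ : Measure (Ivl a b)}
  {g : Ivl a b → E}

lemma tendsto_setIntegral_Ico_atTop {c : Ivl a b} (hg : IntegrableOn g (Ici c) μ) :
    Tendsto (fun x => ∫ s in Ico c x, g s ∂μ) atTop (𝓝 (∫ s in Ici c, g s ∂μ)) := by
  have := (aecover_Iio (μ := μ.restrict (Ici c)) (tendsto_id (α := Ivl a b) (x := atTop))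
    ).integral_tendsto_of_countably_generated hg
  refine this.congr fun x => ?_
  rw [Measure.restrict_restrict measurableSet_Iio, id, Iio_inter_Ici]

lemma tendsto_setIntegral_Ico_atBot {c : Ivl a b} (hg : IntegrableOn g (Iio c) μ) :
    Tendsto (fun x => ∫ s in Ico x c, g s ∂μ) atBot (𝓝 (∫ s in Iio c, g s ∂μ)) := by
  have := (aecover_Ici (μ := μ.restrict (Iio c)) (tendsto_id (α := Ivl a b) (x := atBot))
    ).integral_tendsto_of_countably_generated hg
  refine this.congr fun x => ?_
  rw [Measure.restrict_restrict measurableSet_Ici, id, Ici_inter_Iio]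

lemma tendsto_setIntegral_Ici_atTop {c : Ivl a b} (hg : IntegrableOn g (Ici c) μ) :
    Tendsto (fun x => ∫ s in Ici x, g s ∂μ) atTop (𝓝 0) := by
  have h1 := (tendsto_setIntegral_Ico_atTop hg).const_sub (∫ s in Ici c, g s ∂μ)
  rw [sub_self] at h1
  refine h1.congr' ?_
  filter_upwards [eventually_ge_atTop c] with x hx
  rw [← Ico_union_Ici_eq_Ici hx, setIntegral_union _ measurableSet_Ici
    (hg.mono_set Ico_subset_Ici_self) (hg.mono_set (Ici_subset_Ici.2 hx)), add_sub_cancel_left]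
  rw [Set.disjoint_left]
  exact fun s hs hs' => hs.2.not_ge hs'

lemma tendsto_setIntegral_Iio_atBot {c : Ivl a b} (hg : IntegrableOn g (Iio c) μ) :
    Tendsto (fun x => ∫ s in Iio x, g s ∂μ) atBot (𝓝 0) := by
  have h1 := (tendsto_setIntegral_Ico_atBot hg).const_sub (∫ s in Iio c, g s ∂μ)
  rw [sub_self] at h1
  refine h1.congr' ?_
  filter_upwards [eventually_le_atBot c] with x hx
  rw [← Iio_union_Ico_eq_Iio hx, setIntegral_union _ measurableSet_Ico
    (hg.mono_set (Iio_subset_Iio hx)) (hg.mono_set Ico_subset_Iio_self), add_sub_cancel_right]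
  rw [Set.disjoint_left]
  exact fun s hs hs' => hs'.1.not_gt hs

end Limits

namespace Coefficients

variable (T : Coefficients a b)

/-! ### The bilinear form of `H¹` over a set -/

/-- `f` and `h` are square integrable over `s` with respect to `χ` and `ς`. -/
structure L2On (s : Set (Ivl a b)) (f h : Ivl a b → ℂ) : Prop where
  fst : MemLp f 2 (T.chi.restrict s)
  snd : MemLp h 2 (T.sigma.restrict s)

/-- The bilinear form `∫ f g dχ + ∫ h k dς` over the set `s`. -/
def form (s : Set (Ivl a b)) (f h g k : Ivl a b → ℂ) : ℂ :=
  (∫ x in s, f x * g x ∂T.chi) + ∫ x in s, h x * k x ∂T.sigma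

/-- The squared norm of `(f, h)` over the set `s`. -/
def nsq (s : Set (Ivl a b)) (f h : Ivl a b → ℂ) : ℝ :=
  (∫ x in s, ‖f x‖ ^ 2 ∂T.chi) + ∫ x in s, ‖h x‖ ^ 2 ∂T.sigma

variable {T} {s t : Set (Ivl a b)} {f h g k : Ivl a b → ℂ}

lemma nsq_nonneg : 0 ≤ T.nsq s f h :=
  add_nonneg (integral_nonneg fun _ => by positivity) (integral_nonneg fun _ => by positivity)

namespace L2On

lemma mono (hf : T.L2On t f h) (hst : s ⊆ t) : T.L2On s f h :=
  ⟨hf.1.mono_measure (Measure.restrict_mono hst le_rfl),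
    hf.2.mono_measure (Measure.restrict_mono hst le_rfl)⟩

lemma add (hf : T.L2On s f h) (hg : T.L2On s g k) : T.L2On s (f + g) (h + k) :=
  ⟨hf.1.add hg.1, hf.2.add hg.2⟩

lemma smul (r : ℂ) (hf : T.L2On s f h) : T.L2On s (r • f) (r • h) :=
  ⟨hf.1.const_smul r, hf.2.const_smul r⟩

lemma star (hf : T.L2On s f h) : T.L2On s (fun x => conj (f x)) (fun x => conj (h x)) :=
  ⟨hf.1.star, hf.2.star⟩

lemma union (hf : T.L2On s f h) (hg : T.L2On t f h) : T.L2On (s ∪ t) f h := by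
  have key : ∀ {μ : Measure (Ivl a b)} {f : Ivl a b → ℂ}, MemLp f 2 (μ.restrict s) →
      MemLp f 2 (μ.restrict t) → MemLp f 2 (μ.restrict (s ∪ t)) := by
    intro μ f h1 h2
    refine (memLp_two_iff_integrable_sq_norm
      (aestronglyMeasurable_union_iff.2 ⟨h1.1, h2.1⟩)).2 ?_
    exact IntegrableOn.union ((memLp_two_iff_integrable_sq_norm h1.1).1 h1)
      ((memLp_two_iff_integrable_sq_norm h2.1).1 h2)
  exact ⟨key hf.1 hg.1, key hf.2 hg.2⟩

lemma congr_fun (hf : T.L2On s f h) (hs : MeasurableSet s) (hg : ∀ x ∈ s, f x = g x)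
    (hk : ∀ x ∈ s, h x = k x) : T.L2On s g k :=
  ⟨(memLp_congr_ae ((ae_restrict_iff' hs).2 (ae_of_all _ hg))).1 hf.1,
    (memLp_congr_ae ((ae_restrict_iff' hs).2 (ae_of_all _ hk))).1 hf.2⟩

lemma congr_ae (hf : T.L2On s f h) (hk : h =ᵐ[T.sigma] k) : T.L2On s f k :=
  ⟨hf.1, (memLp_congr_ae (ae_restrict_of_ae hk)).1 hf.2⟩

lemma integrable_chi (hf : T.L2On s f h) (hg : T.L2On s g k) :
    IntegrableOn (fun x => f x * g x) s T.chi := hf.1.integrable_mul hg.1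

lemma integrable_sigma (hf : T.L2On s f h) (hg : T.L2On s g k) :
    IntegrableOn (fun x => h x * k x) s T.sigma := hf.2.integrable_mul hg.2

lemma integrable_sq_chi (hf : T.L2On s f h) : IntegrableOn (fun x => ‖f x‖ ^ 2) s T.chi :=
  hf.1.integrable_norm_pow two_ne_zero

lemma integrable_sq_sigma (hf : T.L2On s f h) : IntegrableOn (fun x => ‖h x‖ ^ 2) s T.sigma :=
  hf.2.integrable_norm_pow two_ne_zero

lemma nsq_mono (hf : T.L2On t f h) (hst : s ⊆ t) : T.nsq s f h ≤ T.nsq t f h :=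
  add_le_add
    (setIntegral_mono_set hf.integrable_sq_chi (ae_of_all _ fun _ => by positivity)
      hst.eventuallyLE)
    (setIntegral_mono_set hf.integrable_sq_sigma (ae_of_all _ fun _ => by positivity)
      hst.eventuallyLE)

end L2On

lemma norm_integral_mul_le {μ : Measure (Ivl a b)} (hf : MemLp f 2 μ) (hg : MemLp g 2 μ) :
    ‖∫ x, f x * g x ∂μ‖ ≤ √(∫ x, ‖f x‖ ^ 2 ∂μ) * √(∫ x, ‖g x‖ ^ 2 ∂μ) := by
  have h1 := integral_mul_norm_le_Lp_mul_Lq (f := f) (g := g) (μ := μ)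
    (Real.HolderConjugate.two_two) (by simpa using hf) (by simpa using hg)
  rw [← Real.sqrt_eq_rpow, ← Real.sqrt_eq_rpow] at h1
  simp only [Real.rpow_two] at h1
  refine (norm_integral_le_integral_norm _).trans ?_
  simpa only [norm_mul] using h1

/-- The Cauchy-Schwarz inequality. -/
lemma norm_form_le (hf : T.L2On s f h) (hg : T.L2On s g k) :
    ‖T.form s f h g k‖ ≤ √(T.nsq s f h) * √(T.nsq s g k) := by
  have h1 := norm_integral_mul_le hf.1 hg.1
  have h2 := norm_integral_mul_le hf.2 hg.2
  refine (norm_add_le _ _).trans ((add_le_add h1 h2).trans ?_)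
  rw [← Real.sqrt_mul (nsq_nonneg), nsq, nsq]
  set A := ∫ x in s, ‖f x‖ ^ 2 ∂T.chi
  set B := ∫ x in s, ‖g x‖ ^ 2 ∂T.chi
  set C := ∫ x in s, ‖h x‖ ^ 2 ∂T.sigma
  set D := ∫ x in s, ‖k x‖ ^ 2 ∂T.sigma
  have hA : 0 ≤ A := integral_nonneg fun _ => by positivity
  have hB : 0 ≤ B := integral_nonneg fun _ => by positivity
  have hC : 0 ≤ C := integral_nonneg fun _ => by positivity
  have hD : 0 ≤ D := integral_nonneg fun _ => by positivity
  refine Real.le_sqrt_of_sq_le ?_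
  nlinarith [Real.sq_sqrt hA, Real.sq_sqrt hB, Real.sq_sqrt hC, Real.sq_sqrt hD,
    sq_nonneg (√A * √D - √C * √B)]

lemma tendsto_form_Ico_atTop {c : Ivl a b} (hf : T.L2On (Ici c) f h) (hg : T.L2On (Ici c) g k) :
    Tendsto (fun x => T.form (Ico c x) f h g k) atTop (𝓝 (T.form (Ici c) f h g k)) :=
  (tendsto_setIntegral_Ico_atTop (hf.integrable_chi hg)).add
    (tendsto_setIntegral_Ico_atTop (hf.integrable_sigma hg))

lemma tendsto_form_Ico_atBot {c : Ivl a b} (hf : T.L2On (Iio c) f h) (hg : T.L2On (Iio c) g k) :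
    Tendsto (fun x => T.form (Ico x c) f h g k) atBot (𝓝 (T.form (Iio c) f h g k)) :=
  (tendsto_setIntegral_Ico_atBot (hf.integrable_chi hg)).add
    (tendsto_setIntegral_Ico_atBot (hf.integrable_sigma hg))

lemma tendsto_nsq_Iio_atBot {c : Ivl a b} (hf : T.L2On (Iio c) f h) :
    Tendsto (fun x => T.nsq (Iio x) f h) atBot (𝓝 0) := by
  simpa [nsq] using (tendsto_setIntegral_Iio_atBot hf.integrable_sq_chi).add
    (tendsto_setIntegral_Iio_atBot hf.integrable_sq_sigma)

lemma tendsto_nsq_Ici_atTop {c : Ivl a b} (hf : T.L2On (Ici c) f h) :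
    Tendsto (fun x => T.nsq (Ici x) f h) atTop (𝓝 0) := by
  simpa [nsq] using (tendsto_setIntegral_Ici_atTop hf.integrable_sq_chi).add
    (tendsto_setIntegral_Ici_atTop hf.integrable_sq_sigma)

lemma form_union (hs : MeasurableSet t) (hd : Disjoint s t) (hf : T.L2On (s ∪ t) f h)
    (hg : T.L2On (s ∪ t) g k) :
    T.form (s ∪ t) f h g k = T.form s f h g k + T.form t f h g k := by
  unfold form
  rw [setIntegral_union hd hs ((hf.integrable_chi hg).mono_set subset_union_left)
    ((hf.integrable_chi hg).mono_set subset_union_right),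
    setIntegral_union hd hs ((hf.integrable_sigma hg).mono_set subset_union_left)
    ((hf.integrable_sigma hg).mono_set subset_union_right)]
  ring

lemma memLp_of_setIntegral_bounded_atTop {μ : Measure (Ivl a b)} [IsLocallyFiniteMeasure μ]
    (hf : LocBdd f) {c : Ivl a b} {B : ℝ} (hB : ∀ x, ∫ s in Ico c x, ‖f s‖ ^ 2 ∂μ ≤ B) :
    MemLp f 2 (μ.restrict (Ici c)) := by
  have : Nonempty (Ivl a b) := ⟨c⟩
  rw [memLp_two_iff_integrable_sq_norm hf.1.aestronglyMeasurable]
  refine (aecover_Iio (μ := μ.restrict (Ici c)) (tendsto_id (α := Ivl a b) (x := atTop))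
    ).integrable_of_integral_norm_bounded B (fun x => ?_) (Eventually.of_forall fun x => ?_)
  · rw [IntegrableOn, Measure.restrict_restrict measurableSet_Iio, id, Iio_inter_Ici]
    exact (hf.memLp c x).integrable_norm_pow two_ne_zero
  · rw [Measure.restrict_restrict measurableSet_Iio, id, Iio_inter_Ici]
    simpa using hB x

lemma memLp_of_setIntegral_bounded_atBot {μ : Measure (Ivl a b)} [IsLocallyFiniteMeasure μ]
    (hf : LocBdd f) {c : Ivl a b} {B : ℝ} (hB : ∀ x, ∫ s in Ico x c, ‖f s‖ ^ 2 ∂μ ≤ B) :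
    MemLp f 2 (μ.restrict (Iio c)) := by
  have : Nonempty (Ivl a b) := ⟨c⟩
  rw [memLp_two_iff_integrable_sq_norm hf.1.aestronglyMeasurable]
  refine (aecover_Ici (μ := μ.restrict (Iio c)) (tendsto_id (α := Ivl a b) (x := atBot))
    ).integrable_of_integral_norm_bounded B (fun x => ?_) (Eventually.of_forall fun x => ?_)
  · rw [IntegrableOn, Measure.restrict_restrict measurableSet_Ici, id, Ici_inter_Iio]
    exact (hf.memLp x c).integrable_norm_pow two_ne_zero
  · rw [Measure.restrict_restrict measurableSet_Ici, id, Ici_inter_Iio]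
    simpa using hB x

lemma l2On_Ici_of_nsq_bounded (hf : LocBdd f) (hh : LocBdd h) {c : Ivl a b} {B : ℝ}
    (hB : ∀ x, T.nsq (Ico c x) f h ≤ B) : T.L2On (Ici c) f h :=
  ⟨memLp_of_setIntegral_bounded_atTop hf fun x => (le_add_of_nonneg_right
      (integral_nonneg fun _ => by positivity)).trans (hB x),
    memLp_of_setIntegral_bounded_atTop hh fun x => (le_add_of_nonneg_left
      (integral_nonneg fun _ => by positivity)).trans (hB x)⟩

lemma l2On_Iio_of_nsq_bounded (hf : LocBdd f) (hh : LocBdd h) {c : Ivl a b} {B : ℝ}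
    (hB : ∀ x, T.nsq (Ico x c) f h ≤ B) : T.L2On (Iio c) f h :=
  ⟨memLp_of_setIntegral_bounded_atBot hf fun x => (le_add_of_nonneg_right
      (integral_nonneg fun _ => by positivity)).trans (hB x),
    memLp_of_setIntegral_bounded_atBot hh fun x => (le_add_of_nonneg_left
      (integral_nonneg fun _ => by positivity)).trans (hB x)⟩

lemma L2On.of_locBdd (hf : LocBdd f) (hh : LocBdd h) (c d : Ivl a b) : T.L2On (Ico c d) f h :=
  ⟨hf.memLp c d, hh.memLp c d⟩

end Coefficients

end LeftDefinite

end

noncomputable section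

namespace LeftDefinite

namespace Coefficients

variable {a b : EReal} {T : Coefficients a b}

lemma sigma_rho_pos_atoms (T : Coefficients a b) (x : Ivl a b) :
    T.sigma {x} * T.rho.pos {x} = 0 := by
  have := T.sigma_rho_atoms x
  rw [RealMeasure.abs, Measure.add_apply, mul_add, add_eq_zero] at this
  exact this.1

lemma sigma_rho_neg_atoms (T : Coefficients a b) (x : Ivl a b) :
    T.sigma {x} * T.rho.neg {x} = 0 := by
  have := T.sigma_rho_atoms x
  rw [RealMeasure.abs, Measure.add_apply, mul_add, add_eq_zero] at this
  exact this.2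

namespace LocPair

/-! ### Elements of `T_loc` -/

/-- The derivative of `f_τ` with respect to `ς`. -/
def dsnd (p : T.LocPair) : Ivl a b → ℂ := p.hasDensity_snd.choose

lemma hasDensity_dsnd (p : T.LocPair) : HasDensity T.sigma p.snd p.dsnd :=
  p.hasDensity_snd.choose_spec

lemma locBdd_fst (p : T.LocPair) : LocBdd p.fst := p.hasDensity_fst.locBdd

lemma locBdd_snd (p : T.LocPair) : LocBdd p.snd := p.hasDensity_dsnd.locBdd

lemma qd_eq_orientedIntegral (p : T.LocPair) (c x : Ivl a b) :
    p.qd x = p.qd c + orientedIntegral T.chi p.fst c x -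
      (orientedIntegral T.rho.pos p.snd c x - orientedIntegral T.rho.neg p.snd c x) := by
  have := (p.tau_eq c).3 c x
  have h0 : orientedIntegral T.chi p.fst c c = 0 := by simp [orientedIntegral]
  rw [h0] at this
  linear_combination -this

lemma qd_eq (p : T.LocPair) {c x : Ivl a b} (hcx : c ≤ x) :
    p.qd x = p.qd c + (∫ s in Ico c x, p.fst s ∂T.chi) -
      ((∫ s in Ico c x, p.snd s ∂T.rho.pos) - ∫ s in Ico c x, p.snd s ∂T.rho.neg) := by
  rw [p.qd_eq_orientedIntegral c x, orientedIntegral_of_le hcx, orientedIntegral_of_le hcx,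
    orientedIntegral_of_le hcx]

lemma locBdd_qd (p : T.LocPair) : LocBdd p.qd := by
  rcases isEmpty_or_nonempty (Ivl a b) with he | ⟨⟨c⟩⟩
  · exact ⟨(measurable_of_empty _).stronglyMeasurable, fun c => (he.false c).elim⟩
  rw [show p.qd = fun x => p.qd c + orientedIntegral T.chi p.fst c x -
      (orientedIntegral T.rho.pos p.snd c x - orientedIntegral T.rho.neg p.snd c x) from
    funext (p.qd_eq_orientedIntegral c)]
  exact ((LocBdd.const _).add (hasDensity_orientedIntegral p.locallyIntegrable_fst c).locBdd).sub
    ((hasDensity_orientedIntegral p.locBdd_snd.locallyIntegrable c).locBdd.sub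
      (hasDensity_orientedIntegral p.locBdd_snd.locallyIntegrable c).locBdd)

/-- An element of `T_loc` from the integrated form of the differential equation. -/
@[simps]
def ofEq (f q g : Ivl a b → ℂ) (hf : HasDensity T.sigma f q) (hg : ∃ h, HasDensity T.sigma g h)
    (heq : ∀ c x, c ≤ x → q x = q c + (∫ s in Ico c x, f s ∂T.chi) -
      ((∫ s in Ico c x, g s ∂T.rho.pos) - ∫ s in Ico c x, g s ∂T.rho.neg)) : T.LocPair where
  fst := f
  qd := q
  snd := g
  hasDensity_fst := hf
  hasDensity_snd := hg
  locallyIntegrable_fst := hf.locBdd.locallyIntegrable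
  tau_eq c := by
    have hgb : LocBdd g := hg.choose_spec.locBdd
    refine ⟨hgb.locallyIntegrable, hgb.locallyIntegrable, fun y x => ?_⟩
    have key : q x = q y + orientedIntegral T.chi f y x -
        (orientedIntegral T.rho.pos g y x - orientedIntegral T.rho.neg g y x) := by
      rcases le_total y x with h | h
      · rw [orientedIntegral_of_le h, orientedIntegral_of_le h, orientedIntegral_of_le h]
        exact heq y x h
      · rw [orientedIntegral_symm x y, orientedIntegral_symm x y, orientedIntegral_symm x y,
          orientedIntegral_of_le h, orientedIntegral_of_le h, orientedIntegral_of_le h, heq x y h]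
        ring
    rw [key, ← orientedIntegral_trans (hf.locBdd.locallyIntegrable (μ := T.chi)) c y x]
    ring

/-- The complex conjugate of an element of `T_loc`. -/
def star (p : T.LocPair) : T.LocPair :=
  ofEq (fun x => conj (p.fst x)) (fun x => conj (p.qd x)) (fun x => conj (p.snd x))
    (HasDensity.of_le (p.locBdd_qd.star.locallyIntegrable) fun c x hcx => by
      rw [p.hasDensity_fst.eq_of_le hcx, map_add, ← integral_conj])
    ⟨fun x => conj (p.dsnd x), HasDensity.of_le
      (fun x => by
        obtain ⟨s, hs, hi⟩ := p.hasDensity_dsnd.1 x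
        exact ⟨s, hs, ⟨Complex.continuous_conj.comp_aestronglyMeasurable hi.1,
          by simpa [HasFiniteIntegral] using hi.2⟩⟩)
      fun c x hcx => by
        rw [p.hasDensity_dsnd.eq_of_le hcx, map_add, ← integral_conj]⟩
    fun c x hcx => by
      rw [p.qd_eq hcx, map_sub, map_add, map_sub, ← integral_conj, ← integral_conj,
        ← integral_conj]

@[simp] lemma star_fst (p : T.LocPair) (x) : p.star.fst x = conj (p.fst x) := rfl
@[simp] lemma star_qd (p : T.LocPair) (x) : p.star.qd x = conj (p.qd x) := rfl
@[simp] lemma star_snd (p : T.LocPair) (x) : p.star.snd x = conj (p.snd x) := rfl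

@[simp] lemma add_fst (p q : T.LocPair) : (p.add q).fst = p.fst + q.fst := rfl
@[simp] lemma add_qd (p q : T.LocPair) : (p.add q).qd = p.qd + q.qd := rfl
@[simp] lemma add_snd (p q : T.LocPair) : (p.add q).snd = p.snd + q.snd := rfl
@[simp] lemma smul_fst (r : ℂ) (p : T.LocPair) : (p.smul r).fst = r • p.fst := rfl
@[simp] lemma smul_qd (r : ℂ) (p : T.LocPair) : (p.smul r).qd = r • p.qd := rfl
@[simp] lemma smul_snd (r : ℂ) (p : T.LocPair) : (p.smul r).snd = r • p.snd := rfl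

/-- The bilinear modified Wronskian. -/
def wr (p q : T.LocPair) (x : Ivl a b) : ℂ := p.snd x * q.qd x - p.qd x * q.snd x

lemma wronskian_eq_wr (p q : T.LocPair) : p.wronskian q = p.wr q.star := by
  funext x
  simp [wronskian, wr]

/-- Integration by parts for the product of a function with a quasi-derivative. -/
lemma mul_qd_eq {F f : Ivl a b → ℂ} (hF : HasDensity T.sigma F f) (q : T.LocPair)
    {c x : Ivl a b} (hcx : c ≤ x) :
    F x * q.qd x = F c * q.qd c + (∫ s in Ico c x, f s * q.qd s ∂T.sigma) +
      (∫ s in Ico c x, F s * q.fst s ∂T.chi) -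
      ((∫ s in Ico c x, F s * q.snd s ∂T.rho.pos) - ∫ s in Ico c x, F s * q.snd s ∂T.rho.neg) := by
  have hX := hasDensity_orientedIntegral q.locallyIntegrable_fst c
  have hP := hasDensity_orientedIntegral (q.locBdd_snd.locallyIntegrable (μ := T.rho.pos)) c
  have hN := hasDensity_orientedIntegral (q.locBdd_snd.locallyIntegrable (μ := T.rho.neg)) c
  have e1 := hF.mul_eq_of_atoms T.sigma_chi_atoms hX hcx
  have e2 := hF.mul_eq_of_atoms T.sigma_rho_pos_atoms hP hcx
  have e3 := hF.mul_eq_of_atoms T.sigma_rho_neg_atoms hN hcx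
  have z1 : orientedIntegral T.chi q.fst c c = 0 := by simp [orientedIntegral]
  have z2 : orientedIntegral T.rho.pos q.snd c c = 0 := by simp [orientedIntegral]
  have z3 : orientedIntegral T.rho.neg q.snd c c = 0 := by simp [orientedIntegral]
  rw [z1] at e1
  rw [z2] at e2
  rw [z3] at e3
  have comm : ∀ {g : Ivl a b → ℂ}, LocBdd g →
      IntegrableOn (fun s => f s * g s) (Ico c x) T.sigma := fun hg =>
    (integrableOn_Ico (hg.mul_locallyIntegrable hF.1) c x).congr
      (ae_of_all _ fun _ => mul_comm _ _)
  have e4 : ∫ s in Ico c x, f s * q.qd s ∂T.sigma = (∫ s in Ico c x, f s ∂T.sigma) * q.qd c +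
      (∫ s in Ico c x, f s * orientedIntegral T.chi q.fst c s ∂T.sigma) -
      ((∫ s in Ico c x, f s * orientedIntegral T.rho.pos q.snd c s ∂T.sigma) -
        ∫ s in Ico c x, f s * orientedIntegral T.rho.neg q.snd c s ∂T.sigma) := by
    rw [← integral_mul_const, ← integral_add, ← integral_sub, ← integral_sub]
    · refine setIntegral_congr_fun measurableSet_Ico fun s hs => ?_
      simp only [q.qd_eq_orientedIntegral c s]
      ring
    · exact ((integrableOn_Ico hF.1 c x).mul_const _).add (comm hX.locBdd)
    · exact (comm hP.locBdd).sub (comm hN.locBdd)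
    · exact comm hP.locBdd
    · exact comm hN.locBdd
    · exact (integrableOn_Ico hF.1 c x).mul_const _
    · exact comm hX.locBdd
  rw [q.qd_eq_orientedIntegral c x, e4]
  linear_combination e1 - e2 + e3 + q.qd c * hF.eq_of_le hcx

/-- The Lagrange identity. -/
lemma wr_eq (p q : T.LocPair) {c x : Ivl a b} (hcx : c ≤ x) :
    p.wr q x = p.wr q c + (T.form (Ico c x) p.snd p.dsnd q.fst q.qd -
      T.form (Ico c x) p.fst p.qd q.snd q.dsnd) := by
  have h1 := mul_qd_eq p.hasDensity_dsnd q hcx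
  have h2 := mul_qd_eq q.hasDensity_dsnd p hcx
  unfold wr form
  simp only [mul_comm (q.snd _) (p.snd _), mul_comm (q.snd _) (p.fst _),
    mul_comm (q.dsnd _) (p.qd _)] at h2
  linear_combination h1 - h2

lemma IsSolution.dsnd_ae {r : T.LocPair} {z : ℂ} (hr : r.IsSolution z) :
    r.dsnd =ᵐ[T.sigma] z • r.qd := by
  have h1 := r.hasDensity_dsnd
  rw [hr] at h1
  exact h1.ae_eq (r.hasDensity_fst.smul z)

lemma IsSolution.star {r : T.LocPair} {z : ℂ} (hr : r.IsSolution z) :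
    r.star.IsSolution (conj z) := by
  funext x
  have := congrFun hr x
  simp only [star_snd, this, Pi.smul_apply, smul_eq_mul, map_mul, star_fst]

lemma IsSolution.add {p q : T.LocPair} {z : ℂ} (hp : p.IsSolution z) (hq : q.IsSolution z) :
    (p.add q).IsSolution z := by
  rw [IsSolution] at *
  simp [hp, hq]

lemma IsSolution.smul {p : T.LocPair} {z : ℂ} (hp : p.IsSolution z) (r : ℂ) :
    (p.smul r).IsSolution z := by
  rw [IsSolution] at *
  rw [smul_snd, smul_fst, hp, smul_comm]

lemma IsSolution.snd_apply {p : T.LocPair} {z : ℂ} (hp : p.IsSolution z) (x : Ivl a b) :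
    p.snd x = z * p.fst x := congrFun hp x

/-- The Lagrange identity for a solution and an arbitrary element of `T_loc`. -/
lemma IsSolution.wr_eq {r : T.LocPair} {z : ℂ} (hr : r.IsSolution z) (q : T.LocPair)
    {c x : Ivl a b} (hcx : c ≤ x) :
    r.wr q x = r.wr q c + T.form (Ico c x) r.fst r.qd (z • q.fst - q.snd) (z • q.qd - q.dsnd) := by
  rw [LocPair.wr_eq r q hcx]
  congr 1
  unfold form
  have i1 : IntegrableOn (fun s => r.fst s * q.fst s) (Ico c x) T.chi :=
    integrableOn_Ico (r.locBdd_fst.mul q.locBdd_fst).locallyIntegrable c x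
  have i2 : IntegrableOn (fun s => r.fst s * q.snd s) (Ico c x) T.chi :=
    integrableOn_Ico (r.locBdd_fst.mul q.locBdd_snd).locallyIntegrable c x
  have i3 : IntegrableOn (fun s => r.qd s * q.qd s) (Ico c x) T.sigma :=
    integrableOn_Ico (r.locBdd_qd.mul q.locBdd_qd).locallyIntegrable c x
  have i4 : IntegrableOn (fun s => r.qd s * q.dsnd s) (Ico c x) T.sigma :=
    integrableOn_Ico (r.locBdd_qd.mul_locallyIntegrable q.hasDensity_dsnd.1) c x
  have e1 : ∫ s in Ico c x, r.snd s * q.fst s ∂T.chi =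
      z * ∫ s in Ico c x, r.fst s * q.fst s ∂T.chi := by
    rw [← integral_const_mul]
    exact integral_congr_ae (ae_of_all _ fun s => by simp only [hr.snd_apply]; ring)
  have e2 : ∫ s in Ico c x, r.dsnd s * q.qd s ∂T.sigma =
      z * ∫ s in Ico c x, r.qd s * q.qd s ∂T.sigma := by
    rw [← integral_const_mul]
    refine integral_congr_ae (ae_restrict_of_ae ?_)
    filter_upwards [hr.dsnd_ae] with s hs
    rw [hs, Pi.smul_apply, smul_eq_mul]
    ring
  have e3 : ∫ s in Ico c x, r.fst s * (z • q.fst - q.snd) s ∂T.chi =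
      (z * ∫ s in Ico c x, r.fst s * q.fst s ∂T.chi) -
        ∫ s in Ico c x, r.fst s * q.snd s ∂T.chi := by
    rw [← integral_const_mul, ← integral_sub (i1.const_mul z) i2]
    exact integral_congr_ae (ae_of_all _ fun s => by
      simp only [Pi.sub_apply, Pi.smul_apply, smul_eq_mul]; ring)
  have e4 : ∫ s in Ico c x, r.qd s * (z • q.qd - q.dsnd) s ∂T.sigma =
      (z * ∫ s in Ico c x, r.qd s * q.qd s ∂T.sigma) -
        ∫ s in Ico c x, r.qd s * q.dsnd s ∂T.sigma := by
    rw [← integral_const_mul, ← integral_sub (i3.const_mul z) i4]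
    exact integral_congr_ae (ae_of_all _ fun s => by
      simp only [Pi.sub_apply, Pi.smul_apply, smul_eq_mul]; ring)
  rw [e1, e2, e3, e4]
  ring

end LocPair

end Coefficients

end LeftDefinite

end

noncomputable section

namespace LeftDefinite

namespace Coefficients

variable {a b : EReal} {T : Coefficients a b}

namespace LocPair

/-! ### Behaviour of the Wronskian at the end points -/

/-- The pair `(f, f_τ)` lies in `H¹ × H¹` over the set `s`. -/
structure H1On (s : Set (Ivl a b)) (p : T.LocPair) : Prop where
  fst : T.L2On s p.fst p.qd
  snd : T.L2On s p.snd p.dsnd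

lemma H1On.mono {s t : Set (Ivl a b)} {p : T.LocPair} (hp : H1On t p) (hst : s ⊆ t) : H1On s p :=
  ⟨hp.1.mono hst, hp.2.mono hst⟩

/-- The pair `(f, f_τ)` lies in `H¹ × H¹` near `a`. -/
def NearLeft (p : T.LocPair) : Prop := ∃ c, H1On (Iio c) p

/-- The pair `(f, f_τ)` lies in `H¹ × H¹` near `b`. -/
def NearRight (p : T.LocPair) : Prop := ∃ c, H1On (Ici c) p

lemma dsnd_star_ae (p : T.LocPair) : p.star.dsnd =ᵐ[T.sigma] fun x => conj (p.dsnd x) := by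
  refine p.star.hasDensity_dsnd.ae_eq (HasDensity.of_le ?_ fun c x hcx => ?_)
  · intro x
    obtain ⟨s, hs, hi⟩ := p.hasDensity_dsnd.1 x
    exact ⟨s, hs, ⟨Complex.continuous_conj.comp_aestronglyMeasurable hi.1,
          by simpa [HasFiniteIntegral] using hi.2⟩⟩
  · rw [star_snd, star_snd, p.hasDensity_dsnd.eq_of_le hcx, map_add, ← integral_conj]

lemma H1On.star {s : Set (Ivl a b)} {p : T.LocPair} (hp : H1On s p) : H1On s p.star :=
  ⟨hp.1.star, hp.2.star.congr_ae p.dsnd_star_ae.symm⟩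

lemma NearLeft.star {p : T.LocPair} (hp : p.NearLeft) : p.star.NearLeft := hp.imp fun _ h => h.star

lemma NearRight.star {p : T.LocPair} (hp : p.NearRight) : p.star.NearRight :=
  hp.imp fun _ h => h.star

lemma IsMax.h1On {p : T.LocPair} (hp : p.IsMax) (s : Set (Ivl a b)) : H1On s p := by
  obtain ⟨⟨h, h1, h2, h3⟩, k, k1, k2, k3⟩ := hp
  refine ⟨(L2On.mk (s := univ) ?_ ?_).mono (subset_univ s),
    (L2On.mk (s := univ) ?_ ?_).mono (subset_univ s)⟩
  · rwa [Measure.restrict_univ]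
  · rw [Measure.restrict_univ]
    exact (memLp_congr_ae (h1.ae_eq p.hasDensity_fst)).1 h3
  · rwa [Measure.restrict_univ]
  · rw [Measure.restrict_univ]
    exact (memLp_congr_ae (k1.ae_eq p.hasDensity_dsnd)).1 k3

lemma IsMax.nearLeft {p : T.LocPair} (hp : p.IsMax) : p.NearLeft :=
  have : Nonempty (Ivl a b) := by
    by_contra h
    rw [not_nonempty_iff] at h
    exact T.chi_ne_zero (Measure.eq_zero_of_isEmpty _)
  ⟨Classical.arbitrary _, hp.h1On _⟩

lemma IsMax.nearRight {p : T.LocPair} (hp : p.IsMax) : p.NearRight :=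
  have : Nonempty (Ivl a b) := by
    by_contra h
    rw [not_nonempty_iff] at h
    exact T.chi_ne_zero (Measure.eq_zero_of_isEmpty _)
  ⟨Classical.arbitrary _, hp.h1On _⟩

lemma IsSolution.h1On {p : T.LocPair} {z : ℂ} (hp : p.IsSolution z) {s : Set (Ivl a b)}
    (h : T.L2On s p.fst p.qd) : H1On s p :=
  ⟨h, by
    have := (h.smul z).congr_ae hp.dsnd_ae.symm
    rwa [← hp] at this⟩

lemma l2On_of_memH1On {s : Set (Ivl a b)} {p : T.LocPair} (hp : T.MemH1On s p.fst) :
    T.L2On s p.fst p.qd := by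
  obtain ⟨h, h1, h2, h3⟩ := hp
  exact (L2On.mk h2 h3).congr_ae (h1.ae_eq p.hasDensity_fst)

lemma IsSolution.nearLeft {p : T.LocPair} {z : ℂ} (hp : p.IsSolution z)
    (h : T.MemH1NearLeft p.fst) : p.NearLeft :=
  h.imp fun _ hc => hp.h1On (l2On_of_memH1On hc)

lemma IsSolution.nearRight {p : T.LocPair} {z : ℂ} (hp : p.IsSolution z)
    (h : T.MemH1NearRight p.fst) : p.NearRight := by
  obtain ⟨c, hc⟩ := h
  obtain ⟨d, hd⟩ := exists_gt c
  exact ⟨d, hp.h1On ((l2On_of_memH1On hc).mono (Ici_subset_Ioi.2 hd))⟩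

lemma memH1NearLeft_of {p : T.LocPair} {c : Ivl a b} (h : T.L2On (Iio c) p.fst p.qd) :
    T.MemH1NearLeft p.fst := ⟨c, p.qd, p.hasDensity_fst, h.1, h.2⟩

lemma memH1NearRight_of {p : T.LocPair} {c : Ivl a b} (h : T.L2On (Ici c) p.fst p.qd) :
    T.MemH1NearRight p.fst :=
  ⟨c, p.qd, p.hasDensity_fst, (h.mono Ioi_subset_Ici_self).1, (h.mono Ioi_subset_Ici_self).2⟩

lemma tendsto_wr_atTop {p q : T.LocPair} {c : Ivl a b} (hp : H1On (Ici c) p)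
    (hq : H1On (Ici c) q) : Tendsto (p.wr q) atTop (𝓝 (p.wr q c +
      (T.form (Ici c) p.snd p.dsnd q.fst q.qd - T.form (Ici c) p.fst p.qd q.snd q.dsnd))) := by
  refine (((tendsto_form_Ico_atTop hp.2 hq.1).sub
    (tendsto_form_Ico_atTop hp.1 hq.2)).const_add (p.wr q c)).congr' ?_
  filter_upwards [eventually_ge_atTop c] with x hx
  rw [p.wr_eq q hx]

lemma tendsto_wr_atBot {p q : T.LocPair} {c : Ivl a b} (hp : H1On (Iio c) p)
    (hq : H1On (Iio c) q) : Tendsto (p.wr q) atBot (𝓝 (p.wr q c -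
      (T.form (Iio c) p.snd p.dsnd q.fst q.qd - T.form (Iio c) p.fst p.qd q.snd q.dsnd))) := by
  refine (((tendsto_form_Ico_atBot hp.2 hq.1).sub
    (tendsto_form_Ico_atBot hp.1 hq.2)).const_sub (p.wr q c)).congr' ?_
  filter_upwards [eventually_le_atBot c] with x hx
  rw [p.wr_eq q hx]
  ring

lemma NearRight.exists_tendsto {p q : T.LocPair} (hp : p.NearRight) (hq : q.NearRight) :
    ∃ l, Tendsto (p.wr q) atTop (𝓝 l) := by
  obtain ⟨c, hc⟩ := hp
  obtain ⟨d, hd⟩ := hq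
  exact ⟨_, tendsto_wr_atTop (hc.mono (Ici_subset_Ici.2 (le_max_left c d)))
    (hd.mono (Ici_subset_Ici.2 (le_max_right c d)))⟩

lemma NearLeft.exists_tendsto {p q : T.LocPair} (hp : p.NearLeft) (hq : q.NearLeft) :
    ∃ l, Tendsto (p.wr q) atBot (𝓝 l) := by
  obtain ⟨c, hc⟩ := hp
  obtain ⟨d, hd⟩ := hq
  exact ⟨_, tendsto_wr_atBot (hc.mono (Iio_subset_Iio (min_le_left c d)))
    (hd.mono (Iio_subset_Iio (min_le_right c d)))⟩

/-- The variation of the Wronskian of a solution with another pair. -/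
lemma IsSolution.norm_wr_sub_le {r q : T.LocPair} {z : ℂ} (hr : r.IsSolution z)
    {s : Set (Ivl a b)} (hq : H1On s q) {c x y : Ivl a b} (hs : Ico (min c x) (max c x) ⊆ s)
    (hy : y ∈ Ico (min c x) (max c x)) :
    ‖r.wr q y‖ ≤ ‖r.wr q c‖ + √(T.nsq (Ico (min c x) (max c x)) r.fst r.qd) *
      √(T.nsq s (z • q.fst - q.snd) (z • q.qd - q.dsnd)) := by
  have hqs : T.L2On s (z • q.fst - q.snd) (z • q.qd - q.dsnd) := by
    have := (hq.1.smul z).add (hq.2.smul (-1))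
    simpa [sub_eq_add_neg] using this
  have hrI : T.L2On (Ico (min c x) (max c x)) r.fst r.qd :=
    L2On.of_locBdd r.locBdd_fst r.locBdd_qd _ _
  have key : ∀ I ⊆ Ico (min c x) (max c x),
      ‖T.form I r.fst r.qd (z • q.fst - q.snd) (z • q.qd - q.dsnd)‖ ≤
      √(T.nsq (Ico (min c x) (max c x)) r.fst r.qd) *
      √(T.nsq s (z • q.fst - q.snd) (z • q.qd - q.dsnd)) := by
    intro I hI
    refine (norm_form_le (hrI.mono hI) (hqs.mono (hI.trans hs))).trans ?_
    gcongr
    · exact hrI.nsq_mono hI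
    · exact hqs.nsq_mono (hI.trans hs)
  rcases le_total c y with hcy | hcy
  · rw [hr.wr_eq q hcy]
    refine (norm_add_le _ _).trans (add_le_add le_rfl (key _ fun t ht => ?_))
    exact ⟨(min_le_left c x).trans ht.1, ht.2.trans hy.2⟩
  · have h1 := hr.wr_eq q hcy
    rw [eq_comm, ← eq_sub_iff_add_eq] at h1
    rw [h1]
    refine (norm_sub_le _ _).trans (add_le_add le_rfl (key _ fun t ht => ?_))
    exact ⟨hy.1.trans ht.1, ht.2.trans_le (le_max_left c x)⟩

/-- An a priori bound for a solution in terms of two pairs with a non-degenerate Wronskian. -/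
lemma IsSolution.sqrt_nsq_le {p q r : T.LocPair} {z : ℂ} (hz : z ≠ 0) (hr : r.IsSolution z)
    {s : Set (Ivl a b)} (hp : H1On s p) (hq : H1On s q) {c x : Ivl a b}
    (hs : Ico (min c x) (max c x) ⊆ s) {L η B K : ℝ} (hL : 0 < L) (hB : 0 ≤ B)
    (hwr : ∀ y ∈ Ico (min c x) (max c x), L ≤ ‖p.wr q y‖)
    (hηp : √(T.nsq s (z • p.fst - p.snd) (z • p.qd - p.dsnd)) ≤ η)
    (hηq : √(T.nsq s (z • q.fst - q.snd) (z • q.qd - q.dsnd)) ≤ η)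
    (hBp : T.nsq s (z⁻¹ • p.snd) p.qd ≤ B ^ 2) (hBq : T.nsq s (z⁻¹ • q.snd) q.qd ≤ B ^ 2)
    (hKp : ‖r.wr p c‖ ≤ K) (hKq : ‖r.wr q c‖ ≤ K) (hη : 4 * B * η ≤ L) :
    √(T.nsq (Ico (min c x) (max c x)) r.fst r.qd) ≤ 4 * B * K / L := by
  set I := Ico (min c x) (max c x) with hI
  set N := √(T.nsq I r.fst r.qd) with hN
  have hN0 : 0 ≤ N := Real.sqrt_nonneg _
  have hη0 : 0 ≤ η := (Real.sqrt_nonneg _).trans hηp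
  have hK0 : 0 ≤ K := (norm_nonneg _).trans hKp
  set M := (K + N * η) / L with hM
  have hM0 : 0 ≤ M := by positivity
  have bq : ∀ y ∈ I, ‖r.wr q y‖ ≤ M * L := fun y hy => by
    rw [hM, div_mul_cancel₀ _ hL.ne']
    exact (hr.norm_wr_sub_le hq hs hy).trans (by gcongr)
  have bp : ∀ y ∈ I, ‖r.wr p y‖ ≤ M * L := fun y hy => by
    rw [hM, div_mul_cancel₀ _ hL.ne']
    exact (hr.norm_wr_sub_le hp hs hy).trans (by gcongr)
  have key : ∀ y ∈ I, ∀ u v w : ℂ, p.wr q y * u = r.wr q y * v - r.wr p y * w →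
      ‖u‖ ^ 2 ≤ 2 * M ^ 2 * (‖v‖ ^ 2 + ‖w‖ ^ 2) := by
    intro y hy u v w huvw
    have h1 : L * ‖u‖ ≤ L * (M * (‖v‖ + ‖w‖)) := by
      calc L * ‖u‖ ≤ ‖p.wr q y‖ * ‖u‖ := by gcongr; exact hwr y hy
        _ = ‖r.wr q y * v - r.wr p y * w‖ := by rw [← norm_mul, huvw]
        _ ≤ ‖r.wr q y‖ * ‖v‖ + ‖r.wr p y‖ * ‖w‖ := by
          rw [← norm_mul, ← norm_mul]; exact norm_sub_le _ _
        _ ≤ M * L * ‖v‖ + M * L * ‖w‖ := by gcongr; exacts [bq y hy, bp y hy]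
        _ = L * (M * (‖v‖ + ‖w‖)) := by ring
    have h2 : ‖u‖ ≤ M * (‖v‖ + ‖w‖) := le_of_mul_le_mul_left h1 hL
    calc ‖u‖ ^ 2 ≤ (M * (‖v‖ + ‖w‖)) ^ 2 := by gcongr
      _ ≤ 2 * M ^ 2 * (‖v‖ ^ 2 + ‖w‖ ^ 2) := by
        nlinarith [mul_nonneg (sq_nonneg M) (sq_nonneg (‖v‖ - ‖w‖))]
  have pt1 : ∀ y ∈ I, ‖r.fst y‖ ^ 2 ≤
      2 * M ^ 2 * (‖(z⁻¹ • p.snd) y‖ ^ 2 + ‖(z⁻¹ • q.snd) y‖ ^ 2) := fun y hy => by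
    refine key y hy _ _ _ ?_
    simp only [wr, hr.snd_apply, Pi.smul_apply, smul_eq_mul]
    field_simp
    ring
  have pt2 : ∀ y ∈ I, ‖r.qd y‖ ^ 2 ≤ 2 * M ^ 2 * (‖p.qd y‖ ^ 2 + ‖q.qd y‖ ^ 2) := fun y hy => by
    refine key y hy _ _ _ ?_
    simp only [wr]
    ring
  have hrI : T.L2On I r.fst r.qd := L2On.of_locBdd r.locBdd_fst r.locBdd_qd _ _
  have hpI : T.L2On s (z⁻¹ • p.snd) p.qd := ⟨(hp.2.smul z⁻¹).1, hp.1.2⟩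
  have hqI : T.L2On s (z⁻¹ • q.snd) q.qd := ⟨(hq.2.smul z⁻¹).1, hq.1.2⟩
  have hsq : N ^ 2 ≤ (2 * M * B) ^ 2 := by
    have i1 : ∫ y in I, ‖r.fst y‖ ^ 2 ∂T.chi ≤
        2 * M ^ 2 * ((∫ y in I, ‖(z⁻¹ • p.snd) y‖ ^ 2 ∂T.chi) +
          ∫ y in I, ‖(z⁻¹ • q.snd) y‖ ^ 2 ∂T.chi) := by
      rw [← integral_add (hpI.mono hs).integrable_sq_chi (hqI.mono hs).integrable_sq_chi,
        ← integral_const_mul]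
      exact setIntegral_mono_on hrI.integrable_sq_chi
        (((hpI.mono hs).integrable_sq_chi.add (hqI.mono hs).integrable_sq_chi).const_mul _)
        measurableSet_Ico pt1
    have i2 : ∫ y in I, ‖r.qd y‖ ^ 2 ∂T.sigma ≤
        2 * M ^ 2 * ((∫ y in I, ‖p.qd y‖ ^ 2 ∂T.sigma) + ∫ y in I, ‖q.qd y‖ ^ 2 ∂T.sigma) := by
      rw [← integral_add (hpI.mono hs).integrable_sq_sigma (hqI.mono hs).integrable_sq_sigma,
        ← integral_const_mul]
      exact setIntegral_mono_on hrI.integrable_sq_sigma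
        (((hpI.mono hs).integrable_sq_sigma.add (hqI.mono hs).integrable_sq_sigma).const_mul _)
        measurableSet_Ico pt2
    have hp' := (hpI.nsq_mono hs).trans hBp
    have hq' := (hqI.nsq_mono hs).trans hBq
    rw [hN, Real.sq_sqrt nsq_nonneg]
    unfold nsq at hp' hq' ⊢
    have h3 : 2 * M ^ 2 * ((∫ y in I, ‖(z⁻¹ • p.snd) y‖ ^ 2 ∂T.chi) +
        (∫ y in I, ‖p.qd y‖ ^ 2 ∂T.sigma) + ((∫ y in I, ‖(z⁻¹ • q.snd) y‖ ^ 2 ∂T.chi) +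
          ∫ y in I, ‖q.qd y‖ ^ 2 ∂T.sigma)) ≤ 2 * M ^ 2 * (B ^ 2 + B ^ 2) := by gcongr
    nlinarith
  have h4 : N ≤ 2 * M * B := (abs_le_of_sq_le_sq' hsq (by positivity)).2
  have h5 : N * L ≤ 2 * B * (K + N * η) := by
    have : M * L = K + N * η := by rw [hM, div_mul_cancel₀ _ hL.ne']
    nlinarith
  rw [le_div_iff₀ hL]
  nlinarith

lemma H1On.l2On_sub {s : Set (Ivl a b)} {p : T.LocPair} (hp : H1On s p) (z : ℂ) :
    T.L2On s (z • p.fst - p.snd) (z • p.qd - p.dsnd) := by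
  have := (hp.1.smul z).add (hp.2.smul (-1))
  simpa [sub_eq_add_neg] using this

/-- If the Wronskian of two pairs in `H¹` near `b` does not vanish at `b`, then `τ` is in the
limit-circle case at `b`. -/
lemma NearRight.limitCircleRight {p q : T.LocPair} (hp : p.NearRight) (hq : q.NearRight)
    (h : ¬ Tendsto (p.wr q) atTop (𝓝 0)) : T.LimitCircleRight := by
  intro z hz r hr
  obtain ⟨l, hl⟩ := hp.exists_tendsto hq
  have hl0 : l ≠ 0 := fun h0 => h (h0 ▸ hl)
  have hL : 0 < ‖l‖ / 2 := by positivity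
  obtain ⟨c1, hc1⟩ := hp
  obtain ⟨c2, hc2⟩ := hq
  have : Nonempty (Ivl a b) := ⟨c1⟩
  set c0 := max c1 c2
  have hp0 := hc1.mono (Ici_subset_Ici.2 (le_max_left c1 c2))
  have hq0 := hc2.mono (Ici_subset_Ici.2 (le_max_right c1 c2))
  set Bp := T.nsq (Ici c0) (z⁻¹ • p.snd) p.qd
  set Bq := T.nsq (Ici c0) (z⁻¹ • q.snd) q.qd
  set B := √(Bp + Bq)
  have hBp0 : 0 ≤ Bp := nsq_nonneg
  have hBq0 : 0 ≤ Bq := nsq_nonneg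
  have hB2 : B ^ 2 = Bp + Bq := Real.sq_sqrt (by positivity)
  have hB0 : 0 ≤ B := Real.sqrt_nonneg _
  obtain ⟨η, hη0, hη⟩ : ∃ η : ℝ, 0 < η ∧ 4 * B * η ≤ ‖l‖ / 2 :=
    ⟨‖l‖ / 2 / (4 * B + 1), by positivity, by
      rw [mul_div_assoc', div_le_iff₀ (by positivity)]
      nlinarith⟩
  have e1 := (tendsto_nsq_Ici_atTop (hp0.l2On_sub z)).sqrt
  have e2 := (tendsto_nsq_Ici_atTop (hq0.l2On_sub z)).sqrt
  rw [Real.sqrt_zero] at e1 e2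
  have e3 : ∀ᶠ x in atTop, ‖l‖ / 2 < ‖p.wr q x‖ :=
    hl.norm.eventually (lt_mem_nhds (half_lt_self (norm_pos_iff.2 hl0)))
  obtain ⟨c, hcall⟩ := eventually_atTop.1 (e3.and ((e1.eventually (gt_mem_nhds hη0)).and
    ((e2.eventually (gt_mem_nhds hη0)).and (eventually_ge_atTop c0))))
  obtain ⟨-, hη1, hη2, hcc0⟩ := hcall c le_rfl
  have hsub : Ici c ⊆ Ici c0 := Ici_subset_Ici.2 hcc0
  have hpI : T.L2On (Ici c0) (z⁻¹ • p.snd) p.qd := ⟨(hp0.2.smul z⁻¹).1, hp0.1.2⟩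
  have hqI : T.L2On (Ici c0) (z⁻¹ • q.snd) q.qd := ⟨(hq0.2.smul z⁻¹).1, hq0.1.2⟩
  refine memH1NearRight_of (c := c) (l2On_Ici_of_nsq_bounded r.locBdd_fst r.locBdd_qd
    (B := (4 * B * max ‖r.wr p c‖ ‖r.wr q c‖ / (‖l‖ / 2)) ^ 2) fun x => ?_)
  rcases le_or_gt x c with hx | hx
  · rw [Ico_eq_empty_of_le hx]
    simp [nsq]
    positivity
  have hmm : Ico (min c x) (max c x) = Ico c x := by rw [min_eq_left hx.le, max_eq_right hx.le]
  have := hr.sqrt_nsq_le hz (hp0.mono hsub) (hq0.mono hsub) (c := c) (x := x)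
    (by rw [hmm]; exact Ico_subset_Ici_self) hL hB0
    (fun y hy => by rw [hmm] at hy; exact (hcall y hy.1).1.le) hη1.le hη2.le
    ((hpI.nsq_mono hsub).trans (by rw [hB2]; linarith))
    ((hqI.nsq_mono hsub).trans (by rw [hB2]; linarith))
    (le_max_left _ _) (le_max_right _ _) hη
  rw [hmm] at this
  rw [← Real.sqrt_le_left (by positivity)]
  exact this

/-- If the Wronskian of two pairs in `H¹` near `a` does not vanish at `a`, then `τ` is in the
limit-circle case at `a`. -/
lemma NearLeft.limitCircleLeft {p q : T.LocPair} (hp : p.NearLeft) (hq : q.NearLeft)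
    (h : ¬ Tendsto (p.wr q) atBot (𝓝 0)) : T.LimitCircleLeft := by
  intro z hz r hr
  obtain ⟨l, hl⟩ := hp.exists_tendsto hq
  have hl0 : l ≠ 0 := fun h0 => h (h0 ▸ hl)
  have hL : 0 < ‖l‖ / 2 := by positivity
  obtain ⟨c1, hc1⟩ := hp
  obtain ⟨c2, hc2⟩ := hq
  have : Nonempty (Ivl a b) := ⟨c1⟩
  set c0 := min c1 c2
  have hp0 := hc1.mono (Iio_subset_Iio (min_le_left c1 c2))
  have hq0 := hc2.mono (Iio_subset_Iio (min_le_right c1 c2))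
  set Bp := T.nsq (Iio c0) (z⁻¹ • p.snd) p.qd
  set Bq := T.nsq (Iio c0) (z⁻¹ • q.snd) q.qd
  set B := √(Bp + Bq)
  have hBp0 : 0 ≤ Bp := nsq_nonneg
  have hBq0 : 0 ≤ Bq := nsq_nonneg
  have hB2 : B ^ 2 = Bp + Bq := Real.sq_sqrt (by positivity)
  have hB0 : 0 ≤ B := Real.sqrt_nonneg _
  obtain ⟨η, hη0, hη⟩ : ∃ η : ℝ, 0 < η ∧ 4 * B * η ≤ ‖l‖ / 2 :=
    ⟨‖l‖ / 2 / (4 * B + 1), by positivity, by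
      rw [mul_div_assoc', div_le_iff₀ (by positivity)]
      nlinarith⟩
  have e1 := (tendsto_nsq_Iio_atBot (hp0.l2On_sub z)).sqrt
  have e2 := (tendsto_nsq_Iio_atBot (hq0.l2On_sub z)).sqrt
  rw [Real.sqrt_zero] at e1 e2
  have e3 : ∀ᶠ x in atBot, ‖l‖ / 2 < ‖p.wr q x‖ :=
    hl.norm.eventually (lt_mem_nhds (half_lt_self (norm_pos_iff.2 hl0)))
  obtain ⟨c, hcall⟩ := eventually_atBot.1 (e3.and ((e1.eventually (gt_mem_nhds hη0)).and
    ((e2.eventually (gt_mem_nhds hη0)).and (eventually_le_atBot c0))))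
  obtain ⟨-, hη1, hη2, hcc0⟩ := hcall c le_rfl
  have hsub : Iio c ⊆ Iio c0 := Iio_subset_Iio hcc0
  have hpI : T.L2On (Iio c0) (z⁻¹ • p.snd) p.qd := ⟨(hp0.2.smul z⁻¹).1, hp0.1.2⟩
  have hqI : T.L2On (Iio c0) (z⁻¹ • q.snd) q.qd := ⟨(hq0.2.smul z⁻¹).1, hq0.1.2⟩
  refine memH1NearLeft_of (c := c) (l2On_Iio_of_nsq_bounded r.locBdd_fst r.locBdd_qd
    (B := (4 * B * max ‖r.wr p c‖ ‖r.wr q c‖ / (‖l‖ / 2)) ^ 2) fun x => ?_)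
  rcases le_or_gt c x with hx | hx
  · rw [Ico_eq_empty_of_le hx]
    simp [nsq]
    positivity
  have hmm : Ico (min c x) (max c x) = Ico x c := by rw [min_eq_right hx.le, max_eq_left hx.le]
  have := hr.sqrt_nsq_le hz (hp0.mono hsub) (hq0.mono hsub) (c := c) (x := x)
    (by rw [hmm]; exact Ico_subset_Iio_self) hL hB0
    (fun y hy => by rw [hmm] at hy; exact (hcall y hy.2.le).1.le) hη1.le hη2.le
    ((hpI.nsq_mono hsub).trans (by rw [hB2]; linarith))
    ((hqI.nsq_mono hsub).trans (by rw [hB2]; linarith))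
    (le_max_left _ _) (le_max_right _ _) hη
  rw [hmm] at this
  rw [← Real.sqrt_le_left (by positivity)]
  exact this

/-- Plücker's identity applied to the limits of Wronskians. -/
lemma tendsto_wr_zero_of_plucker {l : Filter (Ivl a b)} {p q v r : T.LocPair} {k : ℂ}
    (hk : k ≠ 0) (hvr : Tendsto (v.wr r) l (𝓝 k)) (hpv : Tendsto (p.wr v) l (𝓝 0))
    (hqv : Tendsto (q.wr v) l (𝓝 0)) (hpr : ∃ m, Tendsto (p.wr r) l (𝓝 m))
    (hqr : ∃ m, Tendsto (q.wr r) l (𝓝 m)) : Tendsto (p.wr q) l (𝓝 0) := by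
  obtain ⟨m, hm⟩ := hpr
  obtain ⟨n, hn⟩ := hqr
  have h1 := ((hpv.mul hn).sub (hm.mul hqv)).div hvr hk
  simp only [zero_mul, mul_zero, sub_zero, zero_div] at h1
  refine h1.congr' ?_
  filter_upwards [hvr.eventually_ne hk] with x hx
  rw [Pi.div_apply, div_eq_iff hx]
  simp only [wr]
  ring

end LocPair

open LocPair

/-- `V(p, q^*)(a) = 0` if `p` and `q` satisfy the boundary condition at `a`. -/
lemma IsBoundaryFunctionLeft.tendsto_wronskian {v p q : T.LocPair} (hv : IsBoundaryFunctionLeft v)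
    (hp : p.NearLeft) (hq : q.NearLeft) (hpv : T.LimitCircleLeft → p.WronskianVanishesLeft v)
    (hqv : T.LimitCircleLeft → q.WronskianVanishesLeft v) : p.WronskianVanishesLeft q := by
  rw [WronskianVanishesLeft, wronskian_eq_wr]
  by_cases hLC : T.LimitCircleLeft
  swap
  · by_contra h
    exact hLC (hp.limitCircleLeft hq.star h)
  have hpv := hpv hLC
  have hqv := hqv hLC
  obtain ⟨hvv, r, hr, hrv⟩ := hv.2 hLC
  rw [WronskianVanishesLeft, wronskian_eq_wr] at hpv hqv hvv hrv
  have hvn := hv.1.nearLeft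
  obtain ⟨k, hk⟩ := hvn.star.exists_tendsto hr.nearLeft
  have hk0 : k ≠ 0 := by
    rintro rfl
    refine hrv ?_
    have := hk.neg
    rw [neg_zero] at this
    refine this.congr fun x => ?_
    simp only [wr]
    ring
  have hqv' : Tendsto (q.star.wr v.star) atBot (𝓝 0) := by
    have h1 : Tendsto (q.wr v) atBot (𝓝 0) :=
      tendsto_wr_zero_of_plucker hk0 hk hqv hvv (hq.exists_tendsto hr.nearLeft)
        (hvn.exists_tendsto hr.nearLeft)
    have h2 := (Complex.continuous_conj.tendsto 0).comp h1
    rw [map_zero] at h2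
    refine h2.congr fun x => ?_
    simp [wr]
  exact tendsto_wr_zero_of_plucker hk0 hk hpv hqv' (hp.exists_tendsto hr.nearLeft)
    (hq.star.exists_tendsto hr.nearLeft)

/-- `V(p, q^*)(b) = 0` if `p` and `q` satisfy the boundary condition at `b`. -/
lemma IsBoundaryFunctionRight.tendsto_wronskian {v p q : T.LocPair}
    (hv : IsBoundaryFunctionRight v) (hp : p.NearRight) (hq : q.NearRight)
    (hpv : T.LimitCircleRight → p.WronskianVanishesRight v)
    (hqv : T.LimitCircleRight → q.WronskianVanishesRight v) : p.WronskianVanishesRight q := by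
  rw [WronskianVanishesRight, wronskian_eq_wr]
  by_cases hLC : T.LimitCircleRight
  swap
  · by_contra h
    exact hLC (hp.limitCircleRight hq.star h)
  have hpv := hpv hLC
  have hqv := hqv hLC
  obtain ⟨hvv, r, hr, hrv⟩ := hv.2 hLC
  rw [WronskianVanishesRight, wronskian_eq_wr] at hpv hqv hvv hrv
  have hvn := hv.1.nearRight
  obtain ⟨k, hk⟩ := hvn.star.exists_tendsto hr.nearRight
  have hk0 : k ≠ 0 := by
    rintro rfl
    refine hrv ?_
    have := hk.neg
    rw [neg_zero] at this
    refine this.congr fun x => ?_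
    simp only [wr]
    ring
  have hqv' : Tendsto (q.star.wr v.star) atTop (𝓝 0) := by
    have h1 : Tendsto (q.wr v) atTop (𝓝 0) :=
      tendsto_wr_zero_of_plucker hk0 hk hqv hvv (hq.exists_tendsto hr.nearRight)
        (hvn.exists_tendsto hr.nearRight)
    have h2 := (Complex.continuous_conj.tendsto 0).comp h1
    rw [map_zero] at h2
    refine h2.congr fun x => ?_
    simp [wr]
  exact tendsto_wr_zero_of_plucker hk0 hk hpv hqv' (hp.exists_tendsto hr.nearRight)
    (hq.star.exists_tendsto hr.nearRight)

end Coefficients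

end LeftDefinite

end

noncomputable section

namespace LeftDefinite

variable {a b : EReal}

instance (μ ν : Measure (Ivl a b)) [IsLocallyFiniteMeasure μ] [IsLocallyFiniteMeasure ν] :
    IsLocallyFiniteMeasure (μ + ν) :=
  ⟨fun x => by
    obtain ⟨s, hs, hs'⟩ := μ.finiteAt_nhds x
    obtain ⟨t, ht, ht'⟩ := ν.finiteAt_nhds x
    exact ⟨s ∩ t, inter_mem hs ht, ENNReal.add_lt_top.2
      ⟨(measure_mono inter_subset_left).trans_lt hs', (measure_mono inter_subset_right).trans_lt ht'⟩⟩⟩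

/-! ### One-sided limits -/

lemma tendsto_setIntegral_Ico_left {μ : Measure (Ivl a b)} {h : Ivl a b → ℂ}
    (hh : LocallyIntegrable h μ) (y : Ivl a b) :
    Tendsto (fun t => ∫ s in Ico t y, h s ∂μ) (𝓝[<] y) (𝓝 0) := by
  obtain ⟨d, hd⟩ := exists_lt y
  have := tendsto_integral_filter_of_dominated_convergence (l := 𝓝[<] y) (μ := μ)
    (F := fun t => (Ico t y).indicator h) (f := fun _ => (0 : ℂ))
    ((Ico d y).indicator fun s => ‖h s‖)
    (Eventually.of_forall fun t => hh.aestronglyMeasurable.indicator measurableSet_Ico) ?_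
    (IntegrableOn.integrable_indicator (integrableOn_Ico hh d y).norm measurableSet_Ico) ?_
  · simpa [integral_indicator measurableSet_Ico] using this
  · filter_upwards [Ioo_mem_nhdsLT hd] with t ht
    refine ae_of_all _ fun s => ?_
    by_cases hs : s ∈ Ico t y
    · rw [indicator_of_mem hs, indicator_of_mem (Ico_subset_Ico_left ht.1.le hs)]
    · rw [indicator_of_notMem hs, norm_zero]
      exact indicator_nonneg (fun _ _ => norm_nonneg _) s
  · refine ae_of_all _ fun s => tendsto_const_nhds.congr' ?_
    rcases lt_or_ge s y with hs | hs
    · filter_upwards [Ioo_mem_nhdsLT hs] with t ht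
      rw [indicator_of_notMem fun h => ht.1.not_ge h.1]
    · exact Eventually.of_forall fun t => (indicator_of_notMem (fun h => hs.not_gt h.2) _).symm

lemma tendsto_setIntegral_Ico_right {μ : Measure (Ivl a b)} {h : Ivl a b → ℂ}
    (hh : LocallyIntegrable h μ) (y : Ivl a b) :
    Tendsto (fun t => ∫ s in Ico y t, h s ∂μ) (𝓝[>] y) (𝓝 (μ.real {y} • h y)) := by
  obtain ⟨d, hd⟩ := exists_gt y
  have := tendsto_integral_filter_of_dominated_convergence (l := 𝓝[>] y) (μ := μ)
    (F := fun t => (Ico y t).indicator h) (f := ({y} : Set (Ivl a b)).indicator h)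
    ((Ico y d).indicator fun s => ‖h s‖)
    (Eventually.of_forall fun t => hh.aestronglyMeasurable.indicator measurableSet_Ico) ?_
    (IntegrableOn.integrable_indicator (integrableOn_Ico hh y d).norm measurableSet_Ico) ?_
  · rw [integral_indicator (measurableSet_singleton y), integral_singleton] at this
    simpa only [integral_indicator measurableSet_Ico] using this
  · filter_upwards [Ioo_mem_nhdsGT hd] with t ht
    refine ae_of_all _ fun s => ?_
    by_cases hs : s ∈ Ico y t
    · rw [indicator_of_mem hs, indicator_of_mem (Ico_subset_Ico_right ht.2.le hs)]
    · rw [indicator_of_notMem hs, norm_zero]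
      exact indicator_nonneg (fun _ _ => norm_nonneg _) s
  · refine ae_of_all _ fun s => tendsto_const_nhds.congr' ?_
    rcases lt_trichotomy s y with hs | rfl | hs
    · refine Eventually.of_forall fun t => ?_
      simp only [indicator_of_notMem (show s ∉ ({y} : Set (Ivl a b)) from hs.ne),
        indicator_of_notMem (show s ∉ Ico y t from fun h => hs.not_ge h.1)]
    · filter_upwards [self_mem_nhdsWithin] with t ht
      simp only [indicator_of_mem (mem_singleton s),
        indicator_of_mem (show s ∈ Ico s t from ⟨le_rfl, ht⟩)]
    · filter_upwards [Ioo_mem_nhdsGT hs] with t ht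
      simp only [indicator_of_notMem (show s ∉ ({y} : Set (Ivl a b)) from hs.ne'),
        indicator_of_notMem (show s ∉ Ico y t from fun h => ht.2.not_gt h.2)]

lemma HasDensity.tendsto_left {μ : Measure (Ivl a b)} {f h : Ivl a b → ℂ} (hf : HasDensity μ f h)
    (y : Ivl a b) : Tendsto f (𝓝[<] y) (𝓝 (f y)) := by
  have h1 := (tendsto_setIntegral_Ico_left hf.1 y).const_sub (f y)
  rw [sub_zero] at h1
  refine h1.congr' ?_
  filter_upwards [self_mem_nhdsWithin] with t ht
  rw [hf.eq_of_le (le_of_lt ht), add_sub_cancel_right]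

lemma HasDensity.tendsto_right {μ : Measure (Ivl a b)} {f h : Ivl a b → ℂ} (hf : HasDensity μ f h)
    (y : Ivl a b) : Tendsto f (𝓝[>] y) (𝓝 (f y + μ.real {y} • h y)) := by
  refine ((tendsto_setIntegral_Ico_right hf.1 y).const_add (f y)).congr' ?_
  filter_upwards [self_mem_nhdsWithin] with t ht
  rw [hf.eq_of_le (le_of_lt ht)]

namespace Coefficients

variable {T : Coefficients a b}

lemma frequently_of_ae_Iio {P : Ivl a b → Prop} {y : Ivl a b}
    (h : ∀ᵐ x ∂(T.sigma.restrict (Iio y)), P x) : ∃ᶠ x in 𝓝[<] y, P x := by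
  rw [frequently_iff]
  intro U hU
  obtain ⟨l, hl⟩ := exists_lt y
  obtain ⟨t, ht, htU⟩ := (mem_nhdsLT_iff_exists_Ioo_subset' hl).1 hU
  have hpos : 0 < T.sigma (Ioo t y) := isOpen_Ioo.measure_pos _ (nonempty_Ioo.2 ht)
  have h2 : ∀ᵐ x ∂(T.sigma.restrict (Ioo t y)), P x :=
    ae_restrict_of_ae_restrict_of_subset (fun x hx => hx.2) h
  have : NeBot (ae (T.sigma.restrict (Ioo t y))) := ae_neBot.2 (by
    rw [Ne, Measure.restrict_eq_zero]
    exact hpos.ne')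
  obtain ⟨x, hx, hx'⟩ := (h2.and (ae_restrict_mem measurableSet_Ioo)).exists
  exact ⟨x, htU hx', hx⟩

namespace LocPair

lemma tendsto_qd_left (p : T.LocPair) (y : Ivl a b) : Tendsto p.qd (𝓝[<] y) (𝓝 (p.qd y)) := by
  have h1 := tendsto_setIntegral_Ico_left p.locallyIntegrable_fst y
  have h2 := tendsto_setIntegral_Ico_left (p.locBdd_snd.locallyIntegrable (μ := T.rho.pos)) y
  have h3 := tendsto_setIntegral_Ico_left (p.locBdd_snd.locallyIntegrable (μ := T.rho.neg)) y
  have h4 := (h1.sub (h2.sub h3)).const_sub (p.qd y)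
  simp only [sub_zero] at h4
  refine h4.congr' ?_
  filter_upwards [self_mem_nhdsWithin] with t ht
  rw [p.qd_eq (le_of_lt ht)]
  ring

/-- The quasi-derivative is determined by its values almost everywhere. -/
lemma qd_eq_zero_of_ae (p : T.LocPair) {y : Ivl a b}
    (h : ∀ᵐ x ∂(T.sigma.restrict (Iio y)), p.qd x = 0) : p.qd y = 0 := by
  by_contra h0
  have h1 := (p.tendsto_qd_left y).eventually_ne h0
  obtain ⟨x, hx, hx'⟩ := ((frequently_of_ae_Iio h).and_eventually h1).exists
  exact hx' hx

/-- A priori bounds for approximate solutions, uniform in the spectral parameter. -/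
lemma exists_bound_of_approx (T : Coefficients a b) {α β : Ivl a b} (hαβ : α ≤ β) {R : ℝ}
    (hR : 0 ≤ R) : ∃ K, 0 ≤ K ∧ ∀ (z : ℂ) (p : T.LocPair) (ε : ℝ), ‖z‖ ≤ R → 0 ≤ ε →
      (∀ x ∈ Icc α β, ‖p.snd x - z * p.fst x‖ ≤ ε) →
      ∀ x ∈ Icc α β, ‖p.fst x‖ + ‖p.qd x‖ ≤ K * (‖p.fst α‖ + ‖p.qd α‖ + ε) := by
  set ω := T.sigma + (T.chi + (T.rho.pos + T.rho.neg)) with hω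
  obtain ⟨K, hK0, hK⟩ := exists_isGronwallConstant ω (C := 1 + R) (by linarith) hαβ
  set m := T.rho.pos.real (Ico α β) + T.rho.neg.real (Ico α β) with hm
  have hm0 : 0 ≤ m := add_nonneg measureReal_nonneg measureReal_nonneg
  refine ⟨K * (1 + m), by positivity, fun z p ε hz hε hp x hx => ?_⟩
  set g : Ivl a b → ℝ := fun x => ‖p.fst x‖ + ‖p.qd x‖ with hg
  have hgm : Measurable g := (p.locBdd_fst.1.norm.add p.locBdd_qd.1.norm).measurable
  have hg0 : ∀ x, 0 ≤ g x := fun x => by positivity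
  obtain ⟨M1, hM1⟩ := p.locBdd_fst.2 α β
  obtain ⟨M2, hM2⟩ := p.locBdd_qd.2 α β
  have hInt : ∀ {μ : Measure (Ivl a b)} [IsLocallyFiniteMeasure μ] (y : Ivl a b),
      IntegrableOn g (Ico α y) μ := fun {μ} _ y =>
    (integrableOn_Ico p.locBdd_fst.locallyIntegrable α y).norm.add
      (integrableOn_Ico p.locBdd_qd.locallyIntegrable α y).norm
  have main := hK g hgm hg0 ⟨M1 + M2, fun y hy => add_le_add (hM1 y hy) (hM2 y hy)⟩
    (‖p.fst α‖ + ‖p.qd α‖ + ε * m) (by positivity) ?_ x hx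
  · refine main.trans ?_
    rw [mul_assoc]
    gcongr
    nlinarith [norm_nonneg (p.fst α), norm_nonneg (p.qd α)]
  intro y hy
  have b1 : ‖∫ s in Ico α y, p.qd s ∂T.sigma‖ ≤ ∫ s in Ico α y, g s ∂T.sigma :=
    norm_integral_le_of_norm_le (hInt y) (ae_of_all _ fun s => by simp [hg])
  have b2 : ‖∫ s in Ico α y, p.fst s ∂T.chi‖ ≤ ∫ s in Ico α y, g s ∂T.chi :=
    norm_integral_le_of_norm_le (hInt y) (ae_of_all _ fun s => by simp [hg])
  have b3 : ∀ (μ : Measure (Ivl a b)) [IsLocallyFiniteMeasure μ],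
      ‖∫ s in Ico α y, p.snd s ∂μ‖ ≤ R * (∫ s in Ico α y, g s ∂μ) + ε * μ.real (Ico α β) := by
    intro μ _
    have h1 : ‖∫ s in Ico α y, p.snd s ∂μ‖ ≤ ∫ s in Ico α y, (R * g s + ε) ∂μ := by
      refine norm_integral_le_of_norm_le (((hInt y).const_mul R).add
        (integrableOn_const (measure_Ico_lt_top μ α y).ne))
        ((ae_restrict_iff' measurableSet_Ico).2 (ae_of_all _ fun s hs => ?_))
      have h2 := hp s ⟨hs.1, hs.2.le.trans hy.2⟩
      have h3 : ‖p.snd s‖ ≤ ‖z * p.fst s‖ + ‖p.snd s - z * p.fst s‖ := by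
        simpa using norm_add_le (z * p.fst s) (p.snd s - z * p.fst s)
      rw [norm_mul] at h3
      have h4 : ‖z‖ * ‖p.fst s‖ ≤ R * g s := by
        refine mul_le_mul hz ?_ (norm_nonneg _) hR
        simp [hg]
      linarith
    refine h1.trans ?_
    rw [integral_add ((hInt y).const_mul R) (integrableOn_const (measure_Ico_lt_top μ α y).ne),
      integral_const_mul]
    gcongr
    simp only [integral_const, measureReal_restrict_apply_univ, smul_eq_mul]
    rw [mul_comm]
    gcongr
    · exact (measure_Ico_lt_top μ α β).ne
    · exact hy.2
  have hsum : ∫ s in Ico α y, g s ∂ω = (∫ s in Ico α y, g s ∂T.sigma) +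
      ((∫ s in Ico α y, g s ∂T.chi) + ((∫ s in Ico α y, g s ∂T.rho.pos) +
        ∫ s in Ico α y, g s ∂T.rho.neg)) := by
    have i1 : Integrable g (T.sigma.restrict (Ico α y)) := hInt y
    have i2 : Integrable g (T.chi.restrict (Ico α y)) := hInt y
    have i3 : Integrable g (T.rho.pos.restrict (Ico α y)) := hInt y
    have i4 : Integrable g (T.rho.neg.restrict (Ico α y)) := hInt y
    rw [hω, Measure.restrict_add, Measure.restrict_add, Measure.restrict_add,
      integral_add_measure i1 (i2.add_measure (i3.add_measure i4)),
      integral_add_measure i2 (i3.add_measure i4), integral_add_measure i3 i4]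
  have n1 : ‖p.fst y‖ ≤ ‖p.fst α‖ + ∫ s in Ico α y, g s ∂T.sigma := by
    rw [p.hasDensity_fst.eq_of_le hy.1]
    exact (norm_add_le _ _).trans (by gcongr)
  have n2 : ‖p.qd y‖ ≤ ‖p.qd α‖ + (∫ s in Ico α y, g s ∂T.chi) +
      ((R * (∫ s in Ico α y, g s ∂T.rho.pos) + ε * T.rho.pos.real (Ico α β)) +
        (R * (∫ s in Ico α y, g s ∂T.rho.neg) + ε * T.rho.neg.real (Ico α β))) := by
    rw [p.qd_eq hy.1]
    exact (norm_sub_le _ _).trans (add_le_add ((norm_add_le _ _).trans (by gcongr))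
      ((norm_sub_le _ _).trans (add_le_add (b3 _) (b3 _))))
  have p0 : ∀ (μ : Measure (Ivl a b)), 0 ≤ ∫ s in Ico α y, g s ∂μ := fun μ => integral_nonneg hg0
  rw [hsum, hm]
  have := p0 T.sigma
  have := p0 T.chi
  have := p0 T.rho.pos
  have := p0 T.rho.neg
  show ‖p.fst y‖ + ‖p.qd y‖ ≤ _
  nlinarith [mul_nonneg hR (p0 T.sigma), mul_nonneg hR (p0 T.chi)]

/-- Uniqueness for the initial value problem to the right of the initial point. -/
lemma IsSolution.eq_zero_of_initial {p : T.LocPair} {z : ℂ} (hp : p.IsSolution z) {y x : Ivl a b}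
    (h1 : p.fst y = 0) (h2 : p.qd y = 0) (hyx : y ≤ x) : p.fst x = 0 := by
  obtain ⟨K, hK0, hK⟩ := exists_bound_of_approx T hyx (norm_nonneg z)
  have := hK z p 0 le_rfl le_rfl (fun s _ => by simp [hp.snd_apply]) x ⟨hyx, le_rfl⟩
  simp only [h1, h2, norm_zero, add_zero, mul_zero] at this
  exact norm_le_zero_iff.1 ((le_add_of_nonneg_right (norm_nonneg _)).trans this)

end LocPair

end Coefficients

end LeftDefinite

end

noncomputable section

namespace LeftDefinite

namespace Coefficients

variable {a b : EReal} {T : Coefficients a b}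

namespace LocPair

/-! ### Solutions for non-real spectral parameter -/

lemma IsSolution.form_star {r : T.LocPair} {z : ℂ} (hr : r.IsSolution z) (s : Set (Ivl a b)) :
    T.form s r.fst r.qd (z • r.star.fst - r.star.snd) (z • r.star.qd - r.star.dsnd) =
      (z - conj z) * T.nsq s r.fst r.qd := by
  unfold form nsq
  push_cast
  rw [mul_add]
  congr 1
  · rw [← integral_complex_ofReal, ← integral_const_mul]
    refine integral_congr_ae (ae_of_all _ fun x => ?_)
    simp only [Pi.sub_apply, Pi.smul_apply, star_fst, star_snd, hr.snd_apply, smul_eq_mul, map_mul]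
    push_cast
    rw [← Complex.mul_conj']
    ring
  · rw [← integral_complex_ofReal, ← integral_const_mul]
    refine integral_congr_ae (ae_restrict_of_ae ?_)
    filter_upwards [hr.star.dsnd_ae] with x hx
    simp only [Pi.sub_apply, Pi.smul_apply, star_qd, hx, smul_eq_mul]
    push_cast
    rw [← Complex.mul_conj']
    ring

lemma IsSolution.wr_star_eq {r : T.LocPair} {z : ℂ} (hr : r.IsSolution z) {c x : Ivl a b}
    (hcx : c ≤ x) :
    r.wr r.star x = r.wr r.star c + (z - conj z) * T.nsq (Ico c x) r.fst r.qd := by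
  rw [hr.wr_eq r.star hcx, hr.form_star]

lemma NearLeft.l2On_Iio {r : T.LocPair} (hr : r.NearLeft) (x : Ivl a b) :
    T.L2On (Iio x) r.fst r.qd := by
  obtain ⟨c, hc⟩ := hr
  refine (hc.1.union (L2On.of_locBdd r.locBdd_fst r.locBdd_qd c x)).mono fun y hy => ?_
  rcases lt_or_ge y c with h | h
  · exact Or.inl h
  · exact Or.inr ⟨h, hy⟩

lemma NearRight.l2On_Ici {r : T.LocPair} (hr : r.NearRight) (x : Ivl a b) :
    T.L2On (Ici x) r.fst r.qd := by
  obtain ⟨c, hc⟩ := hr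
  refine ((L2On.of_locBdd r.locBdd_fst r.locBdd_qd x c).union hc.1).mono fun y hy => ?_
  rcases lt_or_ge y c with h | h
  · exact Or.inl ⟨hy, h⟩
  · exact Or.inr h

/-- A non-trivial solution of `(τ - z) u = 0` for non-real `z` that lies in `H¹` near `a` and for
which `V(u, u^*)(a) = 0`. -/
structure IsLeftSolution (z : ℂ) (u : T.LocPair) : Prop where
  im_ne : z.im ≠ 0
  isSolution : u.IsSolution z
  ne_zero : u.fst ≠ 0
  nearLeft : u.NearLeft
  vanishes : u.WronskianVanishesLeft u

namespace IsLeftSolution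

variable {z : ℂ} {u : T.LocPair}

lemma z_ne (hu : IsLeftSolution z u) : z ≠ 0 := fun h => hu.im_ne (by simp [h])

lemma sub_conj_ne (hu : IsLeftSolution z u) : z - conj z ≠ 0 := by
  rw [Complex.sub_conj]
  simp [hu.im_ne]

lemma wr_star_eq (hu : IsLeftSolution z u) (x : Ivl a b) :
    u.wr u.star x = (z - conj z) * T.nsq (Iio x) u.fst u.qd := by
  have h0 := hu.vanishes
  rw [WronskianVanishesLeft, wronskian_eq_wr] at h0
  have hL := hu.nearLeft.l2On_Iio x
  have h1 : Tendsto (fun y => T.nsq (Ico y x) u.fst u.qd) atBot (𝓝 (T.nsq (Iio x) u.fst u.qd)) :=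
    (tendsto_setIntegral_Ico_atBot hL.integrable_sq_chi).add
      (tendsto_setIntegral_Ico_atBot hL.integrable_sq_sigma)
  have h2 := (Complex.continuous_ofReal.tendsto _).comp h1
  have h3 := h0.add (h2.const_mul (z - conj z))
  rw [zero_add] at h3
  have : Nonempty (Ivl a b) := ⟨x⟩
  refine (tendsto_nhds_unique h3 (tendsto_const_nhds.congr' ?_)).symm
  filter_upwards [eventually_le_atBot x] with y hy
  exact hu.isSolution.wr_star_eq hy

lemma not_initial_zero (hu : IsLeftSolution z u) (y : Ivl a b)
    (h : T.nsq (Iio y) u.fst u.qd = 0) : u.fst y ≠ 0 := by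
  intro hy
  have hL := hu.nearLeft.l2On_Iio y
  have h2 : ∫ x in Iio y, ‖u.qd x‖ ^ 2 ∂T.sigma = 0 := by
    have i1 : 0 ≤ ∫ x in Iio y, ‖u.fst x‖ ^ 2 ∂T.chi := integral_nonneg fun _ => by positivity
    have i2 : 0 ≤ ∫ x in Iio y, ‖u.qd x‖ ^ 2 ∂T.sigma := integral_nonneg fun _ => by positivity
    unfold nsq at h
    linarith
  rw [integral_eq_zero_iff_of_nonneg (fun _ => by positivity) hL.integrable_sq_sigma] at h2
  have h3 : ∀ᵐ x ∂(T.sigma.restrict (Iio y)), u.qd x = 0 := by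
    filter_upwards [h2] with x hx
    simpa using hx
  have hq : u.qd y = 0 := u.qd_eq_zero_of_ae h3
  refine hu.ne_zero (funext fun x => ?_)
  rcases le_total y x with hyx | hyx
  · exact hu.isSolution.eq_zero_of_initial hy hq hyx
  · have h4 := u.hasDensity_fst.eq_of_le hyx
    rw [hy, integral_congr_ae (g := fun _ => (0 : ℂ))
      (ae_restrict_of_ae_restrict_of_subset (fun s hs => hs.2) h3)] at h4
    simpa using h4.symm

lemma fst_ne_zero (hu : IsLeftSolution z u) (y : Ivl a b) : u.fst y ≠ 0 := by
  intro hy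
  refine hu.not_initial_zero y ?_ hy
  have h1 := hu.wr_star_eq y
  have h2 : u.wr u.star y = 0 := by
    simp [wr, hu.isSolution.snd_apply, hy]
  rw [h2, eq_comm, mul_eq_zero] at h1
  exact_mod_cast h1.resolve_left hu.sub_conj_ne

/-- The right-hand limits of `u`. -/
def fstPlus (u : T.LocPair) (y : Ivl a b) : ℂ := u.fst y + T.sigma.real {y} • u.qd y

lemma fstPlus_ne_zero (hu : IsLeftSolution z u) (y : Ivl a b) : fstPlus u y ≠ 0 := by
  intro hy
  have h1 := hu.wr_star_eq y
  set m := T.sigma.real {y} with hm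
  have hm0 : 0 ≤ m := measureReal_nonneg
  have hf : u.fst y = -(m * u.qd y) := by
    rw [fstPlus, Complex.real_smul] at hy
    exact eq_neg_of_add_eq_zero_left hy
  have h2 : u.wr u.star y = -((z - conj z) * (m * ‖u.qd y‖ ^ 2 : ℝ)) := by
    simp only [wr, hu.isSolution.snd_apply, star_qd, star_snd, map_mul, hf, map_neg,
      Complex.conj_ofReal]
    push_cast
    rw [← Complex.mul_conj']
    ring
  rw [h2, ← mul_neg] at h1
  have h3 := mul_left_cancel₀ hu.sub_conj_ne h1
  have h4 : -(m * ‖u.qd y‖ ^ 2) = T.nsq (Iio y) u.fst u.qd := by exact_mod_cast h3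
  have h5 : 0 ≤ T.nsq (Iio y) u.fst u.qd := nsq_nonneg
  have h6 : 0 ≤ m * ‖u.qd y‖ ^ 2 := by positivity
  have h7 : m * ‖u.qd y‖ ^ 2 = 0 := by linarith
  refine hu.fst_ne_zero y ?_
  rw [hf, neg_eq_zero, mul_eq_zero]
  rcases mul_eq_zero.1 h7 with h | h
  · left; exact_mod_cast h
  · right; simpa using h

lemma exists_lower_bound (hu : IsLeftSolution z u) (c d : Ivl a b) :
    ∃ m > 0, ∀ y ∈ Icc c d, m ≤ ‖u.fst y‖ := by
  refine (isCompact_Icc_ivl c d).induction_on (p := fun s => ∃ m > 0, ∀ y ∈ s, m ≤ ‖u.fst y‖)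
    ⟨1, one_pos, by simp⟩ (fun s t hst ⟨m, hm, h⟩ => ⟨m, hm, fun y hy => h y (hst hy)⟩) ?_ ?_
  · rintro s t ⟨m, hm, h⟩ ⟨n, hn, k⟩
    refine ⟨min m n, lt_min hm hn, fun y hy => ?_⟩
    rcases hy with hy | hy
    · exact (min_le_left _ _).trans (h y hy)
    · exact (min_le_right _ _).trans (k y hy)
  · intro y _
    have p1 : 0 < ‖u.fst y‖ := norm_pos_iff.2 (hu.fst_ne_zero y)
    have p2 : 0 < ‖fstPlus u y‖ := norm_pos_iff.2 (hu.fstPlus_ne_zero y)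
    have e1 := (u.hasDensity_fst.tendsto_left y).norm.eventually (lt_mem_nhds (half_lt_self p1))
    have e2 := (u.hasDensity_fst.tendsto_right y).norm.eventually (lt_mem_nhds (half_lt_self p2))
    set m := min (‖u.fst y‖ / 2) (‖fstPlus u y‖ / 2) with hm
    have hev : ∀ᶠ t in 𝓝 y, m ≤ ‖u.fst t‖ := by
      have h1 : ∀ᶠ t in 𝓝[<] y, m ≤ ‖u.fst t‖ := by
        filter_upwards [e1] with t ht using (min_le_left _ _).trans ht.le
      have h2 : ∀ᶠ t in 𝓝[>] y, m ≤ ‖u.fst t‖ := by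
        filter_upwards [e2] with t ht using (min_le_right _ _).trans ht.le
      have h3 : m ≤ ‖u.fst y‖ := (min_le_left _ _).trans (half_le_self p1.le)
      rw [← nhdsNE_sup_pure, ← nhdsLT_sup_nhdsGT]
      exact eventually_sup.2 ⟨eventually_sup.2 ⟨h1, h2⟩, h3⟩
    exact ⟨_, mem_nhdsWithin_of_mem_nhds hev, m, lt_min (by positivity) (by positivity),
      fun t ht => ht⟩

lemma locBdd_inv (hu : IsLeftSolution z u) : LocBdd (fun x => (u.fst x)⁻¹) :=
  ⟨u.locBdd_fst.1.measurable.inv.stronglyMeasurable, fun c d => by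
    obtain ⟨m, hm, h⟩ := hu.exists_lower_bound c d
    refine ⟨m⁻¹, fun y hy => ?_⟩
    rw [norm_inv]
    exact inv_anti₀ hm (h y hy)⟩

/-- The density `1 / (u(x) u(x+))`. -/
def invDensity (u : T.LocPair) (x : Ivl a b) : ℂ := (u.fst x)⁻¹ * (fstPlus u x)⁻¹

lemma stronglyMeasurable_fstPlus (u : T.LocPair) : Measurable (fstPlus u) := by
  have hc : {t : Ivl a b | 0 < T.sigma {t}}.Countable :=
    Measure.countable_meas_pos_of_disjoint_iUnion (fun t => measurableSet_singleton t)
      (fun s t hst => by simpa using hst)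
  have hm : Measurable fun t : Ivl a b => T.sigma.real {t} := by
    refine Measurable.measurable_of_countable_ne (f := fun _ => (0 : ℝ)) measurable_const
      (hc.mono fun t ht => ?_)
    by_contra h
    refine ht ?_
    have : T.sigma {t} = 0 := by simpa using h
    simp [Measure.real, this]
  exact u.locBdd_fst.1.measurable.add (hm.smul u.locBdd_qd.1.measurable)

lemma locBdd_invDensity (hu : IsLeftSolution z u) : LocBdd (invDensity u) := by
  refine hu.locBdd_inv.mul ⟨(stronglyMeasurable_fstPlus u).inv.stronglyMeasurable, fun c d => ?_⟩
  obtain ⟨e, he⟩ := exists_gt d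
  obtain ⟨m, hm, h⟩ := hu.exists_lower_bound c e
  refine ⟨m⁻¹, fun y hy => ?_⟩
  rw [norm_inv]
  refine inv_anti₀ hm (ge_of_tendsto (u.hasDensity_fst.tendsto_right y).norm ?_)
  filter_upwards [Ioo_mem_nhdsGT (hy.2.trans_lt he)] with t ht
  exact h t ⟨hy.1.trans ht.1.le, ht.2.le⟩

lemma fstPlus_mul_invDensity (hu : IsLeftSolution z u) (x : Ivl a b) :
    fstPlus u x * invDensity u x = (u.fst x)⁻¹ := by
  rw [invDensity, mul_left_comm, mul_inv_cancel₀ (hu.fstPlus_ne_zero x), mul_one]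

lemma inv_eq (hu : IsLeftSolution z u) {c x : Ivl a b} (hcx : c ≤ x) :
    (u.fst x)⁻¹ = (u.fst c)⁻¹ - ∫ s in Ico c x, u.qd s * invDensity u s ∂T.sigma := by
  have hk : LocBdd (fun s => -(u.qd s * invDensity u s)) :=
    (u.locBdd_qd.mul hu.locBdd_invDensity).neg
  set N : Ivl a b → ℂ := fun x =>
    (u.fst c)⁻¹ + orientedIntegral T.sigma (fun s => -(u.qd s * invDensity u s)) c x with hN
  have hND : HasDensity T.sigma N (fun s => -(u.qd s * invDensity u s)) := by
    have := (HasDensity.const T.sigma (u.fst c)⁻¹).add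
      (hasDensity_orientedIntegral (hk.locallyIntegrable (μ := T.sigma)) c)
    rwa [zero_add] at this
  have hNc : N c = (u.fst c)⁻¹ := by simp [hN, orientedIntegral]
  set y : Ivl a b → ℂ := fun x => u.fst x * N x - 1 with hy
  have hyb : LocBdd y := (u.locBdd_fst.mul hND.locBdd).sub (LocBdd.const 1)
  have hqb : LocBdd (fun s => u.qd s * (u.fst s)⁻¹) := u.locBdd_qd.mul hu.locBdd_inv
  have hyeq : ∀ x, c ≤ x → y x = ∫ s in Ico c x, u.qd s * (u.fst s)⁻¹ * y s ∂T.sigma := by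
    intro x hcx
    have h1 := u.hasDensity_fst.mul_eq hND hcx
    rw [hNc, mul_inv_cancel₀ (hu.fst_ne_zero c)] at h1
    have h2 : ∫ s in Ico c x, u.qd s * (u.fst s)⁻¹ * y s ∂T.sigma =
        (∫ s in Ico c x, u.qd s * N s ∂T.sigma) +
        ∫ s in Ico c x, (u.fst s + T.sigma.real {s} • u.qd s) * -(u.qd s * invDensity u s)
          ∂T.sigma := by
      have e : ∀ s, (u.fst s + T.sigma.real {s} • u.qd s) * -(u.qd s * invDensity u s) =
          -(u.qd s * (u.fst s)⁻¹) := fun s => by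
        rw [← hu.fstPlus_mul_invDensity, fstPlus]
        ring
      simp only [e]
      rw [← integral_add]
      · refine integral_congr_ae (ae_of_all _ fun s => ?_)
        simp only [hy]
        have := hu.fst_ne_zero s
        field_simp
        ring
      · exact integrableOn_Ico (u.locBdd_qd.mul hND.locBdd).locallyIntegrable c x
      · exact integrableOn_Ico hqb.neg.locallyIntegrable c x
    rw [h2, hy]
    linear_combination h1
  obtain ⟨C, hC⟩ := hqb.2 c x
  obtain ⟨M, hM⟩ := hyb.2 c x
  obtain ⟨K, -, hK⟩ := exists_isGronwallConstant T.sigma (le_max_right C 0) hcx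
  have h0 := hK (fun x => ‖y x‖) hyb.1.norm.measurable (fun _ => norm_nonneg _) ⟨M, hM⟩ 0 le_rfl
    (fun t ht => ?_) x ⟨hcx, le_rfl⟩
  · rw [mul_zero] at h0
    have h1 : u.fst x * N x = 1 := sub_eq_zero.1 (norm_le_zero_iff.1 h0)
    rw [DivisionMonoid.inv_eq_of_mul _ _ h1, hN]
    simp only
    rw [orientedIntegral_of_le hcx, integral_neg, sub_eq_add_neg]
  · rw [zero_add, hyeq t ht.1, ← integral_const_mul]
    refine norm_integral_le_of_norm_le
      ((integrableOn_Ico hyb.locallyIntegrable c t).norm.const_mul _)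
      ((ae_restrict_iff' measurableSet_Ico).2 (ae_of_all _ fun s hs => ?_))
    rw [norm_mul]
    gcongr
    exact (hC s ⟨hs.1, hs.2.le.trans ht.2⟩).trans (le_max_left _ _)

/-- Reduction of order: a second solution with unit Wronskian. -/
lemma exists_second_solution (hu : IsLeftSolution z u) : ∃ θ : T.LocPair, θ.IsSolution z ∧
    ∀ x, u.fst x * θ.qd x - u.qd x * θ.fst x = 1 := by
  rcases isEmpty_or_nonempty (Ivl a b) with he | ⟨⟨c⟩⟩
  · exact (hu.ne_zero (funext fun x => (he.false x).elim)).elim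
  set I := orientedIntegral T.sigma (invDensity u) c with hI
  have hID : HasDensity T.sigma I (invDensity u) :=
    hasDensity_orientedIntegral hu.locBdd_invDensity.locallyIntegrable c
  set q : Ivl a b → ℂ := fun x => u.qd x * I x + (u.fst x)⁻¹ with hq
  have hθ : HasDensity T.sigma (fun x => u.fst x * I x) q := by
    refine HasDensity.of_le ((u.locBdd_qd.mul hID.locBdd).add hu.locBdd_inv).locallyIntegrable
      fun y x hyx => ?_
    rw [u.hasDensity_fst.mul_eq hID hyx, add_assoc, ← integral_add]
    · congr 1
      refine integral_congr_ae (ae_of_all _ fun s => ?_)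
      simp only [hq]
      rw [← hu.fstPlus_mul_invDensity s, fstPlus]
    · exact integrableOn_Ico (u.locBdd_qd.mul hID.locBdd).locallyIntegrable y x
    · refine (integrableOn_Ico (hu.locBdd_inv.locallyIntegrable (μ := T.sigma)) y x).congr
        (ae_of_all _ fun s => ?_)
      simp only
      rw [← hu.fstPlus_mul_invDensity s, fstPlus]
  refine ⟨ofEq (fun x => u.fst x * I x) q (z • fun x => u.fst x * I x) hθ ⟨_, hθ.smul z⟩ ?_, rfl,
    fun x => ?_⟩
  · intro y x hyx
    have h1 := mul_qd_eq hID u hyx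
    have h2 := hu.inv_eq hyx
    have e1 : ∫ s in Ico y x, invDensity u s * u.qd s ∂T.sigma =
        ∫ s in Ico y x, u.qd s * invDensity u s ∂T.sigma :=
      integral_congr_ae (ae_of_all _ fun s => mul_comm _ _)
    have e2 : ∫ s in Ico y x, I s * u.fst s ∂T.chi = ∫ s in Ico y x, u.fst s * I s ∂T.chi :=
      integral_congr_ae (ae_of_all _ fun s => mul_comm _ _)
    have e3 : ∀ μ : Measure (Ivl a b), ∫ s in Ico y x, I s * u.snd s ∂μ =
        ∫ s in Ico y x, (z • fun x => u.fst x * I x) s ∂μ := fun μ =>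
      integral_congr_ae (ae_of_all _ fun s => by
        simp only [hu.isSolution.snd_apply, Pi.smul_apply, smul_eq_mul]; ring)
    rw [e1, e2, e3, e3] at h1
    simp only [hq]
    linear_combination h1 + h2
  · simp only [ofEq_qd, ofEq_fst, hq]
    have := hu.fst_ne_zero x
    field_simp
    ring

end IsLeftSolution

end LocPair

end Coefficients

end LeftDefinite

end

noncomputable section

namespace LeftDefinite

namespace Coefficients

variable {a b : EReal} {T : Coefficients a b}

/-! ### Weyl solutions at the right end point -/

lemma nsq_comb {s : Set (Ivl a b)} {f h g k : Ivl a b → ℂ} (hf : T.L2On s f h)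
    (hg : T.L2On s g k) (A B : ℂ) :
    T.nsq s (A • f + B • g) (A • h + B • k) = ‖A‖ ^ 2 * T.nsq s f h + ‖B‖ ^ 2 * T.nsq s g k +
      2 * (A * conj B * T.form s f h (fun x => conj (g x)) (fun x => conj (k x))).re := by
  have key : ∀ {μ : Measure (Ivl a b)} {f g : Ivl a b → ℂ}, MemLp f 2 (μ.restrict s) →
      MemLp g 2 (μ.restrict s) → ∫ x in s, ‖(A • f + B • g) x‖ ^ 2 ∂μ =
        ‖A‖ ^ 2 * (∫ x in s, ‖f x‖ ^ 2 ∂μ) + ‖B‖ ^ 2 * (∫ x in s, ‖g x‖ ^ 2 ∂μ) +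
        2 * (A * conj B * ∫ x in s, f x * conj (g x) ∂μ).re := by
    intro μ f g h1 h2
    have i1 := h1.integrable_norm_pow two_ne_zero
    have i2 := h2.integrable_norm_pow two_ne_zero
    have i3 : Integrable (fun x => A * conj B * (f x * conj (g x))) (μ.restrict s) :=
      (h1.integrable_mul h2.star).const_mul _
    have e3 : (A * conj B * ∫ x in s, f x * conj (g x) ∂μ).re =
        ∫ x in s, (A * conj B * (f x * conj (g x))).re ∂μ := by
      rw [← integral_const_mul]
      exact (integral_re i3).symm
    rw [e3, ← integral_const_mul,
      ← integral_const_mul, ← integral_const_mul, ← integral_add (i1.const_mul _) (i2.const_mul _)]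
    refine Eq.trans ?_ (integral_add ((i1.const_mul _).add (i2.const_mul _)) (i3.re.const_mul 2))
    refine integral_congr_ae (ae_of_all _ fun x => ?_)
    simp only [Pi.add_apply, Pi.smul_apply, smul_eq_mul]
    rw [← Complex.normSq_eq_norm_sq, Complex.normSq_add, Complex.normSq_mul, Complex.normSq_mul,
      Complex.normSq_eq_norm_sq, Complex.normSq_eq_norm_sq, Complex.normSq_eq_norm_sq,
      Complex.normSq_eq_norm_sq, map_mul, mul_mul_mul_comm]
  unfold nsq form
  rw [key hf.1 hg.1, key hf.2 hg.2, mul_add (A * conj B), Complex.add_re]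
  ring

namespace LocPair

/-- The solution `A θ + B u`. -/
def comb (θ u : T.LocPair) (w : ℂ × ℂ) : T.LocPair := (θ.smul w.1).add (u.smul w.2)

lemma IsSolution.comb {θ u : T.LocPair} {z : ℂ} (hθ : θ.IsSolution z) (hu : u.IsSolution z)
    (w : ℂ × ℂ) : (comb θ u w).IsSolution z := (hθ.smul w.1).add (hu.smul w.2)

namespace IsLeftSolution

variable {z : ℂ} {u : T.LocPair}

lemma exists_comb_l2On (hu : IsLeftSolution z u) {θ : T.LocPair} (hθ : θ.IsSolution z)
    (c : Ivl a b) : ∃ w : ℂ × ℂ, w ≠ 0 ∧ T.L2On (Ici c) (comb θ u w).fst (comb θ u w).qd := by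
  have : Nonempty (Ivl a b) := ⟨c⟩
  set C : ℝ := 2 * ‖z‖ * (‖θ.fst c‖ + ‖u.fst c‖) * (‖θ.qd c‖ + ‖u.qd c‖) / (2 * |z.im|) with hC
  set K : Ivl a b → Set (ℂ × ℂ) := fun x => Metric.sphere (0 : ℂ × ℂ) 1 ∩
    {w | T.nsq (Ico c x) (comb θ u w).fst (comb θ u w).qd ≤ C} with hK
  have hcont : ∀ x, Continuous fun w : ℂ × ℂ =>
      T.nsq (Ico c x) (comb θ u w).fst (comb θ u w).qd := by
    intro x
    have e : ∀ w : ℂ × ℂ, T.nsq (Ico c x) (comb θ u w).fst (comb θ u w).qd = _ := fun w =>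
      nsq_comb (L2On.of_locBdd θ.locBdd_fst θ.locBdd_qd c x)
        (L2On.of_locBdd u.locBdd_fst u.locBdd_qd c x) w.1 w.2
    simp only [e]
    fun_prop
  have hclosed : ∀ x, IsClosed (K x) := fun x =>
    Metric.isClosed_sphere.inter (isClosed_le (hcont x) continuous_const)
  have hcomp : ∀ x, IsCompact (K x) := fun x =>
    (isCompact_sphere (0 : ℂ × ℂ) 1).inter_right (isClosed_le (hcont x) continuous_const)
  have him : 0 < |z.im| := abs_pos.2 hu.im_ne
  have hC0 : 0 ≤ C := by positivity
  have hne : ∀ x, (K x).Nonempty := by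
    intro x
    have hux := hu.fst_ne_zero x
    set w0 : ℂ × ℂ := (u.fst x, -θ.fst x) with hw0
    have hw0' : w0 ≠ 0 := fun h => hux (congrArg Prod.fst h)
    set w : ℂ × ℂ := (‖w0‖⁻¹ : ℂ) • w0 with hw
    have hwn : ‖w‖ = 1 := by
      rw [hw, norm_smul, norm_inv, Complex.norm_real, norm_norm,
        inv_mul_cancel₀ (norm_ne_zero_iff.2 hw0')]
    refine ⟨w, by simpa using hwn, ?_⟩
    show T.nsq (Ico c x) (comb θ u w).fst (comb θ u w).qd ≤ C
    rcases lt_or_ge x c with hxc | hcx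
    · rw [Ico_eq_empty_of_le hxc.le]
      simpa [nsq] using hC0
    have hr := hθ.comb hu.isSolution w
    have h0 : (comb θ u w).fst x = 0 := by
      simp [comb, hw, hw0]
      ring
    have h1 := hr.wr_star_eq hcx
    have h2 : (comb θ u w).wr (comb θ u w).star x = 0 := by
      simp [wr, hr.snd_apply, h0]
    have hn1 : ‖(comb θ u w).fst c‖ ≤ ‖θ.fst c‖ + ‖u.fst c‖ := by
      simp only [comb, add_fst, smul_fst, Pi.add_apply, Pi.smul_apply, smul_eq_mul]
      refine (norm_add_le _ _).trans ?_
      rw [norm_mul, norm_mul]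
      have i1 : ‖w.1‖ ≤ 1 := (norm_fst_le w).trans hwn.le
      have i2 : ‖w.2‖ ≤ 1 := (norm_snd_le w).trans hwn.le
      nlinarith [norm_nonneg (θ.fst c), norm_nonneg (u.fst c)]
    have hn2 : ‖(comb θ u w).qd c‖ ≤ ‖θ.qd c‖ + ‖u.qd c‖ := by
      simp only [comb, add_qd, smul_qd, Pi.add_apply, Pi.smul_apply, smul_eq_mul]
      refine (norm_add_le _ _).trans ?_
      rw [norm_mul, norm_mul]
      have i1 : ‖w.1‖ ≤ 1 := (norm_fst_le w).trans hwn.le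
      have i2 : ‖w.2‖ ≤ 1 := (norm_snd_le w).trans hwn.le
      nlinarith [norm_nonneg (θ.qd c), norm_nonneg (u.qd c)]
    have hn3 : ‖(comb θ u w).wr (comb θ u w).star c‖ ≤
        2 * ‖z‖ * (‖θ.fst c‖ + ‖u.fst c‖) * (‖θ.qd c‖ + ‖u.qd c‖) := by
      have : ‖(comb θ u w).wr (comb θ u w).star c‖ ≤
          2 * ‖z‖ * ‖(comb θ u w).fst c‖ * ‖(comb θ u w).qd c‖ := by
        simp only [wr, hr.snd_apply, star_qd, star_snd]
        refine (norm_sub_le _ _).trans (le_of_eq ?_)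
        simp only [norm_mul, Complex.norm_conj]
        ring
      refine this.trans ?_
      gcongr
    rw [h2] at h1
    have h3 : ‖(z - conj z) * (T.nsq (Ico c x) (comb θ u w).fst (comb θ u w).qd : ℂ)‖ =
        ‖(comb θ u w).wr (comb θ u w).star c‖ := by
      rw [← norm_neg, ← eq_neg_of_add_eq_zero_left h1.symm]
    rw [norm_mul, Complex.sub_conj, Complex.norm_real, Real.norm_of_nonneg nsq_nonneg] at h3
    simp only [norm_mul, Complex.norm_I, Complex.norm_real, mul_one, Real.norm_eq_abs,
      abs_two] at h3
    rw [hC, le_div_iff₀ (by positivity), mul_comm]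
    linarith
  have hdir : ∀ x y, x ≤ y → K y ⊆ K x := fun x y hxy v hv =>
    ⟨hv.1, ((L2On.of_locBdd (comb θ u v).locBdd_fst (comb θ u v).locBdd_qd c y).nsq_mono
      (Ico_subset_Ico_right hxy)).trans hv.2⟩
  obtain ⟨w, hw⟩ := IsCompact.nonempty_iInter_of_directed_nonempty_isCompact_isClosed K
    (fun x y => ⟨max x y, hdir _ _ (le_max_left x y), hdir _ _ (le_max_right x y)⟩) hne hcomp hclosed
  rw [mem_iInter] at hw
  refine ⟨w, fun h => ?_, l2On_Ici_of_nsq_bounded (comb θ u w).locBdd_fst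
    (comb θ u w).locBdd_qd fun x => (hw x).2⟩
  have := (hw c).1
  simp [h] at this

lemma not_vanishesRight (hu : IsLeftSolution z u) : ¬ u.WronskianVanishesRight u := by
  intro h
  rw [WronskianVanishesRight, wronskian_eq_wr] at h
  have : NeBot (ae T.chi) := ae_neBot.2 T.chi_ne_zero
  obtain ⟨c0, -⟩ := (ae_of_all T.chi fun _ : Ivl a b => trivial).exists
  have : Nonempty (Ivl a b) := ⟨c0⟩
  have hnsq : ∀ x, T.nsq (Iio x) u.fst u.qd = 0 := by
    intro x
    have h1 : Tendsto (fun y => T.nsq (Iio y) u.fst u.qd) atTop (𝓝 0) := by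
      have h2 := (h.const_mul (z - conj z)⁻¹).norm
      rw [mul_zero, norm_zero] at h2
      refine h2.congr fun y => ?_
      rw [hu.wr_star_eq y, inv_mul_cancel_left₀ hu.sub_conj_ne, Complex.norm_real,
        Real.norm_of_nonneg nsq_nonneg]
    refine le_antisymm (ge_of_tendsto h1 ?_) nsq_nonneg
    filter_upwards [eventually_ge_atTop x] with y hy
    exact (hu.nearLeft.l2On_Iio y).nsq_mono (Iio_subset_Iio hy)
  have h3 : ∀ᵐ x ∂T.chi, u.fst x = 0 := by
    obtain ⟨v, hv⟩ := exists_seq_tendsto (atTop : Filter (Ivl a b))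
    have hcov : (⋃ n, Iio (v n)) = univ := by
      refine eq_univ_of_forall fun x => ?_
      obtain ⟨n, hn⟩ := (hv.eventually_gt_atTop x).exists
      exact mem_iUnion.2 ⟨n, hn⟩
    have := (ae_restrict_iUnion_iff (μ := T.chi) (fun n => Iio (v n)) (fun x => u.fst x = 0)).2
      fun n => by
        have hL := hu.nearLeft.l2On_Iio (v n)
        have h2 : ∫ x in Iio (v n), ‖u.fst x‖ ^ 2 ∂T.chi = 0 := by
          have i1 : 0 ≤ ∫ x in Iio (v n), ‖u.fst x‖ ^ 2 ∂T.chi :=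
            integral_nonneg fun _ => by positivity
          have i2 : 0 ≤ ∫ x in Iio (v n), ‖u.qd x‖ ^ 2 ∂T.sigma :=
            integral_nonneg fun _ => by positivity
          have := hnsq (v n)
          unfold nsq at this
          linarith
        rw [integral_eq_zero_iff_of_nonneg (fun _ => by positivity) hL.integrable_sq_chi] at h2
        filter_upwards [h2] with x hx
        simpa using hx
    rwa [hcov, Measure.restrict_univ] at this
  obtain ⟨x, hx⟩ := h3.exists
  exact hu.fst_ne_zero x hx

/-- For non-real `z` there is a solution that lies in `H¹` near `b`, satisfies the boundary
condition at `b` and has unit Wronskian with `u`. -/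
lemma exists_right_solution (hu : IsLeftSolution z u) {vb : T.LocPair}
    (hvb : IsBoundaryFunctionRight vb) : ∃ ψ : T.LocPair, ψ.IsSolution z ∧ ψ.NearRight ∧
      ψ.WronskianVanishesRight vb ∧ ∀ x, u.fst x * ψ.qd x - u.qd x * ψ.fst x = 1 := by
  obtain ⟨θ, hθ, hW⟩ := hu.exists_second_solution
  have : NeBot (ae T.chi) := ae_neBot.2 T.chi_ne_zero
  obtain ⟨c, -⟩ := (ae_of_all T.chi fun _ : Ivl a b => trivial).exists
  obtain ⟨w, hw0, hwn, hwb⟩ : ∃ w : ℂ × ℂ, w ≠ 0 ∧ (comb θ u w).NearRight ∧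
      (comb θ u w).WronskianVanishesRight vb := by
    by_cases hLC : T.LimitCircleRight
    · have hn : ∀ r : T.LocPair, r.IsSolution z → r.NearRight := fun r hr =>
        hr.nearRight (hLC z hu.z_ne r hr)
      obtain ⟨l, hl⟩ := (hn θ hθ).exists_tendsto hvb.1.nearRight.star
      obtain ⟨m, hm⟩ := (hn u hu.isSolution).exists_tendsto hvb.1.nearRight.star
      obtain ⟨w, hw, hw'⟩ : ∃ w : ℂ × ℂ, w ≠ 0 ∧ w.1 * l + w.2 * m = 0 := by
        by_cases hm0 : m = 0
        · exact ⟨(0, 1), by simp, by simp [hm0]⟩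
        · exact ⟨(m, -l), by simp [hm0], by simp; ring⟩
      refine ⟨w, hw, hn _ (hθ.comb hu.isSolution w), ?_⟩
      rw [WronskianVanishesRight, wronskian_eq_wr, ← hw']
      refine ((hl.const_mul w.1).add (hm.const_mul w.2)).congr fun x => ?_
      simp only [wr, comb, add_snd, add_qd, smul_snd, smul_qd, Pi.add_apply, Pi.smul_apply,
        smul_eq_mul]
      ring
    · obtain ⟨w, hw, hL⟩ := hu.exists_comb_l2On hθ c
      have hn : (comb θ u w).NearRight := ⟨c, (hθ.comb hu.isSolution w).h1On hL⟩
      refine ⟨w, hw, hn, ?_⟩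
      rw [WronskianVanishesRight, wronskian_eq_wr]
      by_contra h
      exact hLC (hn.limitCircleRight hvb.1.nearRight.star h)
  have hA : w.1 ≠ 0 := by
    intro h1
    have h2 : w.2 ≠ 0 := fun h => hw0 (Prod.ext h1 h)
    have hvan := hvb.tendsto_wronskian hwn hwn (fun _ => hwb) (fun _ => hwb)
    refine hu.not_vanishesRight ?_
    rw [WronskianVanishesRight, wronskian_eq_wr] at hvan ⊢
    have := hvan.const_mul (w.2 * conj w.2)⁻¹
    rw [mul_zero] at this
    refine this.congr fun x => ?_
    have h3 : w.2 * conj w.2 ≠ 0 := by simpa using h2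
    rw [inv_mul_eq_iff_eq_mul₀ h3]
    simp [wr, comb, h1]
    ring
  refine ⟨(comb θ u w).smul w.1⁻¹, (hθ.comb hu.isSolution w).smul _, ?_, ?_, fun x => ?_⟩
  · obtain ⟨d, hd⟩ := hwn
    exact ⟨d, ((hθ.comb hu.isSolution w).smul _).h1On (hd.1.smul w.1⁻¹)⟩
  · have := Tendsto.const_mul w.1⁻¹ hwb
    rw [mul_zero] at this
    refine this.congr fun x => ?_
    simp only [wronskian, smul_snd, smul_qd, Pi.smul_apply, smul_eq_mul]
    ring
  · have := hW x
    simp only [comb, add_fst, add_qd, smul_fst, smul_qd, Pi.add_apply, Pi.smul_apply, smul_eq_mul]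
    field_simp
    linear_combination w.1 * this

end IsLeftSolution

end LocPair

end Coefficients

end LeftDefinite

end

noncomputable section

namespace LeftDefinite

namespace Coefficients

variable {a b : EReal} {T : Coefficients a b}

/-! ### The elements `δ_c` -/

namespace H1

/-- The element of `H¹(a, b)` with given function and derivative. -/
def ofDensity (f h : Ivl a b → ℂ) (hf : HasDensity T.sigma f h) (h1 : MemLp f 2 T.chi)
    (h2 : MemLp h 2 T.sigma) : T.H1 :=
  ⟨(f, h2.toLp h), h1, hf.congr h2.coeFn_toLp.symm⟩

@[simp] lemma ofDensity_apply (f h : Ivl a b → ℂ) (hf : HasDensity T.sigma f h)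
    (h1 : MemLp f 2 T.chi) (h2 : MemLp h 2 T.sigma) (x) : ofDensity f h hf h1 h2 x = f x := rfl

lemma ext_fun {u v : T.H1} (h : ∀ x, u x = v x) : u = v := by
  have h1 : u.1.1 = v.1.1 := funext h
  have h2 : HasDensity T.sigma v u.deriv := by
    have := u.hasDensity
    rwa [show (u : Ivl a b → ℂ) = v from h1] at this
  exact Subtype.ext (Prod.ext h1 (Lp.ext (h2.ae_eq v.hasDensity)))

lemma memLp_of_hasDensity (u : T.H1) {h : Ivl a b → ℂ} (hu : HasDensity T.sigma u h) :
    MemLp h 2 T.sigma := (memLp_congr_ae (hu.ae_eq u.hasDensity)).2 (Lp.memLp u.deriv)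

lemma l2On_of_hasDensity (u : T.H1) {h : Ivl a b → ℂ} (hu : HasDensity T.sigma u h)
    (s : Set (Ivl a b)) : T.L2On s u h :=
  ⟨u.memLp.restrict s, (u.memLp_of_hasDensity hu).restrict s⟩

lemma inner_eq_form (u v : T.H1) {h k : Ivl a b → ℂ} (hu : HasDensity T.sigma u h)
    (hv : HasDensity T.sigma v k) :
    inner ℂ u v = T.form univ (fun x => conj (u x)) (fun x => conj (h x)) v k := by
  rw [inner_def, form, Measure.restrict_univ, Measure.restrict_univ]
  congr 1
  refine integral_congr_ae ?_
  filter_upwards [hu.ae_eq u.hasDensity, hv.ae_eq v.hasDensity] with x h1 h2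
  rw [h1, h2]

/-- Test functions with compact support. -/
lemma exists_test {h : Ivl a b → ℂ} {y x : Ivl a b} (hyx : y ≤ x)
    (hm : MemLp h 2 (T.sigma.restrict (Ico y x))) (h0 : ∫ s in Ico y x, h s ∂T.sigma = 0) :
    ∃ u : T.H1, HasDensity T.sigma u ((Ico y x).indicator h) ∧ u y = 0 ∧ u x = 0 ∧
      ∀ s, s ∉ Ico y x → u s = 0 := by
  set k := (Ico y x).indicator h with hk
  have hkm : MemLp k 2 T.sigma := (memLp_indicator_iff_restrict measurableSet_Ico).2 hm
  have hkl : LocallyIntegrable k T.sigma := hkm.locallyIntegrable (by norm_num)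
  have hd := hasDensity_orientedIntegral hkl y
  have hy : orientedIntegral T.sigma k y y = 0 := by simp [orientedIntegral]
  have hx : orientedIntegral T.sigma k y x = 0 := by
    rw [orientedIntegral_of_le hyx, hk, setIntegral_indicator measurableSet_Ico, inter_self, h0]
  have hout : ∀ s, s ∉ Ico y x → orientedIntegral T.sigma k y s = 0 := by
    intro s hs
    by_cases hsy : s < y
    · rw [orientedIntegral_symm, orientedIntegral_of_le hsy.le, neg_eq_zero]
      refine setIntegral_eq_zero_of_forall_eq_zero fun t ht => indicator_of_notMem ?_ _
      exact fun h => absurd ht.2 (not_lt.2 h.1)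
    · have hxs : x ≤ s := by
        by_contra h
        exact hs ⟨not_lt.1 hsy, not_le.1 h⟩
      rw [← orientedIntegral_trans hkl y x s, hx, zero_add, orientedIntegral_of_le hxs]
      refine setIntegral_eq_zero_of_forall_eq_zero fun t ht => indicator_of_notMem ?_ _
      exact fun h => absurd h.2 (not_lt.2 ht.1)
  have hmem : MemLp (orientedIntegral T.sigma k y) 2 T.chi := by
    have h1 : orientedIntegral T.sigma k y = (Ico y x).indicator (orientedIntegral T.sigma k y) := by
      funext s
      by_cases hs : s ∈ Ico y x
      · rw [indicator_of_mem hs]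
      · rw [indicator_of_notMem hs, hout s hs]
    rw [h1]
    exact (memLp_indicator_iff_restrict measurableSet_Ico).2 (hd.locBdd.memLp y x)
  exact ⟨ofDensity _ _ hd hmem hkm, hd, hy, hx, hout⟩

/-- The indicator function of `[c, b)`. -/
def step (c x : Ivl a b) : ℂ := if c ≤ x then 1 else 0

lemma locBdd_step (c : Ivl a b) : LocBdd (step c) :=
  ⟨Measurable.stronglyMeasurable (Measurable.ite measurableSet_Ici measurable_const
    measurable_const), fun _ _ => ⟨1, fun x _ => by unfold step; split_ifs <;> simp⟩⟩

/-- The derivative of `δ_c` with respect to `ς`, up to a constant. -/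
def preQd (c : Ivl a b) (s : Ivl a b) : ℂ :=
  orientedIntegral T.chi (fun t => conj ((delta c : T.H1) t)) c s - step c s

lemma star_delta_locBdd (c : Ivl a b) : LocBdd fun t => conj ((delta c : T.H1) t) :=
  (delta c).hasDensity.locBdd.star

lemma hasDensity_preQd_add (c : Ivl a b) :
    HasDensity T.chi (fun s => preQd (T := T) c s + step c s)
      (fun t => conj ((delta c : T.H1) t)) := by
  have := hasDensity_orientedIntegral (star_delta_locBdd (T := T) c).locallyIntegrable (μ := T.chi) c
  refine cast (congrArg (fun F => HasDensity T.chi F _) (funext fun s => ?_)) this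
  simp [preQd]

lemma locBdd_preQd (c : Ivl a b) : LocBdd (preQd (T := T) c) :=
  (hasDensity_orientedIntegral (star_delta_locBdd (T := T) c).locallyIntegrable c).locBdd.sub
    (locBdd_step c)

lemma sigma_Ico_pos {y x : Ivl a b} (hyx : y < x) : 0 < T.sigma (Ico y x) :=
  lt_of_lt_of_le (isOpen_Ioo.measure_pos T.sigma (nonempty_Ioo.2 hyx))
    (measure_mono Ioo_subset_Ico_self)

lemma integral_test {c y x : Ivl a b} (hyc : y ≤ c) (hcx : c ≤ x) {h : Ivl a b → ℂ}
    (hm : MemLp h 2 (T.sigma.restrict (Ico y x))) (h0 : ∫ s in Ico y x, h s ∂T.sigma = 0) :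
    ∫ s in Ico y x, h s * (conj ((delta c : T.H1).deriv s) - preQd (T := T) c s) ∂T.sigma = 0 := by
  have hyx := hyc.trans hcx
  obtain ⟨u, hu, huy, hux, hout⟩ := exists_test (T := T) hyx hm h0
  have e1 := inner_delta c u
  rw [inner_eq_form _ _ (delta c).hasDensity hu] at e1
  have hind : ∀ f : Ivl a b → ℂ, (fun s => f s * (Ico y x).indicator h s) =
      (Ico y x).indicator (fun s => f s * h s) := by
    intro f
    funext s
    by_cases hs : s ∈ Ico y x <;> simp [hs]
  have hind2 : ∀ f : Ivl a b → ℂ, (fun s => f s * u s) =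
      (Ico y x).indicator (fun s => f s * u s) := by
    intro f
    funext s
    by_cases hs : s ∈ Ico y x
    · simp [hs]
    · simp [hs, hout s hs]
  rw [form, Measure.restrict_univ, Measure.restrict_univ, hind, hind2,
    integral_indicator measurableSet_Ico, integral_indicator measurableSet_Ico] at e1
  have ibp := HasDensity.mul_eq_of_atoms T.sigma_chi_atoms hu (hasDensity_preQd_add (T := T) c) hyx
  rw [huy, hux, zero_mul, zero_mul, zero_add] at ibp
  have hI : IntegrableOn h (Ico y x) T.sigma := hm.integrable (by norm_num)
  have e2 : ∫ s in Ico y x, (Ico y x).indicator h s * (preQd (T := T) c s + step c s) ∂T.sigma =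
      (∫ s in Ico y x, h s * preQd (T := T) c s ∂T.sigma) +
        ∫ s in Ico y x, h s * step c s ∂T.sigma := by
    rw [← integral_add]
    · refine setIntegral_congr_fun measurableSet_Ico fun s hs => ?_
      rw [indicator_of_mem hs, mul_add]
    · exact hm.integrable_mul ((locBdd_preQd c).memLp y x)
    · exact hm.integrable_mul ((locBdd_step c).memLp y x)
  have e3 : u c + ∫ s in Ico y x, h s * step c s ∂T.sigma = 0 := by
    have h1 := hu.eq_of_le hyc
    rw [huy, zero_add, setIntegral_indicator measurableSet_Ico,
      inter_eq_left.2 (Ico_subset_Ico_right hcx)] at h1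
    have h2 : ∫ s in Ico y x, h s * step c s ∂T.sigma = ∫ s in Ico c x, h s ∂T.sigma := by
      have : ∀ s ∈ Ico y x, h s * step c s = (Ico c x).indicator h s := by
        intro s hs
        by_cases hcs : c ≤ s
        · simp [step, hcs, indicator_of_mem (show s ∈ Ico c x from ⟨hcs, hs.2⟩)]
        · rw [indicator_of_notMem (fun h => hcs h.1)]
          simp [step, hcs]
      rw [setIntegral_congr_fun measurableSet_Ico this, setIntegral_indicator measurableSet_Ico,
        inter_eq_right.2 (Ico_subset_Ico_left hyc)]
    rw [h1, h2, ← h0, ← Ico_union_Ico_eq_Ico hyc hcx, setIntegral_union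
      (Ico_disjoint_Ico_same) measurableSet_Ico]
    · exact hI.mono_set (Ico_subset_Ico_right hcx)
    · exact hI.mono_set (Ico_subset_Ico_left hyc)
  have e4 : ∫ s in Ico y x, h s * (conj ((delta c : T.H1).deriv s) - preQd (T := T) c s) ∂T.sigma =
      (∫ s in Ico y x, conj ((delta c : T.H1).deriv s) * h s ∂T.sigma) -
        ∫ s in Ico y x, h s * preQd (T := T) c s ∂T.sigma := by
    rw [← integral_sub]
    · refine setIntegral_congr_fun measurableSet_Ico fun s hs => ?_
      ring
    · exact ((Lp.memLp (delta c : T.H1).deriv).star.restrict _).integrable_mul hm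
    · exact hm.integrable_mul ((locBdd_preQd c).memLp y x)
  have e5 : ∫ s in Ico y x, conj ((delta c : T.H1) s) * u s ∂T.chi =
      ∫ s in Ico y x, u s * conj ((delta c : T.H1) s) ∂T.chi := by simp only [mul_comm]
  rw [e2] at ibp
  rw [e4]
  linear_combination e1 + ibp + e3 - e5

lemma ae_eq_average {c y x : Ivl a b} (hyc : y ≤ c) (hcx : c ≤ x) (hyx : y < x) :
    ∃ m : ℂ, ∀ᵐ s ∂(T.sigma.restrict (Ico y x)),
      conj ((delta c : T.H1).deriv s) - preQd (T := T) c s = m := by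
  set N : Ivl a b → ℂ := fun s => conj ((delta c : T.H1).deriv s) - preQd (T := T) c s with hN
  have hNm : MemLp N 2 (T.sigma.restrict (Ico y x)) :=
    ((Lp.memLp (delta c : T.H1).deriv).star.restrict _).sub ((locBdd_preQd c).memLp y x)
  have hfin := measure_Ico_lt_top T.sigma y x
  have hpos : 0 < T.sigma.real (Ico y x) := ENNReal.toReal_pos (sigma_Ico_pos hyx).ne' hfin.ne
  set m : ℂ := (T.sigma.real (Ico y x) : ℂ)⁻¹ * ∫ s in Ico y x, N s ∂T.sigma with hm
  have hNI : Integrable N (T.sigma.restrict (Ico y x)) := hNm.integrable (by norm_num)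
  have hne : (T.sigma.real (Ico y x) : ℂ) ≠ 0 := by exact_mod_cast hpos.ne'
  have hz : ∫ s in Ico y x, (N s - m) ∂T.sigma = 0 := by
    rw [integral_sub hNI (integrable_const _), integral_const, hm]
    simp only [measureReal_restrict_apply_univ, Complex.real_smul]
    rw [mul_inv_cancel_left₀ hne, sub_self]
  have hmem : MemLp (fun s => N s - m) 2 (T.sigma.restrict (Ico y x)) :=
    hNm.sub (memLp_const m)
  have hz' : ∫ s in Ico y x, conj (N s - m) ∂T.sigma = 0 := by
    rw [integral_conj, hz, map_zero]
  have key := integral_test hyc hcx hmem.star hz'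
  have key2 : ∫ s in Ico y x, conj (N s - m) * (N s - m) ∂T.sigma = 0 := by
    have : ∀ s, conj (N s - m) * (N s - m) = conj (N s - m) * N s - conj (N s - m) * m :=
      fun s => by ring
    simp only [this]
    rw [integral_sub, integral_mul_const, hz', zero_mul, sub_zero]
    · exact key
    · exact hmem.star.integrable_mul hNm
    · exact (hmem.star.integrable (by norm_num)).mul_const m
  refine ⟨m, ?_⟩
  have key3 : ∫ s in Ico y x, ‖N s - m‖ ^ 2 ∂T.sigma = 0 := by
    have : ∀ s, conj (N s - m) * (N s - m) = ((‖N s - m‖ ^ 2 : ℝ) : ℂ) := fun s => by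
      rw [mul_comm, Complex.mul_conj, Complex.normSq_eq_norm_sq]
    simp only [this] at key2
    rw [integral_complex_ofReal] at key2
    exact_mod_cast key2
  have := (integral_eq_zero_iff_of_nonneg (fun s => by positivity)
    (hmem.integrable_norm_pow two_ne_zero)).1 key3
  filter_upwards [this] with s hs
  have : ‖N s - m‖ ^ 2 = 0 := hs
  exact sub_eq_zero.1 (norm_eq_zero.1 (pow_eq_zero_iff two_ne_zero |>.1 this))

lemma exists_const (c : Ivl a b) : ∃ m : ℂ, ∀ᵐ s ∂T.sigma,
    conj ((delta c : T.H1).deriv s) = m + preQd (T := T) c s := by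
  obtain ⟨x0, hx0⟩ := exists_gt c
  obtain ⟨m, hm⟩ := ae_eq_average (T := T) le_rfl hx0.le hx0
  refine ⟨m, ?_⟩
  have hl : LocallyIntegrable (fun s => conj ((delta c : T.H1).deriv s) -
      (m + preQd (T := T) c s)) T.sigma :=
    ((Lp.memLp (delta c : T.H1).deriv).star.locallyIntegrable (by norm_num)).sub
      ((LocBdd.const m).add (locBdd_preQd c)).locallyIntegrable
  have h := ae_eq_zero_of_setIntegral_Ico hl ?_
  · filter_upwards [h] with s hs
    exact sub_eq_zero.1 hs
  intro y x hyx
  have h1 : min y c ≤ c := min_le_right _ _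
  have h2 : c ≤ max x x0 := hx0.le.trans (le_max_right _ _)
  obtain ⟨m', hm'⟩ := ae_eq_average (T := T) h1 h2 (h1.trans_lt (hx0.trans_le (le_max_right _ _)))
  have hmm : m' = m := by
    have hs : Ico c x0 ⊆ Ico (min y c) (max x x0) := Ico_subset_Ico h1 (le_max_right _ _)
    have := ae_restrict_of_ae_restrict_of_subset hs hm'
    have hne : NeBot (ae (T.sigma.restrict (Ico c x0))) := by
      rw [ae_neBot]
      intro h
      exact (sigma_Ico_pos (T := T) hx0).ne' (Measure.restrict_eq_zero.1 h)
    obtain ⟨s, hs1, hs2⟩ := (this.and hm).exists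
    exact hs1.symm.trans hs2
  have hs : Ico y x ⊆ Ico (min y c) (max x x0) := Ico_subset_Ico (min_le_left _ _) (le_max_left _ _)
  rw [integral_eq_zero_of_ae]
  filter_upwards [ae_restrict_of_ae_restrict_of_subset hs hm'] with s hs
  rw [Pi.zero_apply, ← hmm, ← hs]
  ring

/-- The distinguished derivative of `δ_c`. -/
def deltaQd (T : Coefficients a b) (c : Ivl a b) (s : Ivl a b) : ℂ :=
  conj ((exists_const (T := T) c).choose + preQd (T := T) c s)

lemma hasDensity_delta (c : Ivl a b) : HasDensity T.sigma (delta c : T.H1) (deltaQd T c) := by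
  refine (delta c).hasDensity.congr ?_
  filter_upwards [(exists_const (T := T) c).choose_spec] with s hs
  rw [deltaQd, ← hs, Complex.conj_conj]

lemma hasDensity_deltaQd (c : Ivl a b) :
    HasDensity T.chi (fun s => deltaQd T c s + step c s) (delta c : T.H1) := by
  refine HasDensity.of_le (delta c).hasDensity.locBdd.locallyIntegrable fun y x hyx => ?_
  have h1 := congrArg conj ((hasDensity_preQd_add (T := T) c).eq_of_le hyx)
  have h2 : ∀ s, conj (step c s) = step c s := fun s => by unfold step; split_ifs <;> simp
  rw [map_add, map_add, map_add, h2, h2, ← integral_conj] at h1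
  simp only [Complex.conj_conj] at h1
  simp only [deltaQd, map_add]
  linear_combination h1

lemma deltaQd_eq (c : Ivl a b) {y x : Ivl a b} (hyx : y ≤ x) :
    deltaQd T c x = deltaQd T c y + (∫ s in Ico y x, (delta c : T.H1) s ∂T.chi) -
      (step c x - step c y) := by
  have := (hasDensity_deltaQd (T := T) c).eq_of_le hyx
  linear_combination this

/-- Cutting off an element of `H¹(a, b)` near `b`. -/
lemma exists_cutoff (u : T.H1) {y x : Ivl a b} (hyx : y < x) :
    ∃ v : T.H1, (∀ s ≤ y, v s = u s) ∧ ∀ s, x ≤ s → v s = 0 := by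
  have hfin := measure_Ico_lt_top T.sigma y x
  have hpos : 0 < T.sigma.real (Ico y x) := ENNReal.toReal_pos (sigma_Ico_pos hyx).ne' hfin.ne
  have hne : (T.sigma.real (Ico y x) : ℂ) ≠ 0 := by exact_mod_cast hpos.ne'
  set m : ℂ := -((T.sigma.real (Ico y x) : ℂ)⁻¹ * u y) with hm
  set k : Ivl a b → ℂ := (Iio y).indicator u.deriv + (Ico y x).indicator (fun _ => m) with hk
  have hkm : MemLp k 2 T.sigma := by
    refine MemLp.add ?_ ?_
    · exact (memLp_indicator_iff_restrict measurableSet_Iio).2 ((Lp.memLp u.deriv).restrict _)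
    · exact (memLp_indicator_iff_restrict measurableSet_Ico).2 (memLp_const m)
  have hkl : LocallyIntegrable k T.sigma := hkm.locallyIntegrable (by norm_num)
  set f : Ivl a b → ℂ := fun s => u y + orientedIntegral T.sigma k y s with hf
  have hd : HasDensity T.sigma f k := by
    refine HasDensity.of_base hkl y fun s => ?_
    simp [hf, orientedIntegral]
  have h1 : ∀ s ≤ y, f s = u s := by
    intro s hs
    have e1 := u.hasDensity.eq_of_le hs
    simp only [hf]
    rw [orientedIntegral_symm, orientedIntegral_of_le hs, e1]
    have : ∫ t in Ico s y, k t ∂T.sigma = ∫ t in Ico s y, u.deriv t ∂T.sigma := by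
      refine setIntegral_congr_fun measurableSet_Ico fun t ht => ?_
      simp only [hk, Pi.add_apply]
      rw [indicator_of_mem (show t ∈ Iio y from ht.2),
        indicator_of_notMem (fun h : t ∈ Ico y x => absurd ht.2 (not_lt.2 h.1)), add_zero]
    rw [this]
    ring
  have h2 : f x = 0 := by
    simp only [hf]
    rw [orientedIntegral_of_le hyx.le]
    have : ∫ t in Ico y x, k t ∂T.sigma = ∫ t in Ico y x, m ∂T.sigma := by
      refine setIntegral_congr_fun measurableSet_Ico fun t ht => ?_
      simp only [hk, Pi.add_apply]
      rw [indicator_of_mem ht, indicator_of_notMem (fun h : t ∈ Iio y => absurd h (not_lt.2 ht.1)),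
        zero_add]
    rw [this, integral_const, measureReal_restrict_apply_univ, Complex.real_smul, hm, mul_neg,
      mul_inv_cancel_left₀ hne, add_neg_cancel]
  have h3 : ∀ s, x ≤ s → f s = 0 := by
    intro s hs
    rw [hd.eq_of_le hs, h2, zero_add]
    refine setIntegral_eq_zero_of_forall_eq_zero fun t ht => ?_
    simp only [hk, Pi.add_apply]
    rw [indicator_of_notMem (fun h : t ∈ Iio y => absurd h (not_lt.2 (hyx.le.trans ht.1))),
      indicator_of_notMem (fun h : t ∈ Ico y x => absurd h.2 (not_lt.2 ht.1)), add_zero]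
  have hmem : MemLp f 2 T.chi := by
    have e : f = (Iio y).indicator u + (Ico y x).indicator f := by
      funext s
      simp only [Pi.add_apply]
      rcases lt_or_ge s y with hs | hs
      · rw [indicator_of_mem (show s ∈ Iio y from hs),
          indicator_of_notMem (fun h : s ∈ Ico y x => absurd hs (not_lt.2 h.1)), add_zero,
          h1 s hs.le]
      · rw [indicator_of_notMem (fun h : s ∈ Iio y => absurd h (not_lt.2 hs)), zero_add]
        rcases lt_or_ge s x with hs' | hs'
        · rw [indicator_of_mem (show s ∈ Ico y x from ⟨hs, hs'⟩)]
        · rw [indicator_of_notMem (fun h : s ∈ Ico y x => absurd h.2 (not_lt.2 hs')), h3 s hs']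
    rw [e]
    refine MemLp.add ?_ ?_
    · exact (memLp_indicator_iff_restrict measurableSet_Iio).2 (u.memLp.restrict _)
    · exact (memLp_indicator_iff_restrict measurableSet_Ico).2 (hd.locBdd.memLp y x)
  exact ⟨ofDensity f k hd hmem hkm, h1, h3⟩

lemma form_star_delta_eq (c : Ivl a b) (u : T.H1) (s : Set (Ivl a b)) :
    T.form s u u.deriv (fun x => conj ((delta c : T.H1) x)) (fun x => conj (deltaQd T c x)) =
      (∫ x in s, u x * conj ((delta c : T.H1) x) ∂T.chi) +
        ∫ x in s, u.deriv x * conj (deltaQd T c x) ∂T.sigma := rfl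

lemma locBdd_deltaQd (c : Ivl a b) : LocBdd (deltaQd T c) :=
  ((LocBdd.const _).add (locBdd_preQd c)).star

lemma l2On_star_delta (c : Ivl a b) (s : Set (Ivl a b)) :
    T.L2On s (fun x => conj ((delta c : T.H1) x)) (fun x => conj (deltaQd T c x)) :=
  ((delta c).l2On_of_hasDensity (hasDensity_delta c) s).star

lemma mul_star_deltaQd_eq (c : Ivl a b) (u : T.H1) {y x : Ivl a b} (hyx : y ≤ x) :
    u x * (conj (deltaQd T c x) + step c x) = u y * (conj (deltaQd T c y) + step c y) +
      T.form (Ico y x) u u.deriv (fun x => conj ((delta c : T.H1) x))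
        (fun x => conj (deltaQd T c x)) + ∫ s in Ico y x, u.deriv s * step c s ∂T.sigma := by
  have h2 : ∀ s, conj (step c s) = step c s := fun s => by unfold step; split_ifs <;> simp
  have hG : HasDensity T.chi (fun s => conj (deltaQd T c s) + step c s)
      (fun s => conj ((delta c : T.H1) s)) := by
    refine HasDensity.of_le (star_delta_locBdd c).locallyIntegrable fun y x hyx => ?_
    have := congrArg conj ((hasDensity_deltaQd (T := T) c).eq_of_le hyx)
    rw [map_add, map_add, map_add, h2, h2, ← integral_conj] at this
    exact this
  have ibp := HasDensity.mul_eq_of_atoms T.sigma_chi_atoms u.hasDensity hG hyx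
  have e : ∫ s in Ico y x, u.deriv s * (conj (deltaQd T c s) + step c s) ∂T.sigma =
      (∫ s in Ico y x, u.deriv s * conj (deltaQd T c s) ∂T.sigma) +
        ∫ s in Ico y x, u.deriv s * step c s ∂T.sigma := by
    rw [← integral_add]
    · simp only [mul_add]
    · exact ((Lp.memLp u.deriv).restrict _).integrable_mul ((locBdd_deltaQd c).star.memLp y x)
    · exact ((Lp.memLp u.deriv).restrict _).integrable_mul ((locBdd_step c).memLp y x)
  rw [e] at ibp
  rw [form_star_delta_eq]
  linear_combination ibp

lemma tendsto_mul_deltaQd_atBot_aux (c : Ivl a b) (u : T.H1) :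
    Tendsto (fun y => u y * conj (deltaQd T c y)) atBot (𝓝 (u c * (conj (deltaQd T c c) + 1) -
      T.form (Iio c) u u.deriv (fun x => conj ((delta c : T.H1) x))
        (fun x => conj (deltaQd T c x)))) := by
  have h1 := (tendsto_form_Ico_atBot (u.l2On_of_hasDensity u.hasDensity (Iio c))
    (l2On_star_delta c (Iio c))).const_sub (u c * (conj (deltaQd T c c) + 1))
  refine h1.congr' ?_
  filter_upwards [Iio_mem_atBot c] with y hy
  have e := mul_star_deltaQd_eq c u (le_of_lt hy)
  have e0 : ∫ s in Ico y c, u.deriv s * step c s ∂T.sigma = 0 := by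
    refine setIntegral_eq_zero_of_forall_eq_zero fun s hs => ?_
    rw [step, if_neg (not_le.2 hs.2), mul_zero]
  rw [e0] at e
  have s1 : step c c = 1 := if_pos le_rfl
  have s2 : step c y = 0 := if_neg (not_le.2 hy)
  rw [s1, s2] at e
  linear_combination e

lemma tendsto_mul_deltaQd_atTop_aux (c : Ivl a b) (u : T.H1) :
    Tendsto (fun y => u y * conj (deltaQd T c y)) atTop (𝓝 (u c * conj (deltaQd T c c) +
      T.form (Ici c) u u.deriv (fun x => conj ((delta c : T.H1) x))
        (fun x => conj (deltaQd T c x)))) := by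
  have h1 := (tendsto_form_Ico_atTop (u.l2On_of_hasDensity u.hasDensity (Ici c))
    (l2On_star_delta c (Ici c))).const_add (u c * conj (deltaQd T c c))
  refine h1.congr' ?_
  filter_upwards [Ici_mem_atTop c] with y hy
  have e := mul_star_deltaQd_eq c u (y := c) (x := y) hy
  have e0 : ∫ s in Ico c y, u.deriv s * step c s ∂T.sigma = u y - u c := by
    rw [u.hasDensity.eq_of_le (show c ≤ y from hy), add_sub_cancel_left]
    refine setIntegral_congr_fun measurableSet_Ico fun s hs => ?_
    rw [step, if_pos hs.1, mul_one]
  rw [e0] at e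
  have s1 : step c c = 1 := if_pos le_rfl
  have s2 : step c y = 1 := if_pos hy
  rw [s1, s2] at e
  linear_combination -e

lemma exists_tendsto_mul_deltaQd (c : Ivl a b) (u : T.H1) :
    ∃ l, Tendsto (fun y => u y * conj (deltaQd T c y)) atBot (𝓝 l) ∧
      Tendsto (fun y => u y * conj (deltaQd T c y)) atTop (𝓝 l) := by
  refine ⟨_, tendsto_mul_deltaQd_atBot_aux c u, ?_⟩
  convert tendsto_mul_deltaQd_atTop_aux c u using 2
  have e1 := inner_delta c u
  rw [inner_eq_form _ _ (hasDensity_delta c) u.hasDensity, ← Iio_union_Ici (a := c),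
    form_union measurableSet_Ici (by rw [disjoint_left]; exact fun x h1 h2 => absurd (mem_Iio.1 h1) (not_lt.2 (mem_Ici.1 h2)))
    (l2On_star_delta c _) (u.l2On_of_hasDensity u.hasDensity _)] at e1
  have hc : ∀ s : Set (Ivl a b), T.form s (fun x => conj ((delta c : T.H1) x))
      (fun x => conj (deltaQd T c x)) u u.deriv = T.form s u u.deriv
      (fun x => conj ((delta c : T.H1) x)) (fun x => conj (deltaQd T c x)) := by
    intro s
    simp only [form, mul_comm]
  rw [hc, hc] at e1
  linear_combination -e1

lemma tendsto_mul_star_deltaQd (c : Ivl a b) (u : T.H1) :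
    Tendsto (fun y => u y * conj (deltaQd T c y)) atBot (𝓝 0) ∧
      Tendsto (fun y => u y * conj (deltaQd T c y)) atTop (𝓝 0) := by
  obtain ⟨l, hl1, hl2⟩ := exists_tendsto_mul_deltaQd c u
  suffices l = 0 from this ▸ ⟨hl1, hl2⟩
  obtain ⟨x, hx⟩ := exists_gt c
  obtain ⟨v, hv1, hv2⟩ := exists_cutoff u hx
  obtain ⟨m, hm1, hm2⟩ := exists_tendsto_mul_deltaQd c v
  have : Nonempty (Ivl a b) := ⟨c⟩
  have h1 : m = 0 := by
    refine tendsto_nhds_unique hm2 (tendsto_const_nhds.congr' ?_)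
    filter_upwards [Ici_mem_atTop x] with y hy
    rw [hv2 y hy, zero_mul]
  have h2 : l = m := by
    refine tendsto_nhds_unique hl1 (hm1.congr' ?_)
    filter_upwards [Iic_mem_atBot c] with y hy
    rw [hv1 y hy]
  rw [h2, h1]

end H1

end Coefficients

end LeftDefinite

end

noncomputable section

namespace LeftDefinite

variable {a b : EReal}

/-! ### The Green function -/

/-- The function that is `f` to the left of `c` and `g` from `c` on. -/
def glue (c : Ivl a b) (f g : Ivl a b → ℂ) (x : Ivl a b) : ℂ := if x < c then f x else g x

lemma glue_of_lt {c x : Ivl a b} (f g : Ivl a b → ℂ) (h : x < c) : glue c f g x = f x := if_pos h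

lemma glue_of_le {c x : Ivl a b} (f g : Ivl a b → ℂ) (h : c ≤ x) : glue c f g x = g x :=
  if_neg (not_lt.2 h)

lemma LocBdd.glue {f g : Ivl a b → ℂ} (hf : LocBdd f) (hg : LocBdd g) (c : Ivl a b) :
    LocBdd (glue c f g) := by
  refine ⟨StronglyMeasurable.ite measurableSet_Iio hf.1 hg.1, fun y x => ?_⟩
  obtain ⟨M, hM⟩ := hf.2 y x
  obtain ⟨N, hN⟩ := hg.2 y x
  refine ⟨max M N, fun s hs => ?_⟩
  unfold LeftDefinite.glue
  split_ifs
  · exact (hM s hs).trans (le_max_left _ _)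
  · exact (hN s hs).trans (le_max_right _ _)

lemma setIntegral_glue_left {μ : Measure (Ivl a b)} {c x : Ivl a b} (hxc : x ≤ c)
    (f g : Ivl a b → ℂ) (y : Ivl a b) :
    ∫ s in Ico y x, glue c f g s ∂μ = ∫ s in Ico y x, f s ∂μ :=
  setIntegral_congr_fun measurableSet_Ico fun _ hs => glue_of_lt f g (hs.2.trans_le hxc)

lemma setIntegral_glue_right {μ : Measure (Ivl a b)} {c y : Ivl a b} (hcy : c ≤ y)
    (f g : Ivl a b → ℂ) (x : Ivl a b) :
    ∫ s in Ico y x, glue c f g s ∂μ = ∫ s in Ico y x, g s ∂μ :=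
  setIntegral_congr_fun measurableSet_Ico fun _ hs => glue_of_le f g (hcy.trans hs.1)

lemma HasDensity.glue {μ : Measure (Ivl a b)} {f h g k : Ivl a b → ℂ} (hf : HasDensity μ f h)
    (hg : HasDensity μ g k) {c : Ivl a b} (hc : f c = g c) :
    HasDensity μ (glue c f g) (glue c h k) := by
  have hl : LocallyIntegrable (LeftDefinite.glue c h k) μ := by
    refine locallyIntegrable_of_Icc fun y x => ?_
    have e : LeftDefinite.glue c h k = (Iio c).indicator h + (Ici c).indicator k := by
      funext s
      rw [Pi.add_apply]
      rcases lt_or_ge s c with hs | hs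
      · rw [glue_of_lt _ _ hs, indicator_of_mem (show s ∈ Iio c from hs),
          indicator_of_notMem (fun h : s ∈ Ici c => absurd hs (not_lt.2 h)), add_zero]
      · rw [glue_of_le _ _ hs, indicator_of_mem (show s ∈ Ici c from hs),
          indicator_of_notMem (fun h : s ∈ Iio c => absurd h (not_lt.2 hs)), zero_add]
    rw [e]
    exact ((hf.1.integrableOn_isCompact (isCompact_Icc_ivl y x)).indicator measurableSet_Iio).add
      ((hg.1.integrableOn_isCompact (isCompact_Icc_ivl y x)).indicator measurableSet_Ici)
  refine HasDensity.of_base hl c fun x => ?_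
  rw [glue_of_le f g le_rfl]
  rcases lt_or_ge x c with hx | hx
  · rw [glue_of_lt f g hx, orientedIntegral_symm, orientedIntegral_of_le hx.le,
      setIntegral_glue_left le_rfl, ← hc, hf.eq_of_le hx.le]
    ring
  · rw [glue_of_le f g hx, orientedIntegral_of_le hx, setIntegral_glue_right le_rfl,
      hg.eq_of_le hx]

namespace Coefficients

variable {T : Coefficients a b}

lemma L2On.glue {c : Ivl a b} {f h g k : Ivl a b → ℂ} (hf : T.L2On (Iio c) f h)
    (hg : T.L2On (Ici c) g k) : T.L2On univ (glue c f g) (glue c h k) := by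
  rw [← Iio_union_Ici (a := c)]
  refine (hf.congr_fun measurableSet_Iio ?_ ?_).union (hg.congr_fun measurableSet_Ici ?_ ?_)
  · exact fun x hx => (glue_of_lt f g hx).symm
  · exact fun x hx => (glue_of_lt h k hx).symm
  · exact fun x hx => (glue_of_le f g hx).symm
  · exact fun x hx => (glue_of_le h k hx).symm

namespace LocPair

/-- The equation for the quasi-derivative of two solutions glued at `c`. -/
lemma glue_qd_eq (p q : T.LocPair) {c y x : Ivl a b} (hyx : y ≤ x) :
    glue c p.qd q.qd x = glue c p.qd q.qd y + (∫ s in Ico y x, glue c p.fst q.fst s ∂T.chi) -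
      ((∫ s in Ico y x, glue c p.snd q.snd s ∂T.rho.pos) -
        ∫ s in Ico y x, glue c p.snd q.snd s ∂T.rho.neg) +
      (q.qd c - p.qd c) * (H1.step c x - H1.step c y) := by
  rcases lt_or_ge x c with hx | hx
  · have hy := hyx.trans_lt hx
    rw [glue_of_lt _ _ hx, glue_of_lt _ _ hy, setIntegral_glue_left hx.le,
      setIntegral_glue_left hx.le, setIntegral_glue_left hx.le, p.qd_eq hyx, H1.step, H1.step,
      if_neg (not_le.2 hx), if_neg (not_le.2 hy)]
    ring
  rcases lt_or_ge y c with hy | hy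
  · have b1 := (p.locBdd_fst.glue q.locBdd_fst c)
    have b2 := (p.locBdd_snd.glue q.locBdd_snd c)
    rw [glue_of_le _ _ hx, glue_of_lt _ _ hy, ← setIntegral_Ico_add b1.locallyIntegrable hy.le hx,
      ← setIntegral_Ico_add b2.locallyIntegrable hy.le hx,
      ← setIntegral_Ico_add b2.locallyIntegrable hy.le hx, setIntegral_glue_left le_rfl,
      setIntegral_glue_left le_rfl, setIntegral_glue_left le_rfl, setIntegral_glue_right le_rfl,
      setIntegral_glue_right le_rfl, setIntegral_glue_right le_rfl, q.qd_eq hx, H1.step, H1.step,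
      if_pos hx, if_neg (not_le.2 hy), p.qd_eq hy.le]
    ring
  · rw [glue_of_le _ _ hx, glue_of_le _ _ hy, setIntegral_glue_right hy,
      setIntegral_glue_right hy, setIntegral_glue_right hy, q.qd_eq hyx, H1.step, H1.step,
      if_pos hx, if_pos hy]
    ring

/-- The Green function: for a solution `u` near `a` and a solution `ψ` near `b`, both satisfying the
boundary conditions, `δ_c` lies in the range of `S - z`. -/
lemma exists_green {z : ℂ} {u ψ va vb : T.LocPair} (hva : va.IsMax) (hvb : vb.IsMax)
    (hu : u.IsSolution z) (hψ : ψ.IsSolution z) (hul : u.NearLeft) (hψr : ψ.NearRight)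
    (huv : u.WronskianVanishesLeft va) (hψv : ψ.WronskianVanishesRight vb)
    (hW : ∀ x, u.fst x * ψ.qd x - u.qd x * ψ.fst x = 1) (c : Ivl a b) :
    ∃ w : T.H1, (∀ x, w x = -z⁻¹ * (u.fst (min x c) * ψ.fst (max x c))) ∧
      (w - z⁻¹ • H1.delta c, z • w) ∈ sepRelation va vb := by
  set p : T.LocPair := u.smul (-z⁻¹ * ψ.fst c) with hp
  set q : T.LocPair := ψ.smul (-z⁻¹ * u.fst c) with hq
  have hps : p.IsSolution z := hu.smul _
  have hqs : q.IsSolution z := hψ.smul _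
  have hc1 : p.fst c = q.fst c := by
    simp only [hp, hq, smul_fst, Pi.smul_apply, smul_eq_mul]
    ring
  have hjump : q.qd c - p.qd c = -z⁻¹ := by
    simp only [hp, hq, smul_qd, Pi.smul_apply, smul_eq_mul]
    linear_combination -z⁻¹ * hW c
  have hd := p.hasDensity_fst.glue q.hasDensity_fst hc1
  have hL : T.L2On univ (glue c p.fst q.fst) (glue c p.qd q.qd) :=
    L2On.glue ((hul.l2On_Iio c).smul _) ((hψr.l2On_Ici c).smul _)
  set w : T.H1 := H1.ofDensity _ _ hd (by simpa using hL.1) (by simpa using hL.2) with hw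
  have hsnd : ∀ x, z * glue c p.fst q.fst x = glue c p.snd q.snd x := by
    intro x
    unfold glue
    split_ifs
    · rw [hps.snd_apply]
    · rw [hqs.snd_apply]
  let G : T.LocPair := ofEq (w - z⁻¹ • H1.delta c : T.H1)
    (glue c p.qd q.qd - z⁻¹ • H1.deltaQd T c) (glue c p.snd q.snd)
    (by
      have h1 := hd.add ((H1.hasDensity_delta (T := T) c).smul (-z⁻¹))
      convert h1 using 1
      · funext x
        simp only [H1.coe_add, Pi.add_apply, Pi.smul_apply, smul_eq_mul, sub_eq_add_neg, neg_mul]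
        rfl
      · rw [neg_smul, sub_eq_add_neg])
    ⟨_, by
      have := hd.smul z
      rwa [show z • glue c p.fst q.fst = glue c p.snd q.snd from funext hsnd] at this⟩
    (by
      intro y x hyx
      have e1 := glue_qd_eq p q (c := c) hyx
      have e2 := H1.deltaQd_eq (T := T) c hyx
      have e3 : ∫ s in Ico y x, (w - z⁻¹ • H1.delta c : T.H1) s ∂T.chi =
          (∫ s in Ico y x, glue c p.fst q.fst s ∂T.chi) -
            z⁻¹ * ∫ s in Ico y x, (H1.delta c : T.H1) s ∂T.chi := by
        rw [← integral_const_mul, ← integral_sub]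
        · rfl
        · exact integrableOn_Ico hd.locBdd.locallyIntegrable y x
        · exact (integrableOn_Ico (H1.delta c).hasDensity.locBdd.locallyIntegrable y x).const_mul _
      rw [e3]
      simp only [Pi.sub_apply, Pi.smul_apply, smul_eq_mul]
      rw [hjump] at e1
      linear_combination e1 - z⁻¹ * e2)
  refine ⟨w, fun x => ?_, G, rfl, ?_, ?_, ?_⟩
  · change glue c p.fst q.fst x = _
    rcases lt_or_ge x c with hx | hx
    · rw [glue_of_lt _ _ hx, min_eq_left hx.le, max_eq_right hx.le, hp]
      simp only [smul_fst, Pi.smul_apply, smul_eq_mul]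
      ring
    · rw [glue_of_le _ _ hx, min_eq_right hx, max_eq_left hx, hq]
      simp only [smul_fst, Pi.smul_apply, smul_eq_mul]
      ring
  · exact (funext hsnd).symm
  · obtain ⟨h, hh1, hh2, hh3⟩ := hva.2
    have hlim := (H1.tendsto_mul_star_deltaQd c (H1.ofDensity va.snd h hh1 hh2 hh3)).1
    have hlim2 : Tendsto (fun y => conj (va.snd y) * H1.deltaQd T c y) atBot (𝓝 0) := by
      have := (Complex.continuous_conj.tendsto 0).comp hlim
      rw [map_zero] at this
      exact this.congr fun y => by simp
    have hlim3 : Tendsto (fun y => (-z⁻¹ * ψ.fst c) * u.wronskian va y +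
        z⁻¹ * (conj (va.snd y) * H1.deltaQd T c y)) atBot (𝓝 0) := by
      simpa using (huv.const_mul (-z⁻¹ * ψ.fst c)).add (hlim2.const_mul z⁻¹)
    refine hlim3.congr' ?_
    have : Nonempty (Ivl a b) := ⟨c⟩
    filter_upwards [Iio_mem_atBot c] with y hy
    simp only [wronskian, G, ofEq_snd, ofEq_qd, Pi.sub_apply, Pi.smul_apply, smul_eq_mul]
    rw [glue_of_lt _ _ hy, glue_of_lt _ _ hy, hp]
    simp only [smul_snd, smul_qd, Pi.smul_apply, smul_eq_mul]
    ring
  · obtain ⟨h, hh1, hh2, hh3⟩ := hvb.2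
    have hlim := (H1.tendsto_mul_star_deltaQd c (H1.ofDensity vb.snd h hh1 hh2 hh3)).2
    have hlim2 : Tendsto (fun y => conj (vb.snd y) * H1.deltaQd T c y) atTop (𝓝 0) := by
      have := (Complex.continuous_conj.tendsto 0).comp hlim
      rw [map_zero] at this
      exact this.congr fun y => by simp
    have hlim3 : Tendsto (fun y => (-z⁻¹ * u.fst c) * ψ.wronskian vb y +
        z⁻¹ * (conj (vb.snd y) * H1.deltaQd T c y)) atTop (𝓝 0) := by
      simpa using (hψv.const_mul (-z⁻¹ * u.fst c)).add (hlim2.const_mul z⁻¹)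
    refine hlim3.congr' ?_
    have : Nonempty (Ivl a b) := ⟨c⟩
    filter_upwards [Ici_mem_atTop c] with y hy
    simp only [wronskian, G, ofEq_snd, ofEq_qd, Pi.sub_apply, Pi.smul_apply, smul_eq_mul]
    rw [glue_of_le _ _ hy, glue_of_le _ _ hy, hq]
    simp only [smul_snd, smul_qd, Pi.smul_apply, smul_eq_mul]
    ring

end LocPair

/-! ### The relation `S` is symmetric -/

lemma isMax_of_eq {p : T.LocPair} {u v : T.H1} (h1 : p.fst = u) (h2 : p.snd = v) : p.IsMax :=
  ⟨⟨_, h1 ▸ u.hasDensity, h1 ▸ u.memLp, Lp.memLp u.deriv⟩,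
    ⟨_, h2 ▸ v.hasDensity, h2 ▸ v.memLp, Lp.memLp v.deriv⟩⟩

lemma form_univ_eq (c : Ivl a b) {f h g k : Ivl a b → ℂ} (hf : T.L2On univ f h)
    (hg : T.L2On univ g k) :
    T.form univ f h g k = T.form (Iio c) f h g k + T.form (Ici c) f h g k := by
  rw [← Iio_union_Ici (a := c)] at hf hg ⊢
  refine form_union measurableSet_Ici ?_ hf hg
  rw [disjoint_left]
  exact fun x h1 h2 => absurd (mem_Iio.1 h1) (not_lt.2 (mem_Ici.1 h2))

lemma sepRelation_symmetric {va vb : T.LocPair} (hva : IsBoundaryFunctionLeft va)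
    (hvb : IsBoundaryFunctionRight vb) {u v : T.H1 × T.H1} (hu : u ∈ sepRelation va vb)
    (hv : v ∈ sepRelation va vb) : inner ℂ v.1 u.2 = inner ℂ v.2 u.1 := by
  obtain ⟨p, hp1, hp2, hp3, hp4⟩ := hu
  obtain ⟨q, hq1, hq2, hq3, hq4⟩ := hv
  have hpm := isMax_of_eq hp1 hp2
  have hqm := isMax_of_eq hq1 hq2
  have hl := hva.tendsto_wronskian hpm.nearLeft hqm.nearLeft (fun _ => hp3) fun _ => hq3
  have hr := hvb.tendsto_wronskian hpm.nearRight hqm.nearRight (fun _ => hp4) fun _ => hq4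
  have : NeBot (ae T.chi) := ae_neBot.2 T.chi_ne_zero
  obtain ⟨c, -⟩ := (Filter.Eventually.of_forall (f := ae T.chi) (p := fun _ => True)
    fun _ => trivial).exists
  have : Nonempty (Ivl a b) := ⟨c⟩
  have hl' : Tendsto (p.wr q.star) atBot (𝓝 0) := p.wronskian_eq_wr q ▸ hl
  have hr' : Tendsto (p.wr q.star) atTop (𝓝 0) := p.wronskian_eq_wr q ▸ hr
  have e1 := tendsto_nhds_unique hl' (LocPair.tendsto_wr_atBot (hpm.h1On (Iio c))
    (hqm.h1On (Iio c)).star)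
  have e2 := tendsto_nhds_unique hr' (LocPair.tendsto_wr_atTop (hpm.h1On (Ici c))
    (hqm.h1On (Ici c)).star)
  have hps := hpm.h1On univ
  have hqs := (hqm.h1On univ).star
  have f1 := form_univ_eq c hps.2 hqs.1
  have f2 := form_univ_eq c hps.1 hqs.2
  have key : T.form univ p.snd p.dsnd q.star.fst q.star.qd =
      T.form univ p.fst p.qd q.star.snd q.star.dsnd := by
    linear_combination f1 - f2 + e1 - e2
  have dq : HasDensity T.sigma v.1 q.qd := hq1 ▸ q.hasDensity_fst
  have dqs : HasDensity T.sigma v.2 q.dsnd := hq2 ▸ q.hasDensity_dsnd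
  have dp : HasDensity T.sigma u.1 p.qd := hp1 ▸ p.hasDensity_fst
  have dps : HasDensity T.sigma u.2 p.dsnd := hp2 ▸ p.hasDensity_dsnd
  rw [H1.inner_eq_form _ _ dq dps, H1.inner_eq_form _ _ dqs dp]
  have k1 : T.form univ (fun x => conj (v.1 x)) (fun x => conj (q.qd x)) u.2 p.dsnd =
      T.form univ p.snd p.dsnd q.star.fst q.star.qd := by
    unfold form
    congr 1
    · refine integral_congr_ae (ae_of_all _ fun x => ?_)
      simp only [LocPair.star_fst, hq1, hp2, mul_comm]
    · refine integral_congr_ae (ae_of_all _ fun x => ?_)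
      simp only [LocPair.star_qd, mul_comm]
  have k2 : T.form univ (fun x => conj (v.2 x)) (fun x => conj (q.dsnd x)) u.1 p.qd =
      T.form univ p.fst p.qd q.star.snd q.star.dsnd := by
    unfold form
    congr 1
    · refine integral_congr_ae (ae_of_all _ fun x => ?_)
      simp only [LocPair.star_snd, hq2, hp1, mul_comm]
    · rw [Measure.restrict_univ]
      refine integral_congr_ae ?_
      filter_upwards [q.dsnd_star_ae] with x hx
      rw [hx, mul_comm]
  rw [k1, k2, key]

end Coefficients

end LeftDefinite

end

noncomputable section

namespace LeftDefinite

variable {a b : EReal}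

/-! ### The relation `S` is closed -/

lemma tendsto_setIntegral_Ico_of_bounded {μ : Measure (Ivl a b)} [IsLocallyFiniteMeasure μ]
    {F : ℕ → Ivl a b → ℂ} {f : Ivl a b → ℂ} {y x : Ivl a b} {M : ℝ}
    (hm : ∀ n, StronglyMeasurable (F n)) (hM : ∀ n, ∀ s ∈ Ico y x, ‖F n s‖ ≤ M)
    (hl : ∀ s ∈ Ico y x, Tendsto (fun n => F n s) atTop (𝓝 (f s))) :
    Tendsto (fun n => ∫ s in Ico y x, F n s ∂μ) atTop (𝓝 (∫ s in Ico y x, f s ∂μ)) :=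
  tendsto_integral_of_dominated_convergence (fun _ => M)
    (fun n => (hm n).aestronglyMeasurable) (integrable_const M)
    (fun n => (ae_restrict_iff' measurableSet_Ico).2 (ae_of_all _ (hM n)))
    ((ae_restrict_iff' measurableSet_Ico).2 (ae_of_all _ hl))

lemma norm_setIntegral_Ico_le_mul {μ : Measure (Ivl a b)} [IsLocallyFiniteMeasure μ]
    {f : Ivl a b → ℂ} {y x d : Ivl a b} {M : ℝ} (hM0 : 0 ≤ M) (hM : ∀ s ∈ Ico y d, ‖f s‖ ≤ M)
    (hx : x ≤ d) : ‖∫ s in Ico y x, f s ∂μ‖ ≤ M * μ.real (Ico y d) :=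
  (norm_setIntegral_le_of_norm_le_const (measure_Ico_lt_top μ y x)
    fun s hs => hM s (Ico_subset_Ico_right hx hs)).trans
    (mul_le_mul_of_nonneg_left (measureReal_mono (Ico_subset_Ico_right hx)
      (measure_Ico_lt_top μ y d).ne) hM0)

namespace Coefficients

variable {T : Coefficients a b}

namespace H1

lemma exists_bound_Icc (c d : Ivl a b) : ∃ K, 0 ≤ K ∧ ∀ x ∈ Icc c d, ∀ u : T.H1,
    ‖u x‖ ≤ K * ‖u‖ := by
  obtain ⟨C, hC⟩ := banach_steinhaus (g := fun x : Icc c d => evalL (T := T) x.1) fun u => by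
    obtain ⟨M, hM⟩ := u.hasDensity.exists_bound c d
    exact ⟨M, fun x => hM x.1 x.2⟩
  refine ⟨max C 0, le_max_right _ _, fun x hx u => ?_⟩
  exact ((evalL x).le_opNorm u).trans
    (mul_le_mul_of_nonneg_right ((hC ⟨x, hx⟩).trans (le_max_left _ _)) (norm_nonneg u))

lemma nsq_eq_norm_sq (u : T.H1) {h : Ivl a b → ℂ} (hu : HasDensity T.sigma u h) :
    T.nsq univ u h = ‖u‖ ^ 2 := by
  have e1 := inner_eq_form u u hu hu
  rw [inner_self_eq_norm_sq_to_K] at e1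
  have key : ∀ {μ : Measure (Ivl a b)} (f : Ivl a b → ℂ), ∫ x in univ, conj (f x) * f x ∂μ =
      ((∫ x in univ, ‖f x‖ ^ 2 ∂μ : ℝ) : ℂ) := by
    intro μ f
    rw [← integral_complex_ofReal]
    refine integral_congr_ae (ae_of_all _ fun x => ?_)
    simp only
    rw [mul_comm, Complex.mul_conj, Complex.normSq_eq_norm_sq]
  rw [form, key, key] at e1
  unfold nsq
  apply Complex.ofReal_injective
  push_cast
  exact e1.symm

lemma tendsto_form {u : ℕ → T.H1} {w : T.H1} (hu : Tendsto u atTop (𝓝 w))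
    {h : ℕ → Ivl a b → ℂ} {k : Ivl a b → ℂ} (hh : ∀ n, HasDensity T.sigma (u n) (h n))
    (hk : HasDensity T.sigma w k) {s : Set (Ivl a b)} {g l : Ivl a b → ℂ} (hg : T.L2On s g l) :
    Tendsto (fun n => T.form s (u n) (h n) g l) atTop (𝓝 (T.form s w k g l)) := by
  rw [tendsto_iff_norm_sub_tendsto_zero]
  have h0 := ((tendsto_iff_norm_sub_tendsto_zero.1 hu).mul_const (√(T.nsq s g l)))
  rw [zero_mul] at h0
  refine squeeze_zero (fun n => norm_nonneg _) (fun n => ?_) h0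
  have hd : HasDensity T.sigma (u n - w : T.H1) (h n + (-1 : ℂ) • k) := by
    have := (hh n).add (hk.smul (-1))
    convert this using 1
    funext x
    simp only [Pi.add_apply, Pi.smul_apply, smul_eq_mul, neg_mul, one_mul, ← sub_eq_add_neg]
    rfl
  have hL := (u n - w).l2On_of_hasDensity hd univ
  have hLs := hL.mono (subset_univ s)
  have e : T.form s (u n) (h n) g l - T.form s w k g l =
      T.form s (u n - w : T.H1) (h n + (-1 : ℂ) • k) g l := by
    have L1 := (u n).l2On_of_hasDensity (hh n) s
    have L2 := w.l2On_of_hasDensity hk s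
    unfold form
    rw [add_sub_add_comm, ← integral_sub (L1.integrable_chi hg) (L2.integrable_chi hg),
      ← integral_sub (L1.integrable_sigma hg) (L2.integrable_sigma hg)]
    congr 1
    · refine integral_congr_ae (ae_of_all _ fun x => ?_)
      exact (sub_mul _ _ _).symm
    · refine integral_congr_ae (ae_of_all _ fun x => ?_)
      simp only [Pi.add_apply, Pi.smul_apply, smul_eq_mul]
      ring
  rw [e]
  refine (norm_form_le hLs hg).trans (mul_le_mul_of_nonneg_right ?_ (Real.sqrt_nonneg _))
  refine (Real.sqrt_le_sqrt (hL.nsq_mono (subset_univ s))).trans ?_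
  rw [nsq_eq_norm_sq _ hd, Real.sqrt_sq (norm_nonneg _)]

end H1

namespace LocPair

/-- The quasi-derivatives of a convergent sequence in `T_max` converge. -/
lemma exists_limit {u : ℕ → T.H1 × T.H1} {w : T.H1 × T.H1} (hu : Tendsto u atTop (𝓝 w))
    {p : ℕ → T.LocPair} (hp1 : ∀ n, (p n).fst = (u n).1) (hp2 : ∀ n, (p n).snd = (u n).2) :
    ∃ P : T.LocPair, P.fst = w.1 ∧ P.snd = w.2 ∧
      ∀ x, Tendsto (fun n => (p n).qd x) atTop (𝓝 (P.qd x)) := by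
  have hu1 : Tendsto (fun n => (u n).1) atTop (𝓝 w.1) := (continuous_fst.tendsto w).comp hu
  have hu2 : Tendsto (fun n => (u n).2) atTop (𝓝 w.2) := (continuous_snd.tendsto w).comp hu
  have lim1 : ∀ x, Tendsto (fun n => (p n).fst x) atTop (𝓝 (w.1 x)) := by
    intro x
    simp only [hp1]
    exact ((H1.evalL x).continuous.tendsto w.1).comp hu1
  have lim2 : ∀ x, Tendsto (fun n => (p n).snd x) atTop (𝓝 (w.2 x)) := by
    intro x
    simp only [hp2]
    exact ((H1.evalL x).continuous.tendsto w.2).comp hu2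
  obtain ⟨M1, hM1⟩ := hu1.norm.bddAbove_range
  obtain ⟨M2, hM2⟩ := hu2.norm.bddAbove_range
  have hbound : ∀ c d : Ivl a b, ∃ M, 0 ≤ M ∧ ∀ n, ∀ x ∈ Icc c d,
      ‖(p n).fst x‖ ≤ M ∧ ‖(p n).snd x‖ ≤ M := by
    intro c d
    obtain ⟨K, hK0, hK⟩ := H1.exists_bound_Icc (T := T) c d
    have hM1' : ∀ n, ‖(u n).1‖ ≤ M1 := fun n => hM1 ⟨n, rfl⟩
    have hM2' : ∀ n, ‖(u n).2‖ ≤ M2 := fun n => hM2 ⟨n, rfl⟩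
    have h1 : 0 ≤ M1 := (norm_nonneg _).trans (hM1' 0)
    refine ⟨K * max M1 M2, mul_nonneg hK0 (h1.trans (le_max_left _ _)), fun n x hx => ⟨?_, ?_⟩⟩
    · rw [hp1]
      exact (hK x hx _).trans (mul_le_mul_of_nonneg_left ((hM1' n).trans (le_max_left _ _)) hK0)
    · rw [hp2]
      exact (hK x hx _).trans (mul_le_mul_of_nonneg_left ((hM2' n).trans (le_max_right _ _)) hK0)
  set D : Ivl a b → Ivl a b → ℂ := fun y x => (∫ s in Ico y x, w.1 s ∂T.chi) -
    ((∫ s in Ico y x, w.2 s ∂T.rho.pos) - ∫ s in Ico y x, w.2 s ∂T.rho.neg) with hD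
  have limD : ∀ y x, y ≤ x → Tendsto (fun n => (p n).qd x - (p n).qd y) atTop (𝓝 (D y x)) := by
    intro y x hyx
    obtain ⟨M, hM0, hM⟩ := hbound y x
    have e : ∀ n, (p n).qd x - (p n).qd y = (∫ s in Ico y x, (p n).fst s ∂T.chi) -
        ((∫ s in Ico y x, (p n).snd s ∂T.rho.pos) - ∫ s in Ico y x, (p n).snd s ∂T.rho.neg) :=
      fun n => by rw [(p n).qd_eq hyx]; ring
    simp only [e]
    refine Tendsto.sub ?_ (Tendsto.sub ?_ ?_)
    · exact tendsto_setIntegral_Ico_of_bounded (fun n => (p n).locBdd_fst.meas)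
        (fun n s hs => (hM n s (Ico_subset_Icc_self hs)).1) fun s _ => lim1 s
    · exact tendsto_setIntegral_Ico_of_bounded (fun n => (p n).locBdd_snd.meas)
        (fun n s hs => (hM n s (Ico_subset_Icc_self hs)).2) fun s _ => lim2 s
    · exact tendsto_setIntegral_Ico_of_bounded (fun n => (p n).locBdd_snd.meas)
        (fun n s hs => (hM n s (Ico_subset_Icc_self hs)).2) fun s _ => lim2 s
  have boundD : ∀ y d, ∃ B, 0 ≤ B ∧ ∀ n, ∀ x ∈ Icc y d, ‖(p n).qd x - (p n).qd y‖ ≤ B := by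
    intro y d
    obtain ⟨M, hM0, hM⟩ := hbound y d
    refine ⟨M * T.chi.real (Ico y d) + (M * T.rho.pos.real (Ico y d) +
      M * T.rho.neg.real (Ico y d)), by positivity, fun n x hx => ?_⟩
    have e : (p n).qd x - (p n).qd y = (∫ s in Ico y x, (p n).fst s ∂T.chi) -
        ((∫ s in Ico y x, (p n).snd s ∂T.rho.pos) - ∫ s in Ico y x, (p n).snd s ∂T.rho.neg) := by
      rw [(p n).qd_eq hx.1]; ring
    rw [e]
    refine (norm_sub_le _ _).trans (add_le_add ?_ ((norm_sub_le _ _).trans (add_le_add ?_ ?_)))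
    · exact norm_setIntegral_Ico_le_mul hM0 (fun s hs => (hM n s (Ico_subset_Icc_self hs)).1) hx.2
    · exact norm_setIntegral_Ico_le_mul hM0 (fun s hs => (hM n s (Ico_subset_Icc_self hs)).2) hx.2
    · exact norm_setIntegral_Ico_le_mul hM0 (fun s hs => (hM n s (Ico_subset_Icc_self hs)).2) hx.2
  have limq : ∀ y, ∃ l, Tendsto (fun n => (p n).qd y) atTop (𝓝 l) := by
    intro y
    obtain ⟨d, hd⟩ := exists_gt y
    obtain ⟨B, -, hB⟩ := boundD y d
    have h1 : Tendsto (fun n => ∫ s in Ico y d, ((p n).qd s - (p n).qd y) ∂T.sigma) atTop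
        (𝓝 (∫ s in Ico y d, D y s ∂T.sigma)) :=
      tendsto_setIntegral_Ico_of_bounded
        (fun n => ((p n).locBdd_qd.sub (LocBdd.const ((p n).qd y))).meas)
        (fun n s hs => hB n s (Ico_subset_Icc_self hs)) fun s hs => limD y s hs.1
    have hne : (T.sigma.real (Ico y d) : ℂ) ≠ 0 := by
      exact_mod_cast (ENNReal.toReal_pos (H1.sigma_Ico_pos hd).ne'
        (measure_Ico_lt_top T.sigma y d).ne).ne'
    refine ⟨_, ((((lim1 d).sub (lim1 y)).sub h1).const_mul
      (T.sigma.real (Ico y d) : ℂ)⁻¹).congr fun n => ?_⟩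
    rw [(p n).hasDensity_fst.eq_of_le hd.le, integral_sub (integrableOn_Ico
      (p n).locBdd_qd.locallyIntegrable y d) (integrable_const _), integral_const,
      measureReal_restrict_apply_univ, Complex.real_smul, add_sub_cancel_left, sub_sub_cancel,
      inv_mul_cancel_left₀ hne]
  choose q hq using limq
  have hqD : ∀ y x, y ≤ x → q x - q y = D y x := fun y x hyx =>
    tendsto_nhds_unique ((hq x).sub (hq y)) (limD y x hyx)
  have boundq : ∀ y d, ∃ B, ∀ n, ∀ x ∈ Icc y d, ‖(p n).qd x‖ ≤ B := by
    intro y d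
    obtain ⟨B, -, hB⟩ := boundD y d
    obtain ⟨N, hN⟩ := (hq y).norm.bddAbove_range
    refine ⟨B + N, fun n x hx => ?_⟩
    have h1 := hB n x hx
    have h2 : ‖(p n).qd y‖ ≤ N := hN ⟨n, rfl⟩
    calc ‖(p n).qd x‖ = ‖((p n).qd x - (p n).qd y) + (p n).qd y‖ := by rw [sub_add_cancel]
      _ ≤ B + N := (norm_add_le _ _).trans (add_le_add h1 h2)
  have hqb : LocBdd q := by
    refine ⟨stronglyMeasurable_of_tendsto atTop (fun n => (p n).locBdd_qd.meas)
      (tendsto_pi_nhds.2 hq), fun y d => ?_⟩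
    obtain ⟨B, hB⟩ := boundq y d
    exact ⟨B, fun x hx => le_of_tendsto (hq x).norm (Eventually.of_forall fun n => hB n x hx)⟩
  have hd : HasDensity T.sigma w.1 q := by
    refine HasDensity.of_le hqb.locallyIntegrable fun y x hyx => ?_
    obtain ⟨B, hB⟩ := boundq y x
    have h1 := tendsto_setIntegral_Ico_of_bounded (μ := T.sigma) (fun n => (p n).locBdd_qd.meas)
      (fun n s hs => hB n s (Ico_subset_Icc_self hs)) fun s (_ : s ∈ Ico y x) => hq s
    refine tendsto_nhds_unique (lim1 x) (((lim1 y).add h1).congr fun n => ?_)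
    rw [(p n).hasDensity_fst.eq_of_le hyx]
  refine ⟨ofEq w.1 q w.2 hd ⟨_, w.2.hasDensity⟩ fun y x hyx => ?_, rfl, rfl, hq⟩
  have := hqD y x hyx
  rw [hD] at this
  linear_combination this

end LocPair

theorem isClosed_sepRelation {va vb : T.LocPair} (hva : va.IsMax) (hvb : vb.IsMax) :
    IsClosed (sepRelation va vb : Set (T.H1 × T.H1)) := by
  refine IsSeqClosed.isClosed fun u w hu hw => ?_
  choose p hp1 hp2 hp3 hp4 using hu
  obtain ⟨P, hP1, hP2, hPq⟩ := LocPair.exists_limit hw hp1 hp2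
  have hu1 : Tendsto (fun n => (u n).1) atTop (𝓝 w.1) := (continuous_fst.tendsto w).comp hw
  have hu2 : Tendsto (fun n => (u n).2) atTop (𝓝 w.2) := (continuous_snd.tendsto w).comp hw
  have : NeBot (ae T.chi) := ae_neBot.2 T.chi_ne_zero
  obtain ⟨c, -⟩ := (Filter.Eventually.of_forall (f := ae T.chi) (p := fun _ => True)
    fun _ => trivial).exists
  have : Nonempty (Ivl a b) := ⟨c⟩
  have hpm : ∀ n, (p n).IsMax := fun n => isMax_of_eq (hp1 n) (hp2 n)
  have hPm : P.IsMax := isMax_of_eq hP1 hP2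
  have lim1 : ∀ v : T.LocPair, Tendsto (fun n => (p n).wr v c) atTop (𝓝 (P.wr v c)) := by
    intro v
    unfold LocPair.wr
    have : Tendsto (fun n => (p n).snd c) atTop (𝓝 (P.snd c)) := by
      simp only [hp2, hP2]
      exact ((H1.evalL c).continuous.tendsto w.2).comp hu2
    exact (this.mul_const _).sub ((hPq c).mul_const _)
  have d1 : ∀ n, HasDensity T.sigma (u n).1 (p n).qd := fun n => hp1 n ▸ (p n).hasDensity_fst
  have d2 : ∀ n, HasDensity T.sigma (u n).2 (p n).dsnd := fun n => hp2 n ▸ (p n).hasDensity_dsnd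
  have e1 : HasDensity T.sigma w.1 P.qd := hP1 ▸ P.hasDensity_fst
  have e2 : HasDensity T.sigma w.2 P.dsnd := hP2 ▸ P.hasDensity_dsnd
  have lim2 : ∀ (v : T.LocPair) (s : Set (Ivl a b)), v.IsMax → Tendsto (fun n =>
      T.form s (p n).snd (p n).dsnd v.star.fst v.star.qd -
        T.form s (p n).fst (p n).qd v.star.snd v.star.dsnd) atTop
      (𝓝 (T.form s P.snd P.dsnd v.star.fst v.star.qd -
        T.form s P.fst P.qd v.star.snd v.star.dsnd)) := by
    intro v s hv
    have hvs := (hv.h1On s).star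
    simp only [hp1, hp2, hP1, hP2]
    exact (H1.tendsto_form hu2 d2 e2 hvs.1).sub (H1.tendsto_form hu1 d1 e1 hvs.2)
  refine ⟨P, hP1, hP2, ?_, ?_⟩
  · have h1 := LocPair.tendsto_wr_atBot (hPm.h1On (Iio c)) (hva.h1On (Iio c)).star
    have h2 : ∀ n, (p n).wr va.star c - (T.form (Iio c) (p n).snd (p n).dsnd va.star.fst va.star.qd -
        T.form (Iio c) (p n).fst (p n).qd va.star.snd va.star.dsnd) = 0 := fun n =>
      tendsto_nhds_unique (LocPair.tendsto_wr_atBot ((hpm n).h1On (Iio c))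
        (hva.h1On (Iio c)).star) ((p n).wronskian_eq_wr va ▸ hp3 n)
    have h3 := tendsto_nhds_unique ((lim1 va.star).sub (lim2 va (Iio c) hva))
      (tendsto_const_nhds.congr fun n => (h2 n).symm)
    rw [h3, ← P.wronskian_eq_wr va] at h1
    exact h1
  · have h1 := LocPair.tendsto_wr_atTop (hPm.h1On (Ici c)) (hvb.h1On (Ici c)).star
    have h2 : ∀ n, (p n).wr vb.star c + (T.form (Ici c) (p n).snd (p n).dsnd vb.star.fst vb.star.qd -
        T.form (Ici c) (p n).fst (p n).qd vb.star.snd vb.star.dsnd) = 0 := fun n =>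
      tendsto_nhds_unique (LocPair.tendsto_wr_atTop ((hpm n).h1On (Ici c))
        (hvb.h1On (Ici c)).star) ((p n).wronskian_eq_wr vb ▸ hp4 n)
    have h3 := tendsto_nhds_unique ((lim1 vb.star).add (lim2 vb (Ici c) hvb))
      (tendsto_const_nhds.congr fun n => (h2 n).symm)
    rw [h3, ← P.wronskian_eq_wr vb] at h1
    exact h1

end Coefficients

end LeftDefinite

end

noncomputable section

namespace LeftDefinite

/-! ### Self-adjoint linear relations -/

section Relations

variable {H : Type*} [NormedAddCommGroup H] [InnerProductSpace ℂ H]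

/-- A symmetric linear relation. -/
def IsSymmetricRel (S : Submodule ℂ (H × H)) : Prop :=
  ∀ u ∈ S, ∀ v ∈ S, inner ℂ v.1 u.2 = inner ℂ v.2 u.1

variable {S : Submodule ℂ (H × H)}

lemma IsResolvent.mem {z : ℂ} {R : H →L[ℂ] H} (hR : IsResolvent S z R) (h : H) :
    (R h, h + z • R h) ∈ S := (hR _ h).1 rfl

lemma IsResolvent.apply_sub {z : ℂ} {R : H →L[ℂ] H} (hR : IsResolvent S z R) {f g : H}
    (hfg : (f, g) ∈ S) : R (g - z • f) = f := (hR f _).2 (by rwa [sub_add_cancel])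

lemma IsResolvent.mem_iff {z : ℂ} {R : H →L[ℂ] H} (hR : IsResolvent S z R) {f g : H} :
    (f, g) ∈ S ↔ R (g - z • f) = f := by
  rw [hR, sub_add_cancel]

lemma IsResolvent.sub_eq {z w : ℂ} {R R' : H →L[ℂ] H} (hR : IsResolvent S z R)
    (hR' : IsResolvent S w R') (h : H) : R h - R' h = (z - w) • R (R' h) := by
  have h1 := hR'.mem h
  have h2 := hR.apply_sub h1
  rw [add_sub_assoc, ← sub_smul, map_add, map_smul] at h2
  calc R h - R' h = R h - (R h + (w - z) • R (R' h)) := by rw [h2]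
    _ = (z - w) • R (R' h) := by module

lemma IsSymmetricRel.norm_le (hS : IsSymmetricRel S) {z : ℂ} {f h : H}
    (hfh : (f, h + z • f) ∈ S) : |z.im| * ‖f‖ ≤ ‖h‖ := by
  have h1 := hS _ hfh _ hfh
  simp only [inner_add_left, inner_add_right, inner_smul_left, inner_smul_right] at h1
  have h2 := congrArg Complex.im h1
  have h3 : inner ℂ f f = ((‖f‖ ^ 2 : ℝ) : ℂ) := by
    rw [inner_self_eq_norm_sq_to_K]
    norm_cast
  have h4 : (inner ℂ h f).im = -(inner ℂ f h).im := by
    rw [← inner_conj_symm h f, Complex.conj_im]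
  rw [h3] at h2
  simp only [Complex.add_im, Complex.mul_im, Complex.ofReal_re, Complex.ofReal_im, mul_zero,
    zero_add, Complex.conj_im, h4] at h2
  have h5 : |z.im| * ‖f‖ ^ 2 ≤ ‖f‖ * ‖h‖ := by
    have h6 : z.im * ‖f‖ ^ 2 = -(inner ℂ f h).im := by linarith
    calc |z.im| * ‖f‖ ^ 2 = |z.im * ‖f‖ ^ 2| := by rw [abs_mul, abs_of_nonneg (sq_nonneg ‖f‖)]
      _ = |(inner ℂ f h).im| := by rw [h6, abs_neg]
      _ ≤ ‖inner ℂ f h‖ := Complex.abs_im_le_norm _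
      _ ≤ ‖f‖ * ‖h‖ := norm_inner_le_norm f h
  rcases (norm_nonneg f).eq_or_lt with h0 | h0
  · rw [← h0, mul_zero]
    exact norm_nonneg h
  · nlinarith

/-- The hypotheses that make a symmetric relation self-adjoint. -/
structure IsEssSelfAdjointRel (S : Submodule ℂ (H × H)) : Prop where
  symm : IsSymmetricRel S
  isClosed : IsClosed (S : Set (H × H))
  dense : ∀ z : ℂ, z.im ≠ 0 → Dense {h : H | ∃ f, (f, h + z • f) ∈ S}

namespace IsEssSelfAdjointRel

variable [CompleteSpace H]

lemma exists_solution (hS : IsEssSelfAdjointRel S) {z : ℂ} (hz : z.im ≠ 0) (h : H) :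
    ∃ f, (f, h + z • f) ∈ S := by
  obtain ⟨u, hu, hlim⟩ := mem_closure_iff_seq_limit.1 (hS.dense z hz h)
  choose f hf using hu
  have hz' : 0 < |z.im| := abs_pos.2 hz
  have hc : CauchySeq f := by
    rw [Metric.cauchySeq_iff']
    intro ε hε
    obtain ⟨N, hN⟩ := Metric.cauchySeq_iff'.1 hlim.cauchySeq (|z.im| * ε) (by positivity)
    refine ⟨N, fun n hn => ?_⟩
    have h1 := hN n hn
    have h2 : (f n - f N, (u n - u N) + z • (f n - f N)) ∈ S := by
      have := S.sub_mem (hf n) (hf N)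
      rw [Prod.mk_sub_mk] at this
      convert this using 2
      module
    have h3 := hS.symm.norm_le h2
    rw [dist_eq_norm] at h1 ⊢
    by_contra h4
    have := mul_le_mul_of_nonneg_left (not_lt.1 h4) hz'.le
    linarith
  obtain ⟨g, hg⟩ := cauchySeq_tendsto_of_complete hc
  exact ⟨g, hS.isClosed.mem_of_tendsto (hg.prodMk_nhds (hlim.add (hg.const_smul z)))
    (Eventually.of_forall hf)⟩

lemma exists_resolvent (hS : IsEssSelfAdjointRel S) {z : ℂ} (hz : z.im ≠ 0) :
    ∃ R : H →L[ℂ] H, IsResolvent S z R := by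
  choose R hR using hS.exists_solution hz
  have hz' : 0 < |z.im| := abs_pos.2 hz
  have huniq : ∀ f h, (f, h + z • f) ∈ S → R h = f := by
    intro f h hf
    have h1 : (f - R h, (0 : H) + z • (f - R h)) ∈ S := by
      have := S.sub_mem hf (hR h)
      rw [Prod.mk_sub_mk] at this
      convert this using 2
      module
    have h2 := hS.symm.norm_le h1
    rw [norm_zero] at h2
    have h3 : ‖f - R h‖ ≤ 0 := by
      by_contra h4
      have := mul_pos hz' (not_le.1 h4)
      linarith
    exact (sub_eq_zero.1 (norm_le_zero_iff.1 h3)).symm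
  let L : H →ₗ[ℂ] H :=
    { toFun := R
      map_add' := fun h k => huniq _ _ (by
        have := S.add_mem (hR h) (hR k)
        rw [Prod.mk_add_mk] at this
        convert this using 2
        module)
      map_smul' := fun r h => huniq (r • R h) (r • h) (by
        have := S.smul_mem r (hR h)
        rw [Prod.smul_mk] at this
        convert this using 2
        module) }
  refine ⟨L.mkContinuous (|z.im|⁻¹) fun h => ?_, fun f h => ⟨?_, huniq f h⟩⟩
  · rw [inv_mul_eq_div, le_div_iff₀ hz', mul_comm]
    exact hS.symm.norm_le (hR h)
  · rintro rfl
    exact hR h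

/-- The resolvent at a non-real point. -/
def res (hS : IsEssSelfAdjointRel S) {z : ℂ} (hz : z.im ≠ 0) : H →L[ℂ] H :=
  (hS.exists_resolvent hz).choose

lemma isResolvent (hS : IsEssSelfAdjointRel S) {z : ℂ} (hz : z.im ≠ 0) :
    IsResolvent S z (hS.res hz) := (hS.exists_resolvent hz).choose_spec

lemma norm_res_apply_le (hS : IsEssSelfAdjointRel S) {z : ℂ} (hz : z.im ≠ 0) (h : H) :
    |z.im| * ‖hS.res hz h‖ ≤ ‖h‖ := hS.symm.norm_le ((hS.isResolvent hz).mem h)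

theorem adjoint_eq (hS : IsEssSelfAdjointRel S) : S.adjoint = S := by
  have hle : ∀ x ∈ S, x ∈ S.adjoint := by
    intro x hx
    rw [Submodule.mem_adjoint_iff]
    intro f g hfg
    rw [sub_eq_zero]
    exact (hS.symm x hx _ hfg).symm
  refine le_antisymm (fun x hx => ?_) hle
  have hi : Complex.I.im ≠ 0 := by simp
  have hi' : (conj Complex.I).im ≠ 0 := by simp
  set f := hS.res hi (x.2 - Complex.I • x.1) with hf
  have h1 := (hS.isResolvent hi).mem (x.2 - Complex.I • x.1)
  rw [← hf] at h1
  have h2 := S.adjoint.sub_mem hx (hle _ h1)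
  have h3 : x.1 - f = 0 := by
    set d := x.1 - f with hd
    have h4 := (hS.isResolvent hi').mem d
    have h5 := (Submodule.mem_adjoint_iff _ _).1 h2 _ _ h4
    simp only [Prod.fst_sub, Prod.snd_sub] at h5
    rw [show x.2 - (x.2 - Complex.I • x.1 + Complex.I • f) = Complex.I • d by rw [hd]; module, ← hd,
      inner_add_left, inner_smul_left, inner_smul_right, Complex.conj_conj, add_sub_cancel_right]
      at h5
    exact inner_self_eq_zero.1 h5
  rw [sub_eq_zero] at h3
  rw [← h3] at h1
  rw [sub_add_cancel] at h1
  exact h1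

lemma inner_res (hS : IsEssSelfAdjointRel S) {z : ℂ} (hz : z.im ≠ 0) (hz' : (conj z).im ≠ 0)
    (f g : H) : inner ℂ (hS.res hz' g) f = inner ℂ g (hS.res hz f) := by
  have h := hS.symm _ ((hS.isResolvent hz).mem f) _ ((hS.isResolvent hz').mem g)
  simp only [inner_add_left, inner_add_right, inner_smul_left, inner_smul_right,
    Complex.conj_conj] at h
  exact add_right_cancel h

lemma adjoint_res (hS : IsEssSelfAdjointRel S) {z : ℂ} (hz : z.im ≠ 0) (hz' : (conj z).im ≠ 0) :
    ContinuousLinearMap.adjoint (hS.res hz) = hS.res hz' := by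
  refine (((hS.res hz').eq_adjoint_iff (hS.res hz)).2 fun g f => ?_).symm
  exact hS.inner_res hz hz' f g

/-- If `0` is not an eigenvalue, then `ε R_{iε} f → 0` as `ε → 0`. -/
lemma tendsto_smul_res (hS : IsEssSelfAdjointRel S) (h0 : ¬ ZeroIsEigenvalue S) (f : H)
    {ε : ℕ → ℝ} (hε : ∀ n, 0 < ε n) (hlim : Tendsto ε atTop (𝓝 0))
    (him : ∀ n, ((ε n : ℂ) * Complex.I).im ≠ 0) :
    Tendsto (fun n => (ε n : ℂ) • hS.res (him n) f) atTop (𝓝 0) := by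
  have hle : ∀ n (h : H), ‖(ε n : ℂ) • hS.res (him n) h‖ ≤ ‖h‖ := by
    intro n h
    have := hS.norm_res_apply_le (him n) h
    rw [norm_smul, Complex.norm_real]
    simpa using this
  have hran : Dense (Set.range fun u : S => u.1.2) := by
    have h1 : (LinearMap.range ((LinearMap.snd ℂ H H).comp S.subtype)).topologicalClosure = ⊤ := by
      rw [Submodule.topologicalClosure_eq_top_iff, Submodule.eq_bot_iff]
      intro g hg
      have : (g, (0 : H)) ∈ S := by
        rw [← hS.adjoint_eq, Submodule.mem_adjoint_iff]
        intro u v huv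
        rw [inner_zero_right, sub_zero]
        exact hg v ⟨⟨(u, v), huv⟩, rfl⟩
      by_contra hne
      exact h0 ⟨g, hne, this⟩
    exact Submodule.dense_iff_topologicalClosure_eq_top.2 h1
  rw [Metric.tendsto_atTop]
  intro η hη
  obtain ⟨k, hk, hkf⟩ : ∃ k ∈ Set.range (fun u : S => u.1.2), dist f k < η / 2 :=
    Metric.dense_iff.1 hran f (η / 2) (by positivity) |>.imp fun k h => ⟨h.2, by
      rw [dist_comm]; exact h.1⟩
  obtain ⟨⟨⟨g, k'⟩, hu⟩, rfl⟩ := hk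
  simp only at hkf
  have hRk : ∀ n, (ε n : ℂ) • hS.res (him n) k' = (ε n : ℂ) • g +
      ((ε n : ℂ) * Complex.I) • ((ε n : ℂ) • hS.res (him n) g) := by
    intro n
    have := (hS.isResolvent (him n)).apply_sub hu
    rw [map_sub, map_smul, sub_eq_iff_eq_add] at this
    rw [this]
    module
  obtain ⟨N, hN⟩ := (Metric.tendsto_atTop.1 hlim) (η / (4 * (‖g‖ + 1))) (by positivity)
  refine ⟨N, fun n hn => ?_⟩
  have h1 := hN n hn
  rw [Real.dist_eq, sub_zero, abs_of_pos (hε n), lt_div_iff₀ (by positivity)] at h1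
  rw [dist_zero_right]
  have h2 : (ε n : ℂ) • hS.res (him n) f = (ε n : ℂ) • hS.res (him n) (f - k') +
      (ε n : ℂ) • hS.res (him n) k' := by rw [map_sub, smul_sub, sub_add_cancel]
  have h3 : ‖(ε n : ℂ) • hS.res (him n) k'‖ ≤ ε n * ‖g‖ + ε n * ‖g‖ := by
    rw [hRk]
    refine (norm_add_le _ _).trans (add_le_add ?_ ?_)
    · rw [norm_smul, Complex.norm_real, Real.norm_of_nonneg (hε n).le]
    · rw [norm_smul, norm_mul, Complex.norm_I, mul_one, Complex.norm_real,
        Real.norm_of_nonneg (hε n).le]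
      exact mul_le_mul_of_nonneg_left (hle n g) (hε n).le
  rw [h2]
  have h4 := norm_add_le ((ε n : ℂ) • hS.res (him n) (f - k')) ((ε n : ℂ) • hS.res (him n) k')
  have h5 := hle n (f - k')
  rw [dist_eq_norm] at hkf
  have h6 := (hε n).le
  nlinarith

end IsEssSelfAdjointRel

end Relations

end LeftDefinite

end

noncomputable section

namespace LeftDefinite

/-! ### Spectral measures of self-adjoint relations -/

section Relations

variable {H : Type*} [NormedAddCommGroup H] [InnerProductSpace ℂ H] [CompleteSpace H]

section NormalOperator

open CompactlySupported

/-- The real valued function `g` as a complex valued function. -/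
def ofRealMap {X : Type*} [TopologicalSpace X] (g : C(X, ℝ)) : C(X, ℂ) :=
  ⟨fun x => (g x : ℂ), Complex.continuous_ofReal.comp g.continuous⟩

/-- The scalar spectral measure of a normal operator. -/
theorem exists_measure_of_isStarNormal (A : H →L[ℂ] H) (hA : IsStarNormal A) (f : H) :
    ∃ m : Measure (spectrum ℂ A), IsFiniteMeasure m ∧ ∀ g : C(spectrum ℂ A, ℂ),
      inner ℂ f (cfcHom hA g f) = ∫ x, g x ∂m := by
  have key : ∀ g : C(spectrum ℂ A, ℝ), (inner ℂ f (cfcHom hA (ofRealMap g) f)).im = 0 := by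
    intro g
    have h1 : IsSelfAdjoint (cfcHom hA (ofRealMap g)) := by
      rw [IsSelfAdjoint, ← map_star]
      congr 1
      ext x
      simp [ofRealMap]
    have h2 := h1.isSymmetric f f
    rw [← inner_conj_symm] at h2
    exact Complex.conj_eq_iff_im.1 h2
  let L : C_c(spectrum ℂ A, ℝ) →ₗ[ℝ] ℝ :=
    { toFun := fun g => (inner ℂ f (cfcHom hA (ofRealMap g.toContinuousMap) f)).re
      map_add' := fun g k => by
        have : ofRealMap (g + k).toContinuousMap =
            ofRealMap g.toContinuousMap + ofRealMap k.toContinuousMap := by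
          ext x
          simp [ofRealMap]
        rw [this, map_add, _root_.add_apply, inner_add_right, Complex.add_re]
      map_smul' := fun r g => by
        have : ofRealMap (r • g).toContinuousMap = (r : ℂ) • ofRealMap g.toContinuousMap := by
          ext x
          simp [ofRealMap]
        rw [this, map_smul, _root_.smul_apply, inner_smul_right]
        simp }
  let Λ : C_c(spectrum ℂ A, ℝ) →ₚ[ℝ] ℝ := PositiveLinearMap.mk₀ L fun g hg => by
    change 0 ≤ (inner ℂ f (cfcHom hA (ofRealMap g.toContinuousMap) f)).re
    let k : C(spectrum ℂ A, ℝ) := ⟨fun x => √(g x), g.continuous.sqrt⟩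
    have h1 : ofRealMap g.toContinuousMap = star (ofRealMap k) * ofRealMap k := by
      ext x
      have : 0 ≤ g x := hg x
      simp only [ofRealMap, ContinuousMap.coe_mk, ContinuousMap.mul_apply, ContinuousMap.star_apply,
        k]
      rw [RCLike.star_def, Complex.conj_ofReal, ← Complex.ofReal_mul, Real.mul_self_sqrt this]
      rfl
    rw [h1, map_mul, map_star, mul_apply_eq_comp, ContinuousLinearMap.star_eq_adjoint,
      ContinuousLinearMap.adjoint_inner_right]
    exact inner_self_nonneg (𝕜 := ℂ)
  have hΛ : ∀ g : C(spectrum ℂ A, ℝ), inner ℂ f (cfcHom hA (ofRealMap g) f) =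
      ((∫ x, g x ∂(RealRMK.rieszMeasure Λ) : ℝ) : ℂ) := by
    intro g
    let g' : C_c(spectrum ℂ A, ℝ) := ⟨g, HasCompactSupport.of_compactSpace _⟩
    have := RealRMK.integral_rieszMeasure Λ g'
    rw [show (∫ x, g x ∂(RealRMK.rieszMeasure Λ)) = Λ g' from this]
    exact Complex.ext (by simp; rfl) (by simpa using key g)
  have hfin : IsFiniteMeasure (RealRMK.rieszMeasure Λ) :=
    ⟨isCompact_univ.measure_lt_top⟩
  refine ⟨RealRMK.rieszMeasure Λ, hfin, fun g => ?_⟩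
  let gr : C(spectrum ℂ A, ℝ) := ⟨fun x => (g x).re, Complex.continuous_re.comp g.continuous⟩
  let gi : C(spectrum ℂ A, ℝ) := ⟨fun x => (g x).im, Complex.continuous_im.comp g.continuous⟩
  have e : g = ofRealMap gr + Complex.I • ofRealMap gi := by
    ext x
    simp only [ofRealMap, gr, gi, ContinuousMap.add_apply, ContinuousMap.coe_mk,
      ContinuousMap.smul_apply, smul_eq_mul]
    rw [mul_comm]
    exact (Complex.re_add_im _).symm
  have hInt : Integrable g (RealRMK.rieszMeasure Λ) := by
    refine Integrable.of_bound g.continuous.aestronglyMeasurable ‖g‖ (ae_of_all _ fun x => ?_)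
    exact g.norm_coe_le_norm x
  conv_lhs => rw [e]
  rw [map_add, map_smul, _root_.add_apply, _root_.smul_apply,
    inner_add_right, inner_smul_right, hΛ, hΛ, ← integral_re_add_im hInt, mul_comm Complex.I]
  rfl

end NormalOperator

variable {S : Submodule ℂ (H × H)}

namespace IsEssSelfAdjointRel

/-- The spectral measure `E_{f,f}`. -/
theorem exists_measure (hS : IsEssSelfAdjointRel S) (f : H) :
    ∃ ν : Measure ℝ, IsFiniteMeasure ν ∧ ∀ (z : ℂ) (hz : z.im ≠ 0),
      inner ℂ f (hS.res hz f) = ∫ t : ℝ, ((t : ℂ) - z)⁻¹ ∂ν := by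
  have hi : Complex.I.im ≠ 0 := by simp
  have hi' : (conj Complex.I).im ≠ 0 := by simp
  set A := hS.res hi with hA
  have hAs : star A = hS.res hi' := hS.adjoint_res hi hi'
  have id1 : A - star A = (2 * Complex.I) • (star A * A) := by
    rw [hAs]
    ext h
    have := (hS.isResolvent hi').sub_eq (hS.isResolvent hi) h
    simp only [_root_.sub_apply, _root_.smul_apply,
      mul_apply_eq_comp]
    rw [← neg_sub, this, ← neg_smul]
    congr 1
    rw [Complex.conj_I]
    ring
  have id2 : A - star A = (2 * Complex.I) • (A * star A) := by
    rw [hAs]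
    ext h
    have := (hS.isResolvent hi).sub_eq (hS.isResolvent hi') h
    simp only [_root_.sub_apply, _root_.smul_apply,
      mul_apply_eq_comp]
    rw [this]
    congr 1
    rw [Complex.conj_I]
    ring
  have hne : (2 * Complex.I) ≠ 0 := by simp
  have hn : IsStarNormal A := by
    refine ⟨?_⟩
    have := id1.symm.trans id2
    exact smul_right_injective _ hne this
  obtain ⟨m, hm, hInt⟩ := exists_measure_of_isStarNormal A hn f
  let I0 : C(spectrum ℂ A, ℂ) := (ContinuousMap.id ℂ).restrict (spectrum ℂ A)
  have hI0 : cfcHom hn I0 = A := cfcHom_id hn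
  have hcirc : ∀ x : spectrum ℂ A, (x : ℂ) - conj (x : ℂ) = 2 * Complex.I * (conj (x : ℂ) * x) := by
    have : I0 - star I0 = (2 * Complex.I) • (star I0 * I0) := by
      apply cfcHom_injective hn
      rw [map_sub, map_smul, map_mul, map_star, hI0, id1]
    intro x
    exact DFunLike.congr_fun this x
  have hcirc2 : ∀ x : spectrum ℂ A, (x : ℂ) ≠ 0 →
      ((((x : ℂ)⁻¹).re : ℝ) : ℂ) - Complex.I = (x : ℂ)⁻¹ := by
    intro x hx
    have h1 := hcirc x
    have hx' : conj (x : ℂ) ≠ 0 := (map_ne_zero _).2 hx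
    have h2 : (x : ℂ)⁻¹ - conj ((x : ℂ)⁻¹) = -(2 * Complex.I) := by
      rw [map_inv₀]
      field_simp
      linear_combination -h1
    have h3 : ((x : ℂ)⁻¹).im = -1 := by
      have := congrArg Complex.im h2
      rw [Complex.sub_im, Complex.conj_im, Complex.neg_im, Complex.mul_im, Complex.I_im,
        Complex.I_re, mul_zero, add_zero, mul_one, Complex.re_ofNat] at this
      linarith
    rw [← Complex.re_add_im ((x : ℂ)⁻¹), h3]
    simp [sub_eq_add_neg]
  have hden : ∀ (z : ℂ), z.im ≠ 0 → ∀ x : spectrum ℂ A, 1 - (z - Complex.I) * (x : ℂ) ≠ 0 := by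
    intro z hz x h
    have hx : (x : ℂ) ≠ 0 := by
      intro h0
      rw [h0] at h
      simp at h
    have h1 : (x : ℂ)⁻¹ = z - Complex.I := by
      rw [inv_eq_iff_eq_inv]
      have : (z - Complex.I) * (x : ℂ) = 1 := by linear_combination -h
      exact eq_inv_of_mul_eq_one_right this
    have h2 := hcirc2 x hx
    rw [h1] at h2
    have h3 := congrArg Complex.im h2
    simp at h3
    exact hz (by linarith)
  let P : Set (spectrum ℂ A) := {x | (x : ℂ) ≠ 0}
  have hP : MeasurableSet P := (measurable_subtype_coe (measurableSet_singleton (0 : ℂ))).compl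
  let τ : spectrum ℂ A → ℝ := fun x => ((x : ℂ)⁻¹).re
  have hτ : Measurable τ := Complex.measurable_re.comp measurable_subtype_coe.inv
  refine ⟨(m.restrict P).map τ, inferInstance, fun z hz => ?_⟩
  let gz : C(spectrum ℂ A, ℂ) := ⟨fun x => (x : ℂ) / (1 - (z - Complex.I) * (x : ℂ)),
    continuous_subtype_val.div₀ (by fun_prop) (hden z hz)⟩
  have e1 : cfcHom hn gz = hS.res hz := by
    have h1 : gz * (1 - (z - Complex.I) • I0) = I0 := by
      ext x
      simp only [gz, I0, ContinuousMap.mul_apply, ContinuousMap.coe_mk, ContinuousMap.sub_apply,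
        ContinuousMap.one_apply, ContinuousMap.smul_apply, smul_eq_mul]
      exact div_mul_cancel₀ _ (hden z hz x)
    have h2 := congrArg (cfcHom hn) h1
    rw [map_mul, map_sub, map_one, map_smul, hI0] at h2
    have h3 : (1 - (z - Complex.I) • A) * (1 + (z - Complex.I) • hS.res hz) = 1 := by
      ext h
      have := (hS.isResolvent hi).sub_eq (hS.isResolvent hz) h
      simp only [_root_.sub_apply, _root_.smul_apply,
        mul_apply_eq_comp, _root_.add_apply,
        one_apply_eq_self, map_add, map_smul]
      rw [← hA] at this
      have h4 : (z - Complex.I) • A ((hS.res hz) h) = hS.res hz h - A h := by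
        rw [← neg_sub (A h), this]
        module
      rw [h4]
      module
    have h5 : A * (1 + (z - Complex.I) • hS.res hz) = hS.res hz := by
      ext h
      have := (hS.isResolvent hi).sub_eq (hS.isResolvent hz) h
      simp only [_root_.smul_apply,
        mul_apply_eq_comp, _root_.add_apply,
        one_apply_eq_self, map_add, map_smul]
      rw [← hA] at this
      have h4 : (z - Complex.I) • A ((hS.res hz) h) = hS.res hz h - A h := by
        rw [← neg_sub (A h), this]
        module
      rw [h4, add_sub_cancel]
    calc cfcHom hn gz = cfcHom hn gz * ((1 - (z - Complex.I) • A) *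
          (1 + (z - Complex.I) • hS.res hz)) := by rw [h3, mul_one]
      _ = A * (1 + (z - Complex.I) • hS.res hz) := by rw [← mul_assoc, h2]
      _ = hS.res hz := h5
  rw [← e1, hInt gz, integral_map hτ.aemeasurable
    (by
      refine Measurable.aestronglyMeasurable ?_
      fun_prop)]
  rw [← integral_indicator hP]
  refine integral_congr_ae (ae_of_all _ fun x => ?_)
  by_cases hx : (x : ℂ) = 0
  · have : x ∉ P := fun h => h hx
    rw [indicator_of_notMem this]
    simp [gz, hx]
  · rw [indicator_of_mem (show x ∈ P from hx)]
    have h1 := hcirc2 x hx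
    have h2 : ((τ x : ℝ) : ℂ) = (x : ℂ)⁻¹ + Complex.I := by rw [← h1]; simp [τ]
    simp only [gz, ContinuousMap.coe_mk]
    rw [h2, ← inv_inj, inv_inv, inv_div, sub_div, mul_div_cancel_right₀ _ hx, one_div]
    ring

end IsEssSelfAdjointRel

end Relations

end LeftDefinite

end

noncomputable section

namespace LeftDefinite

/-! ### Stieltjes inversion -/

section Stieltjes

/-- The Poisson kernel of the upper half plane, up to the factor `π`. -/
def poisson (ε t l : ℝ) : ℝ := ε / ((t - l) ^ 2 + ε ^ 2)

lemma poisson_den_pos {ε : ℝ} (hε : 0 < ε) (t l : ℝ) : 0 < (t - l) ^ 2 + ε ^ 2 := by positivity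

lemma poisson_nonneg {ε : ℝ} (hε : 0 < ε) (t l : ℝ) : 0 ≤ poisson ε t l := by
  unfold poisson
  positivity

lemma poisson_le {ε : ℝ} (hε : 0 < ε) (t l : ℝ) : poisson ε t l ≤ ε⁻¹ := by
  unfold poisson
  rw [div_le_iff₀ (poisson_den_pos hε t l), inv_mul_eq_div, le_div_iff₀ hε]
  nlinarith [sq_nonneg (t - l)]

lemma measurable_poisson (ε : ℝ) : Measurable fun p : ℝ × ℝ => poisson ε p.1 p.2 := by
  unfold poisson
  fun_prop

lemma inv_sub_inv_eq {ε : ℝ} (hε : 0 < ε) (t l : ℝ) :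
    ((t : ℂ) - (l + ε * Complex.I))⁻¹ - ((t : ℂ) - (l - ε * Complex.I))⁻¹ =
      2 * Complex.I * poisson ε t l := by
  have h := poisson_den_pos hε t l
  have h1 : ((t : ℂ) - (l + ε * Complex.I)) * ((t : ℂ) - (l - ε * Complex.I)) =
      (((t - l) ^ 2 + ε ^ 2 : ℝ) : ℂ) := by
    push_cast
    linear_combination -(ε : ℂ) ^ 2 * Complex.I_sq
  have h2 : (((t - l) ^ 2 + ε ^ 2 : ℝ) : ℂ) ≠ 0 := by exact_mod_cast h.ne'
  have h3 : (t : ℂ) - (l + ε * Complex.I) ≠ 0 := left_ne_zero_of_mul (h1 ▸ h2)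
  have h4 : (t : ℂ) - (l - ε * Complex.I) ≠ 0 := right_ne_zero_of_mul (h1 ▸ h2)
  rw [inv_sub_inv h3 h4, h1, poisson, Complex.ofReal_div]
  ring

lemma norm_inv_le {ε : ℝ} (hε : 0 < ε) (t l : ℝ) {w : ℂ} (hw : w.re = l) (hwi : |w.im| = ε) :
    ε * ‖((t : ℂ) - w)⁻¹‖ ≤ √ε / 2 * (1 + poisson ε t l) := by
  have h := poisson_den_pos hε t l
  have h1 : ‖(t : ℂ) - w‖ ^ 2 = (t - l) ^ 2 + ε ^ 2 := by
    rw [← Complex.normSq_eq_norm_sq, Complex.normSq_apply, ← hw, ← hwi, sq_abs]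
    simp
    ring
  have h2 : 0 < ‖(t : ℂ) - w‖ := by
    rcases (norm_nonneg ((t : ℂ) - w)).eq_or_lt with h0 | h0
    · rw [← h0] at h1
      nlinarith
    · exact h0
  rw [norm_inv]
  have h3 : (ε * ‖(t : ℂ) - w‖⁻¹) ^ 2 = ε * poisson ε t l := by
    rw [mul_pow, inv_pow, h1, poisson]
    field_simp
  have h4 : √ε ^ 2 = ε := Real.sq_sqrt hε.le
  have h5 := poisson_nonneg hε t l
  refine abs_le_of_sq_le_sq' ?_ (by positivity) |>.2
  rw [h3, mul_pow, div_pow, h4]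
  nlinarith [sq_nonneg (1 - poisson ε t l)]

lemma integral_poisson_eq {ε : ℝ} (hε : 0 < ε) (H : ℝ → ℂ) (t : ℝ) :
    ∫ l, H l * poisson ε t l = ∫ s, H (t + ε * s) * ((1 + s ^ 2)⁻¹ : ℝ) := by
  have h1 : ∫ l, H l * poisson ε t l = ∫ l, H (t + l) * poisson ε t (t + l) :=
    (integral_add_left_eq_self (fun l => H l * (poisson ε t l : ℂ)) t).symm
  have h2 := Measure.integral_comp_mul_left (fun l => H (t + l) * (poisson ε t (t + l) : ℂ)) ε
  rw [h1]
  rw [abs_of_pos (inv_pos.2 hε)] at h2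
  have h3 : ∫ l, H (t + l) * (poisson ε t (t + l) : ℂ) =
      (ε : ℂ) * ∫ x, H (t + ε * x) * (poisson ε t (t + ε * x) : ℂ) := by
    rw [h2, Complex.real_smul, Complex.ofReal_inv, mul_inv_cancel_left₀]
    exact_mod_cast hε.ne'
  rw [h3, ← integral_const_mul]
  refine integral_congr_ae (ae_of_all _ fun s => ?_)
  have h4 : ε * poisson ε t (t + ε * s) = (1 + s ^ 2)⁻¹ := by
    unfold poisson
    have : (0 : ℝ) < 1 + s ^ 2 := by positivity
    field_simp
    ring
  simp only
  rw [← h4]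
  push_cast
  ring

lemma exists_norm_bound {H : ℝ → ℂ} (hH : Continuous H) (hc : HasCompactSupport H) :
    ∃ M, 0 ≤ M ∧ ∀ l, ‖H l‖ ≤ M := by
  obtain ⟨M, hM⟩ := hH.bounded_above_of_compact_support hc
  exact ⟨M, (norm_nonneg _).trans (hM 0), hM⟩

lemma norm_integral_poisson_le {H : ℝ → ℂ} {M : ℝ} (hM : ∀ l, ‖H l‖ ≤ M) {ε : ℝ} (hε : 0 < ε)
    (t : ℝ) : ‖∫ l, H l * poisson ε t l‖ ≤ M * Real.pi := by
  rw [integral_poisson_eq hε, ← integral_univ_inv_one_add_sq, ← integral_const_mul]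
  refine norm_integral_le_of_norm_le (integrable_inv_one_add_sq.const_mul M)
    (ae_of_all _ fun s => ?_)
  rw [norm_mul, Complex.norm_real, Real.norm_of_nonneg (by positivity)]
  exact mul_le_mul_of_nonneg_right (hM _) (by positivity)

lemma tendsto_integral_poisson {H : ℝ → ℂ} (hH : Continuous H) (hc : HasCompactSupport H)
    (t : ℝ) : Tendsto (fun ε : ℝ => ∫ l, H l * poisson ε t l) (𝓝[>] 0) (𝓝 (Real.pi * H t)) := by
  obtain ⟨M, -, hM⟩ := exists_norm_bound hH hc
  have h1 : Tendsto (fun ε : ℝ => ∫ s, H (t + ε * s) * ((1 + s ^ 2)⁻¹ : ℝ)) (𝓝[>] 0)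
      (𝓝 (∫ s : ℝ, H t * ((1 + s ^ 2)⁻¹ : ℝ))) := by
    refine tendsto_integral_filter_of_dominated_convergence (fun s => M * (1 + s ^ 2)⁻¹)
      (Eventually.of_forall fun ε => ?_) (Eventually.of_forall fun ε => ae_of_all _ fun s => ?_)
      (integrable_inv_one_add_sq.const_mul M) (ae_of_all _ fun s => ?_)
    · refine Continuous.aestronglyMeasurable ?_
      refine (hH.comp (by fun_prop)).mul (Complex.continuous_ofReal.comp ?_)
      exact (by fun_prop : Continuous fun s : ℝ => 1 + s ^ 2).inv₀ fun s => by positivity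
    · rw [norm_mul, Complex.norm_real, Real.norm_of_nonneg (by positivity)]
      exact mul_le_mul_of_nonneg_right (hM _) (by positivity)
    · refine Tendsto.mul_const _ ?_
      have : Tendsto (fun ε : ℝ => t + ε * s) (𝓝[>] 0) (𝓝 (t + 0 * s)) :=
        ((by fun_prop : Continuous fun ε : ℝ => t + ε * s).tendsto 0).mono_left
          nhdsWithin_le_nhds
      rw [zero_mul, add_zero] at this
      exact (hH.tendsto t).comp this
  rw [integral_const_mul, integral_complex_ofReal, integral_univ_inv_one_add_sq, mul_comm] at h1
  refine h1.congr' ?_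
  filter_upwards [self_mem_nhdsWithin] with ε hε
  exact (integral_poisson_eq hε H t).symm

variable {X : Type*} [MeasurableSpace X] {m : Measure X} {τ : X → ℝ} {G : X → ℂ}

lemma integrable_prod_poisson [SFinite m] (hτ : Measurable τ) (hG : Integrable G m) {H : ℝ → ℂ}
    (hH : Continuous H) (hc : HasCompactSupport H) {ε : ℝ} (hε : 0 < ε) :
    Integrable (fun p : ℝ × X => H p.1 * (G p.2 * poisson ε (τ p.2) p.1))
      ((volume : Measure ℝ).prod m) := by
  have h1 := (hH.integrable_of_hasCompactSupport (μ := volume) hc).mul_prod hG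
  have h2 := h1.bdd_mul (c := ε⁻¹) (f := fun p : ℝ × X => (poisson ε (τ p.2) p.1 : ℂ))
    (Complex.measurable_ofReal.comp ((measurable_poisson ε).comp (by fun_prop :
      Measurable fun p : ℝ × X => (τ p.2, p.1)))).aestronglyMeasurable
    (ae_of_all _ fun p => by
      rw [Complex.norm_real, Real.norm_of_nonneg (poisson_nonneg hε _ _)]
      exact poisson_le hε _ _)
  refine h2.congr (ae_of_all _ fun p => ?_)
  simp only
  ring

lemma tendsto_integral_integral_poisson [SFinite m] (hτ : Measurable τ) (hG : Integrable G m)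
    {H : ℝ → ℂ} (hH : Continuous H) (hc : HasCompactSupport H) :
    Tendsto (fun ε : ℝ => ∫ l, H l * ∫ x, G x * poisson ε (τ x) l ∂m) (𝓝[>] 0)
      (𝓝 (Real.pi * ∫ x, H (τ x) * G x ∂m)) := by
  obtain ⟨M, hM0, hM⟩ := exists_norm_bound hH hc
  have e : ∀ ε : ℝ, 0 < ε → ∫ l, H l * ∫ x, G x * poisson ε (τ x) l ∂m =
      ∫ x, G x * (∫ l, H l * poisson ε (τ x) l) ∂m := by
    intro ε hε
    have h1 := integral_integral_swap (f := fun (l : ℝ) (x : X) =>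
      H l * (G x * poisson ε (τ x) l)) (integrable_prod_poisson hτ hG hH hc hε)
    simp only [integral_const_mul] at h1
    rw [h1]
    refine integral_congr_ae (ae_of_all _ fun x => ?_)
    simp only
    rw [← integral_const_mul]
    refine integral_congr_ae (ae_of_all _ fun l => ?_)
    simp only
    ring
  have h2 : Tendsto (fun ε : ℝ => ∫ x, G x * (∫ l, H l * poisson ε (τ x) l) ∂m) (𝓝[>] 0)
      (𝓝 (∫ x, G x * (Real.pi * H (τ x)) ∂m)) := by
    refine tendsto_integral_filter_of_dominated_convergence (fun x => ‖G x‖ * (M * Real.pi))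
      ?_ ?_ (hG.norm.mul_const _) (ae_of_all _ fun x => ?_)
    · filter_upwards [self_mem_nhdsWithin] with ε hε
      have h3 := (integrable_prod_poisson hτ hG hH hc hε).swap.integral_prod_left
      refine h3.aestronglyMeasurable.congr (ae_of_all _ fun x => ?_)
      simp only [Function.comp, Prod.swap]
      rw [← integral_const_mul]
      refine integral_congr_ae (ae_of_all _ fun l => ?_)
      simp only
      ring
    · filter_upwards [self_mem_nhdsWithin] with ε hε
      refine ae_of_all _ fun x => ?_
      rw [norm_mul]
      exact mul_le_mul_of_nonneg_left (norm_integral_poisson_le hM hε _) (norm_nonneg _)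
    · exact (tendsto_integral_poisson hH hc (τ x)).const_mul _
  rw [← integral_const_mul]
  have h3 : ∫ x, G x * (Real.pi * H (τ x)) ∂m = ∫ x, (Real.pi : ℂ) * (H (τ x) * G x) ∂m := by
    refine integral_congr_ae (ae_of_all _ fun x => ?_)
    simp only
    ring
  rw [h3] at h2
  refine h2.congr' ?_
  filter_upwards [self_mem_nhdsWithin] with ε hε
  exact (e ε hε).symm

lemma measurable_inv_sub (hτ : Measurable τ) (z : ℂ) :
    Measurable fun x => ((τ x : ℂ) - z)⁻¹ := by fun_prop

lemma norm_inv_sub_le {z : ℂ} (hz : z.im ≠ 0) (t : ℝ) : ‖((t : ℂ) - z)⁻¹‖ ≤ |z.im|⁻¹ := by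
  rw [norm_inv]
  refine inv_anti₀ (abs_pos.2 hz) ?_
  have := Complex.abs_im_le_norm ((t : ℂ) - z)
  simpa using this

lemma integrable_mul_inv (hτ : Measurable τ) (hG : Integrable G m) {z : ℂ} (hz : z.im ≠ 0) :
    Integrable (fun x => G x * ((τ x : ℂ) - z)⁻¹) m := by
  have := hG.bdd_mul (c := |z.im|⁻¹) (measurable_inv_sub hτ z).aestronglyMeasurable
    (ae_of_all _ fun x => norm_inv_sub_le hz (τ x))
  simpa only [mul_comm] using this

lemma stieltjes_sub (hτ : Measurable τ) (hG : Integrable G m) {ε : ℝ} (hε : 0 < ε) (l : ℝ) :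
    (∫ x, G x * ((τ x : ℂ) - (l + ε * Complex.I))⁻¹ ∂m) -
      ∫ x, G x * ((τ x : ℂ) - (l - ε * Complex.I))⁻¹ ∂m =
      2 * Complex.I * ∫ x, G x * poisson ε (τ x) l ∂m := by
  rw [← integral_sub (integrable_mul_inv hτ hG (by simp [hε.ne']))
    (integrable_mul_inv hτ hG (by simp [hε.ne'])), ← integral_const_mul]
  refine integral_congr_ae (ae_of_all _ fun x => ?_)
  simp only
  rw [← mul_sub, inv_sub_inv_eq hε]
  ring

/-- An integrable density with vanishing Stieltjes transform vanishes. -/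
theorem integral_eq_zero_of_stieltjes [SFinite m] (hτ : Measurable τ) (hG : Integrable G m)
    (h0 : ∀ z : ℂ, z.im ≠ 0 → ∫ x, G x * ((τ x : ℂ) - z)⁻¹ ∂m = 0) {H : ℝ → ℂ}
    (hH : Continuous H) (hc : HasCompactSupport H) : ∫ x, H (τ x) * G x ∂m = 0 := by
  have h1 := tendsto_integral_integral_poisson hτ hG hH hc
  have h2 : (Real.pi : ℂ) * ∫ x, H (τ x) * G x ∂m = 0 := by
    refine tendsto_nhds_unique h1 (tendsto_const_nhds.congr' ?_)
    filter_upwards [self_mem_nhdsWithin] with ε hε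
    have h3 : ∀ l : ℝ, ∫ x, G x * poisson ε (τ x) l ∂m = 0 := by
      intro l
      have hε' : (0 : ℝ) < ε := hε
      have := stieltjes_sub hτ hG hε' l
      rw [h0 _ (by simp [hε'.ne']), h0 _ (by simp [hε'.ne']), sub_zero] at this
      exact (mul_eq_zero.1 this.symm).resolve_left (by simp)
    simp [h3]
  exact (mul_eq_zero.1 h2).resolve_left (by exact_mod_cast Real.pi_ne_zero)

lemma norm_stieltjes_le {ν : Measure ℝ} [IsFiniteMeasure ν] {ε : ℝ} (hε : 0 < ε) (l : ℝ) {w : ℂ}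
    (hw : w.re = l) (hwi : |w.im| = ε) : ε * ‖∫ t : ℝ, ((t : ℂ) - w)⁻¹ ∂ν‖ ≤
      √ε / 2 * (ν.real univ + ∫ t : ℝ, poisson ε t l ∂ν) := by
  have hP : Integrable (fun t => poisson ε t l) ν :=
    Integrable.of_bound ((measurable_poisson ε).comp (by fun_prop :
      Measurable fun t : ℝ => (t, l))).aestronglyMeasurable ε⁻¹ (ae_of_all _ fun t => by
      rw [Real.norm_of_nonneg (poisson_nonneg hε _ _)]
      exact poisson_le hε _ _)
  have h1 : ‖(ε : ℂ) * ∫ t : ℝ, ((t : ℂ) - w)⁻¹ ∂ν‖ ≤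
      ∫ t : ℝ, √ε / 2 * (1 + poisson ε t l) ∂ν := by
    rw [← integral_const_mul]
    refine norm_integral_le_of_norm_le (((integrable_const 1).add hP).const_mul _)
      (ae_of_all _ fun t => ?_)
    rw [norm_mul, Complex.norm_real, Real.norm_of_nonneg hε.le]
    exact norm_inv_le hε t l hw hwi
  rw [norm_mul, Complex.norm_real, Real.norm_of_nonneg hε.le, integral_const_mul,
    integral_add (integrable_const 1) hP, integral_const, smul_eq_mul, mul_one] at h1
  exact h1

/-- Let the Stieltjes transforms `F₁`, `F₂` of two measures satisfy `p₁ F₁ - p₂ F₂ = r` off the real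
line, where `p₁`, `p₂` and `r` do not jump across the real line near the support of `h`. Then
`∫ h p₁ dν₁ = ∫ h p₂ dν₂`. -/
theorem integral_eq_of_stieltjes {ν₁ ν₂ : Measure ℝ} [IsFiniteMeasure ν₁] [IsFiniteMeasure ν₂]
    {p₁ p₂ r : ℂ → ℂ} {h : ℝ → ℂ} (hc : HasCompactSupport h)
    (hc₁ : Continuous fun l : ℝ => h l * p₁ l) (hc₂ : Continuous fun l : ℝ => h l * p₂ l)
    (hh : Continuous h) {C : ℝ} (hC : 0 ≤ C)
    (hp₁ : ∀ l : ℝ, h l ≠ 0 → ∀ ε : ℝ, |ε| ≤ 1 → ‖p₁ (l + ε * Complex.I) - p₁ l‖ ≤ C * |ε|)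
    (hp₂ : ∀ l : ℝ, h l ≠ 0 → ∀ ε : ℝ, |ε| ≤ 1 → ‖p₂ (l + ε * Complex.I) - p₂ l‖ ≤ C * |ε|)
    (hr : ∀ l : ℝ, h l ≠ 0 → ∀ ε : ℝ, 0 < ε → ε ≤ 1 →
      ‖r (l + ε * Complex.I) - r (l - ε * Complex.I)‖ ≤ C * ε)
    (heq : ∀ z : ℂ, z.im ≠ 0 → p₁ z * (∫ t : ℝ, ((t : ℂ) - z)⁻¹ ∂ν₁) -
      p₂ z * (∫ t : ℝ, ((t : ℂ) - z)⁻¹ ∂ν₂) = r z) :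
    ∫ t, h t * p₁ t ∂ν₁ = ∫ t, h t * p₂ t ∂ν₂ := by
  set F₁ : ℂ → ℂ := fun z => ∫ t : ℝ, ((t : ℂ) - z)⁻¹ ∂ν₁ with hF₁
  set F₂ : ℂ → ℂ := fun z => ∫ t : ℝ, ((t : ℂ) - z)⁻¹ ∂ν₂ with hF₂
  set P₁ : ℝ → ℝ → ℝ := fun ε l => ∫ t : ℝ, poisson ε t l ∂ν₁ with hP₁
  set P₂ : ℝ → ℝ → ℝ := fun ε l => ∫ t : ℝ, poisson ε t l ∂ν₂ with hP₂
  have hcast : ∀ (ν : Measure ℝ) (ε l : ℝ), ∫ t : ℝ, (1 : ℂ) * poisson ε t l ∂ν =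
      ((∫ t : ℝ, poisson ε t l ∂ν : ℝ) : ℂ) := fun ν ε l => by
    simp only [one_mul]
    exact integral_complex_ofReal
  have lim : ∀ (ν : Measure ℝ) [IsFiniteMeasure ν] (H : ℝ → ℂ), Continuous H →
      HasCompactSupport H → Tendsto (fun ε : ℝ => ∫ l, H l * ((∫ t : ℝ, poisson ε t l ∂ν : ℝ) : ℂ))
      (𝓝[>] 0) (𝓝 (Real.pi * ∫ t, H t ∂ν)) := by
    intro ν _ H hH hHc
    have := tendsto_integral_integral_poisson (m := ν) (τ := id) (G := fun _ => 1) measurable_id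
      (integrable_const 1) hH hHc
    simpa only [id, hcast, mul_one] using this
  have intg : ∀ (ν : Measure ℝ) [IsFiniteMeasure ν] (H : ℝ → ℂ), Continuous H →
      HasCompactSupport H → ∀ ε : ℝ, 0 < ε →
      Integrable fun l => H l * ((∫ t : ℝ, poisson ε t l ∂ν : ℝ) : ℂ) := by
    intro ν _ H hH hHc ε hε
    have := (integrable_prod_poisson (m := ν) (τ := id) (G := fun _ => 1) measurable_id
      (integrable_const 1) hH hHc hε).integral_prod_left
    refine this.congr (ae_of_all _ fun l => ?_)
    simp only [id, integral_const_mul, ← hcast]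
  have hn : Continuous fun l => (‖h l‖ : ℂ) := Complex.continuous_ofReal.comp hh.norm
  have hnc : HasCompactSupport fun l => (‖h l‖ : ℂ) := hc.norm.comp_left Complex.ofReal_zero
  have hcc₁ : HasCompactSupport fun l : ℝ => h l * p₁ l := hc.mul_right
  have hcc₂ : HasCompactSupport fun l : ℝ => h l * p₂ l := hc.mul_right
  set J : ℝ → ℂ := fun ε => (∫ l, h l * p₁ l * (P₁ ε l : ℂ)) - ∫ l, h l * p₂ l * (P₂ ε l : ℂ)
    with hJ
  have limJ : Tendsto J (𝓝[>] 0)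
      (𝓝 (Real.pi * (∫ t, h t * p₁ t ∂ν₁) - Real.pi * ∫ t, h t * p₂ t ∂ν₂)) :=
    (lim ν₁ _ hc₁ hcc₁).sub (lim ν₂ _ hc₂ hcc₂)
  set B : ℝ → ℝ := fun ε => C * (ε * (∫ l, ‖h l‖) + √ε * ((ν₁.real univ + ν₂.real univ) *
    (∫ l, ‖h l‖) + ((∫ l, ‖h l‖ * P₁ ε l) + ∫ l, ‖h l‖ * P₂ ε l))) with hB
  have intR : ∀ (ν : Measure ℝ) [IsFiniteMeasure ν] (ε : ℝ), 0 < ε →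
      Integrable fun l => ‖h l‖ * ∫ t : ℝ, poisson ε t l ∂ν := by
    intro ν _ ε hε
    have := (intg ν _ hn hnc ε hε).re
    refine this.congr (ae_of_all _ fun l => ?_)
    simp only [← Complex.ofReal_mul]
    exact Complex.ofReal_re _
  have limR : ∀ (ν : Measure ℝ) [IsFiniteMeasure ν], ∃ L, Tendsto (fun ε : ℝ =>
      ∫ l, ‖h l‖ * ∫ t : ℝ, poisson ε t l ∂ν) (𝓝[>] 0) (𝓝 L) := by
    intro ν _
    have := (Complex.continuous_re.tendsto _).comp (lim ν _ hn hnc)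
    refine ⟨_, this.congr fun ε => ?_⟩
    simp only [Function.comp, ← Complex.ofReal_mul]
    rw [integral_complex_ofReal, Complex.ofReal_re]
  have limB : Tendsto B (𝓝[>] 0) (𝓝 0) := by
    obtain ⟨L₁, hL₁⟩ := limR ν₁
    obtain ⟨L₂, hL₂⟩ := limR ν₂
    have t0 : Tendsto (fun ε : ℝ => ε) (𝓝[>] 0) (𝓝 0) := nhdsWithin_le_nhds
    have t1 : Tendsto (fun ε : ℝ => √ε) (𝓝[>] 0) (𝓝 0) := by
      have := (Real.continuous_sqrt.tendsto 0).mono_left (nhdsWithin_le_nhds (s := Ioi (0 : ℝ)))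
      rwa [Real.sqrt_zero] at this
    have := ((t0.mul_const (∫ l, ‖h l‖)).add (t1.mul ((hL₁.add hL₂).const_add
      ((ν₁.real univ + ν₂.real univ) * (∫ l, ‖h l‖))))).const_mul C
    simpa using this
  have hle : ∀ ε : ℝ, 0 < ε → ε ≤ 1 → ‖2 * Complex.I * J ε‖ ≤ B ε := by
    intro ε hε hε1
    have e1 : 2 * Complex.I * J ε = ∫ l, 2 * Complex.I * (h l * p₁ l * (P₁ ε l : ℂ) -
        h l * p₂ l * (P₂ ε l : ℂ)) := by
      rw [integral_const_mul, integral_sub (intg ν₁ _ hc₁ hcc₁ ε hε) (intg ν₂ _ hc₂ hcc₂ ε hε)]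
    have hnI : Integrable fun l => ‖h l‖ := (hh.integrable_of_hasCompactSupport hc).norm
    have e2 : B ε = ∫ l, C * (ε * ‖h l‖ + √ε * ((ν₁.real univ + ν₂.real univ) * ‖h l‖ +
        (‖h l‖ * P₁ ε l + ‖h l‖ * P₂ ε l))) := by
      have i1 : Integrable fun l => ‖h l‖ * P₁ ε l := intR ν₁ ε hε
      have i2 : Integrable fun l => ‖h l‖ * P₂ ε l := intR ν₂ ε hε
      have i3 : Integrable fun l => ‖h l‖ * P₁ ε l + ‖h l‖ * P₂ ε l := i1.add i2
      have i4 : Integrable fun l => (ν₁.real univ + ν₂.real univ) * ‖h l‖ +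
        (‖h l‖ * P₁ ε l + ‖h l‖ * P₂ ε l) := (hnI.const_mul _).add i3
      rw [integral_const_mul, integral_add (hnI.const_mul _) (i4.const_mul _), integral_const_mul,
        integral_const_mul, integral_add (hnI.const_mul _) i3, integral_const_mul,
        integral_add i1 i2]
    rw [e1, e2]
    refine norm_integral_le_of_norm_le ?_ (ae_of_all _ fun l => ?_)
    · exact (((hnI.const_mul _).add (((hnI.const_mul _).add
        ((intR ν₁ ε hε).add (intR ν₂ ε hε))).const_mul _)).const_mul _)
    by_cases hl : h l = 0
    · simp [hl]
    set zp : ℂ := l + ε * Complex.I with hzp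
    set zm : ℂ := l - ε * Complex.I with hzm
    have hzm' : zm = l + ((-ε : ℝ) : ℂ) * Complex.I := by rw [hzm]; push_cast; ring
    have ip : zp.im = ε := by simp [hzp]
    have im : zm.im = -ε := by simp [hzm]
    have rp : zp.re = l := by simp [hzp]
    have rm : zm.re = l := by simp [hzm]
    have s1 : F₁ zp - F₁ zm = 2 * Complex.I * (P₁ ε l : ℂ) := by
      have := stieltjes_sub (m := ν₁) (τ := id) (G := fun _ => 1) measurable_id
        (integrable_const 1) hε l
      simp only [id] at this
      rw [hcast] at this
      simp only [one_mul] at this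
      exact this
    have s2 : F₂ zp - F₂ zm = 2 * Complex.I * (P₂ ε l : ℂ) := by
      have := stieltjes_sub (m := ν₂) (τ := id) (G := fun _ => 1) measurable_id
        (integrable_const 1) hε l
      simp only [id] at this
      rw [hcast] at this
      simp only [one_mul] at this
      exact this
    have q1 := heq zp (by rw [ip]; exact hε.ne')
    have q2 := heq zm (by rw [im]; exact (neg_neg_of_pos hε).ne)
    have e3 : 2 * Complex.I * (h l * p₁ l * (P₁ ε l : ℂ) - h l * p₂ l * (P₂ ε l : ℂ)) =
        h l * ((r zp - r zm) - (p₁ zp - p₁ l) * F₁ zp + (p₁ zm - p₁ l) * F₁ zm +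
          (p₂ zp - p₂ l) * F₂ zp - (p₂ zm - p₂ l) * F₂ zm) := by
      rw [← q1, ← q2]
      linear_combination -(h l * p₁ l) * s1 + (h l * p₂ l) * s2
    rw [e3, norm_mul]
    have b1 := hr l hl ε hε hε1
    have b2 := hp₁ l hl ε (by rw [abs_of_pos hε]; exact hε1)
    have b3 := hp₁ l hl (-ε) (by rw [abs_neg, abs_of_pos hε]; exact hε1)
    have b4 := hp₂ l hl ε (by rw [abs_of_pos hε]; exact hε1)
    have b5 := hp₂ l hl (-ε) (by rw [abs_neg, abs_of_pos hε]; exact hε1)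
    rw [abs_of_pos hε] at b2 b4
    rw [abs_neg, abs_of_pos hε, ← hzm'] at b3 b5
    have c1 := norm_stieltjes_le (ν := ν₁) hε l rp (by rw [ip, abs_of_pos hε])
    have c2 := norm_stieltjes_le (ν := ν₁) hε l rm (by rw [im, abs_neg, abs_of_pos hε])
    have c3 := norm_stieltjes_le (ν := ν₂) hε l rp (by rw [ip, abs_of_pos hε])
    have c4 := norm_stieltjes_le (ν := ν₂) hε l rm (by rw [im, abs_neg, abs_of_pos hε])
    have prod : ∀ {A F : ℂ} {D : ℝ}, ‖A‖ ≤ C * ε → ε * ‖F‖ ≤ D → ‖A * F‖ ≤ C * D := by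
      intro A F D hA hD
      rw [norm_mul]
      calc ‖A‖ * ‖F‖ ≤ C * ε * ‖F‖ := mul_le_mul_of_nonneg_right hA (norm_nonneg _)
        _ = C * (ε * ‖F‖) := by ring
        _ ≤ C * D := mul_le_mul_of_nonneg_left hD hC
    have d1 := prod b2 c1
    have d2 := prod b3 c2
    have d3 := prod b4 c3
    have d4 := prod b5 c4
    have tri : ‖(r zp - r zm) - (p₁ zp - p₁ l) * F₁ zp + (p₁ zm - p₁ l) * F₁ zm +
          (p₂ zp - p₂ l) * F₂ zp - (p₂ zm - p₂ l) * F₂ zm‖ ≤ ‖r zp - r zm‖ +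
          ‖(p₁ zp - p₁ l) * F₁ zp‖ + ‖(p₁ zm - p₁ l) * F₁ zm‖ + ‖(p₂ zp - p₂ l) * F₂ zp‖ +
          ‖(p₂ zm - p₂ l) * F₂ zm‖ :=
      (norm_sub_le _ _).trans (add_le_add_left ((norm_add_le _ _).trans (add_le_add_left
        ((norm_add_le _ _).trans (add_le_add_left (norm_sub_le _ _) _)) _)) _)
    calc ‖h l‖ * ‖(r zp - r zm) - (p₁ zp - p₁ l) * F₁ zp + (p₁ zm - p₁ l) * F₁ zm +
          (p₂ zp - p₂ l) * F₂ zp - (p₂ zm - p₂ l) * F₂ zm‖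
        ≤ ‖h l‖ * (C * ε + C * (√ε / 2 * (ν₁.real univ + P₁ ε l)) +
          C * (√ε / 2 * (ν₁.real univ + P₁ ε l)) + C * (√ε / 2 * (ν₂.real univ + P₂ ε l)) +
          C * (√ε / 2 * (ν₂.real univ + P₂ ε l))) :=
          mul_le_mul_of_nonneg_left (tri.trans (by linarith)) (norm_nonneg _)
      _ = _ := by ring
  have limJ0 : Tendsto (fun ε => 2 * Complex.I * J ε) (𝓝[>] 0) (𝓝 0) := by
    refine squeeze_zero_norm' ?_ limB
    filter_upwards [Ioc_mem_nhdsGT (zero_lt_one' ℝ)] with ε hε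
    exact hle ε hε.1 hε.2
  have := tendsto_nhds_unique limJ0 (limJ.const_mul (2 * Complex.I))
  have h2 : (2 * Complex.I * Real.pi) * ((∫ t, h t * p₁ t ∂ν₁) - ∫ t, h t * p₂ t ∂ν₂) = 0 := by
    rw [this]
    ring
  exact sub_eq_zero.1 ((mul_eq_zero.1 h2).resolve_left (by simp [Real.pi_ne_zero]))

end Stieltjes

end LeftDefinite

end

noncomputable section

namespace LeftDefinite

namespace Coefficients

variable {a b : EReal} {T : Coefficients a b}

/-! ### Self-adjointness and the resolvent kernel -/

lemma H1.span_delta_dense :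
    (Submodule.span ℂ (Set.range (H1.delta : Ivl a b → T.H1))).topologicalClosure = ⊤ := by
  rw [Submodule.topologicalClosure_eq_top_iff, Submodule.eq_bot_iff]
  intro f hf
  refine H1.ext_fun fun c => ?_
  rw [← H1.inner_delta c f]
  exact hf _ (Submodule.subset_span ⟨c, rfl⟩)

namespace IsRealAnalyticFamily

variable {va vb : T.LocPair} {φ : ℂ → T.LocPair}

lemma nearLeft (hφ : IsRealAnalyticFamily va φ) {z : ℂ} (hz : z ≠ 0) : (φ z).NearLeft :=
  (hφ.isSolution z hz).nearLeft (hφ.memH1_left z hz)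

lemma vanishesLeft (hφ : IsRealAnalyticFamily va φ) (hva : IsBoundaryFunctionLeft va) {z : ℂ}
    (hz : z ≠ 0) : (φ z).WronskianVanishesLeft va :=
  hva.tendsto_wronskian (hφ.nearLeft hz) hva.1.nearLeft (fun h => hφ.boundary_left h z hz)
    fun h => (hva.2 h).1

lemma ne_zero_of_im {z : ℂ} (hz : z.im ≠ 0) : z ≠ 0 := fun h => hz (by rw [h, Complex.zero_im])

lemma isLeftSolution (hφ : IsRealAnalyticFamily va φ) (hva : IsBoundaryFunctionLeft va) {z : ℂ}
    (hz : z.im ≠ 0) : LocPair.IsLeftSolution z (φ z) := by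
  have hz0 := ne_zero_of_im hz
  refine ⟨hz, hφ.isSolution z hz0, hφ.nontrivial z hz0, hφ.nearLeft hz0, ?_⟩
  exact hva.tendsto_wronskian (hφ.nearLeft hz0) (hφ.nearLeft hz0)
    (fun _ => hφ.vanishesLeft hva hz0) fun _ => hφ.vanishesLeft hva hz0

lemma exists_green (hφ : IsRealAnalyticFamily va φ) (hva : IsBoundaryFunctionLeft va)
    (hvb : IsBoundaryFunctionRight vb) {z : ℂ} (hz : z.im ≠ 0) : ∃ ψ : T.LocPair,
      ψ.IsSolution z ∧ (∀ x, (φ z).fst x * ψ.qd x - (φ z).qd x * ψ.fst x = 1) ∧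
      ∀ c, ∃ w : T.H1, (∀ x, w x = -z⁻¹ * ((φ z).fst (min x c) * ψ.fst (max x c))) ∧
        (w - z⁻¹ • H1.delta c, z • w) ∈ sepRelation va vb := by
  have hu := hφ.isLeftSolution hva hz
  obtain ⟨ψ, h1, h2, h3, h4⟩ := hu.exists_right_solution hvb
  exact ⟨ψ, h1, h4, fun c => LocPair.exists_green hva.1 hvb.1 hu.isSolution h1 hu.nearLeft h2
    (hφ.vanishesLeft hva hu.z_ne) h3 h4 c⟩

theorem isEssSelfAdjointRel (hφ : IsRealAnalyticFamily va φ) (hva : IsBoundaryFunctionLeft va)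
    (hvb : IsBoundaryFunctionRight vb) : IsEssSelfAdjointRel (sepRelation va vb) where
  symm u hu v hv := sepRelation_symmetric hva hvb hu hv
  isClosed := isClosed_sepRelation hva.1 hvb.1
  dense z hz := by
    obtain ⟨ψ, -, -, hψ⟩ := hφ.exists_green hva hvb hz
    have hz0 := ne_zero_of_im hz
    have hd : Dense (Submodule.span ℂ (Set.range (H1.delta : Ivl a b → T.H1)) : Set T.H1) :=
      Submodule.dense_iff_topologicalClosure_eq_top.2 H1.span_delta_dense
    refine hd.mono fun h hh => ?_
    induction hh using Submodule.span_induction with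
    | mem h hh =>
      obtain ⟨c, rfl⟩ := hh
      obtain ⟨w, -, hw⟩ := hψ c
      refine ⟨w - z⁻¹ • H1.delta c, ?_⟩
      convert hw using 2
      rw [smul_sub, smul_inv_smul₀ hz0]
      abel
    | zero =>
      refine ⟨0, ?_⟩
      rw [smul_zero, add_zero]
      exact Submodule.zero_mem _
    | add h k _ _ ih1 ih2 =>
      obtain ⟨f, hf⟩ := ih1
      obtain ⟨g, hg⟩ := ih2
      refine ⟨f + g, ?_⟩
      convert Submodule.add_mem _ hf hg using 1
      rw [Prod.mk_add_mk]
      congr 1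
      module
    | smul r h _ ih =>
      obtain ⟨f, hf⟩ := ih
      refine ⟨r • f, ?_⟩
      convert Submodule.smul_mem _ r hf using 1
      rw [Prod.smul_mk]
      congr 1
      module

/-- The resolvent kernel `⟨R_z δ_α, δ_x⟩ + ⟨δ_α, δ_x⟩ / z = φ_z(min) D_z(max)`, with a function `D_z`
for which `φ_z(x) D_z - φ_z D_z(x)` is a solution with initial data `0`, `-1/z` at `x`. -/
structure IsKernel (φ : ℂ → T.LocPair) (hS : IsEssSelfAdjointRel (sepRelation va vb))
    (ψ : ℂ → T.LocPair) : Prop where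
  isSolution : ∀ z : ℂ, z.im ≠ 0 → (ψ z).IsSolution z
  wronskian : ∀ z : ℂ, z.im ≠ 0 → ∀ x,
    (φ z).fst x * (ψ z).qd x - (φ z).qd x * (ψ z).fst x = -z⁻¹
  inner_res : ∀ (z : ℂ) (hz : z.im ≠ 0) (α x : Ivl a b),
    inner ℂ (H1.delta x) (hS.res hz (H1.delta α)) =
      (φ z).fst (min x α) * (ψ z).fst (max x α) - z⁻¹ * inner ℂ (H1.delta x : T.H1) (H1.delta α)

lemma exists_isKernel (hφ : IsRealAnalyticFamily va φ) (hva : IsBoundaryFunctionLeft va)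
    (hvb : IsBoundaryFunctionRight vb) (hS : IsEssSelfAdjointRel (sepRelation va vb)) :
    ∃ ψ, IsKernel φ hS ψ := by
  have key : ∀ z : ℂ, ∃ D : T.LocPair, ∀ hz : z.im ≠ 0, D.IsSolution z ∧
      (∀ x, (φ z).fst x * D.qd x - (φ z).qd x * D.fst x = -z⁻¹) ∧ ∀ α x : Ivl a b,
      inner ℂ (H1.delta x) (hS.res hz (H1.delta α)) =
      (φ z).fst (min x α) * D.fst (max x α) -
        z⁻¹ * inner ℂ (H1.delta x : T.H1) (H1.delta α) := by
    intro z
    by_cases hz : z.im = 0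
    · exact ⟨LocPair.zero, fun h => absurd hz h⟩
    obtain ⟨ψ, h1, h2, h3⟩ := hφ.exists_green hva hvb hz
    have hz0 := ne_zero_of_im hz
    refine ⟨ψ.smul (-z⁻¹), fun hz => ⟨h1.smul _, fun x => ?_, fun α x => ?_⟩⟩
    · simp only [LocPair.smul_qd, LocPair.smul_fst, Pi.smul_apply, smul_eq_mul]
      linear_combination -z⁻¹ * h2 x
    · obtain ⟨w, hw1, hw2⟩ := h3 α
      have h4 := (hS.isResolvent hz).apply_sub hw2
      rw [smul_sub, smul_inv_smul₀ hz0, sub_sub_cancel] at h4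
      rw [h4, inner_sub_right, inner_smul_right, H1.inner_delta, hw1]
      simp only [LocPair.smul_fst, Pi.smul_apply, smul_eq_mul]
      ring
  choose ψ hψ using key
  exact ⟨ψ, fun z hz => (hψ z hz).1, fun z hz => (hψ z hz).2.1, fun z hz => (hψ z hz).2.2⟩

/-- The antisymmetric kernel `φ_z(x) D_z(y) - φ_z(y) D_z(x)`. -/
def antiKernel (φ ψ : ℂ → T.LocPair) (x y : Ivl a b) (z : ℂ) : ℂ :=
  (φ z).fst x * (ψ z).fst y - (φ z).fst y * (ψ z).fst x

lemma antiKernel_symm (φ ψ : ℂ → T.LocPair) (x y : Ivl a b) (z : ℂ) :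
    antiKernel φ ψ x y z = -antiKernel φ ψ y x z := by
  unfold antiKernel
  ring

lemma exists_bound_antiKernel_of_le (hφ : IsRealAnalyticFamily va φ)
    {hS : IsEssSelfAdjointRel (sepRelation va vb)} {ψ : ℂ → T.LocPair} (hψ : IsKernel φ hS ψ)
    {x y : Ivl a b} (hxy : x ≤ y) {p R : ℝ} (hp : 0 < p) (hR : 0 ≤ R) :
    ∃ C, 0 ≤ C ∧ ∀ z : ℂ, z.im ≠ 0 → p ≤ ‖z‖ → ‖z‖ ≤ R → ‖antiKernel φ ψ x y z‖ ≤ C ∧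
      ‖antiKernel φ ψ x y z - antiKernel φ ψ x y (conj z)‖ ≤ C * |z.im| := by
  obtain ⟨K, hK0, hK⟩ := LocPair.exists_bound_of_approx T hxy hR
  let k : ℂ → T.LocPair := fun z => ((ψ z).smul ((φ z).fst x)).add ((φ z).smul (-(ψ z).fst x))
  have hk1 : ∀ z y, (k z).fst y = antiKernel φ ψ x y z := by
    intro z y
    simp only [k, LocPair.add_fst, LocPair.smul_fst, Pi.add_apply, Pi.smul_apply, smul_eq_mul,
      antiKernel]
    ring
  have hks : ∀ z : ℂ, z.im ≠ 0 → (k z).IsSolution z := fun z hz =>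
    ((hψ.isSolution z hz).smul _).add ((hφ.isSolution z (ne_zero_of_im hz)).smul _)
  have hk0 : ∀ z, (k z).fst x = 0 := fun z => by rw [hk1, antiKernel]; ring
  have hkq : ∀ z : ℂ, z.im ≠ 0 → (k z).qd x = -z⁻¹ := by
    intro z hz
    rw [← hψ.wronskian z hz x]
    simp only [k, LocPair.add_qd, LocPair.smul_qd, Pi.add_apply, Pi.smul_apply, smul_eq_mul]
    ring
  have hb : ∀ z : ℂ, z.im ≠ 0 → p ≤ ‖z‖ → ‖z‖ ≤ R → ∀ s ∈ Icc x y, ‖(k z).fst s‖ ≤ K * p⁻¹ := by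
    intro z hz hpz hzR s hs
    have h1 := hK z (k z) 0 hzR le_rfl (fun t _ => by
      rw [(hks z hz).snd_apply, sub_self, norm_zero]) s hs
    rw [hk0, hkq z hz, norm_zero, norm_neg, norm_inv, zero_add, add_zero] at h1
    have h2 : ‖z‖⁻¹ ≤ p⁻¹ := inv_anti₀ hp hpz
    exact (le_add_of_nonneg_right (norm_nonneg _)).trans
      (h1.trans (mul_le_mul_of_nonneg_left h2 hK0))
  refine ⟨max (K * p⁻¹) (K * (2 * (p⁻¹ * p⁻¹) + 2 * (K * p⁻¹))), le_max_of_le_left (by positivity),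
    fun z hz hpz hzR => ⟨?_, ?_⟩⟩
  · rw [← hk1]
    exact (hb z hz hpz hzR y (right_mem_Icc.2 hxy)).trans (le_max_left _ _)
  have hz' : (conj z).im ≠ 0 := by rwa [Complex.conj_im, neg_ne_zero]
  have hnz : ‖conj z‖ = ‖z‖ := Complex.norm_conj z
  have hzz : ‖z - conj z‖ = 2 * |z.im| := by
    rw [Complex.sub_conj, norm_mul, Complex.norm_I, mul_one, Complex.norm_real, Real.norm_eq_abs,
      abs_mul, abs_two]
  let d : T.LocPair := (k z).add ((k (conj z)).smul (-1))
  have hd1 : ∀ s, d.fst s = (k z).fst s - (k (conj z)).fst s := fun s => by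
    simp [d, sub_eq_add_neg]
  have hdq : d.qd x = -z⁻¹ + (conj z)⁻¹ := by
    simp [d, hkq z hz, hkq _ hz']
  have hds : ∀ s ∈ Icc x y, ‖d.snd s - z * d.fst s‖ ≤ 2 * (K * p⁻¹) * |z.im| := by
    intro s hs
    have e : d.snd s - z * d.fst s = (z - conj z) * (k (conj z)).fst s := by
      rw [hd1]
      simp only [d, LocPair.add_snd, LocPair.smul_snd, Pi.add_apply, Pi.smul_apply, smul_eq_mul,
        (hks z hz).snd_apply, (hks _ hz').snd_apply]
      ring
    rw [e, norm_mul, hzz]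
    have := hb _ hz' (hnz.symm ▸ hpz) (hnz.symm ▸ hzR) s hs
    nlinarith [abs_nonneg z.im]
  have h1 := hK z d _ hzR (by positivity) hds y (right_mem_Icc.2 hxy)
  have h2 : ‖d.qd x‖ ≤ 2 * (p⁻¹ * p⁻¹) * |z.im| := by
    have hz0 := ne_zero_of_im hz
    have hz0' := ne_zero_of_im hz'
    have e : d.qd x = (z - conj z) * (z⁻¹ * (conj z)⁻¹) := by
      rw [hdq]
      field_simp
      ring
    rw [e, norm_mul, norm_mul, norm_inv, norm_inv, hnz, hzz]
    have h3 : ‖z‖⁻¹ ≤ p⁻¹ := inv_anti₀ hp hpz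
    have h4 : ‖z‖⁻¹ * ‖z‖⁻¹ ≤ p⁻¹ * p⁻¹ := mul_le_mul h3 h3 (by positivity) (by positivity)
    nlinarith [abs_nonneg z.im]
  have h5 : d.fst x = 0 := by rw [hd1, hk0, hk0, sub_zero]
  rw [h5, norm_zero, zero_add] at h1
  rw [← hk1, ← hk1, ← hd1]
  calc ‖d.fst y‖ ≤ ‖d.fst y‖ + ‖d.qd y‖ := le_add_of_nonneg_right (norm_nonneg _)
    _ ≤ K * (2 * (p⁻¹ * p⁻¹) * |z.im| + 2 * (K * p⁻¹) * |z.im|) :=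
      h1.trans (mul_le_mul_of_nonneg_left (add_le_add_left h2 _) hK0)
    _ = K * (2 * (p⁻¹ * p⁻¹) + 2 * (K * p⁻¹)) * |z.im| := by ring
    _ ≤ _ := mul_le_mul_of_nonneg_right (le_max_right _ _) (abs_nonneg _)

lemma exists_bound_antiKernel (hφ : IsRealAnalyticFamily va φ)
    {hS : IsEssSelfAdjointRel (sepRelation va vb)} {ψ : ℂ → T.LocPair} (hψ : IsKernel φ hS ψ)
    (x y : Ivl a b) {p R : ℝ} (hp : 0 < p) (hR : 0 ≤ R) :
    ∃ C, 0 ≤ C ∧ ∀ z : ℂ, z.im ≠ 0 → p ≤ ‖z‖ → ‖z‖ ≤ R → ‖antiKernel φ ψ x y z‖ ≤ C ∧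
      ‖antiKernel φ ψ x y z - antiKernel φ ψ x y (conj z)‖ ≤ C * |z.im| := by
  rcases le_total x y with hxy | hxy
  · exact hφ.exists_bound_antiKernel_of_le hψ hxy hp hR
  · obtain ⟨C, hC, h⟩ := hφ.exists_bound_antiKernel_of_le hψ hxy hp hR
    refine ⟨C, hC, fun z hz h1 h2 => ?_⟩
    rw [antiKernel_symm, antiKernel_symm φ ψ x y (conj z), norm_neg, neg_sub_neg, norm_sub_rev]
    exact h z hz h1 h2

end IsRealAnalyticFamily

end Coefficients

end LeftDefinite

end

noncomputable section

namespace LeftDefinite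

/-! ### Functions that are regular across the punctured real line -/

/-- On `p ≤ |l| ≤ q` the function is bounded and its jump across the real line is `O(ε)` at height
`ε`. -/
def RegularAcross (p q : ℝ) (r : ℂ → ℂ) : Prop :=
  ∃ C, 0 ≤ C ∧ ∀ l : ℝ, p ≤ |l| → |l| ≤ q → ∀ ε : ℝ, 0 < ε → ε ≤ 1 →
    ‖r (l + ε * Complex.I)‖ ≤ C ∧ ‖r (l - ε * Complex.I)‖ ≤ C ∧
      ‖r (l + ε * Complex.I) - r (l - ε * Complex.I)‖ ≤ C * ε

lemma RegularAcross.add {p q : ℝ} {r s : ℂ → ℂ} (hr : RegularAcross p q r)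
    (hs : RegularAcross p q s) : RegularAcross p q (fun z => r z + s z) := by
  obtain ⟨C, hC, h⟩ := hr
  obtain ⟨D, hD, k⟩ := hs
  refine ⟨C + D, add_nonneg hC hD, fun l h1 h2 ε h3 h4 => ?_⟩
  obtain ⟨a1, a2, a3⟩ := h l h1 h2 ε h3 h4
  obtain ⟨b1, b2, b3⟩ := k l h1 h2 ε h3 h4
  refine ⟨norm_add_le_of_le a1 b1, norm_add_le_of_le a2 b2, ?_⟩
  rw [add_sub_add_comm, add_mul]
  exact norm_add_le_of_le a3 b3

lemma RegularAcross.mul {p q : ℝ} {r s : ℂ → ℂ} (hr : RegularAcross p q r)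
    (hs : RegularAcross p q s) : RegularAcross p q (fun z => r z * s z) := by
  obtain ⟨C, hC, h⟩ := hr
  obtain ⟨D, hD, k⟩ := hs
  have hCD : 0 ≤ C * D := mul_nonneg hC hD
  refine ⟨2 * (C * D), by positivity, fun l h1 h2 ε h3 h4 => ?_⟩
  obtain ⟨a1, a2, a3⟩ := h l h1 h2 ε h3 h4
  obtain ⟨b1, b2, b3⟩ := k l h1 h2 ε h3 h4
  refine ⟨?_, ?_, ?_⟩
  · rw [norm_mul]
    exact (mul_le_mul a1 b1 (norm_nonneg _) hC).trans (by linarith)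
  · rw [norm_mul]
    exact (mul_le_mul a2 b2 (norm_nonneg _) hC).trans (by linarith)
  · have e : ∀ u v u' v' : ℂ, u * v - u' * v' = u * (v - v') + (u - u') * v' := by
      intros
      ring
    rw [e]
    refine (norm_add_le_of_le ((norm_mul_le _ _).trans (mul_le_mul a1 b3 (norm_nonneg _) hC))
      ((norm_mul_le _ _).trans (mul_le_mul a3 b2 (norm_nonneg _) (by positivity)))).trans ?_
    exact le_of_eq (by ring)

lemma RegularAcross.const (p q : ℝ) (c : ℂ) : RegularAcross p q (fun _ => c) :=
  ⟨‖c‖, norm_nonneg c, fun l _ _ ε h3 _ => ⟨le_rfl, le_rfl, by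
    rw [sub_self, norm_zero]; positivity⟩⟩

lemma exists_lipschitz_across {f : ℂ → ℂ} (hf : DifferentiableOn ℂ f {0}ᶜ) {p : ℝ} (hp : 0 < p)
    (q : ℝ) : ∃ C, 0 ≤ C ∧ ∀ l : ℝ, p ≤ |l| → |l| ≤ q → ∀ ε : ℝ, |ε| ≤ 1 →
      ‖f (l + ε * Complex.I)‖ ≤ C ∧ ‖f (l + ε * Complex.I) - f l‖ ≤ C * |ε| := by
  have ho : IsOpen ({0}ᶜ : Set ℂ) := isOpen_compl_singleton
  let K : Set ℂ := {z | p ≤ |z.re| ∧ |z.re| ≤ q ∧ |z.im| ≤ 1}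
  have hK0 : K ⊆ {0}ᶜ := by
    rintro z ⟨h1, -, -⟩ (rfl : z = 0)
    simp at h1
    linarith
  have hKc : IsCompact K := by
    refine Metric.isCompact_of_isClosed_isBounded ?_ ?_
    · exact (isClosed_le continuous_const (continuous_abs.comp Complex.continuous_re)).inter
        ((isClosed_le (continuous_abs.comp Complex.continuous_re) continuous_const).inter
        (isClosed_le (continuous_abs.comp Complex.continuous_im) continuous_const))
    · refine Metric.isBounded_iff_subset_closedBall 0 |>.2 ⟨q + 1, fun z hz => ?_⟩
      rw [mem_closedBall_zero_iff]
      exact (Complex.norm_le_abs_re_add_abs_im z).trans (add_le_add hz.2.1 hz.2.2)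
  obtain ⟨C, hC⟩ := hKc.exists_bound_of_continuousOn (hf.continuousOn.mono hK0)
  obtain ⟨D, hD⟩ := hKc.exists_bound_of_continuousOn ((hf.deriv ho).continuousOn.mono hK0)
  refine ⟨max 0 (max C D), le_max_left _ _, fun l h1 h2 ε h3 => ⟨?_, ?_⟩⟩
  · exact (hC _ ⟨by simpa using h1, by simpa using h2, by simpa using h3⟩).trans
      ((le_max_left _ _).trans (le_max_right _ _))
  · let s : Set ℂ := {z | z.re = l ∧ |z.im| ≤ 1}
    have hsK : s ⊆ K := by
      rintro z ⟨e1, e2⟩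
      exact ⟨by rwa [e1], by rwa [e1], e2⟩
    have hs : Convex ℝ s := by
      have e : s = Complex.reLm ⁻¹' {l} ∩ Complex.imLm ⁻¹' (Icc (-1) 1) := by
        ext z
        simp [s, abs_le]
      rw [e]
      exact ((convex_singleton l).linear_preimage _).inter ((convex_Icc _ _).linear_preimage _)
    have := hs.norm_image_sub_le_of_norm_deriv_le (f := f) (C := max 0 (max C D))
      (x := (l : ℂ)) (y := l + ε * Complex.I)
      (fun z hz => hf.differentiableAt (ho.mem_nhds (hK0 (hsK hz))))
      (fun z hz => (hD z (hsK hz)).trans ((le_max_right _ _).trans (le_max_right _ _)))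
      ⟨by simp, by simp⟩ ⟨by simp, by simpa using h3⟩
    simpa using this

lemma RegularAcross.of_differentiableOn {f : ℂ → ℂ} (hf : DifferentiableOn ℂ f {0}ᶜ) {p : ℝ}
    (hp : 0 < p) (q : ℝ) : RegularAcross p q f := by
  obtain ⟨C, hC, h⟩ := exists_lipschitz_across hf hp q
  refine ⟨2 * C, by positivity, fun l h1 h2 ε h3 h4 => ?_⟩
  have hε : |ε| = ε := abs_of_pos h3
  obtain ⟨a1, a2⟩ := h l h1 h2 ε (by rwa [hε])
  obtain ⟨b1, b2⟩ := h l h1 h2 (-ε) (by rwa [abs_neg, hε])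
  have e : (l : ℂ) + ((-ε : ℝ) : ℂ) * Complex.I = l - ε * Complex.I := by
    push_cast
    ring
  rw [e] at b1 b2
  rw [abs_neg, hε] at b2
  rw [hε] at a2
  refine ⟨a1.trans (by linarith), b1.trans (by linarith), ?_⟩
  have := norm_sub_le_of_le a2 b2
  rw [sub_sub_sub_cancel_right] at this
  linarith

namespace Coefficients

variable {a b : EReal} {T : Coefficients a b}

namespace IsRealAnalyticFamily

variable {va vb : T.LocPair} {φ : ℂ → T.LocPair}

lemma regularAcross_antiKernel (hφ : IsRealAnalyticFamily va φ)
    {hS : IsEssSelfAdjointRel (sepRelation va vb)} {ψ : ℂ → T.LocPair} (hψ : IsKernel φ hS ψ)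
    (x y : Ivl a b) {p q : ℝ} (hp : 0 < p) (hq : 0 ≤ q) :
    RegularAcross p q (antiKernel φ ψ x y) := by
  obtain ⟨C, hC, h⟩ := hφ.exists_bound_antiKernel hψ x y hp (R := q + 1) (by positivity)
  refine ⟨C, hC, fun l h1 h2 ε h3 h4 => ?_⟩
  have hb : ∀ s : ℝ, |s| ≤ 1 → p ≤ ‖(l : ℂ) + s * Complex.I‖ ∧ ‖(l : ℂ) + s * Complex.I‖ ≤ q + 1 := by
    intro s hs
    constructor
    · refine h1.trans ?_
      simpa using Complex.abs_re_le_norm ((l : ℂ) + s * Complex.I)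
    · refine (Complex.norm_le_abs_re_add_abs_im _).trans ?_
      simpa using add_le_add h2 hs
  have e : (l : ℂ) + ((-ε : ℝ) : ℂ) * Complex.I = l - ε * Complex.I := by
    push_cast
    ring
  have hε : |ε| = ε := abs_of_pos h3
  have e1 := hb ε (by rwa [hε])
  have e2 := hb (-ε) (by rwa [abs_neg, hε])
  rw [e] at e2
  have e3 : conj ((l : ℂ) + ε * Complex.I) = l - ε * Complex.I := by
    simp [sub_eq_add_neg]
  have k1 := h _ (by simpa using h3.ne') e1.1 e1.2
  have k2 := h (l - ε * Complex.I) (by simpa using h3.ne') e2.1 e2.2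
  refine ⟨k1.1, k2.1, ?_⟩
  have := k1.2
  rw [e3] at this
  simpa [hε] using this

/-- The analytic continuation of `|φ_t(α) + s φ_t(β)|²`. -/
def density (φ : ℂ → T.LocPair) (α β : Ivl a b) (s z : ℂ) : ℂ :=
  ((φ z).fst α + s * (φ z).fst β) * ((φ z).fst α + conj s * (φ z).fst β)

lemma differentiableOn_density (hφ : IsRealAnalyticFamily va φ) (α β : Ivl a b) (s : ℂ) :
    DifferentiableOn ℂ (density φ α β s) {0}ᶜ :=
  ((hφ.differentiable_fst α).add ((hφ.differentiable_fst β).const_mul s)).mul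
    ((hφ.differentiable_fst α).add ((hφ.differentiable_fst β).const_mul (conj s)))

lemma density_ofReal (hφ : IsRealAnalyticFamily va φ) (α β : Ivl a b) (s : ℂ) {t : ℝ}
    (ht : t ≠ 0) : density φ α β s t = ((‖(φ t).fst α + s * (φ t).fst β‖ ^ 2 : ℝ) : ℂ) := by
  have h : ∀ c, conj ((φ t).fst c) = (φ t).fst c := fun c => by
    rw [← hφ.real_fst c t (by exact_mod_cast ht), Complex.conj_ofReal]
  rw [density, Complex.ofReal_pow, ← Complex.mul_conj', map_add, map_mul, h, h]

lemma density_zero (φ : ℂ → T.LocPair) (x y : Ivl a b) (z : ℂ) :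
    density φ x y 0 z = (φ z).fst x * (φ z).fst x := by
  simp [density]

/-- The Stieltjes inversion behind the spectral measure: the measures `ν_f` of
`f = δ_α + s δ_β` and `ν_x` of `δ_x` satisfy `φ_t(x)² dν_f = |φ_t(α) + s φ_t(β)|² dν_x` away
from `0`. -/
theorem integral_density_eq (hφ : IsRealAnalyticFamily va φ) (hva : IsBoundaryFunctionLeft va)
    (hvb : IsBoundaryFunctionRight vb) (hS : IsEssSelfAdjointRel (sepRelation va vb))
    {α β : Ivl a b} (hαβ : α ≤ β) (s : ℂ) (x y : Ivl a b) {f : T.H1}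
    (hf : f = H1.delta α + s • H1.delta β) {νf νx : Measure ℝ} [IsFiniteMeasure νf]
    [IsFiniteMeasure νx]
    (h1 : ∀ z (hz : z.im ≠ 0), inner ℂ f (hS.res hz f) = ∫ t : ℝ, ((t : ℂ) - z)⁻¹ ∂νf)
    (h2 : ∀ z (hz : z.im ≠ 0), inner ℂ (H1.delta x) (hS.res hz (H1.delta x)) =
      ∫ t : ℝ, ((t : ℂ) - z)⁻¹ ∂νx) {h : ℝ → ℂ} (hh : Continuous h) (hc : HasCompactSupport h)
    (h0 : (0 : ℝ) ∉ tsupport h) :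
    ∫ t, h t * density φ x y 0 t ∂νf = ∫ t, h t * density φ α β s t ∂νx := by
  obtain ⟨ψ, hψ⟩ := hφ.exists_isKernel hva hvb hS
  obtain ⟨p, hp, hp'⟩ : ∃ p : ℝ, 0 < p ∧ ∀ l, h l ≠ 0 → p ≤ |l| := by
    obtain ⟨p, hp, hp'⟩ := Metric.isOpen_iff.1 (isClosed_tsupport h).isOpen_compl 0 h0
    refine ⟨p, hp, fun l hl => not_lt.1 fun hlt => ?_⟩
    exact hp' (by simpa using hlt) (subset_tsupport _ hl)
  obtain ⟨q, hq⟩ : ∃ q : ℝ, ∀ l, h l ≠ 0 → |l| ≤ q := by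
    obtain ⟨q, hq⟩ := hc.isCompact.isBounded.exists_norm_le
    exact ⟨q, fun l hl => hq l (subset_tsupport _ hl)⟩
  have hq0 : 0 ≤ max q 0 := le_max_right _ _
  have hq' : ∀ l, h l ≠ 0 → |l| ≤ max q 0 := fun l hl => (hq l hl).trans (le_max_left _ _)
  have hcont : ∀ (α β : Ivl a b) (s : ℂ), Continuous fun l : ℝ => h l * density φ α β s l := by
    intro α β s
    rw [continuous_iff_continuousAt]
    intro l
    by_cases hl : l = 0
    · subst hl
      have e : (fun l : ℝ => h l * density φ α β s l) =ᶠ[𝓝 0] fun _ => 0 := by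
        filter_upwards [(isClosed_tsupport h).isOpen_compl.mem_nhds h0] with l hl
        rw [image_eq_zero_of_notMem_tsupport hl, zero_mul]
      exact continuousAt_const.congr e.symm
    · have hl' : (l : ℂ) ∈ ({0}ᶜ : Set ℂ) := by simpa using hl
      refine hh.continuousAt.mul (ContinuousAt.comp (g := density φ α β s)
        (f := fun l : ℝ => (l : ℂ)) ?_
        Complex.continuous_ofReal.continuousAt)
      exact ((hφ.differentiableOn_density α β s).continuousOn).continuousAt
        (isOpen_compl_singleton.mem_nhds hl')
  obtain ⟨C₁, hC₁, k1⟩ := exists_lipschitz_across (hφ.differentiableOn_density x y 0) hp (max q 0)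
  obtain ⟨C₂, hC₂, k2⟩ := exists_lipschitz_across (hφ.differentiableOn_density α β s) hp (max q 0)
  let r : ℂ → ℂ := fun z => (φ z).fst x * ((φ z).fst α * antiKernel φ ψ x α z +
    (s + conj s) * ((φ z).fst α * antiKernel φ ψ x β z) +
      s * conj s * ((φ z).fst β * antiKernel φ ψ x β z)) +
    (-z⁻¹ * (density φ x y 0 z * inner ℂ f f -
      density φ α β s z * inner ℂ (H1.delta x : T.H1) (H1.delta x)))
  have hr : RegularAcross p (max q 0) r := by
    have hd : ∀ c, RegularAcross p (max q 0) (fun z => (φ z).fst c) := fun c =>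
      .of_differentiableOn (hφ.differentiable_fst c) hp _
    have hK : ∀ u v, RegularAcross p (max q 0) (antiKernel φ ψ u v) := fun u v =>
      hφ.regularAcross_antiKernel hψ u v hp hq0
    refine .add (.mul (hd x) (.add (.add (.mul (hd α) (hK x α)) (.mul (.const _ _ _)
      (.mul (hd α) (hK x β)))) (.mul (.const _ _ _) (.mul (hd β) (hK x β)))))
      (.of_differentiableOn ?_ hp _)
    exact (differentiableOn_inv.neg).mul
      (((hφ.differentiableOn_density x y 0).mul_const _).sub
        ((hφ.differentiableOn_density α β s).mul_const _))
  obtain ⟨C₃, hC₃, k3⟩ := hr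
  have m1 : C₁ ≤ max C₁ (max C₂ C₃) := le_max_left _ _
  have m2 : C₂ ≤ max C₁ (max C₂ C₃) := (le_max_left _ _).trans (le_max_right _ _)
  have m3 : C₃ ≤ max C₁ (max C₂ C₃) := (le_max_right _ _).trans (le_max_right _ _)
  refine integral_eq_of_stieltjes (r := r) (C := max C₁ (max C₂ C₃)) hc (hcont _ _ _) (hcont _ _ _)
    hh (hC₁.trans m1) ?_ ?_ ?_ ?_
  · intro l hl ε hε
    exact (k1 l (hp' l hl) (hq' l hl) ε hε).2.trans (mul_le_mul_of_nonneg_right m1 (abs_nonneg _))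
  · intro l hl ε hε
    exact (k2 l (hp' l hl) (hq' l hl) ε hε).2.trans (mul_le_mul_of_nonneg_right m2 (abs_nonneg _))
  · intro l hl ε hε hε'
    exact (k3 l (hp' l hl) (hq' l hl) ε hε hε').2.2.trans (mul_le_mul_of_nonneg_right m3 hε.le)
  · intro z hz
    have hG := hψ.inner_res z hz
    have hff : inner ℂ f f = inner ℂ (H1.delta α : T.H1) (H1.delta α) +
        s * inner ℂ (H1.delta α : T.H1) (H1.delta β) +
        (conj s * inner ℂ (H1.delta β : T.H1) (H1.delta α) +
        s * conj s * inner ℂ (H1.delta β : T.H1) (H1.delta β)) := by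
      rw [hf]
      simp only [inner_add_left, inner_add_right, inner_smul_left, inner_smul_right]
      ring
    rw [← h1 z hz, ← h2 z hz]
    simp only [r]
    rw [hff, hf]
    simp only [map_add, map_smul, inner_add_left, inner_add_right, inner_smul_left,
      inner_smul_right, hG, min_self, max_self, min_eq_left hαβ, max_eq_right hαβ,
      min_eq_right hαβ, max_eq_left hαβ, density, antiKernel, map_zero]
    ring

end IsRealAnalyticFamily

end Coefficients

end LeftDefinite

end

noncomputable section

namespace LeftDefinite

/-! ### Patching measures with prescribed densities -/

section Patching

variable {X : Type*} [MeasurableSpace X] {d : ℕ → X → ℝ≥0∞}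

/-- The part of `{d j ≠ 0}` on which all previous `d i` vanish. -/
def firstNonzero {X : Type*} (d : ℕ → X → ℝ≥0∞) : ℕ → Set X := disjointed fun j => {t | d j t ≠ 0}

lemma measurableSet_firstNonzero (hd : ∀ j, Measurable (d j)) (j : ℕ) :
    MeasurableSet (firstNonzero d j) :=
  MeasurableSet.disjointed (fun i => (hd i) (measurableSet_singleton 0).compl) j

lemma ne_zero_of_mem_firstNonzero {X : Type*} {d : ℕ → X → ℝ≥0∞} {j : ℕ} {t : X}
    (ht : t ∈ firstNonzero d j) : d j t ≠ 0 :=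
  disjointed_subset (fun j => {t | d j t ≠ 0}) j ht

lemma sum_restrict_firstNonzero (hd : ∀ j, Measurable (d j)) (h0 : ∀ t, ∃ j, d j t ≠ 0)
    (μ : Measure X) : (Measure.sum fun j => μ.restrict (firstNonzero d j)) = μ := by
  rw [← Measure.restrict_iUnion (s := firstNonzero d) (disjoint_disjointed _)
    (measurableSet_firstNonzero hd)]
  have : (⋃ j, firstNonzero d j) = univ := by
    rw [firstNonzero, iUnion_disjointed, eq_univ_iff_forall]
    exact fun t => mem_iUnion.2 (h0 t)
  rw [this, Measure.restrict_univ]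

lemma withDensity_inv_restrict_firstNonzero (hd : ∀ j, Measurable (d j))
    (hfin : ∀ j t, d j t ≠ ∞) (μ : Measure X) (j : ℕ) :
    ((μ.withDensity (d j)).restrict (firstNonzero d j)).withDensity (fun t => (d j t)⁻¹) =
      μ.restrict (firstNonzero d j) := by
  rw [restrict_withDensity (measurableSet_firstNonzero hd j)]
  refine withDensity_inv_same (hd j) ?_ (ae_of_all _ fun t => hfin j t)
  exact (ae_restrict_mem (measurableSet_firstNonzero hd j)).mono fun t =>
    ne_zero_of_mem_firstNonzero

lemma eq_sum_withDensity (hd : ∀ j, Measurable (d j)) (hfin : ∀ j t, d j t ≠ ∞)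
    (h0 : ∀ t, ∃ j, d j t ≠ 0) (μ : Measure X) :
    μ = Measure.sum fun j => ((μ.withDensity (d j)).restrict (firstNonzero d j)).withDensity
      (fun t => (d j t)⁻¹) := by
  simp only [withDensity_inv_restrict_firstNonzero hd hfin]
  exact (sum_restrict_firstNonzero hd h0 μ).symm

lemma ext_of_withDensity (hd : ∀ j, Measurable (d j)) (hfin : ∀ j t, d j t ≠ ∞)
    (h0 : ∀ t, ∃ j, d j t ≠ 0) {μ₁ μ₂ : Measure X}
    (h : ∀ j, μ₁.withDensity (d j) = μ₂.withDensity (d j)) : μ₁ = μ₂ := by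
  rw [eq_sum_withDensity hd hfin h0 μ₁, eq_sum_withDensity hd hfin h0 μ₂]
  simp only [h]

lemma sFinite_of_withDensity (hd : ∀ j, Measurable (d j)) (hfin : ∀ j t, d j t ≠ ∞)
    (h0 : ∀ t, ∃ j, d j t ≠ 0) {μ : Measure X}
    (h : ∀ j, IsFiniteMeasure (μ.withDensity (d j))) : SFinite μ := by
  rw [eq_sum_withDensity hd hfin h0 μ]
  infer_instance

lemma exists_measure_withDensity {ι : Type*} {d : ι → X → ℝ≥0∞} {ν : ι → Measure X}
    (hd : ∀ i, Measurable (d i)) (hfin : ∀ i t, d i t ≠ ∞) {x : ℕ → ι}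
    (h0 : ∀ t, ∃ j, d (x j) t ≠ 0)
    (h : ∀ i j, (ν i).withDensity (d (x j)) = (ν (x j)).withDensity (d i)) :
    ∃ μ : Measure X, ∀ i, μ.withDensity (d i) = ν i := by
  have hA := measurableSet_firstNonzero fun j => hd (x j)
  refine ⟨Measure.sum fun j => ((ν (x j)).restrict (firstNonzero (fun j => d (x j)) j)).withDensity
    (fun t => (d (x j) t)⁻¹), fun i => ?_⟩
  rw [withDensity_sum]
  conv_rhs => rw [eq_sum_withDensity (fun j => hd (x j)) (fun j => hfin (x j)) h0 (ν i)]
  congr 1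
  funext j
  have hm : Measurable fun t => (d (x j) t)⁻¹ := (hd (x j)).inv
  rw [← withDensity_mul _ hm (hd i), mul_comm, withDensity_mul _ (hd i) hm,
    ← restrict_withDensity (hA j), h]

end Patching

/-! ### The measures of a relation do not charge the origin -/

lemma IsEssSelfAdjointRel.measure_singleton_zero {H : Type*} [NormedAddCommGroup H]
    [InnerProductSpace ℂ H] [CompleteSpace H] {S : Submodule ℂ (H × H)}
    (hS : IsEssSelfAdjointRel S) (h0 : ¬ ZeroIsEigenvalue S) {f : H} {ν : Measure ℝ}
    [IsFiniteMeasure ν] (hν : ∀ (z : ℂ) (hz : z.im ≠ 0),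
      inner ℂ f (hS.res hz f) = ∫ t : ℝ, ((t : ℂ) - z)⁻¹ ∂ν) : ν {0} = 0 := by
  let ε : ℕ → ℝ := fun n => 1 / ((n : ℝ) + 1)
  have hε : ∀ n, 0 < ε n := fun n => Nat.one_div_pos_of_nat
  have hlim : Tendsto ε atTop (𝓝 0) := tendsto_one_div_add_atTop_nhds_zero_nat
  have him : ∀ n, ((ε n : ℂ) * Complex.I).im ≠ 0 := fun n => by simpa using (hε n).ne'
  have h1 := (tendsto_const_nhds (x := f)).inner (𝕜 := ℂ) (hS.tendsto_smul_res h0 f hε hlim him)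
  simp only [inner_smul_right, hν, inner_zero_right, ← integral_const_mul] at h1
  have h2 : Tendsto (fun n => ∫ t : ℝ, (ε n : ℂ) * ((t : ℂ) - ε n * Complex.I)⁻¹ ∂ν) atTop
      (𝓝 (∫ t : ℝ, ({0} : Set ℝ).indicator (fun _ => Complex.I) t ∂ν)) := by
    refine tendsto_integral_of_dominated_convergence (fun _ => 1) (fun n => ?_)
      (integrable_const 1) (fun n => ae_of_all _ fun t => ?_) (ae_of_all _ fun t => ?_)
    · exact (((Complex.measurable_ofReal.sub_const _).inv).const_mul _).aestronglyMeasurable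
    · have := norm_inv_sub_le (him n) t
      rw [norm_mul, Complex.norm_real, Real.norm_eq_abs, abs_of_pos (hε n)]
      have e : |((ε n : ℂ) * Complex.I).im| = ε n := by simpa using (hε n).le
      rw [e] at this
      exact (mul_le_mul_of_nonneg_left this (hε n).le).trans
        (mul_inv_cancel₀ (hε n).ne').le
    · by_cases ht : t = 0
      · subst ht
        refine tendsto_const_nhds.congr fun n => ?_
        have : (ε n : ℂ) ≠ 0 := by exact_mod_cast (hε n).ne'
        rw [indicator_of_mem (mem_singleton _), Complex.ofReal_zero, zero_sub]
        field_simp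
        simp
      · rw [indicator_of_notMem (by simpa using ht)]
        have hc : Tendsto (fun n => (ε n : ℂ)) atTop (𝓝 0) := by
          exact_mod_cast (Complex.continuous_ofReal.tendsto 0).comp hlim
        have ht' : (t : ℂ) - 0 * Complex.I ≠ 0 := by simpa using ht
        simpa using hc.mul ((tendsto_const_nhds.sub (hc.mul_const Complex.I)).inv₀ ht')
  have h3 := tendsto_nhds_unique h1 h2
  rw [integral_indicator (measurableSet_singleton 0), setIntegral_const] at h3
  have h4 : ν.real {0} = 0 := by simpa using h3.symm
  exact (measureReal_eq_zero_iff).1 h4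

/-! ### The punctured real line -/

instance : LocallyCompactSpace RealCross :=
  (isOpen_compl_singleton (x := (0 : ℝ))).locallyCompactSpace

lemma measurableSet_ne_zero : MeasurableSet {t : ℝ | t ≠ 0} := (measurableSet_singleton 0).compl

lemma measurableEmbedding_realCross : MeasurableEmbedding (Subtype.val : RealCross → ℝ) :=
  MeasurableEmbedding.subtype_coe measurableSet_ne_zero

lemma integral_comap_realCross {ν : Measure ℝ} (h : ℝ → ℂ) (h0 : ν {0} = 0 ∨ h 0 = 0) :
    ∫ t : RealCross, h t ∂(ν.comap Subtype.val) = ∫ t, h t ∂ν := by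
  refine (integral_subtype_comap measurableSet_ne_zero h).trans ?_
  rcases h0 with h0 | h0
  · rw [Measure.restrict_eq_self_of_ae_mem]
    rw [ae_iff]
    simpa using h0
  · refine setIntegral_eq_integral_of_forall_compl_eq_zero fun t ht => ?_
    have : t = 0 := by simpa using ht
    rw [this, h0]

lemma exists_extension (g : CompactlySupportedContinuousMap RealCross ℝ) : ∃ h : ℝ → ℂ,
    Continuous h ∧ HasCompactSupport h ∧ (0 : ℝ) ∉ tsupport h ∧ h 0 = 0 ∧
      ∀ t : RealCross, h t = (g t : ℂ) := by
  let g' : RealCross → ℂ := fun t => (g t : ℂ)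
  have hg' : Continuous g' := Complex.continuous_ofReal.comp g.continuous
  have hgc : HasCompactSupport g' := g.hasCompactSupport.comp_left Complex.ofReal_zero
  let h : ℝ → ℂ := Function.extend Subtype.val g' 0
  have hext : ∀ t : RealCross, h t = g' t := fun t =>
    Subtype.val_injective.extend_apply g' 0 t
  have hK : IsCompact (Subtype.val '' tsupport g') := hgc.isCompact.image continuous_subtype_val
  have h0 : h 0 = 0 := Function.extend_apply' _ _ _ (by
    rintro ⟨t, ht⟩
    exact t.2 ht)
  have hsupp : Function.support h ⊆ Subtype.val '' tsupport g' := by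
    intro t ht
    have ht0 : t ≠ 0 := by
      rintro rfl
      exact ht h0
    refine ⟨⟨t, ht0⟩, subset_tsupport _ ?_, rfl⟩
    rw [Function.mem_support, ← hext]
    exact ht
  refine ⟨h, ?_, HasCompactSupport.of_support_subset_isCompact hK hsupp, fun hmem => ?_, h0, hext⟩
  · exact HasCompactSupport.continuous_extend_zero (U := {t : ℝ | t ≠ 0}) isOpen_compl_singleton
      hg' hgc
  · obtain ⟨t, -, ht⟩ := closure_minimal hsupp hK.isClosed hmem
    exact t.2 ht

namespace Coefficients

variable {a b : EReal} {T : Coefficients a b}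

lemma nonempty_ivl (T : Coefficients a b) : Nonempty (Ivl a b) := by
  by_contra h
  rw [not_nonempty_iff] at h
  exact T.chi_ne_zero (Measure.eq_zero_of_isEmpty _)

namespace IsRealAnalyticFamily

variable {va vb : T.LocPair} {φ : ℂ → T.LocPair}

lemma exists_seq_fst_ne_zero (hφ : IsRealAnalyticFamily va φ) :
    ∃ x : ℕ → Ivl a b, ∀ z, z ≠ 0 → ∃ j, (φ z).fst (x j) ≠ 0 := by
  have := T.nonempty_ivl
  obtain ⟨x, hx⟩ := TopologicalSpace.exists_dense_seq (Ivl a b)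
  refine ⟨x, fun z hz => ?_⟩
  obtain ⟨c, hc⟩ := Function.ne_iff.1 (hφ.nontrivial z hz)
  have h1 := ((φ z).hasDensity_fst.tendsto_left c).eventually_ne hc
  obtain ⟨y, hy, hyc⟩ := (mem_nhdsLT_iff_exists_Ioo_subset (a := c)).1 h1
  obtain ⟨j, hj⟩ := hx.exists_mem_open isOpen_Ioo (nonempty_Ioo.2 hy)
  exact ⟨j, hyc hj⟩

lemma continuous_fst (hφ : IsRealAnalyticFamily va φ) (c : Ivl a b) :
    Continuous fun t : RealCross => (φ ((t : ℝ) : ℂ)).fst c := by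
  refine (hφ.differentiable_fst c).continuousOn.comp_continuous
    (Complex.continuous_ofReal.comp continuous_subtype_val) fun t => ?_
  simpa using t.2

/-- The density `|φ_t(α) + s φ_t(β)|²` on the punctured real line. -/
def nnDensity (φ : ℂ → T.LocPair) (α β : Ivl a b) (s : ℂ) (t : RealCross) : NNReal :=
  ‖(φ ((t : ℝ) : ℂ)).fst α + s * (φ ((t : ℝ) : ℂ)).fst β‖₊ ^ 2

lemma continuous_nnDensity (hφ : IsRealAnalyticFamily va φ) (α β : Ivl a b) (s : ℂ) :
    Continuous (nnDensity φ α β s) :=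
  (((hφ.continuous_fst α).add (continuous_const.mul (hφ.continuous_fst β))).nnnorm).pow 2

lemma density_eq_nnDensity (hφ : IsRealAnalyticFamily va φ) (α β : Ivl a b) (s : ℂ)
    (t : RealCross) : density φ α β s (t : ℝ) = ((nnDensity φ α β s t : ℝ) : ℂ) := by
  rw [hφ.density_ofReal α β s t.2]
  simp [nnDensity]

lemma withDensity_comap_eq (hφ : IsRealAnalyticFamily va φ) (hva : IsBoundaryFunctionLeft va)
    (hvb : IsBoundaryFunctionRight vb) (hS : IsEssSelfAdjointRel (sepRelation va vb))
    {α β : Ivl a b} (hαβ : α ≤ β) (s : ℂ) (x y : Ivl a b) {f : T.H1}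
    (hf : f = H1.delta α + s • H1.delta β) {νf νx : Measure ℝ} [IsFiniteMeasure νf]
    [IsFiniteMeasure νx]
    (h1 : ∀ z (hz : z.im ≠ 0), inner ℂ f (hS.res hz f) = ∫ t : ℝ, ((t : ℂ) - z)⁻¹ ∂νf)
    (h2 : ∀ z (hz : z.im ≠ 0), inner ℂ (H1.delta x) (hS.res hz (H1.delta x)) =
      ∫ t : ℝ, ((t : ℂ) - z)⁻¹ ∂νx) :
    (νf.comap (Subtype.val : RealCross → ℝ)).withDensity (fun t => nnDensity φ x y 0 t) =
      (νx.comap (Subtype.val : RealCross → ℝ)).withDensity (fun t => nnDensity φ α β s t) := by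
  have i1 := IsLocallyFiniteMeasure.withDensity_coe
    (μ := νf.comap (Subtype.val : RealCross → ℝ)) (hφ.continuous_nnDensity x y 0)
  have i2 := IsLocallyFiniteMeasure.withDensity_coe
    (μ := νx.comap (Subtype.val : RealCross → ℝ)) (hφ.continuous_nnDensity α β s)
  refine Measure.ext_of_integral_eq_on_compactlySupported fun g => ?_
  obtain ⟨h, e1, e2, e3, e4, e5⟩ := exists_extension g
  rw [integral_withDensity_eq_integral_smul (hφ.continuous_nnDensity x y 0).measurable,
    integral_withDensity_eq_integral_smul (hφ.continuous_nnDensity α β s).measurable]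
  have key : ∀ (ν : Measure ℝ) (α β : Ivl a b) (s : ℂ),
      ((∫ t : RealCross, nnDensity φ α β s t • g t ∂(ν.comap Subtype.val) : ℝ) : ℂ) =
        ∫ t, h t * density φ α β s t ∂ν := by
    intro ν α β s
    rw [← integral_comap_realCross _ (Or.inr (by rw [e4, zero_mul])), ← integral_complex_ofReal]
    refine integral_congr_ae (ae_of_all _ fun t => ?_)
    simp only
    rw [e5, hφ.density_eq_nnDensity, NNReal.smul_def, smul_eq_mul, Complex.ofReal_mul, mul_comm]
  have := hφ.integral_density_eq hva hvb hS hαβ s x y hf h1 h2 e1 e2 e3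
  rw [← key, ← key] at this
  exact_mod_cast this

end IsRealAnalyticFamily

/-- The Stieltjes transform of `φ_t(α) φ_t(β) dμ` is `⟨R_z δ_α, δ_β⟩`. -/
structure IsKernelMeasure {S : Submodule ℂ (T.H1 × T.H1)} (hS : IsEssSelfAdjointRel S)
    (φ : ℂ → T.LocPair) (μ : Measure RealCross) : Prop where
  integrable : ∀ α β, Integrable (fun t : RealCross => (φ (t : ℝ)).fst α * (φ (t : ℝ)).fst β) μ
  inner_res : ∀ (z : ℂ) (hz : z.im ≠ 0) (α β : Ivl a b),
    inner ℂ (H1.delta β) (hS.res hz (H1.delta α)) =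
      ∫ t : RealCross, (φ (t : ℝ)).fst α * (φ (t : ℝ)).fst β * (((t : ℝ) : ℂ) - z)⁻¹ ∂μ

namespace IsRealAnalyticFamily

variable {va vb : T.LocPair} {φ : ℂ → T.LocPair}

theorem exists_isKernelMeasure (hφ : IsRealAnalyticFamily va φ) (hva : IsBoundaryFunctionLeft va)
    (hvb : IsBoundaryFunctionRight vb) (hS : IsEssSelfAdjointRel (sepRelation va vb))
    (h0 : ¬ ZeroIsEigenvalue (sepRelation va vb)) : ∃ μ, IsKernelMeasure hS φ μ := by
  choose ν hνfin hν using fun f : T.H1 => hS.exists_measure f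
  obtain ⟨x, hx⟩ := hφ.exists_seq_fst_ne_zero
  let ι := {i : Ivl a b × Ivl a b × ℂ // i.1 ≤ i.2.1}
  let f : ι → T.H1 := fun i => H1.delta i.1.1 + i.1.2.2 • H1.delta i.1.2.1
  let d : ι → RealCross → ℝ≥0∞ := fun i t => nnDensity φ i.1.1 i.1.2.1 i.1.2.2 t
  have hd : ∀ i, Measurable (d i) := fun i =>
    (hφ.continuous_nnDensity _ _ _).measurable.coe_nnreal_ennreal
  obtain ⟨μ, hμ⟩ := exists_measure_withDensity (d := d)
    (ν := fun i => (ν (f i)).comap (Subtype.val : RealCross → ℝ))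
    (x := fun j => ⟨(x j, x j, 0), le_rfl⟩) hd (fun i t => ENNReal.coe_ne_top)
    (fun t => by
      obtain ⟨j, hj⟩ := hx (t : ℝ) (by exact_mod_cast t.2)
      refine ⟨j, ?_⟩
      simp only [d, nnDensity, zero_mul, add_zero]
      simpa using hj)
    (fun i j => by
      refine hφ.withDensity_comap_eq hva hvb hS i.2 i.1.2.2 (x j) (x j) rfl (hν _) ?_
      intro z hz
      have e : f ⟨(x j, x j, 0), le_rfl⟩ = H1.delta (x j) := by simp [f]
      rw [← hν, e])
  have key1 : ∀ i : ι, Integrable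
      (fun t : RealCross => density φ i.1.1 i.1.2.1 i.1.2.2 (t : ℝ)) μ := by
    intro i
    have h1 : IsFiniteMeasure (μ.withDensity (d i)) := by
      rw [hμ i]
      infer_instance
    have h2 : Integrable (fun _ => (1 : ℂ)) (μ.withDensity (d i)) := integrable_const _
    rw [integrable_withDensity_iff_integrable_smul (hφ.continuous_nnDensity _ _ _).measurable] at h2
    refine h2.congr (ae_of_all _ fun t => ?_)
    simp only
    rw [hφ.density_eq_nnDensity, NNReal.smul_def, Complex.real_smul, mul_one]
  have key2 : ∀ (i : ι) (z : ℂ) (hz : z.im ≠ 0), inner ℂ (f i) (hS.res hz (f i)) =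
      ∫ t : RealCross, density φ i.1.1 i.1.2.1 i.1.2.2 (t : ℝ) * (((t : ℝ) : ℂ) - z)⁻¹ ∂μ := by
    intro i z hz
    rw [hν, ← integral_comap_realCross _ (Or.inl (hS.measure_singleton_zero h0 (hν (f i)))), ← hμ i,
      integral_withDensity_eq_integral_smul (hφ.continuous_nnDensity _ _ _).measurable]
    refine integral_congr_ae (ae_of_all _ fun t => ?_)
    simp only
    rw [hφ.density_eq_nnDensity, NNReal.smul_def, Complex.real_smul]
  have pol : ∀ (α β : Ivl a b) (z : ℂ), density φ α β 1 z - density φ α β (-1) z =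
      4 * ((φ z).fst α * (φ z).fst β) := by
    intro α β z
    simp only [density, map_neg, map_one]
    ring
  have key3 : ∀ α β : Ivl a b, α ≤ β →
      Integrable (fun t : RealCross => (φ (t : ℝ)).fst α * (φ (t : ℝ)).fst β) μ := by
    intro α β hαβ
    have i := fun s : ℂ => key1 ⟨(α, β, s), hαβ⟩
    refine (((i 1).sub (i (-1))).const_mul 4⁻¹).congr (ae_of_all _ fun t => ?_)
    simp only [Pi.sub_apply]
    rw [pol]
    ring
  have key4 : ∀ α β : Ivl a b, α ≤ β → ∀ (z : ℂ) (hz : z.im ≠ 0),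
      (inner ℂ (H1.delta β) (hS.res hz (H1.delta α)) =
        ∫ t : RealCross, (φ (t : ℝ)).fst α * (φ (t : ℝ)).fst β * (((t : ℝ) : ℂ) - z)⁻¹ ∂μ) ∧
      (inner ℂ (H1.delta α) (hS.res hz (H1.delta β)) =
        ∫ t : RealCross, (φ (t : ℝ)).fst α * (φ (t : ℝ)).fst β * (((t : ℝ) : ℂ) - z)⁻¹ ∂μ) := by
    intro α β hαβ z hz
    have i : ∀ s : ℂ, Integrable (fun t : RealCross =>
        density φ α β s (t : ℝ) * (((t : ℝ) : ℂ) - z)⁻¹) μ := fun s =>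
      integrable_mul_inv measurable_subtype_coe (key1 ⟨(α, β, s), hαβ⟩) hz
    have e := fun s : ℂ => key2 ⟨(α, β, s), hαβ⟩ z hz
    simp only [f, map_add, map_smul, inner_add_left, inner_add_right, inner_smul_left,
      inner_smul_right] at e
    have p1 := e 1
    have p2 := e (-1)
    have p3 := e Complex.I
    have p4 := e (-Complex.I)
    simp only [map_neg, map_one, Complex.conj_I] at p1 p2 p3 p4
    have h4 : (4 : ℂ) * ∫ t : RealCross, (φ (t : ℝ)).fst α * (φ (t : ℝ)).fst β *
        (((t : ℝ) : ℂ) - z)⁻¹ ∂μ =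
        (∫ t : RealCross, density φ α β 1 (t : ℝ) * (((t : ℝ) : ℂ) - z)⁻¹ ∂μ) -
        ∫ t : RealCross, density φ α β (-1) (t : ℝ) * (((t : ℝ) : ℂ) - z)⁻¹ ∂μ := by
      rw [← integral_sub (i _) (i _), ← integral_const_mul]
      refine integral_congr_ae (ae_of_all _ fun t => ?_)
      simp only
      linear_combination (-(((t : ℝ) : ℂ) - z)⁻¹) * pol α β (t : ℝ)
    have h5 : (∫ t : RealCross, density φ α β Complex.I (t : ℝ) * (((t : ℝ) : ℂ) - z)⁻¹ ∂μ) =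
        ∫ t : RealCross, density φ α β (-Complex.I) (t : ℝ) * (((t : ℝ) : ℂ) - z)⁻¹ ∂μ := by
      refine integral_congr_ae (ae_of_all _ fun t => ?_)
      simp only [density, map_neg, Complex.conj_I]
      ring
    have hI : Complex.I ^ 2 = -1 := Complex.I_sq
    rw [← p1, ← p2] at h4
    rw [← p3, ← p4] at h5
    have h6 : inner ℂ (H1.delta α) (hS.res hz (H1.delta β)) =
        inner ℂ (H1.delta β) (hS.res hz (H1.delta α)) := by
      linear_combination (-Complex.I / 2) * h5 + (inner ℂ (H1.delta α) (hS.res hz (H1.delta β)) -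
        inner ℂ (H1.delta β) (hS.res hz (H1.delta α))) * hI
    constructor
    · linear_combination (-1 / 4) * h4 - (1 / 2) * h6
    · linear_combination (-1 / 4) * h4 + (1 / 2) * h6
  refine ⟨μ, fun α β => ?_, fun z hz α β => ?_⟩
  · rcases le_total α β with h | h
    · exact key3 α β h
    · simpa only [mul_comm] using key3 β α h
  · rcases le_total α β with h | h
    · exact (key4 α β h z hz).1
    · rw [(key4 β α h z hz).2]
      simp only [mul_comm ((φ _).fst β)]

end IsRealAnalyticFamily

end Coefficients

end LeftDefinite

end

noncomputable section

namespace LeftDefinite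

/-! ### The resolvent of multiplication by the independent variable -/

section MulRes

variable {μ : Measure RealCross}

lemma aestronglyMeasurable_inv_sub (z : ℂ) :
    AEStronglyMeasurable (fun t : RealCross => (((t : ℝ) : ℂ) - z)⁻¹) μ :=
  (((Complex.measurable_ofReal.comp measurable_subtype_coe).sub_const z).inv).aestronglyMeasurable

lemma memLp_inv_sub_mul {z : ℂ} (hz : z.im ≠ 0) (g : Lp ℂ 2 μ) :
    MemLp (fun t : RealCross => (((t : ℝ) : ℂ) - z)⁻¹ * g t) 2 μ := by
  refine (Lp.memLp g).of_le_mul (c := |z.im|⁻¹)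
    ((aestronglyMeasurable_inv_sub z).mul (Lp.aestronglyMeasurable g)) (ae_of_all _ fun t => ?_)
  rw [norm_mul]
  exact mul_le_mul_of_nonneg_right (norm_inv_sub_le hz t) (norm_nonneg _)

/-- Multiplication by `(t - z)⁻¹` for non-real `z`. -/
def mulRes (μ : Measure RealCross) {z : ℂ} (hz : z.im ≠ 0) : Lp ℂ 2 μ →L[ℂ] Lp ℂ 2 μ :=
  LinearMap.mkContinuous
    { toFun := fun g => (memLp_inv_sub_mul hz g).toLp _
      map_add' := fun f g => by
        refine Lp.ext ?_
        filter_upwards [(memLp_inv_sub_mul hz (f + g)).coeFn_toLp,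
          (memLp_inv_sub_mul hz f).coeFn_toLp, (memLp_inv_sub_mul hz g).coeFn_toLp,
          Lp.coeFn_add f g, Lp.coeFn_add ((memLp_inv_sub_mul hz f).toLp _)
            ((memLp_inv_sub_mul hz g).toLp _)] with t h1 h2 h3 h4 h5
        rw [h1, h5, Pi.add_apply, h2, h3, h4, Pi.add_apply, mul_add]
      map_smul' := fun r f => by
        refine Lp.ext ?_
        filter_upwards [(memLp_inv_sub_mul hz (r • f)).coeFn_toLp,
          (memLp_inv_sub_mul hz f).coeFn_toLp, Lp.coeFn_smul r f,
          Lp.coeFn_smul r ((memLp_inv_sub_mul hz f).toLp _)] with t h1 h2 h3 h4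
        rw [RingHom.id_apply, h1, h4, Pi.smul_apply, h2, h3, Pi.smul_apply, smul_eq_mul,
          smul_eq_mul, mul_left_comm] }
    |z.im|⁻¹ fun f => by
      refine Lp.norm_le_mul_norm_of_ae_le_mul ?_
      filter_upwards [(memLp_inv_sub_mul hz f).coeFn_toLp] with t h1
      simp only [LinearMap.coe_mk, AddHom.coe_mk]
      rw [h1, norm_mul]
      exact mul_le_mul_of_nonneg_right (norm_inv_sub_le hz t) (norm_nonneg _)

lemma coeFn_mulRes {z : ℂ} (hz : z.im ≠ 0) (g : Lp ℂ 2 μ) :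
    mulRes μ hz g =ᵐ[μ] fun t : RealCross => (((t : ℝ) : ℂ) - z)⁻¹ * g t :=
  (memLp_inv_sub_mul hz g).coeFn_toLp

lemma ofReal_sub_ne_zero {z : ℂ} (hz : z.im ≠ 0) (t : ℝ) : (t : ℂ) - z ≠ 0 := by
  intro h
  apply hz
  rw [← sub_eq_zero.1 h, Complex.ofReal_im]

lemma inner_mulRes_eq_integral {z : ℂ} (hz : z.im ≠ 0) (f g : Lp ℂ 2 μ) :
    inner ℂ f (mulRes μ hz g) =
      ∫ t : RealCross, conj (f t) * g t * (((t : ℝ) : ℂ) - z)⁻¹ ∂μ := by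
  rw [L2.inner_def]
  refine integral_congr_ae ?_
  filter_upwards [coeFn_mulRes hz g] with t ht
  rw [ht, RCLike.inner_apply]
  ring

lemma integrable_conj_mul (f g : Lp ℂ 2 μ) : Integrable (fun t => conj (f t) * g t) μ := by
  refine (L2.integrable_inner (𝕜 := ℂ) f g).congr (ae_of_all _ fun t => ?_)
  simp only [RCLike.inner_apply, mul_comm]

lemma inner_mulRes_left {z : ℂ} (hz : z.im ≠ 0) (hz' : (conj z).im ≠ 0) (f g : Lp ℂ 2 μ) :
    inner ℂ (mulRes μ hz' f) g = inner ℂ f (mulRes μ hz g) := by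
  rw [L2.inner_def, L2.inner_def]
  refine integral_congr_ae ?_
  filter_upwards [coeFn_mulRes hz g, coeFn_mulRes hz' f] with t h1 h2
  rw [h1, h2, RCLike.inner_apply, RCLike.inner_apply, map_mul, map_inv₀, map_sub,
    Complex.conj_ofReal, Complex.conj_conj]
  ring

lemma mulRes_sub {z w : ℂ} (hz : z.im ≠ 0) (hw : w.im ≠ 0) (g : Lp ℂ 2 μ) :
    mulRes μ hz g - mulRes μ hw g = (z - w) • mulRes μ hz (mulRes μ hw g) := by
  refine Lp.ext ?_
  filter_upwards [coeFn_mulRes hz g, coeFn_mulRes hw g, coeFn_mulRes hz (mulRes μ hw g),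
    Lp.coeFn_sub (mulRes μ hz g) (mulRes μ hw g),
    Lp.coeFn_smul (z - w) (mulRes μ hz (mulRes μ hw g))] with t h1 h2 h3 h4 h5
  rw [h4, h5, Pi.sub_apply, Pi.smul_apply, h1, h2, h3, h2, smul_eq_mul]
  have e1 := ofReal_sub_ne_zero hz t
  have e2 := ofReal_sub_ne_zero hw t
  field_simp
  ring

lemma mulRes_eq_zero {z : ℂ} (hz : z.im ≠ 0) {g : Lp ℂ 2 μ} (h : mulRes μ hz g = 0) : g = 0 := by
  refine Lp.ext ?_
  filter_upwards [coeFn_mulRes hz g, Lp.coeFn_zero ℂ 2 μ] with t h1 h2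
  rw [h, h2] at h1
  rw [h2]
  exact (mul_eq_zero.1 h1.symm).resolve_left (inv_ne_zero (ofReal_sub_ne_zero hz t))

lemma mem_mulId_iff {z : ℂ} (hz : z.im ≠ 0) (f g : Lp ℂ 2 μ) :
    (f, g) ∈ mulId μ ↔ mulRes μ hz (g - z • f) = f := by
  have e : (fun t => (g - z • f : Lp ℂ 2 μ) t) =ᵐ[μ] fun t => g t - z * f t := by
    filter_upwards [Lp.coeFn_sub g (z • f), Lp.coeFn_smul z f] with t h1 h2
    rw [h1, Pi.sub_apply, h2, Pi.smul_apply, smul_eq_mul]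
  constructor
  · intro (h : ∀ᵐ t ∂μ, g t = ((t : ℝ) : ℂ) * f t)
    refine Lp.ext ?_
    filter_upwards [coeFn_mulRes hz (g - z • f), e, h] with t h1 h2 h3
    rw [h1, h2, h3, ← sub_mul, inv_mul_cancel_left₀ (ofReal_sub_ne_zero hz t)]
  · intro h
    change ∀ᵐ t ∂μ, g t = ((t : ℝ) : ℂ) * f t
    have h0 := coeFn_mulRes hz (g - z • f)
    rw [h] at h0
    filter_upwards [h0, e] with t h1 h2
    rw [h2] at h1
    have e1 := ofReal_sub_ne_zero hz t
    rw [eq_comm, inv_mul_eq_iff_eq_mul₀ e1] at h1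
    linear_combination h1

/-- If the quadratic form of the resolvent at `h` is that of multiplication at `v`, then
`‖v‖ ≤ ‖h‖`. -/
lemma norm_le_of_inner_mulRes {H : Type*} [NormedAddCommGroup H] [InnerProductSpace ℂ H]
    [CompleteSpace H] {S : Submodule ℂ (H × H)} (hS : IsEssSelfAdjointRel S) {h : H} {v : Lp ℂ 2 μ}
    (hv : ∀ (z : ℂ) (hz : z.im ≠ 0), inner ℂ h (hS.res hz h) = inner ℂ v (mulRes μ hz v)) :
    ‖v‖ ≤ ‖h‖ := by
  let y : ℕ → ℝ := fun n => (n : ℝ) + 1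
  have hy : ∀ n, 0 < y n := fun n => by positivity
  have him : ∀ n, ((y n : ℂ) * Complex.I).im ≠ 0 := fun n => by simpa using (hy n).ne'
  have hn : ∀ n, |((y n : ℂ) * Complex.I).im| = y n := fun n => by simpa using (hy n).le
  let q : ℕ → RealCross → ℂ := fun n t =>
    -(y n * Complex.I) * (conj (v t) * v t * (((t : ℝ) : ℂ) - y n * Complex.I)⁻¹)
  have h1 : Tendsto (fun n => ∫ t, q n t ∂μ) atTop (𝓝 (∫ t, conj (v t) * v t ∂μ)) := by
    have hm := (integrable_conj_mul v v)
    refine tendsto_integral_of_dominated_convergence (fun t => ‖conj (v t) * v t‖) (fun n => ?_)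
      hm.norm (fun n => ae_of_all _ fun t => ?_) (ae_of_all _ fun t => ?_)
    · exact (hm.aestronglyMeasurable.mul (aestronglyMeasurable_inv_sub _)).const_mul _
    · have e := norm_inv_sub_le (him n) t
      rw [hn] at e
      simp only [q]
      rw [norm_mul, norm_mul _ ((_ - _)⁻¹), norm_neg, norm_mul, Complex.norm_I, mul_one,
        Complex.norm_real, Real.norm_eq_abs, abs_of_pos (hy n), mul_left_comm]
      refine mul_le_of_le_one_right (norm_nonneg _) ?_
      exact (mul_le_mul_of_nonneg_left e (hy n).le).trans (mul_inv_cancel₀ (hy n).ne').le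
    · have hlim : Tendsto (fun n => (y n)⁻¹) atTop (𝓝 0) := by
        have := tendsto_one_div_add_atTop_nhds_zero_nat (𝕜 := ℝ)
        simpa [y] using this
      have hc : Tendsto (fun n => (((y n)⁻¹ : ℝ) : ℂ)) atTop (𝓝 0) := by
        exact_mod_cast (Complex.continuous_ofReal.tendsto 0).comp hlim
      have h2 : Tendsto (fun n => (1 + Complex.I * ((t : ℝ) : ℂ) * (((y n)⁻¹ : ℝ) : ℂ))⁻¹) atTop
          (𝓝 1) := by
        have := ((hc.const_mul (Complex.I * ((t : ℝ) : ℂ))).const_add 1).inv₀ (by simp)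
        simpa using this
      have h3 := h2.const_mul (conj (v t) * v t)
      rw [mul_one] at h3
      refine h3.congr fun n => ?_
      have e1 : ((y n : ℝ) : ℂ) ≠ 0 := by exact_mod_cast (hy n).ne'
      have e2 := ofReal_sub_ne_zero (him n) t
      have e3 : 1 + Complex.I * ((t : ℝ) : ℂ) * (((y n)⁻¹ : ℝ) : ℂ) =
          Complex.I * (y n : ℂ)⁻¹ * (((t : ℝ) : ℂ) - y n * Complex.I) := by
        push_cast
        field_simp
        linear_combination (y n : ℂ) * Complex.I_sq
      simp only [q]
      rw [e3, mul_inv, mul_inv, Complex.inv_I, inv_inv]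
      ring
  have h2 : ∀ n, ‖∫ t, q n t ∂μ‖ ≤ ‖h‖ ^ 2 := by
    intro n
    simp only [q]
    rw [integral_const_mul, ← inner_mulRes_eq_integral (him n), ← hv, norm_mul, norm_neg, norm_mul,
      Complex.norm_I, mul_one, Complex.norm_real, Real.norm_eq_abs, abs_of_pos (hy n)]
    have e := hS.norm_res_apply_le (him n) h
    rw [hn] at e
    calc y n * ‖inner ℂ h (hS.res (him n) h)‖ ≤ y n * (‖h‖ * ‖hS.res (him n) h‖) :=
          mul_le_mul_of_nonneg_left (norm_inner_le_norm _ _) (hy n).le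
      _ = ‖h‖ * (y n * ‖hS.res (him n) h‖) := by ring
      _ ≤ ‖h‖ * ‖h‖ := mul_le_mul_of_nonneg_left e (norm_nonneg _)
      _ = ‖h‖ ^ 2 := (sq _).symm
  have h3 := le_of_tendsto h1.norm (Eventually.of_forall h2)
  have h4 : ∫ t, conj (v t) * v t ∂μ = ((‖v‖ ^ 2 : ℝ) : ℂ) := by
    rw [Complex.ofReal_pow]
    rw [show ((‖v‖ : ℂ)) ^ 2 = inner ℂ v v from (inner_self_eq_norm_sq_to_K v).symm, L2.inner_def]
    refine integral_congr_ae (ae_of_all _ fun t => ?_)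
    simp only [RCLike.inner_apply, mul_comm]
  rw [h4, Complex.norm_real, Real.norm_eq_abs, abs_of_nonneg (by positivity)] at h3
  exact abs_le_of_sq_le_sq' h3 (norm_nonneg _) |>.2

/-- An integrable function on the punctured line with vanishing Stieltjes transform is zero. -/
lemma ae_eq_zero_of_stieltjes [SFinite μ] {G : RealCross → ℂ} (hG : Integrable G μ)
    (h0 : ∀ z : ℂ, z.im ≠ 0 → ∫ t : RealCross, G t * (((t : ℝ) : ℂ) - z)⁻¹ ∂μ = 0) :
    G =ᵐ[μ] 0 := by
  let G' : ℝ → ℂ := Function.extend Subtype.val G 0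
  have hext : ∀ t : RealCross, G' t = G t := fun t => Subtype.val_injective.extend_apply G 0 t
  have hG' : Integrable G' (μ.map Subtype.val) := by
    rw [measurableEmbedding_realCross.integrable_map_iff]
    exact hG.congr (ae_of_all _ fun t => (hext t).symm)
  have h1 : ∀ᵐ t ∂(μ.map Subtype.val), G' t = 0 := by
    refine ae_eq_zero_of_integral_contDiff_smul_eq_zero hG'.locallyIntegrable fun g hg hgc => ?_
    rw [measurableEmbedding_realCross.integral_map]
    have := integral_eq_zero_of_stieltjes measurable_subtype_coe hG h0
      (H := fun t => (g t : ℂ)) (Complex.continuous_ofReal.comp hg.continuous)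
      (hgc.comp_left Complex.ofReal_zero)
    rw [← this]
    refine integral_congr_ae (ae_of_all _ fun t => ?_)
    simp only
    rw [hext, Complex.real_smul]
  rw [measurableEmbedding_realCross.ae_map_iff] at h1
  filter_upwards [h1] with t ht
  rwa [hext] at ht

end MulRes

end LeftDefinite

end

noncomputable section

namespace LeftDefinite

/-! ### Transformations that diagonalize a self-adjoint relation -/

section Diagonalization

variable {H : Type*} [NormedAddCommGroup H] [InnerProductSpace ℂ H] [CompleteSpace H]
  {S : Submodule ℂ (H × H)} {μ : Measure RealCross}

/-- The bounded operator `F` turns the resolvents of `S` into multiplication operators, with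
vectors `F h` that are total under these. -/
structure Diagonalizes (hS : IsEssSelfAdjointRel S) (F : H →L[ℂ] Lp ℂ 2 μ) : Prop where
  inner_res : ∀ (z : ℂ) (hz : z.im ≠ 0) (f g : H),
    inner ℂ g (hS.res hz f) = inner ℂ (F g) (mulRes μ hz (F f))
  total : ∀ v : Lp ℂ 2 μ,
    (∀ (z : ℂ) (hz : z.im ≠ 0) (f : H), inner ℂ v (mulRes μ hz (F f)) = 0) → v = 0

namespace Diagonalizes

variable {hS : IsEssSelfAdjointRel S} {F : H →L[ℂ] Lp ℂ 2 μ}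

open ContinuousLinearMap (adjoint)

lemma res_eq (hF : Diagonalizes hS F) {z : ℂ} (hz : z.im ≠ 0) (f : H) :
    hS.res hz f = adjoint F (mulRes μ hz (F f)) := by
  refine ext_inner_left ℂ fun g => ?_
  rw [hF.inner_res, ContinuousLinearMap.adjoint_inner_right]

lemma norm_apply_le (hF : Diagonalizes hS F) (f : H) : ‖F f‖ ≤ ‖f‖ :=
  norm_le_of_inner_mulRes hS fun z hz => hF.inner_res z hz f f

lemma apply_adjoint_mulRes (hF : Diagonalizes hS F) {w : ℂ} (hw : w.im ≠ 0) (f : H) :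
    F (adjoint F (mulRes μ hw (F f))) = mulRes μ hw (F f) := by
  set v := mulRes μ hw (F f) with hv
  have hz : (conj w).im ≠ 0 := by rwa [Complex.conj_im, neg_ne_zero]
  have hne : conj w - w ≠ 0 := by
    intro h
    have := congrArg Complex.im h
    rw [Complex.sub_im, Complex.conj_im, Complex.zero_im] at this
    exact hw (by linarith)
  have h1 : inner ℂ v (F (adjoint F v)) = inner ℂ v v := by
    have e1 := congrArg (inner ℂ f) ((hS.isResolvent hz).sub_eq (hS.isResolvent hw) f)
    have e2 := congrArg (inner ℂ (F f)) (mulRes_sub hz hw (F f))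
    rw [inner_sub_right, inner_smul_right] at e1 e2
    rw [hF.inner_res, hF.inner_res, hF.inner_res, e2, hF.res_eq] at e1
    have e3 := mul_left_cancel₀ hne e1
    rw [← inner_mulRes_left hz (by rwa [Complex.conj_conj]),
      ← inner_mulRes_left hz (by rwa [Complex.conj_conj])] at e3
    simp only [Complex.conj_conj] at e3
    exact e3.symm
  have h2 : ‖adjoint F v‖ ^ 2 = ‖v‖ ^ 2 := by
    rw [← ContinuousLinearMap.adjoint_inner_left, inner_self_eq_norm_sq_to_K,
      inner_self_eq_norm_sq_to_K] at h1
    exact_mod_cast h1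
  have h3 : ‖F (adjoint F v) - v‖ ^ 2 ≤ 0 := by
    rw [@norm_sub_sq ℂ]
    have e : RCLike.re (inner ℂ (F (adjoint F v)) v) = ‖v‖ ^ 2 := by
      rw [← inner_conj_symm, h1, RCLike.conj_re, inner_self_eq_norm_sq]
    have := hF.norm_apply_le (adjoint F v)
    rw [e]
    nlinarith [norm_nonneg (F (adjoint F v))]
  have h4 : ‖F (adjoint F v) - v‖ = 0 := by
    have := sq_nonneg ‖F (adjoint F v) - v‖
    exact pow_eq_zero_iff two_ne_zero |>.1 (le_antisymm h3 this)
  exact sub_eq_zero.1 (norm_eq_zero.1 h4)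

lemma apply_adjoint (hF : Diagonalizes hS F) (v : Lp ℂ 2 μ) : F (adjoint F v) = v := by
  refine sub_eq_zero.1 (hF.total _ fun z hz f => ?_)
  rw [inner_sub_left, ← ContinuousLinearMap.adjoint_inner_right,
    ContinuousLinearMap.adjoint_inner_left, hF.apply_adjoint_mulRes, sub_self]

lemma res_mem_domClosure (hz : (Complex.I).im ≠ 0) (f : H) : hS.res hz f ∈ domClosure S :=
  Submodule.le_topologicalClosure _ ⟨_, (hS.isResolvent hz).mem f, rfl⟩

lemma apply_eq_zero (hF : Diagonalizes hS F) {f : H} (hf : f ∈ (domClosure S)ᗮ) : F f = 0 := by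
  have hi : Complex.I.im ≠ 0 := by simp
  have hi' : (conj Complex.I).im ≠ 0 := by simp
  have h1 : hS.res hi' f = 0 := by
    refine ext_inner_left ℂ fun g => ?_
    rw [inner_zero_right, ← inner_conj_symm, hS.inner_res hi hi', ← inner_conj_symm,
      hf _ (res_mem_domClosure hi g), map_zero, map_zero]
  rw [hF.res_eq] at h1
  have h2 := congrArg F h1
  rw [hF.apply_adjoint, map_zero] at h2
  exact mulRes_eq_zero hi' h2

lemma adjoint_mem (hF : Diagonalizes hS F) (v : Lp ℂ 2 μ) : adjoint F v ∈ domClosure S := by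
  have hc : IsClosed (domClosure S : Set H) := Submodule.isClosed_topologicalClosure _
  have : CompleteSpace (domClosure S) := hc.completeSpace_coe
  rw [← Submodule.orthogonal_orthogonal (domClosure S), Submodule.mem_orthogonal]
  intro f hf
  rw [ContinuousLinearMap.adjoint_inner_right, hF.apply_eq_zero hf, inner_zero_left]

lemma adjoint_apply (hF : Diagonalizes hS F) {f : H} (hf : f ∈ domClosure S) : adjoint F (F f) = f := by
  have hi : Complex.I.im ≠ 0 := by simp
  have h1 : IsClosed {f : H | adjoint F (F f) = f} :=
    isClosed_eq ((adjoint F).continuous.comp F.continuous) continuous_id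
  refine closure_minimal ?_ h1 hf
  rintro _ ⟨⟨f, g⟩, hfg, rfl⟩
  have h2 := (hS.isResolvent hi).apply_sub hfg
  rw [hF.res_eq] at h2
  simp only [LinearMap.fst_apply, mem_ofPred_eq]
  rw [← h2, hF.apply_adjoint]

/-- `F` as a unitary map from the closure of the domain of `S` onto `L²`. -/
def unitary (hF : Diagonalizes hS F) : domClosure S ≃ₗᵢ[ℂ] Lp ℂ 2 μ :=
  LinearIsometryEquiv.ofSurjective
    (⟨F.toLinearMap.comp (domClosure S).subtype, fun f => by
      have h1 : inner ℂ (F f) (F f) = inner ℂ (f : H) f := by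
        rw [← ContinuousLinearMap.adjoint_inner_right, hF.adjoint_apply f.2]
      rw [inner_self_eq_norm_sq_to_K, inner_self_eq_norm_sq_to_K] at h1
      have h2 : ‖F f‖ ^ 2 = ‖(f : H)‖ ^ 2 := by exact_mod_cast h1
      exact (pow_left_inj₀ (norm_nonneg _) (norm_nonneg _) two_ne_zero).1 h2⟩ :
      domClosure S →ₗᵢ[ℂ] Lp ℂ 2 μ)
    fun v => ⟨⟨adjoint F v, hF.adjoint_mem v⟩, hF.apply_adjoint v⟩

lemma unitary_apply (hF : Diagonalizes hS F) (f : domClosure S) : hF.unitary f = F f := rfl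

lemma mem_iff (hF : Diagonalizes hS F) {f g : H} :
    (f, g) ∈ S ↔ f ∈ domClosure S ∧ (F f, F g) ∈ mulId μ := by
  have hi : Complex.I.im ≠ 0 := by simp
  rw [(hS.isResolvent hi).mem_iff, hF.res_eq, mem_mulId_iff hi, ← map_smul, ← map_sub]
  constructor
  · intro h
    refine ⟨?_, ?_⟩
    · rw [← h]
      exact hF.adjoint_mem _
    · conv_rhs => rw [← h, hF.apply_adjoint]
  · rintro ⟨hf, h⟩
    rw [h, hF.adjoint_apply hf]

end Diagonalizes

end Diagonalization

namespace Coefficients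

variable {a b : EReal} {T : Coefficients a b}

/-! ### The spectral transformation -/

namespace IsRealAnalyticFamily

variable {va vb : T.LocPair} {φ : ℂ → T.LocPair}

lemma conj_fst (hφ : IsRealAnalyticFamily va φ) (c : Ivl a b) (t : RealCross) :
    conj ((φ (t : ℝ)).fst c) = (φ (t : ℝ)).fst c := by
  rw [← hφ.real_fst c (t : ℝ) (by exact_mod_cast t.2), Complex.conj_ofReal]

lemma nnDensity_zero (φ : ℂ → T.LocPair) (x : Ivl a b) (t : RealCross) :
    nnDensity φ x x 0 t = ‖(φ (t : ℝ)).fst x‖₊ ^ 2 := by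
  simp [nnDensity]

end IsRealAnalyticFamily

namespace IsKernelMeasure

variable {va vb : T.LocPair} {φ : ℂ → T.LocPair} {S : Submodule ℂ (T.H1 × T.H1)}
  {hS : IsEssSelfAdjointRel S} {μ : Measure RealCross}

open IsRealAnalyticFamily

lemma memLp (hμ : IsKernelMeasure hS φ μ) (hφ : IsRealAnalyticFamily va φ) (c : Ivl a b) :
    MemLp (fun t : RealCross => (φ (t : ℝ)).fst c) 2 μ := by
  refine (memLp_two_iff_integrable_sq_norm
    (hφ.continuous_fst c).aestronglyMeasurable).2 ?_
  refine (hμ.integrable c c).norm.congr (ae_of_all _ fun t => ?_)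
  simp only [norm_mul, sq]

lemma isFiniteMeasure_withDensity (hμ : IsKernelMeasure hS φ μ) (c : Ivl a b) :
    IsFiniteMeasure (μ.withDensity fun t => nnDensity φ c c 0 t) := by
  refine MeasureTheory.isFiniteMeasure_withDensity ?_
  have := (hμ.integrable c c).2
  rw [HasFiniteIntegral] at this
  refine (lt_of_eq_of_lt (lintegral_congr fun t => ?_) this).ne
  rw [nnDensity_zero, sq, enorm_mul]
  push_cast
  rfl

lemma sFinite (hμ : IsKernelMeasure hS φ μ) (hφ : IsRealAnalyticFamily va φ) : SFinite μ := by
  obtain ⟨x, hx⟩ := hφ.exists_seq_fst_ne_zero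
  refine sFinite_of_withDensity (d := fun j t => nnDensity φ (x j) (x j) 0 t)
    (fun j => (hφ.continuous_nnDensity _ _ _).measurable.coe_nnreal_ennreal)
    (fun j t => ENNReal.coe_ne_top) (fun t => ?_) fun j => hμ.isFiniteMeasure_withDensity (x j)
  obtain ⟨j, hj⟩ := hx (t : ℝ) (by exact_mod_cast t.2)
  exact ⟨j, by simpa [nnDensity_zero] using hj⟩

/-- The function `t ↦ φ_t(c)` in `L²(μ)`. -/
def deltaHat (hμ : IsKernelMeasure hS φ μ) (hφ : IsRealAnalyticFamily va φ) (c : Ivl a b) :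
    Lp ℂ 2 μ := (hμ.memLp hφ c).toLp _

lemma coeFn_deltaHat (hμ : IsKernelMeasure hS φ μ) (hφ : IsRealAnalyticFamily va φ) (c : Ivl a b) :
    hμ.deltaHat hφ c =ᵐ[μ] fun t : RealCross => (φ (t : ℝ)).fst c := (hμ.memLp hφ c).coeFn_toLp

lemma inner_res_eq (hμ : IsKernelMeasure hS φ μ) (hφ : IsRealAnalyticFamily va φ) {z : ℂ}
    (hz : z.im ≠ 0) (α β : Ivl a b) : inner ℂ (H1.delta β) (hS.res hz (H1.delta α)) =
      inner ℂ (hμ.deltaHat hφ β) (mulRes μ hz (hμ.deltaHat hφ α)) := by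
  rw [hμ.inner_res, inner_mulRes_eq_integral]
  refine integral_congr_ae ?_
  filter_upwards [hμ.coeFn_deltaHat hφ α, hμ.coeFn_deltaHat hφ β] with t h1 h2
  rw [h1, h2, hφ.conj_fst]
  ring

lemma eq_zero_of_inner_mulRes (hμ : IsKernelMeasure hS φ μ) (hφ : IsRealAnalyticFamily va φ)
    {v : Lp ℂ 2 μ} (hv : ∀ (z : ℂ) (hz : z.im ≠ 0) (c : Ivl a b),
      inner ℂ v (mulRes μ hz (hμ.deltaHat hφ c)) = 0) : v = 0 := by
  have := hμ.sFinite hφ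
  have h1 : ∀ c, ∀ᵐ t ∂μ, conj (v t) * hμ.deltaHat hφ c t = 0 := fun c =>
    ae_eq_zero_of_stieltjes (integrable_conj_mul v (hμ.deltaHat hφ c)) fun z hz => by
      rw [← inner_mulRes_eq_integral hz, hv]
  obtain ⟨x, hx⟩ := hφ.exists_seq_fst_ne_zero
  refine Lp.ext ?_
  filter_upwards [ae_all_iff.2 fun j => h1 (x j), ae_all_iff.2 fun j => hμ.coeFn_deltaHat hφ (x j),
    Lp.coeFn_zero ℂ 2 μ] with t h2 h3 h4
  obtain ⟨j, hj⟩ := hx (t : ℝ) (by exact_mod_cast t.2)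
  have h5 := h2 j
  rw [h3 j] at h5
  rw [h4]
  exact (map_eq_zero _).1 ((mul_eq_zero.1 h5).resolve_right hj)

lemma denseRange_linearCombination :
    DenseRange (Finsupp.linearCombination ℂ (H1.delta : Ivl a b → T.H1)) := by
  have := Submodule.dense_iff_topologicalClosure_eq_top.2 (H1.span_delta_dense (T := T))
  rw [← Finsupp.range_linearCombination] at this
  exact this

lemma apply_delta_eq (hμ : IsKernelMeasure hS φ μ) (hφ : IsRealAnalyticFamily va φ)
    {F : T.H1 →L[ℂ] Lp ℂ 2 μ} (hF : IsSpectralTransformation φ F) (c : Ivl a b) :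
    F (H1.delta c) = hμ.deltaHat hφ c := by
  refine Lp.ext ?_
  filter_upwards [hF c, hμ.coeFn_deltaHat hφ c] with t h1 h2
  rw [h1, h2]

theorem diagonalizes (hμ : IsKernelMeasure hS φ μ) (hφ : IsRealAnalyticFamily va φ)
    {F : T.H1 →L[ℂ] Lp ℂ 2 μ} (hF : IsSpectralTransformation φ F) : Diagonalizes hS F where
  inner_res z hz f g := by
    have h1 : ∀ α, hS.res hz (H1.delta α) =
        ContinuousLinearMap.adjoint F (mulRes μ hz (F (H1.delta α))) := by
      intro α
      refine H1.ext_fun fun β => ?_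
      rw [← H1.inner_delta, ← H1.inner_delta, ContinuousLinearMap.adjoint_inner_right,
        hμ.inner_res_eq hφ hz, hμ.apply_delta_eq hφ hF, hμ.apply_delta_eq hφ hF]
    have h2 : hS.res hz = (ContinuousLinearMap.adjoint F).comp ((mulRes μ hz).comp F) := by
      refine ContinuousLinearMap.ext_on
        (Submodule.dense_iff_topologicalClosure_eq_top.2 H1.span_delta_dense) ?_
      rintro _ ⟨α, rfl⟩
      exact h1 α
    rw [h2, ContinuousLinearMap.comp_apply, ContinuousLinearMap.adjoint_inner_right]
    rfl
  total v hv := hμ.eq_zero_of_inner_mulRes hφ fun z hz c => by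
    rw [← hμ.apply_delta_eq hφ hF]
    exact hv z hz _

theorem exists_unique_transformation (hμ : IsKernelMeasure hS φ μ)
    (hφ : IsRealAnalyticFamily va φ) :
    ∃! F : T.H1 →L[ℂ] Lp ℂ 2 μ, IsSpectralTransformation φ F := by
  let d := Finsupp.linearCombination ℂ (H1.delta : Ivl a b → T.H1)
  let e := Finsupp.linearCombination ℂ (hμ.deltaHat hφ)
  have h1 : ∀ (z : ℂ) (hz : z.im ≠ 0) (x y : Ivl a b →₀ ℂ),
      inner ℂ (d y) (hS.res hz (d x)) = inner ℂ (e y) (mulRes μ hz (e x)) := by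
    intro z hz x y
    induction x using Finsupp.induction_linear with
    | zero => simp only [map_zero, inner_zero_right]
    | add x x' ih ih' => simp only [map_add, inner_add_right, ih, ih']
    | single α r =>
      induction y using Finsupp.induction_linear with
      | zero => simp only [map_zero, inner_zero_left]
      | add y y' ih ih' => simp only [map_add, inner_add_left, ih, ih']
      | single β s =>
        simp only [d, e, Finsupp.linearCombination_single, map_smul, inner_smul_left,
          inner_smul_right, hμ.inner_res_eq hφ]
  have h2 : ∀ x, ‖e x‖ ≤ 1 * ‖d x‖ := fun x => by
    rw [one_mul]
    exact norm_le_of_inner_mulRes hS fun z hz => h1 z hz x x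
  refine ⟨e.extendOfNorm d, fun c => ?_, fun G hG => ?_⟩
  · have h3 := LinearMap.extendOfNorm_eq denseRange_linearCombination ⟨1, h2⟩ (Finsupp.single c 1)
    simp only [e, Finsupp.linearCombination_single, one_smul] at h3
    simp only [d, e]
    rw [h3]
    exact hμ.coeFn_deltaHat hφ c
  · refine ContinuousLinearMap.ext_on
      (Submodule.dense_iff_topologicalClosure_eq_top.2 H1.span_delta_dense) ?_
    rintro _ ⟨c, rfl⟩
    have h3 := LinearMap.extendOfNorm_eq denseRange_linearCombination ⟨1, h2⟩ (Finsupp.single c 1)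
    simp only [e, Finsupp.linearCombination_single, one_smul] at h3
    simp only [d, e]
    rw [h3, hμ.apply_delta_eq hφ hG]

/-- A measure with the given Stieltjes transforms is unique. -/
theorem eq (hφ : IsRealAnalyticFamily va φ) {μ₁ μ₂ : Measure RealCross}
    (h₁ : IsKernelMeasure hS φ μ₁) (h₂ : IsKernelMeasure hS φ μ₂) : μ₁ = μ₂ := by
  obtain ⟨x, hx⟩ := hφ.exists_seq_fst_ne_zero
  refine ext_of_withDensity (d := fun j t => nnDensity φ (x j) (x j) 0 t)
    (fun j => (hφ.continuous_nnDensity _ _ _).measurable.coe_nnreal_ennreal)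
    (fun j t => ENNReal.coe_ne_top) (fun t => ?_) fun j => ?_
  · obtain ⟨j, hj⟩ := hx (t : ℝ) (by exact_mod_cast t.2)
    exact ⟨j, by simpa [nnDensity_zero] using hj⟩
  have i1 := h₁.isFiniteMeasure_withDensity (x j)
  have i2 := h₂.isFiniteMeasure_withDensity (x j)
  set σ₁ := μ₁.withDensity fun t => (nnDensity φ (x j) (x j) 0 t : ℝ≥0∞) with hσ₁
  set σ₂ := μ₂.withDensity fun t => (nnDensity φ (x j) (x j) 0 t : ℝ≥0∞) with hσ₂
  have key : ∀ {μ : Measure RealCross}, IsKernelMeasure hS φ μ → ∀ (z : ℂ) (hz : z.im ≠ 0),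
      ∫ t : ℝ, ((t : ℂ) - z)⁻¹
        ∂((μ.withDensity fun t => (nnDensity φ (x j) (x j) 0 t : ℝ≥0∞)).map Subtype.val) =
        inner ℂ (H1.delta (x j)) (hS.res hz (H1.delta (x j))) := by
    intro μ hμ z hz
    rw [measurableEmbedding_realCross.integral_map,
      integral_withDensity_eq_integral_smul (hφ.continuous_nnDensity _ _ _).measurable,
      hμ.inner_res]
    refine integral_congr_ae (ae_of_all _ fun t => ?_)
    simp only
    rw [NNReal.smul_def, Complex.real_smul, ← hφ.density_eq_nnDensity, density_zero]
  have h3 : σ₁.map (Subtype.val : RealCross → ℝ) = σ₂.map Subtype.val := by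
    refine Measure.ext_of_integral_eq_on_compactlySupported fun g => ?_
    have hg : Continuous fun t => (g t : ℂ) := Complex.continuous_ofReal.comp g.continuous
    have := integral_eq_of_stieltjes (ν₁ := σ₁.map (Subtype.val : RealCross → ℝ))
      (ν₂ := σ₂.map (Subtype.val : RealCross → ℝ)) (p₁ := fun _ => 1) (p₂ := fun _ => 1)
      (r := fun _ => 0) (h := fun t => (g t : ℂ)) (C := 0)
      (g.hasCompactSupport.comp_left Complex.ofReal_zero)
      (by simpa using hg) (by simpa using hg) hg le_rfl (by simp) (by simp) (by simp)
      (fun z hz => by rw [hσ₁, hσ₂, key h₁ z hz, key h₂ z hz, sub_self])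
    simp only [mul_one] at this
    rw [integral_complex_ofReal, integral_complex_ofReal] at this
    exact_mod_cast this
  rw [← measurableEmbedding_realCross.comap_map σ₁, h3, measurableEmbedding_realCross.comap_map]

end IsKernelMeasure

end Coefficients

end LeftDefinite

end

noncomputable section

namespace LeftDefinite

/-! ### Integration against a complex measure with a density -/

section VectorIntegral

variable {X : Type*} [MeasurableSpace X] {μ : Measure X} {G : X → ℂ}

lemma integrable_withDensity_enorm_iff (hG : Integrable G μ) {f : X → ℂ} :
    Integrable f (μ.withDensity fun x => ‖G x‖ₑ) ↔ Integrable (fun x => ‖G x‖ • f x) μ :=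
  integrable_withDensity_iff_integrable_smul₀ (f := fun x => ‖G x‖₊)
    hG.aestronglyMeasurable.nnnorm.aemeasurable

lemma integrable_mul_of_withDensity (hG : Integrable G μ) {f : X → ℂ}
    (hf : Integrable f (μ.withDensity fun x => ‖G x‖ₑ)) : Integrable (fun x => f x * G x) μ := by
  rw [integrable_withDensity_enorm_iff hG] at hf
  have h1 : Integrable (fun x => ‖G x‖ • f x * ((‖G x‖⁻¹ : ℝ) • G x)) μ := by
    have h2 : AEStronglyMeasurable (fun x => (‖G x‖⁻¹ : ℝ) • G x) μ :=
      hG.aestronglyMeasurable.norm.aemeasurable.inv.aestronglyMeasurable.smul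
        hG.aestronglyMeasurable
    refine (hf.bdd_mul (c := 1) h2 (ae_of_all _ fun x => ?_)).congr (ae_of_all _ fun x => ?_)
    · rw [norm_smul, norm_inv, norm_norm]
      exact inv_mul_le_one
    · exact mul_comm _ _
  refine h1.congr (ae_of_all _ fun x => ?_)
  rcases eq_or_ne (G x) 0 with h | h
  · simp [h]
  · have : ((‖G x‖ : ℝ) : ℂ) ≠ 0 := by exact_mod_cast norm_ne_zero_iff.2 h
    simp only [Complex.real_smul, Complex.ofReal_inv]
    field_simp

lemma norm_integral_mul_le (hG : Integrable G μ) (f : X → ℂ) :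
    ‖∫ x, f x * G x ∂μ‖ ≤ ∫ x, ‖f x‖ ∂(μ.withDensity fun x => ‖G x‖ₑ) := by
  have e : ∫ x, ‖f x‖ ∂(μ.withDensity fun x => ‖G x‖ₑ) = ∫ x, ‖f x * G x‖ ∂μ := by
    refine (integral_withDensity_eq_integral_smul₀ (f := fun x => ‖G x‖₊)
      hG.aestronglyMeasurable.nnnorm.aemeasurable _).trans ?_
    refine integral_congr_ae (ae_of_all _ fun x => ?_)
    simp only
    rw [NNReal.smul_def, coe_nnnorm, smul_eq_mul, norm_mul, mul_comm]
  rw [e]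
  exact norm_integral_le_integral_norm _

lemma vectorIntegral_withDensity (hG : Integrable G μ) {f : X → ℂ}
    (hf : Integrable (fun x => ‖G x‖ • f x) μ) :
    ∫ᵛ x, f x ∂[ContinuousLinearMap.mul ℝ ℂ; μ.withDensityᵥ G] = ∫ x, f x * G x ∂μ := by
  have hV := Measure.variation_withDensityᵥ hG
  rw [← integrable_withDensity_enorm_iff hG, ← hV] at hf
  refine Integrable.induction (μ := (μ.withDensityᵥ G).variation)
    (fun f : X → ℂ => ∫ᵛ x, f x ∂[ContinuousLinearMap.mul ℝ ℂ; μ.withDensityᵥ G] =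
      ∫ x, f x * G x ∂μ) ?_ ?_ ?_ ?_ hf
  · intro c s hs hfin
    have : IsFiniteMeasure ((μ.withDensityᵥ G).variation.restrict s) :=
      isFiniteMeasure_restrict.2 hfin.ne
    rw [VectorMeasure.integral_indicator_const c hs, withDensityᵥ_apply hG hs,
      ContinuousLinearMap.mul_apply', ← integral_const_mul, ← integral_indicator hs]
    refine integral_congr_ae (ae_of_all _ fun x => ?_)
    by_cases hx : x ∈ s <;> simp [hx]
  · intro f g _ hf hg h1 h2
    rw [VectorMeasure.integral_add hf hg, h1, h2]
    rw [hV] at hf hg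
    rw [← integral_add (integrable_mul_of_withDensity hG hf) (integrable_mul_of_withDensity hG hg)]
    simp only [Pi.add_apply, add_mul]
  · refine isClosed_eq VectorMeasure.continuous_integral ?_
    refine (LipschitzWith.of_dist_le_mul (K := 1) fun f g => ?_).continuous
    have i : ∀ f : X →₁[(μ.withDensityᵥ G).variation] ℂ, Integrable (fun x => f x * G x) μ :=
      fun f => integrable_mul_of_withDensity hG (by
        rw [← hV]
        exact L1.integrable_coeFn f)
    rw [NNReal.coe_one, one_mul, dist_eq_norm, dist_eq_norm, ← integral_sub (i f) (i g),
      L1.norm_eq_integral_norm]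
    simp only [← sub_mul]
    refine (norm_integral_mul_le hG _).trans (le_of_eq ?_)
    rw [← hV]
    refine integral_congr_ae ?_
    filter_upwards [Lp.coeFn_sub f g] with x hx
    rw [hx, Pi.sub_apply]
  · intro f g hfg _ h1
    rw [← VectorMeasure.integral_congr_ae hfg, h1]
    rw [hV] at hfg
    have := (ae_withDensity_iff' hG.aestronglyMeasurable.enorm).1 hfg
    refine integral_congr_ae ?_
    filter_upwards [this] with x hx
    rcases eq_or_ne (G x) 0 with h | h
    · simp [h]
    · rw [hx (by simpa using h)]

end VectorIntegral

lemma vectorIntegral_eq {μ : Measure RealCross} {G : RealCross → ℂ} (hG : Integrable G μ)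
    {E : ComplexMeasure ℝ} (hE : ∀ B : Set ℝ, MeasurableSet B →
      E B = ∫ t in (Subtype.val ⁻¹' B : Set RealCross), G t ∂μ) {z : ℂ}
    (hf : Integrable (fun t : RealCross => G t * (((t : ℝ) : ℂ) - z)⁻¹) μ) :
    ∫ᵛ t, ((t : ℂ) - z)⁻¹ ∂[ContinuousLinearMap.mul ℝ ℂ; E] =
      ∫ t : RealCross, G t * (((t : ℝ) : ℂ) - z)⁻¹ ∂μ := by
  have e : E = (μ.withDensityᵥ G).map Subtype.val := by
    refine VectorMeasure.ext fun B hB => ?_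
    rw [hE B hB, VectorMeasure.map_apply _ measurable_subtype_coe hB,
      withDensityᵥ_apply hG (measurable_subtype_coe hB)]
  rw [e, measurableEmbedding_realCross.integral_map_vectorMeasure, vectorIntegral_withDensity hG]
  · simp only [mul_comm]
  · refine hf.norm.mono' (hG.aestronglyMeasurable.norm.smul (aestronglyMeasurable_inv_sub z))
      (ae_of_all _ fun t => ?_)
    rw [norm_smul, norm_mul, norm_norm]

namespace Coefficients

variable {a b : EReal} {T : Coefficients a b} {va vb : T.LocPair} {φ : ℂ → T.LocPair}
  {S : Submodule ℂ (T.H1 × T.H1)} {hS : IsEssSelfAdjointRel S} {μ : Measure RealCross}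

namespace IsKernelMeasure

/-- The kernel formula holds at every point of the resolvent set. -/
lemma inner_resolvent (hμ : IsKernelMeasure hS φ μ) (hφ : IsRealAnalyticFamily va φ) {z : ℂ}
    {R : T.H1 →L[ℂ] T.H1} (hR : IsResolvent S z R) (α β : Ivl a b) :
    Integrable (fun t : RealCross => (φ (t : ℝ)).fst α * (φ (t : ℝ)).fst β *
      (((t : ℝ) : ℂ) - z)⁻¹) μ ∧
    inner ℂ (H1.delta β) (R (H1.delta α)) = ∫ t : RealCross, (φ (t : ℝ)).fst α *
      (φ (t : ℝ)).fst β * (((t : ℝ) : ℂ) - z)⁻¹ ∂μ := by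
  obtain ⟨F, hF, -⟩ := hμ.exists_unique_transformation hφ
  have hD := hμ.diagonalizes hφ hF
  have h1 : ∀ c, R (H1.delta c) ∈ domClosure S ∧
      ∀ᵐ t : RealCross ∂μ, (((t : ℝ) : ℂ) - z) * F (R (H1.delta c)) t = (φ (t : ℝ)).fst c := by
    intro c
    obtain ⟨h2, h3⟩ := hD.mem_iff.1 (hR.mem (H1.delta c))
    refine ⟨h2, ?_⟩
    change ∀ᵐ t : RealCross ∂μ,
      F (H1.delta c + z • R (H1.delta c)) t = ((t : ℝ) : ℂ) * F (R (H1.delta c)) t at h3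
    rw [map_add, map_smul] at h3
    filter_upwards [h3, hF c, Lp.coeFn_add (F (H1.delta c)) (z • F (R (H1.delta c))),
      Lp.coeFn_smul z (F (R (H1.delta c)))] with t k1 k2 k3 k4
    rw [k3, Pi.add_apply, k4, Pi.smul_apply, smul_eq_mul, k2] at k1
    linear_combination -k1
  have h2 : ∀ᵐ t : RealCross ∂μ, ((t : ℝ) : ℂ) - z ≠ 0 := by
    obtain ⟨x, hx⟩ := hφ.exists_seq_fst_ne_zero
    filter_upwards [ae_all_iff.2 fun j => (h1 (x j)).2] with t ht h0
    obtain ⟨j, hj⟩ := hx (t : ℝ) (by exact_mod_cast t.2)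
    apply hj
    rw [← ht j, h0, zero_mul]
  have h3 : (fun t => conj (F (H1.delta β) t) * F (R (H1.delta α)) t) =ᵐ[μ]
      fun t : RealCross => (φ (t : ℝ)).fst α * (φ (t : ℝ)).fst β * (((t : ℝ) : ℂ) - z)⁻¹ := by
    filter_upwards [hF β, (h1 α).2, h2] with t k1 k2 k3
    rw [k1, ← k2, hφ.conj_fst]
    field_simp
  refine ⟨(integrable_conj_mul _ _).congr h3, ?_⟩
  rw [← integral_congr_ae h3]
  conv_lhs => rw [← hD.adjoint_apply (h1 α).1]
  rw [ContinuousLinearMap.adjoint_inner_right, L2.inner_def]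
  refine integral_congr_ae (ae_of_all _ fun t => ?_)
  simp only [RCLike.inner_apply, mul_comm]

theorem isSpectralMeasure (hμ : IsKernelMeasure hS φ μ) (hφ : IsRealAnalyticFamily va φ) :
    IsSpectralMeasure S φ μ := by
  intro α β
  have hG := hμ.integrable α β
  have hE : ∀ B : Set ℝ, MeasurableSet B → (μ.withDensityᵥ fun t : RealCross =>
      (φ (t : ℝ)).fst α * (φ (t : ℝ)).fst β).map Subtype.val B =
      ∫ t in (Subtype.val ⁻¹' B : Set RealCross), (φ (t : ℝ)).fst α * (φ (t : ℝ)).fst β ∂μ := by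
    intro B hB
    rw [VectorMeasure.map_apply _ measurable_subtype_coe hB,
      withDensityᵥ_apply hG (measurable_subtype_coe hB)]
  refine ⟨hG, _, fun z R hR => ?_, hE⟩
  obtain ⟨h1, h2⟩ := hμ.inner_resolvent hφ hR α β
  rw [h2, vectorIntegral_eq hG hE h1]

end IsKernelMeasure

lemma IsSpectralMeasure.isKernelMeasure (hS : IsEssSelfAdjointRel S)
    (hμ : IsSpectralMeasure S φ μ) : IsKernelMeasure hS φ μ where
  integrable α β := (hμ α β).1
  inner_res z hz α β := by
    obtain ⟨hG, E, h1, h2⟩ := hμ α β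
    rw [h1 z _ (hS.isResolvent hz), vectorIntegral_eq hG h2
      (integrable_mul_inv measurable_subtype_coe hG hz)]

end Coefficients

end LeftDefinite

end

/-- `S` is the relation given by separated boundary conditions. Relation composition `○` is written
from left to right, so the last line is `S = F⁻¹ M_id F|_D` with `D` the closure of the domain. -/
theorem mainTheorem7 {a b : EReal} (T : Coefficients a b) (va vb : T.LocPair)
    (hva : IsBoundaryFunctionLeft va) (hvb : IsBoundaryFunctionRight vb)
    (S : Submodule ℂ (T.H1 × T.H1)) (hS : S = sepRelation va vb)
    (φ : ℂ → T.LocPair) (hφ : IsRealAnalyticFamily va φ)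
    (h0 : ¬ ZeroIsEigenvalue S) :
    S.adjoint = S ∧
    (∃! μ : Measure RealCross, IsSpectralMeasure S φ μ) ∧
    ∀ μ : Measure RealCross, IsSpectralMeasure S φ μ →
      (∃! F : T.H1 →L[ℂ] Lp ℂ 2 μ, IsSpectralTransformation φ F) ∧
      ∀ F : T.H1 →L[ℂ] Lp ℂ 2 μ, IsSpectralTransformation φ F →
        (∀ f ∈ (domClosure S)ᗮ, F f = 0) ∧
        (∃ U : domClosure S ≃ₗᵢ[ℂ] Lp ℂ 2 μ,
          (∀ f, U f = F f) ∧
          ∀ f g : domClosure S, ((f : T.H1), (g : T.H1)) ∈ S ↔ (U f, U g) ∈ mulId μ) ∧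
        (S : Set (T.H1 × T.H1)) = restrictedGraph F (domClosure S) ○ mulId μ ○ inverseRel F := by
  subst hS
  have hs := hφ.isEssSelfAdjointRel hva hvb
  obtain ⟨μ₀, hμ₀⟩ := hφ.exists_isKernelMeasure hva hvb hs h0
  refine ⟨hs.adjoint_eq, ⟨μ₀, hμ₀.isSpectralMeasure hφ, fun μ hμ =>
    IsKernelMeasure.eq hφ (hμ.isKernelMeasure hs) hμ₀⟩, fun μ hμ => ?_⟩
  have hμ' := hμ.isKernelMeasure hs
  refine ⟨hμ'.exists_unique_transformation hφ, fun F hF => ?_⟩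
  have hD := hμ'.diagonalizes hφ hF
  refine ⟨fun f hf => hD.apply_eq_zero hf, ⟨hD.unitary, hD.unitary_apply, fun f g => ?_⟩, ?_⟩
  · rw [hD.mem_iff, hD.unitary_apply, hD.unitary_apply]
    exact and_iff_right f.2
  · ext ⟨f, g⟩
    constructor
    · intro h
      obtain ⟨h1, h2⟩ := hD.mem_iff.1 h
      exact ⟨F g, ⟨F f, ⟨h1, rfl⟩, h2⟩, rfl⟩
    · rintro ⟨v, ⟨u, ⟨h1, h2⟩, h3⟩, h4⟩
      refine hD.mem_iff.2 ⟨h1, ?_⟩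
      have h2' : F f = u := h2
      have h4' : F g = v := h4
      rw [h2', h4']
      exact h3
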